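/- **Setting.** Let $M$ be a smooth ($\sigma$-compact, Hausdorff) $n$-manifold without boundary, $g$ a smooth Riemannian metric on $M$, and $x,\rho\in C^\infty(M;\mathbb R)$ with $dx\neq0$ on $\{x=0\}$, so that $X=\{x\ge0\}$ is a manifold with boundary with boundary defining function $x$ (the artificial boundary is $\partial X=\{x=0\}$). Let $g_{\rm sc}=x^{-4}dx^2+x^{-2}h$ be a scattering metric on $X$: $h$ is a smooth symmetric $2$-cotensor, $g_{\rm sc}$ is positive definite on $\{x>0\}$, and $h$ is positive definite on $T\partial X$ (i.e. $g_{\rm sc}$ is positive definite as a section of $\mathrm{Sym}^2\,{}^{\rm sc}T^*X$ over $X$). Let $\Omega=\{x>0,\ \rho>0\}$, where $\overline\Omega=\{x\ge0,\ \rho\ge0\}$ is compact, $d\rho\ne0$ on the interior boundary $\partial_{\rm int}\Omega=\{\rho=0,\ x\ge0\}$, $dx$ and $d\rho$ are linearly independent on $\{x=\rho=0\}$, and every connected component of $\overline\Omega$ meets $\partial_{\rm int}\Omega$. Functions and tensors are real or complex valued; $L^2$ products of functions and tensors are those of $g_{\rm sc}$ and its volume density. Let $\dot H^{1,0}_{\rm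 sc}(\Omega)$ be the completion of $C_c^\infty(\Omega)$ in the norm $(\|u\|^2_{L^2}+\|\nabla u\|_{L^2}^2)^{1/2}$, both for functions ($\nabla=d$) and for one-forms ($\nabla$ the Levi-Civita gradient of $g_{\rm sc}$), and let $\bar H^{-1,0}_{\rm sc}(\Omega)=(\dot H^{1,0}_{\rm sc}(\Omega))^*$ be its (conjugate-linear) dual space, with respect to the $L^2$ pairing. Let $d^s$ be the exterior derivative $d$ on functions, and on one-forms the symmetric differential of $g$, $(d^sv)_{ij}=\frac12(\nabla^g_iv_j+\nabla^g_jv_i)$. For $F>0$ put $d^s_F=e^{-F/x}d^se^{F/x}$, let $\delta^s_F$ be the adjoint of $d^s_F$ with respect to $g_{\rm sc}$, and let $\Delta_{F,s}=\delta^s_Fd^s_F$ be the solenoidal Witten Laplacian, so that for $u,v\in C_c^\infty(\Omega)$ $$\langle\Delta_{F,s}u,v\rangle=\langle d^s_Fu,d^s_Fv\rangle_{L^2}.$$ **Lemma.** 1. For every $F>0$, the operator $\Delta_{F,s}$ on functions (with Dirichlet condition on $\partial_{\rm int}\Omega$) extends to a continuous linear map $\dot H^{1,0}_{\rm sc}(\Omega)\to\bar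 H^{-1,0}_{\rm sc}(\Omega)$ which is invertible, with continuous inverse. 2. There is $F_0>0$ such that for every $F\ge F_0$ the operator $\Delta_{F,s}$ on one-forms extends to a continuous linear map $\dot H^{1,0}_{\rm sc}(\Omega;{}^{\rm sc}T^*X)\to\bar H^{-1,0}_{\rm sc}(\Omega;{}^{\rm sc}T^*X)$ which is invertible, with continuous inverse. -/

import Mathlib

set_option linter.unusedSectionVars false

open scoped Manifold ContDiff Topology
open Set Bundle MeasureTheory

noncomputable section

namespace ScatteringGauge

/-- Euclidean space `ℝⁿ`, the model of an `n`-manifold. -/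
abbrev Eu (n : ℕ) : Type := EuclideanSpace ℝ (Fin n)

section Coordinates

attribute [-instance] TopCat.of.chartedSpace

variable {n : ℕ} {M : Type*} [TopologicalSpace M] [ChartedSpace (Eu n) M]

/-- The differential at `p` of a real function, as a covector at `p`. -/
def dAt (n : ℕ) {M : Type*} [TopologicalSpace M] [ChartedSpace (Eu n) M]
    (f : M → ℝ) (p : M) : TangentSpace (𝓡 n) p →L[ℝ] ℝ :=
  mfderiv (𝓡 n) 𝓘(ℝ, ℝ) f p

/-- The coordinate vector `∂_i` of the chart `φ` at `c`, at the point `φ⁻¹ z`. -/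
def coordVec (c : M) (z : Eu n) (i : Fin n) :
    TangentSpace (𝓡 n) ((chartAt (Eu n) c).symm z) :=
  mfderiv (𝓡 n) (𝓡 n) (chartAt (Eu n) c).symm z (EuclideanSpace.single i (1 : ℝ))

/-- The components `B_{ij}` of a field of bilinear forms in the chart at `c`. -/
def bilinMatrix (B : ∀ p : M, TangentSpace (𝓡 n) p →L[ℝ] TangentSpace (𝓡 n) p →L[ℝ] ℝ)
    (c : M) (z : Eu n) : Matrix (Fin n) (Fin n) ℝ :=
  Matrix.of fun i j ↦ B ((chartAt (Eu n) c).symm z) (coordVec c z i) (coordVec c z j)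

variable [IsManifold (𝓡 n) ∞ M]

/-- Smoothness of a field of bilinear forms on the tangent spaces (a `2`-cotensor). -/
def SmoothBilin (n : ℕ) {M : Type*} [TopologicalSpace M]
    [ChartedSpace (Eu n) M] [IsManifold (𝓡 n) ∞ M]
    (B : ∀ p : M, TangentSpace (𝓡 n) p →L[ℝ] TangentSpace (𝓡 n) p →L[ℝ] ℝ) : Prop :=
  ContMDiff (𝓡 n) ((𝓡 n).prod 𝓘(ℝ, Eu n →L[ℝ] Eu n →L[ℝ] ℝ)) ∞
    (fun p : M ↦ TotalSpace.mk' (Eu n →L[ℝ] Eu n →L[ℝ] ℝ)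
      (E := fun p : M ↦ TangentSpace (𝓡 n) p →L[ℝ] TangentSpace (𝓡 n) p →L[ℝ] ℝ) p (B p))

/-- Smoothness of a `𝕜`-valued one-form. -/
def SmoothForm (n : ℕ) {M : Type*} [TopologicalSpace M]
    [ChartedSpace (Eu n) M] [IsManifold (𝓡 n) ∞ M] {𝕜 : Type*} [RCLike 𝕜]
    (u : ∀ p : M, TangentSpace (𝓡 n) p →L[ℝ] 𝕜) : Prop :=
  ContMDiff (𝓡 n) ((𝓡 n).prod 𝓘(ℝ, Eu n →L[ℝ] 𝕜)) ∞
    (fun p : M ↦ TotalSpace.mk' (Eu n →L[ℝ] 𝕜)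
      (E := fun p : M ↦ TangentSpace (𝓡 n) p →L[ℝ] Bundle.Trivial M 𝕜 p) p (u p))

theorem contMDiffOn_coordVec (c : M) (i : Fin n) :
    ContMDiffOn (𝓡 n) ((𝓡 n).prod (𝓡 n)) ∞
      (fun z ↦ (TotalSpace.mk' (Eu n)
        ((chartAt (Eu n) c).symm z) (coordVec c z i) :
          TangentBundle (𝓡 n) M))
      (chartAt (Eu n) c).target := by
  have h1 : ContMDiffOn (𝓡 n) (𝓡 n) ∞ (chartAt (Eu n) c).symm
      (chartAt (Eu n) c).target := contMDiffOn_chart_symm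
  have ho := (chartAt (Eu n) c).open_target
  have h2 := h1.contMDiffOn_tangentMapWithin (m := ∞) (by simp) ho.uniqueMDiffOn
  have h3 : ContMDiff (𝓡 n) ((𝓡 n).prod (𝓡 n)) ∞
      (fun z : Eu n ↦ (TotalSpace.mk' (Eu n) z
        (EuclideanSpace.single i (1 : ℝ)) :
          TangentBundle (𝓡 n) (Eu n))) := by
    intro z
    exact (contMDiffAt_section (IB := 𝓡 n) (E := fun z : Eu n ↦ TangentSpace (𝓡 n) z)
      (s := fun _ ↦ (EuclideanSpace.single i (1 : ℝ) : Eu n)) z).2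
        (by simpa using contMDiffAt_const)
  refine (h2.comp h3.contMDiffOn (fun z hz ↦ by exact hz)).congr fun z hz ↦ ?_
  simp only [Function.comp, tangentMapWithin, coordVec]
  rw [mfderivWithin_of_isOpen ho hz]

theorem SmoothBilin.contDiffOn_comp
    {B : ∀ p : M, TangentSpace (𝓡 n) p →L[ℝ] TangentSpace (𝓡 n) p →L[ℝ] ℝ}
    (hB : SmoothBilin n B) (c : M) (i j : Fin n) :
    ContDiffOn ℝ ∞ (fun z ↦ B ((chartAt (Eu n) c).symm z)
      (coordVec c z i) (coordVec c z j)) (chartAt (Eu n) c).target := by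
  have h1 : ContMDiffOn (𝓡 n) (𝓡 n) ∞ (chartAt (Eu n) c).symm
      (chartAt (Eu n) c).target := contMDiffOn_chart_symm
  have h2 : ContMDiffOn (𝓡 n) ((𝓡 n).prod 𝓘(ℝ, ℝ)) ∞
      (fun z ↦ TotalSpace.mk' ℝ (E := Bundle.Trivial M ℝ)
        ((chartAt (Eu n) c).symm z)
        (B ((chartAt (Eu n) c).symm z) (coordVec c z i) (coordVec c z j)))
        (chartAt (Eu n) c).target := by
    apply ContMDiffOn.clm_bundle_apply₂ (F₁ := Eu n)
      (F₂ := Eu n)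
    · exact hB.comp_contMDiffOn h1
    · exact contMDiffOn_coordVec c i
    · exact contMDiffOn_coordVec c j
  rw [← contMDiffOn_iff_contDiffOn]
  intro z hz
  have := h2 z hz
  simp only [contMDiffWithinAt_totalSpace] at this
  exact this.2

theorem SmoothForm.contDiffOn_comp {𝕜 : Type*} [RCLike 𝕜]
    {u : ∀ p : M, TangentSpace (𝓡 n) p →L[ℝ] 𝕜}
    (hu : SmoothForm n u) (c : M) (i : Fin n) :
    ContDiffOn ℝ ∞ (fun z ↦ u ((chartAt (Eu n) c).symm z)
      (coordVec c z i)) (chartAt (Eu n) c).target := by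
  have h1 : ContMDiffOn (𝓡 n) (𝓡 n) ∞ (chartAt (Eu n) c).symm
      (chartAt (Eu n) c).target := contMDiffOn_chart_symm
  have h2 : ContMDiffOn (𝓡 n) ((𝓡 n).prod 𝓘(ℝ, 𝕜)) ∞
      (fun z ↦ TotalSpace.mk' 𝕜 (E := Bundle.Trivial M 𝕜)
        ((chartAt (Eu n) c).symm z)
        (u ((chartAt (Eu n) c).symm z) (coordVec c z i)))
        (chartAt (Eu n) c).target := by
    apply ContMDiffOn.clm_bundle_apply (F₁ := Eu n)
    · exact hu.comp_contMDiffOn h1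
    · exact contMDiffOn_coordVec c i
  rw [← contMDiffOn_iff_contDiffOn]
  intro z hz
  have := h2 z hz
  simp only [contMDiffWithinAt_totalSpace] at this
  exact this.2

theorem dAt_coordVec {f : M → ℝ} (hf : ContMDiff (𝓡 n) 𝓘(ℝ, ℝ) ∞ f) (c : M) (i : Fin n)
    {z : Eu n} (hz : z ∈ (chartAt (Eu n) c).target) :
    dAt n f ((chartAt (Eu n) c).symm z) (coordVec c z i) =
      fderiv ℝ (fun w ↦ f ((chartAt (Eu n) c).symm w)) z
        (EuclideanSpace.single i 1) := by
  have h1 : ContMDiffOn (𝓡 n) (𝓡 n) ∞ (chartAt (Eu n) c).symm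
      (chartAt (Eu n) c).target := contMDiffOn_chart_symm
  have ho := (chartAt (Eu n) c).open_target
  have h2 := (h1.contMDiffAt (ho.mem_nhds hz)).mdifferentiableAt (by simp)
  have h3 := (hf ((chartAt (Eu n) c).symm z)).mdifferentiableAt (by simp)
  have := mfderiv_comp (I := 𝓡 n) (I' := 𝓡 n) (I'' := 𝓘(ℝ, ℝ)) z h3 h2
  rw [← mfderiv_eq_fderiv]
  simp only [Function.comp_def] at this
  rw [this]
  rfl

theorem SmoothForm.smul {𝕜 : Type*} [RCLike 𝕜]
    {u : ∀ p : M, TangentSpace (𝓡 n) p →L[ℝ] 𝕜} (hu : SmoothForm n u) (a : 𝕜) :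
    SmoothForm n (fun p ↦ a • u p) := by
  intro p
  have := hu p
  rw [contMDiffAt_section] at this ⊢
  have h2 : ContMDiff 𝓘(ℝ, Eu n →L[ℝ] 𝕜)
     𝓘(ℝ, Eu n →L[ℝ] 𝕜) ∞ 
     (fun w : Eu n →L[ℝ] 𝕜 ↦ a • w) := by
    rw [contMDiff_iff_contDiff]
    exact contDiff_id.const_smul a
  have h3 := h2.contMDiffAt.comp p this
  refine h3.congr_of_eventuallyEq (Filter.Eventually.of_forall fun q ↦ ?_)
  ext v
  simp [hom_trivializationAt_apply, ContinuousLinearMap.inCoordinates]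

theorem SmoothForm.add {𝕜 : Type*} [RCLike 𝕜]
    {u v : ∀ p : M, TangentSpace (𝓡 n) p →L[ℝ] 𝕜} (hu : SmoothForm n u) (hv : SmoothForm n v) :
    SmoothForm n (fun p ↦ u p + v p) := 
  ContMDiff.add_section hu hv

theorem SmoothForm.zero {𝕜 : Type*} [RCLike 𝕜] :
    SmoothForm (M := M) n (fun p ↦ (0 : TangentSpace (𝓡 n) p →L[ℝ] 𝕜)) := by
  exact contMDiff_zeroSection ℝ (fun p : M ↦ TangentSpace (𝓡 n) p →L[ℝ] Bundle.Trivial M 𝕜 p)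

end Coordinates

/-! ### The geometry -/

/-- A region `Ω` between an artificial boundary `x = 0` and an interior boundary `ρ = 0`.

`M` is the ambient manifold without boundary, `X = {x ≥ 0}` is a manifold with boundary
`{x = 0}` of which `x` is a boundary defining function, `g` is a smooth (up to and across `x = 0`)
Riemannian metric, and `x⁻⁴ dx² + x⁻² h` is a scattering metric on `X`.
The closed region `{x ≥ 0, ρ ≥ 0}` is a compact manifold with corners, with
boundary hypersurfaces in `{x = 0}` and in `{ρ = 0}`. -/
structure Region (n : ℕ) (M : Type*) [TopologicalSpace M] [ChartedSpace (Eu n) M]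
    [IsManifold (𝓡 n) ∞ M] where
  /-- the defining function of the artificial boundary -/
  x : M → ℝ
  /-- the defining function of the interior boundary -/
  rho : M → ℝ
  /-- the Riemannian metric that defines the symmetric differential -/
  g : ContMDiffRiemannianMetric (𝓡 n) ∞ (Eu n) (fun p : M ↦ TangentSpace (𝓡 n) p)
  /-- the smooth symmetric `2`-cotensor in the scattering metric -/
  h : ∀ p : M, TangentSpace (𝓡 n) p →L[ℝ] TangentSpace (𝓡 n) p →L[ℝ] ℝ
  x_smooth : ContMDiff (𝓡 n) 𝓘(ℝ, ℝ) ∞ x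
  rho_smooth : ContMDiff (𝓡 n) 𝓘(ℝ, ℝ) ∞ rho
  h_smooth : SmoothBilin n h
  h_symm : ∀ (p : M) (v w : TangentSpace (𝓡 n) p), h p v w = h p w v
  /-- `{x = 0}` is a regular hypersurface. -/
  x_regular : ∀ p : M, x p = 0 → dAt n x p ≠ 0
  /-- The scattering metric is positive definite in the interior of `X`. -/
  sc_pos : ∀ p : M, 0 < x p → ∀ v : TangentSpace (𝓡 n) p, v ≠ 0 →
    0 < (x p ^ 4)⁻¹ * (dAt n x p v * dAt n x p v) + (x p ^ 2)⁻¹ * h p v v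
  /-- The scattering metric is positive definite at `∂X` on the scattering tangent bundle, that is,
  `h` is positive definite on the tangent spaces of `∂X`. -/
  sc_pos_boundary : ∀ p : M, x p = 0 → ∀ v : TangentSpace (𝓡 n) p, v ≠ 0 → dAt n x p v = 0 →
    0 < h p v v
  /-- The closed region is compact. -/
  compact : IsCompact {p : M | 0 ≤ x p ∧ 0 ≤ rho p}
  /-- The interior boundary is a regular hypersurface. -/
  rho_regular : ∀ p : M, 0 ≤ x p → rho p = 0 → dAt n rho p ≠ 0
  /-- The interior boundary is transversal to the artificial boundary. -/
  transversal : ∀ p : M, x p = 0 → rho p = 0 →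
    LinearIndependent ℝ ![dAt n x p, dAt n rho p]
  /-- Every connected component of the closed region has a part of the interior boundary. -/
  meets : ∀ p : M, 0 ≤ x p → 0 ≤ rho p →
    ∃ q ∈ connectedComponentIn {p : M | 0 ≤ x p ∧ 0 ≤ rho p} p, rho q = 0

namespace Region

variable {n : ℕ} {M : Type*} [TopologicalSpace M] [ChartedSpace (Eu n) M]
  [IsManifold (𝓡 n) ∞ M] (S : Region n M)

/-- The open region `Ω`. -/
def dom : Set M := {p | 0 < S.x p ∧ 0 < S.rho p}

/-- The scattering metric `x⁻⁴ dx² + x⁻² h` (used only where `x > 0`). -/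
def gsc (p : M) : TangentSpace (𝓡 n) p →L[ℝ] TangentSpace (𝓡 n) p →L[ℝ] ℝ :=
  (S.x p ^ 4)⁻¹ • (dAt n S.x p).smulRight (dAt n S.x p) + (S.x p ^ 2)⁻¹ • S.h p

end Region

/-! ### Tensor calculus in coordinates -/

/-- The components of a covariant tensor field of rank `r` in all the charts `chartAt c`:
`s c z I` is the component with indices `I 0, …, I (r-1)` in the chart at `c`, at the point
with coordinates `z`. -/
abbrev Comps (n : ℕ) (M 𝕜 : Type*) (r : ℕ) : Type _ := M → Eu n → (Fin r → Fin n) → 𝕜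

section Calculus

variable {n : ℕ} {M : Type*} {𝕜 : Type*} [RCLike 𝕜]

/-- The partial derivative `∂_i f`. -/
def pderiv {F : Type*} [NormedAddCommGroup F] [NormedSpace ℝ F] (i : Fin n) (f : Eu n → F)
    (z : Eu n) : F :=
  fderiv ℝ f z (EuclideanSpace.single i (1 : ℝ))

/-- The Christoffel symbol `Γ^k_{ij}` of a field `G` of metric matrices. -/
def christoffel (G : Eu n → Matrix (Fin n) (Fin n) ℝ) (k i j : Fin n) (z : Eu n) : ℝ :=
  (1 / 2) * ∑ l, (G z)⁻¹ k l *
    (pderiv i (fun w ↦ G w j l) z + pderiv j (fun w ↦ G w i l) z - pderiv l (fun w ↦ G w i j) z)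

/-- The differential of a function: `(du)_i = ∂_i u`. -/
def gradFun (s : Comps n M 𝕜 0) : Comps n M 𝕜 1 := fun c z I ↦
  pderiv (I 0) (fun w ↦ s c w ![]) z

/-- The covariant derivative of a one-form for the metric with matrix `G c` in the chart at `c`:
`(∇v)_{ij} = ∂_i v_j - Γ^k_{ij} v_k`. -/
def gradForm (G : M → Eu n → Matrix (Fin n) (Fin n) ℝ) (s : Comps n M 𝕜 1) : Comps n M 𝕜 2 :=
  fun c z I ↦ pderiv (I 0) (fun w ↦ s c w ![I 1]) z -
    ∑ k, christoffel (G c) k (I 0) (I 1) z • s c z ![k]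

/-- The symmetric differential of a one-form: `(dˢv)_{ij} = ((∇v)_{ij} + (∇v)_{ji}) / 2`. -/
def symGrad (G : M → Eu n → Matrix (Fin n) (Fin n) ℝ) (s : Comps n M 𝕜 1) : Comps n M 𝕜 2 :=
  fun c z I ↦ (1 / 2 : ℝ) •
    (gradForm G s c z ![I 0, I 1] + gradForm G s c z ![I 1, I 0])

variable [TopologicalSpace M] [ChartedSpace (Eu n) M]

/-- The product of a real function and a tensor field. -/
def mulFun {r : ℕ} (f : M → ℝ) (s : Comps n M 𝕜 r) : Comps n M 𝕜 r := fun c z I ↦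
  f ((chartAt (Eu n) c).symm z) • s c z I

/-- The components of a function. -/
def compsFun (u : M → 𝕜) : Comps n M 𝕜 0 := fun c z _ ↦ u ((chartAt (Eu n) c).symm z)

/-- The components of a one-form. -/
def compsForm (u : ∀ p : M, TangentSpace (𝓡 n) p →L[ℝ] 𝕜) : Comps n M 𝕜 1 := fun c z I ↦
  u ((chartAt (Eu n) c).symm z) (coordVec c z (I 0))

end Calculus

/-- A smooth partition of unity on `M` subordinate to the domains of the charts. -/
def chartPartition (n : ℕ) (M : Type*) [TopologicalSpace M] [ChartedSpace (Eu n) M]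
    [IsManifold (𝓡 n) ∞ M] [T2Space M] [SigmaCompactSpace M] :
    SmoothPartitionOfUnity M (𝓡 n) M univ :=
  (SmoothPartitionOfUnity.exists_isSubordinate_chartAt_source (𝓡 n) M).choose

theorem chartPartition_isSubordinate (n : ℕ) (M : Type*) [TopologicalSpace M]
    [ChartedSpace (Eu n) M] [IsManifold (𝓡 n) ∞ M] [T2Space M] [SigmaCompactSpace M] :
    (chartPartition n M).IsSubordinate (fun c ↦ (chartAt (Eu n) c).source) :=
  (SmoothPartitionOfUnity.exists_isSubordinate_chartAt_source (𝓡 n) M).choose_spec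

namespace Region

variable {n : ℕ} {M : Type*} [TopologicalSpace M] [ChartedSpace (Eu n) M]
  [IsManifold (𝓡 n) ∞ M] [T2Space M] [SigmaCompactSpace M] (S : Region n M)
  {𝕜 : Type*} [RCLike 𝕜]

/-- The matrix `G` of the scattering metric in the chart at `c`. -/
def gscMat (c : M) (z : Eu n) : Matrix (Fin n) (Fin n) ℝ := bilinMatrix S.gsc c z

/-- The matrix of the metric `g` in the chart at `c`. -/
def gMat (c : M) (z : Eu n) : Matrix (Fin n) (Fin n) ℝ := bilinMatrix S.g.inner c z

/-- The pointwise product of two tensors of rank `r` for the scattering metric: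
`⟨s, t⟩ = G^{i₁j₁} ⋯ G^{i_r j_r} conj(s_{i₁…i_r}) t_{j₁…j_r}`. -/
def pair {r : ℕ} (s t : Comps n M 𝕜 r) (c : M) (z : Eu n) : 𝕜 :=
  ∑ I, ∑ J, ((∏ k, (S.gscMat c z)⁻¹ (I k) (J k) : ℝ) : 𝕜) * (starRingEnd 𝕜 (s c z I) * t c z J)

/-- The `L²` product of two tensor fields of rank `r` for the scattering metric and its volume
density `√det G dz`; the integral over the manifold is taken chart by chart with the help of
the partition of unity. -/
def l2 {r : ℕ} (s t : Comps n M 𝕜 r) : 𝕜 :=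
  ∑ᶠ c : M, ∫ z in (chartAt (Eu n) c).target,
    ((chartPartition n M c ((chartAt (Eu n) c).symm z) * √(S.gscMat c z).det : ℝ) : 𝕜) *
      S.pair s t c z

/-! ### Test functions, test one-forms, and the Sobolev spaces -/

variable (𝕜) in
/-- The space `C_c^∞(Ω)` of functions. -/
def testFunSubmodule : Submodule 𝕜 (M → 𝕜) where
  carrier := {u | ContMDiff (𝓡 n) 𝓘(ℝ, 𝕜) ∞ u ∧
    ∃ K ⊆ S.dom, IsCompact K ∧ ∀ p ∉ K, u p = 0}
  add_mem' := by
    rintro u v ⟨hu, K, hK, hKc, hu0⟩ ⟨hv, L, hL, hLc, hv0⟩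
    refine ⟨hu.add hv, K ∪ L, union_subset hK hL, hKc.union hLc, fun p hp ↦ ?_⟩
    rw [mem_union, not_or] at hp
    simp [hu0 p hp.1, hv0 p hp.2]
  zero_mem' := ⟨contMDiff_const, ∅, empty_subset _, isCompact_empty, fun _ _ ↦ rfl⟩
  smul_mem' := by
    rintro a u ⟨hu, K, hK, hKc, hu0⟩
    refine ⟨?_, K, hK, hKc, fun p hp ↦ by simp [hu0 p hp]⟩
    have : ContDiff ℝ ∞ (fun w : 𝕜 ↦ a • w) := contDiff_id.const_smul a
    exact this.contMDiff.comp hu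

variable (𝕜) in
/-- The space `C_c^∞(Ω; T^*M)` of one-forms. -/
def testFormSubmodule : Submodule 𝕜 (∀ p : M, TangentSpace (𝓡 n) p →L[ℝ] 𝕜) where
  carrier := {u | SmoothForm n u ∧ ∃ K ⊆ S.dom, IsCompact K ∧ ∀ p ∉ K, u p = 0}
  add_mem' := by
    rintro u v ⟨hu, K, hK, hKc, hu0⟩ ⟨hv, L, hL, hLc, hv0⟩
    refine ⟨hu.add hv, K ∪ L, union_subset hK hL, hKc.union hLc, fun p hp ↦ ?_⟩
    rw [mem_union, not_or] at hp
    simp [hu0 p hp.1, hv0 p hp.2]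
  zero_mem' := ⟨SmoothForm.zero, ∅, empty_subset _, isCompact_empty, fun _ _ ↦ rfl⟩
  smul_mem' := by
    rintro a u ⟨hu, K, hK, hKc, hu0⟩
    exact ⟨hu.smul a, K, hK, hKc, fun p hp ↦ by simp [hu0 p hp]⟩

variable (𝕜) in
/-- Smooth functions with compact support in `Ω`, as a type without a topology. -/
def TestFun : Type _ := ↥(S.testFunSubmodule 𝕜)

variable (𝕜) in
/-- Smooth one-forms with compact support in `Ω`, as a type without a topology. -/
def TestForm : Type _ := ↥(S.testFormSubmodule 𝕜)

instance : AddCommGroup (S.TestFun 𝕜) := inferInstanceAs (AddCommGroup ↥(S.testFunSubmodule 𝕜))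
instance : Module 𝕜 (S.TestFun 𝕜) := inferInstanceAs (Module 𝕜 ↥(S.testFunSubmodule 𝕜))
instance : AddCommGroup (S.TestForm 𝕜) := inferInstanceAs (AddCommGroup ↥(S.testFormSubmodule 𝕜))
instance : Module 𝕜 (S.TestForm 𝕜) := inferInstanceAs (Module 𝕜 ↥(S.testFormSubmodule 𝕜))

/-- The components of a test function. -/
def TestFun.comps {S : Region n M} (u : S.TestFun 𝕜) : Comps n M 𝕜 0 := compsFun u.1

/-- The components of a test one-form. -/
def TestForm.comps {S : Region n M} (u : S.TestForm 𝕜) : Comps n M 𝕜 1 := compsForm u.1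

/-- The `H_sc^{1,0}` inner product on functions. -/
def sobolevFun (u v : S.TestFun 𝕜) : 𝕜 :=
  S.l2 u.comps v.comps + S.l2 (gradFun u.comps) (gradFun v.comps)

/-- The `H_sc^{1,0}` inner product on one-forms; `∇` is the Levi-Civita gradient of the
scattering metric. -/
def sobolevForm (u v : S.TestForm 𝕜) : 𝕜 :=
  S.l2 u.comps v.comps + S.l2 (gradForm S.gscMat u.comps) (gradForm S.gscMat v.comps)

/-! ### Helper facts: the Sobolev inner products are inner products -/

theorem isOpen_dom : IsOpen S.dom :=
  (isOpen_lt continuous_const S.x_smooth.continuous).inter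
    (isOpen_lt continuous_const S.rho_smooth.continuous)

/-- The part of the range of the chart at `c` that lies in `Ω`. -/
def chartDom (c : M) : Set (Eu n) :=
  (chartAt (Eu n) c).target ∩ (chartAt (Eu n) c).symm ⁻¹' S.dom

theorem isOpen_chartDom (c : M) : IsOpen (S.chartDom c) :=
  (chartAt (Eu n) c).isOpen_inter_preimage_symm S.isOpen_dom

theorem contDiffOn_fun_comp {F : Type*} [NormedAddCommGroup F] [NormedSpace ℝ F] {u : M → F}
    (hu : ContMDiff (𝓡 n) 𝓘(ℝ, F) ∞ u) (c : M) :
    ContDiffOn ℝ ∞ (fun z ↦ u ((chartAt (Eu n) c).symm z)) (chartAt (Eu n) c).target := by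
  have h1 : ContMDiffOn (𝓡 n) (𝓡 n) ∞ (chartAt (Eu n) c).symm
      (chartAt (Eu n) c).target := contMDiffOn_chart_symm
  rw [← contMDiffOn_iff_contDiffOn]
  exact hu.comp_contMDiffOn h1

theorem contDiffOn_pderiv {F : Type*} [NormedAddCommGroup F] [NormedSpace ℝ F] {f : Eu n → F}
    {s : Set (Eu n)} (hs : IsOpen s) (hf : ContDiffOn ℝ ∞ f s) (i : Fin n) :
    ContDiffOn ℝ ∞ (fun z ↦ pderiv i f z) s :=
  (hf.fderiv_of_isOpen hs (m := ∞) (by simp)).clm_apply contDiffOn_const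

theorem contDiffOn_gscMat (c : M) (i j : Fin n) :
    ContDiffOn ℝ ∞ (fun z ↦ S.gscMat c z i j) (S.chartDom c) := by
  have hsub : S.chartDom c ⊆ (chartAt (Eu n) c).target := inter_subset_left
  have hx := (contDiffOn_fun_comp S.x_smooth c).mono hsub
  have hx0 : ∀ z ∈ S.chartDom c, S.x ((chartAt (Eu n) c).symm z) ≠ 0 := fun z hz ↦ hz.2.1.ne'
  have hd : ∀ i, ContDiffOn ℝ ∞ (fun z ↦ dAt n S.x ((chartAt (Eu n) c).symm z) (coordVec c z i))
      (S.chartDom c) := fun i ↦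
    ((contDiffOn_pderiv (chartAt (Eu n) c).open_target (contDiffOn_fun_comp S.x_smooth c)
      i).mono hsub).congr fun z hz ↦ dAt_coordVec S.x_smooth c i (hsub hz)
  have hh := (S.h_smooth.contDiffOn_comp c i j).mono hsub
  exact (((hx.pow 4).inv fun z hz ↦ pow_ne_zero _ (hx0 z hz)).mul ((hd i).mul (hd j))).add
    (((hx.pow 2).inv fun z hz ↦ pow_ne_zero _ (hx0 z hz)).mul hh)

theorem gscMat_symm (c : M) (z : Eu n) (i j : Fin n) : S.gscMat c z i j = S.gscMat c z j i := by
  simp [gscMat, bilinMatrix, gsc, S.h_symm _ (coordVec c z i) (coordVec c z j), mul_comm]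

theorem gscMat_inv_symm (c : M) (z : Eu n) (i j : Fin n) :
    (S.gscMat c z)⁻¹ i j = (S.gscMat c z)⁻¹ j i := by
  have h : (S.gscMat c z).transpose = S.gscMat c z := by
    ext i j
    exact S.gscMat_symm c z j i
  calc (S.gscMat c z)⁻¹ i j = ((S.gscMat c z)⁻¹).transpose j i := rfl
    _ = _ := by rw [Matrix.transpose_nonsing_inv, h]

theorem posDef_gscMat (c : M) {z : Eu n} (hz : z ∈ S.chartDom c) : (S.gscMat c z).PosDef := by
  refine Matrix.PosDef.of_dotProduct_mulVec_pos ?_ fun a ha ↦ ?_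
  · ext i j
    simpa using S.gscMat_symm c z j i
  · set p := (chartAt (Eu n) c).symm z
    set v : TangentSpace (𝓡 n) p := ∑ i, a i • coordVec c z i with hv
    have hv0 : v ≠ 0 := by
      intro h0
      let L : Eu n →L[ℝ] TangentSpace (𝓡 n) p :=
        mfderiv (𝓡 n) (𝓡 n) (chartAt (Eu n) c).symm z
      have h1 : v = L (∑ i, a i • EuclideanSpace.single i (1 : ℝ)) := by
        rw [hv, map_sum]
        exact Finset.sum_congr rfl fun i _ ↦ (map_smul L _ _).symm
      have h2 := ((mdifferentiable_chart (I := 𝓡 n) c).symm).ker_mfderiv_eq_bot (x := z) hz.1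
      have h3 : (∑ i, a i • EuclideanSpace.single i (1 : ℝ) : Eu n) = 0 := by
        rw [LinearMap.ker_eq_bot'] at h2
        exact h2 _ (by rw [← h0, h1]; rfl)
      apply ha
      ext i
      have := congrArg (fun w : Eu n ↦ w i) h3
      simpa [Pi.single_apply] using this
    have h4 := S.sc_pos p hz.2.1 v hv0
    have h5 : star a ⬝ᵥ (S.gscMat c z).mulVec a = S.gsc p v v := by
      simp only [hv, map_sum, map_smul, sum_apply,
        smul_apply, dotProduct, Matrix.mulVec, Finset.mul_sum, smul_eq_mul,
        Pi.star_apply, star_trivial]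
      rw [Finset.sum_comm]
      refine Finset.sum_congr rfl fun i _ ↦ Finset.sum_congr rfl fun j _ ↦ ?_
      simp only [gscMat, bilinMatrix, Matrix.of_apply, p]
      ring
    rw [h5]
    simpa [gsc] using h4

theorem continuousOn_gscMat_inv (c : M) (k l : Fin n) :
    ContinuousOn (fun z ↦ (S.gscMat c z)⁻¹ k l) (S.chartDom c) := by
  have h0 : ContinuousOn (fun z ↦ S.gscMat c z) (S.chartDom c) :=
    continuousOn_pi.2 fun i ↦ continuousOn_pi.2 fun j ↦ (S.contDiffOn_gscMat c i j).continuousOn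
  rw [continuousOn_iff_continuous_domRestrict] at h0 ⊢
  have h1 : ∀ z : S.chartDom c, (S.gscMat c z).det ≠ 0 := fun z ↦ (S.posDef_gscMat c z.2).det_pos.ne'
  have h2 := (h0.matrix_det.inv₀ h1).mul (h0.matrix_adjugate.matrix_elem k l)
  refine h2.congr fun z ↦ ?_
  simp [Matrix.inv_def]

theorem continuousOn_sqrt_det (c : M) :
    ContinuousOn (fun z ↦ √(S.gscMat c z).det) (S.chartDom c) := by
  have h0 : ContinuousOn (fun z ↦ S.gscMat c z) (S.chartDom c) :=
    continuousOn_pi.2 fun i ↦ continuousOn_pi.2 fun j ↦ (S.contDiffOn_gscMat c i j).continuousOn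
  rw [continuousOn_iff_continuous_domRestrict] at h0 ⊢
  exact h0.matrix_det.sqrt

theorem continuousOn_christoffel (c : M) (k i j : Fin n) :
    ContinuousOn (fun z ↦ christoffel (S.gscMat c) k i j z) (S.chartDom c) := by
  have hp : ∀ a b d, ContinuousOn (fun z ↦ pderiv a (fun w ↦ S.gscMat c w b d) z)
      (S.chartDom c) := fun a b d ↦
    (contDiffOn_pderiv (S.isOpen_chartDom c) (S.contDiffOn_gscMat c b d) a).continuousOn
  exact continuousOn_const.mul (continuousOn_finsetSum _ fun l _ ↦
    (S.continuousOn_gscMat_inv c k l).mul (((hp i j l).add (hp j i l)).sub (hp l i j)))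

/-- Tensor fields with compact support in `Ω`, with continuous components. -/
def IsTest {r : ℕ} (s : Comps n M 𝕜 r) : Prop :=
  ∃ K ⊆ S.dom, IsCompact K ∧
    (∀ c, ∀ z ∈ (chartAt (Eu n) c).target, (chartAt (Eu n) c).symm z ∉ K → ∀ I, s c z I = 0) ∧
    ∀ c I, ContinuousOn (fun z ↦ s c z I) (S.chartDom c)

theorem continuousOn_pair {r : ℕ} {s t : Comps n M 𝕜 r} (hs : S.IsTest s) (ht : S.IsTest t)
    (c : M) : ContinuousOn (fun z ↦ S.pair s t c z) (S.chartDom c) := by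
  obtain ⟨K, -, -, -, hs⟩ := hs
  obtain ⟨L, -, -, -, ht⟩ := ht
  refine continuousOn_finsetSum _ fun I _ ↦ continuousOn_finsetSum _ fun J _ ↦ ?_
  refine ContinuousOn.mul ?_ ((RCLike.continuous_conj.comp_continuousOn (hs c I)).mul (ht c J))
  exact RCLike.continuous_ofReal.comp_continuousOn
    (continuousOn_finsetProd _ fun k _ ↦ S.continuousOn_gscMat_inv c (I k) (J k))

theorem pair_eq_zero {r : ℕ} {s t : Comps n M 𝕜 r} {c : M} {z : Eu n} (h : ∀ I, t c z I = 0) :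
    S.pair s t c z = 0 := by
  simp [pair, h]

theorem integrableOn_l2 {r : ℕ} {s t : Comps n M 𝕜 r} (hs : S.IsTest s) (ht : S.IsTest t)
    (c : M) : IntegrableOn (fun z ↦
      ((chartPartition n M c ((chartAt (Eu n) c).symm z) * √(S.gscMat c z).det : ℝ) : 𝕜) *
        S.pair s t c z) (chartAt (Eu n) c).target := by
  have hp := S.continuousOn_pair hs ht c
  obtain ⟨K, hK, hKc, h0, -⟩ := ht
  set φ := chartAt (Eu n) c with hφ
  have hsub : tsupport (chartPartition n M c) ⊆ φ.source := chartPartition_isSubordinate n M c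
  set C : Set (Eu n) := φ '' (K ∩ tsupport (chartPartition n M c)) with hC
  have hCc : IsCompact C := (hKc.inter_right (isClosed_tsupport _)).image_of_continuousOn
    (φ.continuousOn.mono fun p hp ↦ hsub hp.2)
  have hCW : C ⊆ S.chartDom c := by
    rintro _ ⟨p, hp, rfl⟩
    exact ⟨φ.map_source (hsub hp.2), by
      rw [mem_preimage, φ.left_inv (hsub hp.2)]; exact hK hp.1⟩
  have hcont : ContinuousOn (fun z ↦
      ((chartPartition n M c (φ.symm z) * √(S.gscMat c z).det : ℝ) : 𝕜) *
        S.pair s t c z) (S.chartDom c) := by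
    refine ContinuousOn.mul (RCLike.continuous_ofReal.comp_continuousOn
      (ContinuousOn.mul ?_ (S.continuousOn_sqrt_det c))) hp
    exact (chartPartition n M c).contMDiff.continuous.comp_continuousOn
      (φ.continuousOn_symm.mono inter_subset_left)
  refine ((hcont.mono hCW).integrableOn_compact hCc).of_forall_sdiff_eq_zero
    φ.open_target.measurableSet fun z hz ↦ ?_
  by_cases hzK : φ.symm z ∈ K
  · have : φ.symm z ∉ tsupport (chartPartition n M c) := fun h ↦
      hz.2 ⟨φ.symm z, ⟨hzK, h⟩, φ.right_inv hz.1⟩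
    rw [image_eq_zero_of_notMem_tsupport this]
    simp
  · rw [S.pair_eq_zero (h0 c z hz.1 hzK), mul_zero]

theorem finite_support_l2 {r : ℕ} {s t : Comps n M 𝕜 r} (ht : S.IsTest t) :
    (Function.support fun c : M ↦ ∫ z in (chartAt (Eu n) c).target,
      ((chartPartition n M c ((chartAt (Eu n) c).symm z) * √(S.gscMat c z).det : ℝ) : 𝕜) *
        S.pair s t c z).Finite := by
  obtain ⟨K, hK, hKc, h0, -⟩ := ht
  refine ((chartPartition n M).locallyFinite.finite_nonempty_inter_compact hKc).subset
    fun c hc ↦ ?_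
  by_contra hne
  refine hc (setIntegral_eq_zero_of_forall_eq_zero fun z hz ↦ ?_)
  by_cases hzK : (chartAt (Eu n) c).symm z ∈ K
  · have : chartPartition n M c ((chartAt (Eu n) c).symm z) = 0 := by
      by_contra h
      exact hne ⟨_, h, hzK⟩
    simp [this]
  · rw [S.pair_eq_zero (h0 c z hz hzK), mul_zero]

theorem l2_conj {r : ℕ} (s t : Comps n M 𝕜 r) : starRingEnd 𝕜 (S.l2 t s) = S.l2 s t := by
  have h1 : ∀ c z, starRingEnd 𝕜 (S.pair t s c z) = S.pair s t c z := by
    intro c z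
    simp only [pair, map_sum, map_mul, RCLike.conj_conj, RCLike.conj_ofReal]
    rw [Finset.sum_comm]
    refine Finset.sum_congr rfl fun I _ ↦ Finset.sum_congr rfl fun J _ ↦ ?_
    rw [mul_comm (t c z J)]
    congr 2
    exact Finset.prod_congr rfl fun k _ ↦ S.gscMat_inv_symm c z _ _
  rw [l2, l2]
  refine ((starRingEnd 𝕜 : 𝕜 →+* 𝕜).toAddMonoidHom.map_finsum_of_injective
    (starRingEnd 𝕜).injective _).trans (finsum_congr fun c ↦ ?_)
  change starRingEnd 𝕜 _ = _
  rw [← integral_conj]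
  refine integral_congr_ae (Filter.Eventually.of_forall fun z ↦ ?_)
  simp [h1]

theorem l2_add {r : ℕ} {s s₁ s₂ t : Comps n M 𝕜 r} (h₁ : S.IsTest s₁) (h₂ : S.IsTest s₂)
    (ht : S.IsTest t) (h : ∀ c, ∀ z ∈ (chartAt (Eu n) c).target, ∀ I,
      s c z I = s₁ c z I + s₂ c z I) : S.l2 s t = S.l2 s₁ t + S.l2 s₂ t := by
  rw [l2, l2, l2, ← finsum_add_distrib (S.finite_support_l2 ht) (S.finite_support_l2 ht)]
  refine finsum_congr fun c ↦ ?_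
  rw [← integral_add (S.integrableOn_l2 h₁ ht c) (S.integrableOn_l2 h₂ ht c)]
  refine setIntegral_congr_fun (chartAt (Eu n) c).open_target.measurableSet fun z hz ↦ ?_
  simp only [pair, h c z hz, map_add, add_mul, mul_add, Finset.sum_add_distrib]

theorem l2_smul {r : ℕ} {s s₁ t : Comps n M 𝕜 r} (a : 𝕜)
    (h : ∀ c, ∀ z ∈ (chartAt (Eu n) c).target, ∀ I, s c z I = a * s₁ c z I) :
    S.l2 s t = starRingEnd 𝕜 a * S.l2 s₁ t := by
  rw [l2, l2, ← smul_eq_mul, smul_finsum]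
  refine finsum_congr fun c ↦ ?_
  rw [smul_eq_mul, ← integral_const_mul]
  refine setIntegral_congr_fun (chartAt (Eu n) c).open_target.measurableSet fun z hz ↦ ?_
  simp only [pair, h c z hz, map_mul, Finset.mul_sum]
  refine Finset.sum_congr rfl fun I _ ↦ Finset.sum_congr rfl fun J _ ↦ ?_
  ring

theorem pair_self {r : ℕ} (s : Comps n M 𝕜 r) {c : M} {z : Eu n} (hz : z ∈ S.chartDom c) :
    ∃ b : ℝ, 0 ≤ b ∧ S.pair s s c z = (b : 𝕜) := by
  obtain ⟨B, hB⟩ : ∃ B : Matrix (Fin n) (Fin n) ℝ, (S.gscMat c z)⁻¹ = B.transpose * B := by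
    have h1 := (Matrix.posDef_inv_iff.2 (S.posDef_gscMat c hz)).posSemidef
    open scoped MatrixOrder in
    obtain ⟨B, hB⟩ := CStarAlgebra.nonneg_iff_eq_star_mul_self.1 h1.nonneg
    exact ⟨B, by simpa [Matrix.star_eq_conjTranspose] using hB⟩
  refine ⟨∑ L : Fin r → Fin n, ‖∑ I, ((∏ k, B (L k) (I k) : ℝ) : 𝕜) * s c z I‖ ^ 2,
    Finset.sum_nonneg fun _ _ ↦ by positivity, ?_⟩
  have h2 : ∀ I J : Fin r → Fin n, ∏ k, (S.gscMat c z)⁻¹ (I k) (J k) =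
      ∑ L : Fin r → Fin n, (∏ k, B (L k) (I k)) * ∏ k, B (L k) (J k) := by
    intro I J
    rw [hB]
    simp only [Matrix.mul_apply, Matrix.transpose_apply]
    rw [Finset.prod_univ_sum]
    simp only [Fintype.piFinset_univ, Finset.prod_mul_distrib]
  have h3 : ∀ L : Fin r → Fin n,
      ((‖∑ I, ((∏ k, B (L k) (I k) : ℝ) : 𝕜) * s c z I‖ ^ 2 : ℝ) : 𝕜) =
        ∑ I, ∑ J, (((∏ k, B (L k) (I k)) * ∏ k, B (L k) (J k) : ℝ) : 𝕜) *
          (starRingEnd 𝕜 (s c z I) * s c z J) := by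
    intro L
    rw [RCLike.ofReal_pow, ← RCLike.conj_mul, map_sum, Finset.sum_mul_sum]
    refine Finset.sum_congr rfl fun I _ ↦ Finset.sum_congr rfl fun J _ ↦ ?_
    rw [map_mul, RCLike.conj_ofReal, RCLike.ofReal_mul]
    ring
  rw [RCLike.ofReal_sum, Finset.sum_congr rfl fun L _ ↦ h3 L, Finset.sum_comm]
  refine Finset.sum_congr rfl fun I _ ↦ ?_
  rw [Finset.sum_comm]
  refine Finset.sum_congr rfl fun J _ ↦ ?_
  rw [h2, RCLike.ofReal_sum, Finset.sum_mul]

theorem l2_self_nonneg {r : ℕ} {s : Comps n M 𝕜 r} (hs : S.IsTest s) :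
    0 ≤ RCLike.re (S.l2 s s) := by
  have h1 : ∀ c, ∀ z ∈ (chartAt (Eu n) c).target, ∃ b : ℝ, 0 ≤ b ∧ S.pair s s c z = (b : 𝕜) := by
    intro c z hz
    by_cases hz' : z ∈ S.chartDom c
    · exact S.pair_self s hz'
    · obtain ⟨K, hK, -, h0, -⟩ := hs
      exact ⟨0, le_rfl, by
        rw [S.pair_eq_zero (h0 c z hz fun h ↦ hz' ⟨hz, hK h⟩), RCLike.ofReal_zero]⟩
  have h2 : ∀ c : M, ∃ b : ℝ, 0 ≤ b ∧ ∫ z in (chartAt (Eu n) c).target,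
      ((chartPartition n M c ((chartAt (Eu n) c).symm z) * √(S.gscMat c z).det : ℝ) : 𝕜) *
        S.pair s s c z = (b : 𝕜) := by
    intro c
    refine ⟨∫ z in (chartAt (Eu n) c).target,
      (chartPartition n M c ((chartAt (Eu n) c).symm z) * √(S.gscMat c z).det) *
        RCLike.re (S.pair s s c z),
      setIntegral_nonneg (chartAt (Eu n) c).open_target.measurableSet fun z hz ↦ ?_, ?_⟩
    · obtain ⟨b, hb, hb'⟩ := h1 c z hz
      rw [hb', RCLike.ofReal_re]
      have := (chartPartition n M).nonneg c ((chartAt (Eu n) c).symm z)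
      positivity
    · rw [← integral_ofReal]
      refine setIntegral_congr_fun (chartAt (Eu n) c).open_target.measurableSet fun z hz ↦ ?_
      obtain ⟨b, hb, hb'⟩ := h1 c z hz
      simp [hb']
  choose b hb hb' using h2
  have h3 : S.l2 s s = ((∑ᶠ c, b c : ℝ) : 𝕜) := by
    rw [l2, finsum_congr hb']
    exact (((algebraMap ℝ 𝕜).toAddMonoidHom.map_finsum_of_injective
      (algebraMap ℝ 𝕜).injective _)).symm
  rw [h3, RCLike.ofReal_re]
  exact finsum_nonneg hb

theorem isTest_comps_fun (u : S.TestFun 𝕜) : S.IsTest u.comps := by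
  obtain ⟨u, hu, K, hK, hKc, h0⟩ := u
  exact ⟨K, hK, hKc, fun c z _ hz I ↦ h0 _ hz, fun c I ↦
    ((contDiffOn_fun_comp hu c).continuousOn).mono inter_subset_left⟩

theorem isTest_comps_form (u : S.TestForm 𝕜) : S.IsTest u.comps := by
  obtain ⟨u, hu, K, hK, hKc, h0⟩ := u
  refine ⟨K, hK, hKc, fun c z _ hz I ↦ ?_, fun c I ↦
    ((hu.contDiffOn_comp c (I 0)).continuousOn).mono inter_subset_left⟩
  simp [TestForm.comps, compsForm, h0 _ hz]

theorem pderiv_eq_zero {K : Set M} (hK : IsClosed K) {c : M} {f : Eu n → 𝕜}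
    (h0 : ∀ z ∈ (chartAt (Eu n) c).target, (chartAt (Eu n) c).symm z ∉ K → f z = 0)
    {z : Eu n} (hz : z ∈ (chartAt (Eu n) c).target) (hzK : (chartAt (Eu n) c).symm z ∉ K)
    (i : Fin n) : pderiv i f z = 0 := by
  have ho := (chartAt (Eu n) c).isOpen_inter_preimage_symm hK.isOpen_compl
  have : f =ᶠ[𝓝 z] fun _ ↦ 0 := by
    filter_upwards [ho.mem_nhds ⟨hz, hzK⟩] with w hw using h0 w hw.1 hw.2
  rw [pderiv, this.fderiv_eq]
  simp

theorem isTest_gradFun (u : S.TestFun 𝕜) : S.IsTest (gradFun u.comps) := by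
  obtain ⟨u, hu, K, hK, hKc, h0⟩ := u
  refine ⟨K, hK, hKc, fun c z hz hzK I ↦ pderiv_eq_zero hKc.isClosed
    (fun w _ hw ↦ h0 _ hw) hz hzK _, fun c I ↦ ?_⟩
  exact ((contDiffOn_pderiv (chartAt (Eu n) c).open_target
    (contDiffOn_fun_comp hu c) (I 0)).continuousOn).mono inter_subset_left

theorem isTest_gradForm (u : S.TestForm 𝕜) : S.IsTest (gradForm S.gscMat u.comps) := by
  obtain ⟨u, hu, K, hK, hKc, h0⟩ := u
  have h0' : ∀ (c : M) (z : Eu n) (I : Fin 1 → Fin n), (chartAt (Eu n) c).symm z ∉ K →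
      compsForm u c z I = 0 := by
    intro c z I hz
    simp [compsForm, h0 _ hz]
  refine ⟨K, hK, hKc, fun c z hz hzK I ↦ ?_, fun c I ↦ ?_⟩
  · simp only [gradForm, TestForm.comps, h0' c z _ hzK, smul_zero, Finset.sum_const_zero, sub_zero]
    exact pderiv_eq_zero hKc.isClosed (fun w _ hw ↦ h0' c w _ hw) hz hzK _
  · refine ContinuousOn.sub ?_ (continuousOn_finsetSum _ fun k _ ↦
      (S.continuousOn_christoffel c k (I 0) (I 1)).smul ?_)
    · exact ((contDiffOn_pderiv (chartAt (Eu n) c).open_target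
        (hu.contDiffOn_comp c (I 1)) (I 0)).continuousOn).mono inter_subset_left
    · exact ((hu.contDiffOn_comp c k).continuousOn).mono inter_subset_left

theorem pderiv_add {c : M} {f g : Eu n → 𝕜}
    (hf : ContDiffOn ℝ ∞ f (chartAt (Eu n) c).target)
    (hg : ContDiffOn ℝ ∞ g (chartAt (Eu n) c).target) {z : Eu n}
    (hz : z ∈ (chartAt (Eu n) c).target) (i : Fin n) :
    pderiv i (fun w ↦ f w + g w) z = pderiv i f z + pderiv i g z := by
  have ho := (chartAt (Eu n) c).open_target.mem_nhds hz
  have hf' := (hf.contDiffAt ho).differentiableAt (by simp)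
  have hg' := (hg.contDiffAt ho).differentiableAt (by simp)
  simp only [pderiv]
  rw [fderiv_fun_add hf' hg', add_apply]

theorem pderiv_smul {c : M} {f : Eu n → 𝕜} (a : 𝕜)
    (hf : ContDiffOn ℝ ∞ f (chartAt (Eu n) c).target) {z : Eu n}
    (hz : z ∈ (chartAt (Eu n) c).target) (i : Fin n) :
    pderiv i (fun w ↦ a * f w) z = a * pderiv i f z := by
  have ho := (chartAt (Eu n) c).open_target.mem_nhds hz
  have hf' := (hf.contDiffAt ho).differentiableAt (by simp)
  simp only [pderiv]
  rw [fderiv_const_mul hf' a, smul_apply, smul_eq_mul]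

/-- The `H_sc^{1,0}` inner product on `C_c^∞(Ω)`, as a semi-inner product. -/
@[reducible] def coreFun : PreInnerProductSpace.Core 𝕜 (S.TestFun 𝕜) where
  inner := S.sobolevFun
  conj_inner_symm u v := by
    simp only [sobolevFun, map_add, l2_conj]
  re_inner_nonneg u := by
    rw [sobolevFun, map_add]
    exact add_nonneg (S.l2_self_nonneg (S.isTest_comps_fun u))
      (S.l2_self_nonneg (S.isTest_gradFun u))
  add_left u v w := by
    simp only [sobolevFun]
    rw [S.l2_add (s := (u + v).comps) (S.isTest_comps_fun u) (S.isTest_comps_fun v)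
        (S.isTest_comps_fun w)
        fun c z _ I ↦ rfl,
      S.l2_add (s := gradFun (u + v).comps) (S.isTest_gradFun u) (S.isTest_gradFun v)
        (S.isTest_gradFun w)
        fun c z hz I ↦ pderiv_add (contDiffOn_fun_comp u.2.1 c) (contDiffOn_fun_comp v.2.1 c) hz _]
    ring
  smul_left u v a := by
    simp only [sobolevFun]
    rw [S.l2_smul (s := (a • u).comps) (s₁ := u.comps) a fun c z _ I ↦ rfl,
      S.l2_smul (s := gradFun (a • u).comps) (s₁ := gradFun u.comps) a
        fun c z hz I ↦ pderiv_smul a (contDiffOn_fun_comp u.2.1 c) hz _]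
    ring

/-- The `H_sc^{1,0}` inner product on `C_c^∞(Ω; T^*M)`, as a semi-inner product. -/
@[reducible] def coreForm : PreInnerProductSpace.Core 𝕜 (S.TestForm 𝕜) where
  inner := S.sobolevForm
  conj_inner_symm u v := by
    simp only [sobolevForm, map_add, l2_conj]
  re_inner_nonneg u := by
    rw [sobolevForm, map_add]
    exact add_nonneg (S.l2_self_nonneg (S.isTest_comps_form u))
      (S.l2_self_nonneg (S.isTest_gradForm u))
  add_left u v w := by
    simp only [sobolevForm]
    rw [S.l2_add (s := (u + v).comps) (S.isTest_comps_form u) (S.isTest_comps_form v)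
        (S.isTest_comps_form w)
        fun c z _ I ↦ rfl,
      S.l2_add (s := gradForm S.gscMat (u + v).comps) (S.isTest_gradForm u) (S.isTest_gradForm v)
        (S.isTest_gradForm w)
        fun c z hz I ↦ ?_]
    · ring
    · have h1 : pderiv (I 0) (fun w ↦ (u + v).comps c w ![I 1]) z =
          pderiv (I 0) (fun w ↦ u.comps c w ![I 1]) z +
            pderiv (I 0) (fun w ↦ v.comps c w ![I 1]) z :=
        pderiv_add (u.2.1.contDiffOn_comp c (I 1)) (v.2.1.contDiffOn_comp c (I 1)) hz (I 0)
      have h2 : ∀ k, (u + v).comps c z ![k] = u.comps c z ![k] + v.comps c z ![k] := fun k ↦ rfl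
      simp only [gradForm]
      rw [h1, Finset.sum_congr rfl fun k _ ↦ by rw [h2 k, smul_add], Finset.sum_add_distrib]
      ring
  smul_left u v a := by
    simp only [sobolevForm]
    rw [S.l2_smul (s := (a • u).comps) (s₁ := u.comps) a fun c z _ I ↦ rfl,
      S.l2_smul (s := gradForm S.gscMat (a • u).comps) (s₁ := gradForm S.gscMat u.comps) a
        fun c z hz I ↦ ?_]
    · ring
    · have h1 := pderiv_smul a (u.2.1.contDiffOn_comp c (I 1)) hz (I 0)
      have h2 : ∀ k, (a • u).comps c z ![k] = a * u.comps c z ![k] := fun k ↦ rfl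
      simp only [gradForm, h2, ← mul_smul_comm, ← Finset.mul_sum, mul_sub]
      congr 1

instance : SeminormedAddCommGroup (S.TestFun 𝕜) :=
  InnerProductSpace.Core.toSeminormedAddCommGroup (𝕜 := 𝕜) (c := S.coreFun)

instance : InnerProductSpace 𝕜 (S.TestFun 𝕜) := InnerProductSpace.ofCore S.coreFun

instance : SeminormedAddCommGroup (S.TestForm 𝕜) :=
  InnerProductSpace.Core.toSeminormedAddCommGroup (𝕜 := 𝕜) (c := S.coreForm)

instance : InnerProductSpace 𝕜 (S.TestForm 𝕜) := InnerProductSpace.ofCore S.coreForm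

variable (𝕜) in
/-- The space `Ḣ_sc^{1,0}(Ω)` of functions: the completion of `C_c^∞(Ω)` in the norm
`(‖u‖² + ‖du‖²)^{1/2}`. -/
abbrev HdotFun : Type _ := UniformSpace.Completion (S.TestFun 𝕜)

variable (𝕜) in
/-- The space `Ḣ_sc^{1,0}(Ω; T^*)` of one-forms: the completion of `C_c^∞(Ω; T^*M)` in the norm
`(‖u‖² + ‖∇u‖²)^{1/2}`. -/
abbrev HdotForm : Type _ := UniformSpace.Completion (S.TestForm 𝕜)

/-! ### The solenoidal Witten Laplacian -/

/-- The function `e^{a/x}`. -/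
def expWeight (a : ℝ) (p : M) : ℝ := Real.exp (a / S.x p)

/-- `dˢ_F = e^{-F/x} d e^{F/x}` on functions. -/
def dFun (F : ℝ) (u : S.TestFun 𝕜) : Comps n M 𝕜 1 :=
  mulFun (S.expWeight (-F)) (gradFun (mulFun (S.expWeight F) u.comps))

/-- `dˢ_F = e^{-F/x} dˢ e^{F/x}` on one-forms, where `dˢ` is the symmetric differential of the
metric `g`. -/
def dForm (F : ℝ) (u : S.TestForm 𝕜) : Comps n M 𝕜 2 :=
  mulFun (S.expWeight (-F)) (symGrad S.gMat (mulFun (S.expWeight F) u.comps))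

/-- `δˢ_F` on one-forms, the adjoint of `dˢ_F` for the scattering metric: `δˢ_F t` is the
distribution on `Ω` (a conjugate-linear functional of test functions) with
`⟨δˢ_F t, v⟩ = ⟨t, dˢ_F v⟩_{L²}`. -/
def deltaFun (F : ℝ) (t : Comps n M 𝕜 1) : S.TestFun 𝕜 → 𝕜 := fun v ↦ S.l2 (S.dFun F v) t

/-- `δˢ_F` on symmetric `2`-tensors, the adjoint of `dˢ_F` for the scattering metric. -/
def deltaForm (F : ℝ) (t : Comps n M 𝕜 2) : S.TestForm 𝕜 → 𝕜 := fun v ↦ S.l2 (S.dForm F v) t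

/-- The solenoidal Witten Laplacian `Δ_{F,s} = δˢ_F dˢ_F` on functions. -/
def laplaceFun (F : ℝ) (u : S.TestFun 𝕜) : S.TestFun 𝕜 → 𝕜 := S.deltaFun F (S.dFun F u)

/-- The solenoidal Witten Laplacian `Δ_{F,s} = δˢ_F dˢ_F` on one-forms. -/
def laplaceForm (F : ℝ) (u : S.TestForm 𝕜) : S.TestForm 𝕜 → 𝕜 := S.deltaForm F (S.dForm F u)

end Region

end ScatteringGauge

end

set_option linter.unusedSectionVars false
set_option linter.unusedSimpArgs false

open scoped Manifold ContDiff Topology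
open Set Bundle MeasureTheory

noncomputable section

namespace ScatteringGauge

section LaxMilgram

variable {𝕜 : Type*} [RCLike 𝕜]

open scoped InnerProductSpace

theorem exists_equiv_of_coercive_hilbert {V : Type*} [NormedAddCommGroup V] [InnerProductSpace 𝕜 V]
    [CompleteSpace V] (B : V →L⋆[𝕜] V →L[𝕜] 𝕜) {κ : ℝ} (hκ : 0 < κ)
    (hB : ∀ v, κ * ‖v‖ ^ 2 ≤ RCLike.re (B v v)) :
    ∃ P : V ≃L[𝕜] V, ∀ u v, ⟪P u, v⟫_𝕜 = B u v := by
  set P := InnerProductSpace.continuousLinearMapOfBilin B with hP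
  have happ : ∀ u v, ⟪P u, v⟫_𝕜 = B u v :=
    InnerProductSpace.continuousLinearMapOfBilin_apply B
  have hbelow : ∀ v, κ * ‖v‖ ≤ ‖P v‖ := by
    intro v
    by_cases h : 0 < ‖v‖
    · refine le_of_mul_le_mul_right ?_ h
      calc κ * ‖v‖ * ‖v‖ = κ * ‖v‖ ^ 2 := by ring
        _ ≤ RCLike.re (B v v) := hB v
        _ = RCLike.re ⟪P v, v⟫_𝕜 := by rw [happ]
        _ ≤ ‖P v‖ * ‖v‖ := re_inner_le_norm _ _
    · have : v = 0 := by simpa using h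
      simp [this]
  have hanti : AntilipschitzWith (κ⁻¹).toNNReal P := by
    refine ContinuousLinearMap.antilipschitz_of_bound P fun v ↦ ?_
    rw [Real.coe_toNNReal', max_eq_left (inv_pos.2 hκ).le, ← div_eq_inv_mul, le_div_iff₀ hκ,
      mul_comm]
    exact hbelow v
  have hker : P.ker = ⊥ := LinearMap.ker_eq_bot.2 hanti.injective
  have hclosed : IsClosed (P.range : Set V) := hanti.isClosed_range P.uniformContinuous
  have hrange : P.range = ⊤ := by
    have := hclosed.completeSpace_coe
    rw [← P.range.orthogonal_orthogonal, Submodule.eq_top_iff']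
    intro v w hw
    have h0 : RCLike.re (B w w) = 0 := by
      have h := hw _ ⟨w, rfl⟩
      rw [← happ]
      exact (congrArg RCLike.re h).trans (map_zero _)
    have h1 := hB w
    have h2 : ‖w‖ ^ 2 ≤ 0 := by
      rw [h0] at h1
      nlinarith [sq_nonneg ‖w‖]
    have h3 : w = 0 := by
      rw [← norm_eq_zero]
      nlinarith [norm_nonneg w]
    rw [h3]
    exact inner_zero_left _
  exact ⟨ContinuousLinearEquiv.ofBijective P hker hrange, happ⟩

/-- The equivalence of a Hilbert space with its conjugate-linear dual. -/
theorem exists_equiv_conj_dual {V : Type*} [NormedAddCommGroup V] [InnerProductSpace 𝕜 V]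
    [CompleteSpace V] : ∃ R : V ≃L[𝕜] (V →L⋆[𝕜] 𝕜), ∀ u v, R u v = ⟪v, u⟫_𝕜 := by
  let f : V →L[𝕜] V →L⋆[𝕜] 𝕜 := (innerSL 𝕜 (E := V)).flip
  have hf : ∀ u v, f u v = ⟪v, u⟫_𝕜 := fun u v ↦ rfl
  have hinj : Function.Injective f := by
    intro u u' h
    refine ext_inner_left 𝕜 fun v ↦ ?_
    rw [← hf, ← hf, h]
  have hsurj : Function.Surjective f := by
    intro g
    let g' : StrongDual 𝕜 V :=
      LinearMap.mkContinuous
        { toFun := fun v ↦ starRingEnd 𝕜 (g v)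
          map_add' := fun v w ↦ by simp
          map_smul' := fun a v ↦ by simp } ‖g‖ (fun v ↦ by
            simpa using g.le_opNorm v)
    refine ⟨(InnerProductSpace.toDual 𝕜 V).symm g', ?_⟩
    ext v
    rw [hf, ← inner_conj_symm, InnerProductSpace.toDual_symm_apply]
    change starRingEnd 𝕜 (starRingEnd 𝕜 (g v)) = g v
    simp
  exact ⟨ContinuousLinearEquiv.ofBijective f (LinearMap.ker_eq_bot.2 hinj)
    (LinearMap.range_eq_top.2 hsurj), hf⟩

theorem exists_equiv_of_coercive {T : Type*} [SeminormedAddCommGroup T] [InnerProductSpace 𝕜 T]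
    (b : T → T → 𝕜)
    (hconj : ∀ u v, starRingEnd 𝕜 (b u v) = b v u)
    (hadd : ∀ u u' v, b (u + u') v = b u v + b u' v)
    (hsmul : ∀ (a : 𝕜) u v, b (a • u) v = starRingEnd 𝕜 a * b u v)
    {C κ : ℝ} (hbound : ∀ u, RCLike.re (b u u) ≤ C * ‖u‖ ^ 2) (hκ : 0 < κ)
    (hcoer : ∀ u, κ * ‖u‖ ^ 2 ≤ RCLike.re (b u u)) :
    ∃ Δ : UniformSpace.Completion T ≃L[𝕜] (UniformSpace.Completion T →L⋆[𝕜] 𝕜),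
      ∀ u v : T, Δ u v = b v u := by
  have hadd' : ∀ u v v', b u (v + v') = b u v + b u v' := by
    intro u v v'
    rw [← hconj, hadd, map_add, hconj, hconj]
  have hsmul' : ∀ (a : 𝕜) u v, b u (a • v) = a * b u v := by
    intro a u v
    rw [← hconj, hsmul, map_mul, hconj, RCLike.conj_conj]
  have hcs : ∀ u v, ‖b u v‖ ≤ |C| * ‖u‖ * ‖v‖ := by
    intro u v
    let core : PreInnerProductSpace.Core 𝕜 T :=
      { inner := b
        conj_inner_symm := fun u v ↦ hconj v u
        re_inner_nonneg := fun u ↦ le_trans (by positivity) (hcoer u)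
        add_left := hadd
        smul_left := fun u v a ↦ hsmul a u v }
    have h1 := InnerProductSpace.Core.inner_mul_inner_self_le (c := core) u v
    change ‖b u v‖ * ‖b v u‖ ≤ RCLike.re (b u u) * RCLike.re (b v v) at h1
    have h2 : ‖b v u‖ = ‖b u v‖ := by rw [← hconj, RCLike.norm_conj]
    rw [h2] at h1
    have hC : ∀ u, RCLike.re (b u u) ≤ |C| * ‖u‖ ^ 2 := fun u ↦
      (hbound u).trans (by gcongr; exact le_abs_self C)
    have h0 : ∀ u, 0 ≤ RCLike.re (b u u) := fun u ↦ le_trans (by positivity) (hcoer u)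
    have h3 : ‖b u v‖ ^ 2 ≤ (|C| * ‖u‖ * ‖v‖) ^ 2 := by
      calc ‖b u v‖ ^ 2 = ‖b u v‖ * ‖b u v‖ := by ring
        _ ≤ _ := h1
        _ ≤ (|C| * ‖u‖ ^ 2) * (|C| * ‖v‖ ^ 2) :=
          mul_le_mul (hC u) (hC v) (h0 v) (by positivity)
        _ = _ := by ring
    exact le_of_sq_le_sq h3 (by positivity) 
  let B₀ : T →L⋆[𝕜] T →L[𝕜] 𝕜 := LinearMap.mkContinuous₂
    (LinearMap.mk₂'ₛₗ (starRingEnd 𝕜) (RingHom.id 𝕜) b hadd hsmul hadd' hsmul') |C| hcs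
  have hB₀ : ∀ u v, B₀ u v = b u v := fun u v ↦ rfl
  let e : T →L[𝕜] UniformSpace.Completion T := UniformSpace.Completion.toComplL
  have hed : DenseRange e := UniformSpace.Completion.denseRange_coe
  have hei : IsUniformInducing e := UniformSpace.Completion.isUniformInducing_coe T
  have hee : ∀ u : T, e u = (u : UniformSpace.Completion T) := fun _ ↦ rfl
  let B₁ : T →L[𝕜] UniformSpace.Completion T →L⋆[𝕜] 𝕜 := (B₀.extend e).flip
  let B : UniformSpace.Completion T →L⋆[𝕜] UniformSpace.Completion T →L[𝕜] 𝕜 :=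
    (B₁.extend e).flip
  have hB : ∀ u v : T, B u v = b u v := by
    intro u v
    change (B₁.extend e) (e v) (e u) = _
    rw [ContinuousLinearMap.extend_eq B₁ hed hei]
    change (B₀.extend e) (e u) v = _
    rw [ContinuousLinearMap.extend_eq B₀ hed hei, hB₀]
  have hcoerB : ∀ w : UniformSpace.Completion T, κ * ‖w‖ ^ 2 ≤ RCLike.re (B w w) := by
    intro w
    induction w using UniformSpace.Completion.induction_on with
    | hp =>
      refine isClosed_le (by fun_prop) ?_
      exact RCLike.continuous_re.comp (B.continuous.clm_apply continuous_id)
    | ih u =>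
      rw [hB, UniformSpace.Completion.norm_coe]
      exact hcoer u
  obtain ⟨P, hP⟩ := exists_equiv_of_coercive_hilbert B hκ hcoerB
  obtain ⟨R, hR⟩ := exists_equiv_conj_dual (𝕜 := 𝕜) (V := UniformSpace.Completion T)
  refine ⟨P.trans R, fun u v ↦ ?_⟩
  change R (P u) v = b v u
  rw [hR, ← inner_conj_symm, hP, hB, hconj]

end LaxMilgram


section TensorAlgebra

variable {n r : ℕ} {𝕜 : Type*} [RCLike 𝕜]

/-- The sesquilinear form induced on tensors of rank `r` by a matrix. -/
def tform (Q : Matrix (Fin n) (Fin n) ℝ) (s t : (Fin r → Fin n) → 𝕜) : 𝕜 :=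
  ∑ I, ∑ J, ((∏ k, Q (I k) (J k) : ℝ) : 𝕜) * (starRingEnd 𝕜 (s I) * t J)

/-- The action of a matrix on the components of a tensor of rank `r`. -/
def tmap (A : Matrix (Fin n) (Fin n) ℝ) (s : (Fin r → Fin n) → 𝕜) : (Fin r → Fin n) → 𝕜 :=
  fun I ↦ ∑ J, ((∏ k, A (I k) (J k) : ℝ) : 𝕜) * s J

/-- The Euclidean square norm of the components of a tensor. -/
def sqn (s : (Fin r → Fin n) → 𝕜) : ℝ := ∑ I, ‖s I‖ ^ 2

theorem sqn_nonneg (s : (Fin r → Fin n) → 𝕜) : 0 ≤ sqn s :=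
  Finset.sum_nonneg fun _ _ ↦ by positivity

theorem prod_mul_apply (A B : Matrix (Fin n) (Fin n) ℝ) (I J : Fin r → Fin n) :
    ∏ k, (A * B) (I k) (J k) =
      ∑ L : Fin r → Fin n, (∏ k, A (I k) (L k)) * ∏ k, B (L k) (J k) := by
  simp only [Matrix.mul_apply]
  rw [Finset.prod_univ_sum]
  simp only [Fintype.piFinset_univ, Finset.prod_mul_distrib]

theorem tmap_mul (A B : Matrix (Fin n) (Fin n) ℝ) (s : (Fin r → Fin n) → 𝕜) :
    tmap (A * B) s = tmap A (tmap B s) := by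
  ext I
  simp only [tmap, prod_mul_apply, RCLike.ofReal_sum, Finset.sum_mul, Finset.mul_sum]
  rw [Finset.sum_comm]
  refine Finset.sum_congr rfl fun L _ ↦ Finset.sum_congr rfl fun J _ ↦ ?_
  rw [RCLike.ofReal_mul]
  ring

theorem prod_one_apply (I J : Fin r → Fin n) :
    ∏ k, (1 : Matrix (Fin n) (Fin n) ℝ) (I k) (J k) = if I = J then 1 else 0 := by
  simp only [Matrix.one_apply]
  split_ifs with h
  · simp [h]
  · obtain ⟨k, hk⟩ := Function.ne_iff.1 h
    exact Finset.prod_eq_zero (Finset.mem_univ k) (by simp [hk])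

theorem tmap_one (s : (Fin r → Fin n) → 𝕜) : tmap 1 s = s := by
  ext I
  simp [tmap, prod_one_apply]

theorem tform_eq_sum (Q : Matrix (Fin n) (Fin n) ℝ) (s t : (Fin r → Fin n) → 𝕜) :
    tform Q s t = ∑ I, starRingEnd 𝕜 (s I) * tmap Q t I := by
  simp only [tform, tmap, Finset.mul_sum]
  refine Finset.sum_congr rfl fun I _ ↦ Finset.sum_congr rfl fun J _ ↦ ?_
  ring

theorem sum_conj_tmap_mul (A : Matrix (Fin n) (Fin n) ℝ) (s t : (Fin r → Fin n) → 𝕜) :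
    ∑ I, starRingEnd 𝕜 (tmap A s I) * t I =
      ∑ I, starRingEnd 𝕜 (s I) * tmap A.transpose t I := by
  simp only [tmap, Finset.mul_sum, map_sum, Finset.sum_mul, map_mul, RCLike.conj_ofReal,
    Matrix.transpose_apply]
  rw [Finset.sum_comm]
  refine Finset.sum_congr rfl fun I _ ↦ Finset.sum_congr rfl fun J _ ↦ ?_
  ring

theorem tform_tmap (Q A : Matrix (Fin n) (Fin n) ℝ) (s t : (Fin r → Fin n) → 𝕜) :
    tform Q (tmap A s) (tmap A t) = tform (A.transpose * Q * A) s t := by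
  rw [tform_eq_sum, sum_conj_tmap_mul, tform_eq_sum, Matrix.mul_assoc, tmap_mul, tmap_mul]

theorem tform_one (s : (Fin r → Fin n) → 𝕜) : RCLike.re (tform 1 s s) = sqn s := by
  simp only [tform, prod_one_apply, sqn, map_sum]
  refine Finset.sum_congr rfl fun I _ ↦ ?_
  rw [Finset.sum_eq_single I]
  · rw [if_pos rfl, RCLike.ofReal_one, one_mul, RCLike.conj_mul, ← RCLike.ofReal_pow,
      RCLike.ofReal_re]
  · intro J _ hJ
    simp [hJ.symm]
  · simp

theorem sqn_tmap_le {b : ℝ} {B : Matrix (Fin n) (Fin n) ℝ} (hB : ∀ i j, |B i j| ≤ b)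
    (s : (Fin r → Fin n) → 𝕜) :
    sqn (tmap B s) ≤ (Fintype.card (Fin r → Fin n)) ^ 2 * (b ^ 2) ^ r * sqn s := by
  set N : ℝ := (Fintype.card (Fin r → Fin n) : ℝ) with hN
  have hprod : ∀ I J : Fin r → Fin n, ‖((∏ k, B (I k) (J k) : ℝ) : 𝕜)‖ ≤ b ^ r := by
    intro I J
    rw [RCLike.norm_ofReal, Finset.abs_prod]
    calc ∏ k, |B (I k) (J k)| ≤ ∏ _k : Fin r, b :=
          Finset.prod_le_prod (fun _ _ ↦ abs_nonneg _) fun k _ ↦ hB _ _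
      _ = b ^ r := by simp
  have h1 : ∀ I, ‖tmap B s I‖ ^ 2 ≤ N * (b ^ 2) ^ r * sqn s := by
    intro I
    have h2 : ‖tmap B s I‖ ≤ ∑ J, b ^ r * ‖s J‖ := by
      refine (norm_sum_le _ _).trans (Finset.sum_le_sum fun J _ ↦ ?_)
      rw [norm_mul]
      exact mul_le_mul_of_nonneg_right (hprod I J) (norm_nonneg _)
    have h3 : (∑ J, b ^ r * ‖s J‖) ^ 2 ≤ N * ∑ J, (b ^ r * ‖s J‖) ^ 2 := by
      simpa [hN] using
        sq_sum_le_card_mul_sum_sq (s := (Finset.univ : Finset (Fin r → Fin n)))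
          (f := fun J ↦ b ^ r * ‖s J‖)
    calc ‖tmap B s I‖ ^ 2 ≤ (∑ J, b ^ r * ‖s J‖) ^ 2 := by gcongr
      _ ≤ _ := h3
      _ = N * (b ^ 2) ^ r * sqn s := by
        have h4 : ∑ J, (b ^ r * ‖s J‖) ^ 2 = (b ^ 2) ^ r * sqn s := by
          rw [sqn, Finset.mul_sum]
          refine Finset.sum_congr rfl fun J _ ↦ ?_
          rw [mul_pow, ← pow_mul, ← pow_mul, mul_comm r]
        rw [h4, mul_assoc]
  calc sqn (tmap B s) ≤ ∑ _I : Fin r → Fin n, N * (b ^ 2) ^ r * sqn s :=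
        Finset.sum_le_sum fun I _ ↦ h1 I
    _ = _ := by
      rw [Finset.sum_const, Finset.card_univ, nsmul_eq_mul, ← hN]
      ring

theorem tform_inv_bounds {q : ℝ} {H : Matrix (Fin n) (Fin n) ℝ} (hH : H.PosDef)
    (h1 : ∀ i, H i i ≤ q) (h2 : ∀ i, H⁻¹ i i ≤ q) (s : (Fin r → Fin n) → 𝕜) :
    RCLike.re (tform H⁻¹ s s) ≤ (Fintype.card (Fin r → Fin n)) ^ 2 * q ^ r * sqn s ∧
    sqn s ≤ (Fintype.card (Fin r → Fin n)) ^ 2 * q ^ r * RCLike.re (tform H⁻¹ s s) := by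
  obtain hn | hn := isEmpty_or_nonempty (Fin n)
  · rcases Nat.eq_zero_or_pos r with hr | hr
    · subst hr
      have : tform H⁻¹ s s = tform 1 s s := by simp [tform]
      rw [this, tform_one]
      simp
    · have : Nonempty (Fin r) := ⟨⟨0, hr⟩⟩
      simp [sqn, tform]
  have hq : 0 ≤ q := by
    obtain ⟨i⟩ := hn
    exact (hH.diag_pos (i := i)).le.trans (h1 i)
  obtain ⟨B, hB⟩ : ∃ B : Matrix (Fin n) (Fin n) ℝ, H⁻¹ = B.transpose * B := by
    have h1 := (Matrix.posDef_inv_iff.2 hH).posSemidef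
    open scoped MatrixOrder in
    obtain ⟨B, hB⟩ := CStarAlgebra.nonneg_iff_eq_star_mul_self.1 h1.nonneg
    exact ⟨B, by simpa [Matrix.star_eq_conjTranspose] using hB⟩
  have hform : RCLike.re (tform H⁻¹ s s) = sqn (tmap B s) := by
    rw [← tform_one, tform_tmap, Matrix.mul_one, ← hB]
  have hdet : IsUnit H.det := hH.det_pos.ne'.isUnit
  have hBdet : IsUnit B.det := by
    have := congrArg Matrix.det hB
    rw [Matrix.det_mul, Matrix.det_transpose] at this
    have h3 : IsUnit (H⁻¹).det := Matrix.isUnit_nonsing_inv_det H hdet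
    rw [this] at h3
    exact isUnit_of_mul_isUnit_left h3
  have hH' : H = B⁻¹ * (B⁻¹).transpose := by
    rw [← Matrix.nonsing_inv_nonsing_inv H hdet, hB, Matrix.mul_inv_rev,
      Matrix.transpose_nonsing_inv]
  have hb : ∀ x : ℝ, x ^ 2 ≤ q → |x| ≤ √q := fun x hx ↦ Real.abs_le_sqrt hx
  have hB1 : ∀ i j, |B i j| ≤ √q := by
    intro i j
    refine hb _ (le_trans ?_ (h2 j))
    rw [hB, Matrix.mul_apply]
    simp only [Matrix.transpose_apply, ← sq]
    exact Finset.single_le_sum (f := fun k ↦ B k j ^ 2) (fun _ _ ↦ sq_nonneg _) (Finset.mem_univ i)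
  have hB2 : ∀ i j, |B⁻¹ i j| ≤ √q := by
    intro i j
    refine hb _ (le_trans ?_ (h1 i))
    have : H i i = ∑ k, B⁻¹ i k ^ 2 := by
      conv_lhs => rw [hH', Matrix.mul_apply]
      simp only [Matrix.transpose_apply, ← sq]
    rw [this]
    exact Finset.single_le_sum (f := fun k ↦ B⁻¹ i k ^ 2) (fun _ _ ↦ sq_nonneg _)
      (Finset.mem_univ j)
  rw [hform]
  have e1 := sqn_tmap_le hB1 s
  have e2 := sqn_tmap_le hB2 (tmap B s)
  rw [← tmap_mul, Matrix.nonsing_inv_mul B hBdet, tmap_one] at e2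
  rw [Real.sq_sqrt hq] at e1 e2
  exact ⟨e1, e2⟩

end TensorAlgebra


section Transition

attribute [-instance] TopCat.of.chartedSpace

variable {n : ℕ} {M : Type*} [TopologicalSpace M] [ChartedSpace (Eu n) M]

/-- The transition map from the chart at `c` to the chart at `c'`. -/
def transition (c c' : M) (z : Eu n) : Eu n := chartAt (Eu n) c' ((chartAt (Eu n) c).symm z)

/-- The domain of the transition map. -/
def overlap (c c' : M) : Set (Eu n) :=
  (chartAt (Eu n) c).target ∩ (chartAt (Eu n) c).symm ⁻¹' (chartAt (Eu n) c').source

/-- The Jacobian matrix of the transition map: `∂ z'ᵏ / ∂ zⁱ` in row `i`, column `k`. -/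
def jac (c c' : M) (z : Eu n) : Matrix (Fin n) (Fin n) ℝ :=
  Matrix.of fun i k ↦ pderiv i (transition c c') z k

theorem isOpen_overlap (c c' : M) : IsOpen (overlap (n := n) c c') :=
  (chartAt (Eu n) c).isOpen_inter_preimage_symm (chartAt (Eu n) c').open_source

theorem transition_mem_overlap {c c' : M} {z : Eu n} (hz : z ∈ overlap c c') :
    transition c c' z ∈ overlap c' c :=
  ⟨(chartAt (Eu n) c').map_source hz.2, by
    rw [mem_preimage, transition, (chartAt (Eu n) c').left_inv hz.2]
    exact (chartAt (Eu n) c).map_target hz.1⟩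

theorem symm_transition {c c' : M} {z : Eu n} (hz : z ∈ overlap c c') :
    (chartAt (Eu n) c').symm (transition c c' z) = (chartAt (Eu n) c).symm z :=
  (chartAt (Eu n) c').left_inv hz.2

theorem transition_transition {c c' : M} {z : Eu n} (hz : z ∈ overlap c c') :
    transition c' c (transition c c' z) = z := by
  rw [transition, symm_transition hz, (chartAt (Eu n) c).right_inv hz.1]

theorem image_transition (c c' : M) :
    transition c c' '' overlap (n := n) c c' = overlap c' c := by
  ext w
  constructor
  · rintro ⟨z, hz, rfl⟩
    exact transition_mem_overlap hz
  · intro hw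
    exact ⟨transition c' c w, transition_mem_overlap hw, transition_transition hw⟩

theorem injOn_transition (c c' : M) : InjOn (transition c c') (overlap (n := n) c c') := by
  intro z hz w hw h
  rw [← transition_transition hz, h, transition_transition hw]

variable [IsManifold (𝓡 n) ∞ M]

theorem contDiffOn_transition (c c' : M) :
    ContDiffOn ℝ ∞ (transition c c') (overlap (n := n) c c') := by
  rw [← contMDiffOn_iff_contDiffOn]
  have h1 : ContMDiffOn (𝓡 n) (𝓡 n) ∞ (chartAt (Eu n) c).symm
      (chartAt (Eu n) c).target := contMDiffOn_chart_symm
  have h2 : ContMDiffOn (𝓡 n) (𝓡 n) ∞ (chartAt (Eu n) c')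
      (chartAt (Eu n) c').source := contMDiffOn_chart
  exact h2.comp (h1.mono inter_subset_left) fun z hz ↦ hz.2

theorem differentiableAt_transition {c c' : M} {z : Eu n} (hz : z ∈ overlap c c') :
    DifferentiableAt ℝ (transition c c') z :=
  ((contDiffOn_transition c c').contDiffAt ((isOpen_overlap c c').mem_nhds hz)).differentiableAt
    (by simp)

theorem eu_eq_sum (v : Eu n) : v = ∑ k, v k • EuclideanSpace.single k (1 : ℝ) := by
  ext i
  simp [Pi.single_apply]

theorem pderiv_comp_transition {F : Type*} [NormedAddCommGroup F] [NormedSpace ℝ F]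
    {c c' : M} {z : Eu n} (hz : z ∈ overlap c c') {f : Eu n → F}
    (hf : DifferentiableAt ℝ f (transition c c' z)) (i : Fin n) :
    pderiv i (fun w ↦ f (transition c c' w)) z =
      ∑ k, jac c c' z i k • pderiv k f (transition c c' z) := by
  have h := fderiv_comp z hf (differentiableAt_transition hz)
  simp only [Function.comp_def] at h
  simp only [pderiv, jac, Matrix.of_apply]
  rw [h, ContinuousLinearMap.comp_apply]
  conv_lhs => rw [eu_eq_sum (fderiv ℝ (transition c c') z (EuclideanSpace.single i 1))]
  simp only [map_sum, map_smul]

/-- The coordinate vector as an element of the model space. -/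
def coordVecEu (c : M) (z : Eu n) (i : Fin n) : Eu n := coordVec c z i

theorem coordVecEu_eq_sum {c c' : M} {z : Eu n} (hz : z ∈ overlap c c') (i : Fin n) :
    coordVecEu c z i = ∑ k, jac c c' z i k • coordVecEu c' (transition c c' z) k := by
  have h1 : MDifferentiableAt (𝓡 n) (𝓡 n) (chartAt (Eu n) c').symm (transition c c' z) :=
    ((contMDiffOn_chart_symm (I := 𝓡 n) (n := ∞)).contMDiffAt
      ((chartAt (Eu n) c').open_target.mem_nhds
        (transition_mem_overlap hz).1)).mdifferentiableAt (by simp)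
  have h2 : MDifferentiableAt (𝓡 n) (𝓡 n) (transition c c') z :=
    (differentiableAt_transition hz).mdifferentiableAt
  have h3 : (chartAt (Eu n) c).symm =ᶠ[𝓝 z] (chartAt (Eu n) c').symm ∘ transition c c' := by
    filter_upwards [(isOpen_overlap c c').mem_nhds hz] with w hw
    exact (symm_transition hw).symm
  let L : Eu n →L[ℝ] Eu n := mfderiv (𝓡 n) (𝓡 n) (chartAt (Eu n) c').symm (transition c c' z)
  let L' : Eu n →L[ℝ] Eu n := mfderiv (𝓡 n) (𝓡 n) (chartAt (Eu n) c).symm z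
  have h4 : L' = L.comp (fderiv ℝ (transition c c') z) := by
    have := h3.mfderiv_eq (I := 𝓡 n) (I' := 𝓡 n)
    refine this.trans ?_
    rw [mfderiv_comp z h1 h2, mfderiv_eq_fderiv]
    rfl
  change L' (EuclideanSpace.single i 1) = ∑ k, jac c c' z i k • L (EuclideanSpace.single k 1)
  rw [h4, ContinuousLinearMap.comp_apply]
  conv_lhs => rw [eu_eq_sum (fderiv ℝ (transition c c') z (EuclideanSpace.single i 1))]
  simp only [map_sum, map_smul]
  rfl

theorem compsForm_transition {𝕜 : Type*} [RCLike 𝕜]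
    (u : ∀ p : M, TangentSpace (𝓡 n) p →L[ℝ] 𝕜) {c c' : M} {z : Eu n} (hz : z ∈ overlap c c') :
    compsForm u c z = tmap (jac c c' z) (compsForm u c' (transition c c' z)) := by
  let u' : M → Eu n →L[ℝ] 𝕜 := u
  ext I
  have h1 : compsForm u c z I = u' ((chartAt (Eu n) c).symm z) (coordVecEu c z (I 0)) := rfl
  have h2 : ∀ J, compsForm u c' (transition c c' z) J =
      u' ((chartAt (Eu n) c').symm (transition c c' z))
        (coordVecEu c' (transition c c' z) (J 0)) := fun _ ↦ rfl
  rw [h1, coordVecEu_eq_sum hz, map_sum, tmap]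
  simp only [h2, symm_transition hz, map_smul]
  rw [← Equiv.sum_comp (Equiv.funUnique (Fin 1) (Fin n)).symm]
  refine Finset.sum_congr rfl fun k _ ↦ ?_
  simp [RCLike.real_smul_eq_coe_mul]

theorem bilinMatrix_transition
    (B : ∀ p : M, TangentSpace (𝓡 n) p →L[ℝ] TangentSpace (𝓡 n) p →L[ℝ] ℝ)
    {c c' : M} {z : Eu n} (hz : z ∈ overlap c c') :
    bilinMatrix B c z =
      jac c c' z * bilinMatrix B c' (transition c c' z) * (jac c c' z).transpose := by
  let B' : M → Eu n →L[ℝ] Eu n →L[ℝ] ℝ := B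
  ext i j
  have h1 : bilinMatrix B c z i j =
    B' ((chartAt (Eu n) c).symm z) (coordVecEu c z i) (coordVecEu c z j) := rfl
  have h2 : ∀ k l, bilinMatrix B c' (transition c c' z) k l =
      B' ((chartAt (Eu n) c').symm (transition c c' z))
        (coordVecEu c' (transition c c' z) k) (coordVecEu c' (transition c c' z) l) :=
    fun _ _ ↦ rfl
  rw [h1, coordVecEu_eq_sum hz, coordVecEu_eq_sum hz]
  simp only [Matrix.mul_apply, Matrix.transpose_apply, h2, symm_transition hz, map_sum, map_smul,
    sum_apply, smul_apply, smul_eq_mul, Finset.sum_mul,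
    Finset.mul_sum]
  refine Finset.sum_congr rfl fun k _ ↦ Finset.sum_congr rfl fun l _ ↦ ?_
  ring

theorem det_jac {c c' : M} (z : Eu n) :
    (jac c c' z).det = (fderiv ℝ (transition c c') z).det := by
  have h := LinearMap.det_toMatrix (EuclideanSpace.basisFun (Fin n) ℝ).toBasis
    (fderiv ℝ (transition c c') z : Eu n →ₗ[ℝ] Eu n)
  rw [ContinuousLinearMap.det, ← h, ← Matrix.det_transpose]
  congr 1

end Transition


section Koszul

variable {n : ℕ}

/-- The Christoffel symbols of the first kind, from the derivatives `D a b d = ∂_a G_{bd}`. -/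
def lowChr (D : Fin n → Fin n → Fin n → ℝ) (a b d : Fin n) : ℝ :=
  (1 / 2) * (D a b d + D b a d - D d a b)

theorem christoffel_eq (G : Eu n → Matrix (Fin n) (Fin n) ℝ) (k i j : Fin n) (z : Eu n) :
    christoffel G k i j z =
      ∑ l, (G z)⁻¹ k l * lowChr (fun a b d ↦ pderiv a (fun w ↦ G w b d) z) i j l := by
  simp only [christoffel, lowChr, Finset.mul_sum]
  exact Finset.sum_congr rfl fun l _ ↦ by ring

theorem sum_christoffel_mul {G : Eu n → Matrix (Fin n) (Fin n) ℝ} {z : Eu n}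
    (hsymm : (G z).transpose = G z) (hdet : (G z).det ≠ 0) (i j m : Fin n) :
    ∑ k, christoffel G k i j z * G z k m =
      lowChr (fun a b d ↦ pderiv a (fun w ↦ G w b d) z) i j m := by
  simp only [christoffel_eq, Finset.sum_mul]
  rw [Finset.sum_comm]
  have hinv : ∀ l, ∑ k, (G z)⁻¹ k l * G z k m = if l = m then 1 else 0 := by
    intro l
    have h1 : ((G z)⁻¹).transpose * G z = 1 := by
      rw [Matrix.transpose_nonsing_inv, hsymm, Matrix.nonsing_inv_mul _ hdet.isUnit]
    have h2 := congrFun (congrFun h1 l) m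
    rw [Matrix.mul_apply, Matrix.one_apply] at h2
    simpa only [Matrix.transpose_apply] using h2
  rw [Finset.sum_eq_single m]
  · have := hinv m
    rw [if_pos rfl] at this
    calc _ = (∑ k, (G z)⁻¹ k m * G z k m) * _ := by
          rw [Finset.sum_mul]
          exact Finset.sum_congr rfl fun k _ ↦ by ring
      _ = _ := by rw [this, one_mul]
  · intro l _ hl
    have := hinv l
    rw [if_neg hl] at this
    calc _ = (∑ k, (G z)⁻¹ k l * G z k m) * _ := by
          rw [Finset.sum_mul]
          exact Finset.sum_congr rfl fun k _ ↦ by ring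
      _ = _ := by rw [this, zero_mul]
  · simp

/-- The Koszul formula in a frame `A`, with `B i j = A_i(A_j)`. -/
theorem koszul_frame {G : Matrix (Fin n) (Fin n) ℝ} (D : Fin n → Fin n → Fin n → ℝ)
    (A : Matrix (Fin n) (Fin n) ℝ) (B Γ : Fin n → Fin n → Fin n → ℝ)
    (hΓ : ∀ a b d, ∑ c, Γ c a b * G c d = lowChr D a b d)
    (P Q : Fin n → Fin n → Fin n → ℝ)
    (hP : ∀ i j l, P i j l = ∑ b, ∑ d, B i j b * G b d * A l d)
    (hQ : ∀ i j l, Q i j l = ∑ a, ∑ b, ∑ d, A i a * A j b * A l d * D a b d)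
    (i j l : Fin n) :
    2 * ∑ c, ∑ d, (B i j c + ∑ a, ∑ b, A i a * A j b * Γ c a b) * G c d * A l d =
      (P i j l + P i l j + Q i j l) + (P j i l + P j l i + Q j i l)
        - (P l i j + P l j i + Q l i j)
        + (P i j l - P j i l) - (P i l j - P l i j) - (P j l i - P l j i) := by
  have h1 : ∑ c, ∑ d, (B i j c + ∑ a, ∑ b, A i a * A j b * Γ c a b) * G c d * A l d =
      P i j l + ∑ a, ∑ b, ∑ d, A i a * A j b * A l d * lowChr D a b d := by
    simp only [add_mul, Finset.sum_add_distrib, hP]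
    congr 1
    simp only [← hΓ, Finset.sum_mul, Finset.mul_sum]
    calc ∑ c, ∑ d, ∑ a, ∑ b, A i a * A j b * Γ c a b * G c d * A l d
        = ∑ c, ∑ a, ∑ d, ∑ b, A i a * A j b * Γ c a b * G c d * A l d :=
          Finset.sum_congr rfl fun c _ ↦ Finset.sum_comm
      _ = ∑ a, ∑ c, ∑ d, ∑ b, A i a * A j b * Γ c a b * G c d * A l d := Finset.sum_comm
      _ = ∑ a, ∑ c, ∑ b, ∑ d, A i a * A j b * Γ c a b * G c d * A l d :=
          Finset.sum_congr rfl fun a _ ↦ Finset.sum_congr rfl fun c _ ↦ Finset.sum_comm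
      _ = ∑ a, ∑ b, ∑ c, ∑ d, A i a * A j b * Γ c a b * G c d * A l d :=
          Finset.sum_congr rfl fun a _ ↦ Finset.sum_comm
      _ = ∑ a, ∑ b, ∑ d, ∑ c, A i a * A j b * Γ c a b * G c d * A l d :=
          Finset.sum_congr rfl fun a _ ↦ Finset.sum_congr rfl fun b _ ↦ Finset.sum_comm
      _ = _ := Finset.sum_congr rfl fun a _ ↦ Finset.sum_congr rfl fun b _ ↦
          Finset.sum_congr rfl fun d _ ↦ Finset.sum_congr rfl fun c _ ↦ by ring
  have h2 : ∑ a, ∑ b, ∑ d, A i a * A j b * A l d * lowChr D a b d =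
      (1 / 2) * (Q i j l + Q j i l - Q l i j) := by
    have e2 : Q j i l = ∑ a, ∑ b, ∑ d, A i a * A j b * A l d * D b a d := by
      rw [hQ, Finset.sum_comm]
      exact Finset.sum_congr rfl fun a _ ↦ Finset.sum_congr rfl fun b _ ↦
          Finset.sum_congr rfl fun d _ ↦ by ring
    have e3 : Q l i j = ∑ a, ∑ b, ∑ d, A i a * A j b * A l d * D d a b := by
      rw [hQ, Finset.sum_comm]
      refine Finset.sum_congr rfl fun a _ ↦ ?_
      rw [Finset.sum_comm]
      exact Finset.sum_congr rfl fun b _ ↦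
          Finset.sum_congr rfl fun d _ ↦ by ring
    rw [e2, e3, hQ]
    simp only [← Finset.sum_add_distrib, ← Finset.sum_sub_distrib, Finset.mul_sum, lowChr]
    exact Finset.sum_congr rfl fun a _ ↦ Finset.sum_congr rfl fun b _ ↦
          Finset.sum_congr rfl fun d _ ↦ by ring
  rw [h1, h2]
  ring

theorem pderiv_congr {F : Type*} [NormedAddCommGroup F] [NormedSpace ℝ F] {f g : Eu n → F}
    {z : Eu n} (h : f =ᶠ[𝓝 z] g) (i : Fin n) : pderiv i f z = pderiv i g z := by
  rw [pderiv, pderiv, h.fderiv_eq]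

theorem pderiv_sum {ι : Type*} {F : Type*} [NormedAddCommGroup F] [NormedSpace ℝ F]
    {t : Finset ι} {f : ι → Eu n → F} {z : Eu n}
    (h : ∀ k ∈ t, DifferentiableAt ℝ (f k) z) (i : Fin n) :
    pderiv i (fun w ↦ ∑ k ∈ t, f k w) z = ∑ k ∈ t, pderiv i (f k) z := by
  simp only [pderiv]
  rw [fderiv_fun_sum h, sum_apply]

theorem pderiv_fun_smul {F : Type*} [NormedAddCommGroup F] [NormedSpace ℝ F]
    {f : Eu n → ℝ} {g : Eu n → F} {z : Eu n}
    (hf : DifferentiableAt ℝ f z) (hg : DifferentiableAt ℝ g z) (i : Fin n) :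
    pderiv i (fun w ↦ f w • g w) z = f z • pderiv i g z + pderiv i f z • g z := by
  simp only [pderiv]
  rw [fderiv_fun_smul hf hg]
  simp

theorem pderiv_fun_mul {f g : Eu n → ℝ} {z : Eu n}
    (hf : DifferentiableAt ℝ f z) (hg : DifferentiableAt ℝ g z) (i : Fin n) :
    pderiv i (fun w ↦ f w * g w) z = f z * pderiv i g z + pderiv i f z * g z :=
  pderiv_fun_smul hf hg i

theorem pderiv_fun_add {F : Type*} [NormedAddCommGroup F] [NormedSpace ℝ F]
    {f g : Eu n → F} {z : Eu n}
    (hf : DifferentiableAt ℝ f z) (hg : DifferentiableAt ℝ g z) (i : Fin n) :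
    pderiv i (fun w ↦ f w + g w) z = pderiv i f z + pderiv i g z := by
  simp only [pderiv]
  rw [fderiv_fun_add hf hg, add_apply]

/-- The product rule for `H_{jl} = A_j^b G_{bd} A_l^d`. -/
theorem pderiv_congruence {A G : Eu n → Matrix (Fin n) (Fin n) ℝ} {z : Eu n}
    (hA : ∀ i j, DifferentiableAt ℝ (fun w ↦ A w i j) z)
    (hG : ∀ i j, DifferentiableAt ℝ (fun w ↦ G w i j) z)
    (hsymm : (G z).transpose = G z) (i j l : Fin n) :
    pderiv i (fun w ↦ (A w * G w * (A w).transpose) j l) z =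
      ∑ b, ∑ d, pderiv i (fun w ↦ A w j b) z * G z b d * A z l d +
      ∑ b, ∑ d, pderiv i (fun w ↦ A w l b) z * G z b d * A z j d +
      ∑ b, ∑ d, A z j b * A z l d * pderiv i (fun w ↦ G w b d) z := by
  have h1 : (fun w ↦ (A w * G w * (A w).transpose) j l) =
      fun w ↦ ∑ b, ∑ d, A w j b * (G w b d * A w l d) := by
    ext w
    simp only [Matrix.mul_apply, Matrix.transpose_apply, Finset.sum_mul]
    rw [Finset.sum_comm]
    exact Finset.sum_congr rfl fun b _ ↦ Finset.sum_congr rfl fun d _ ↦ by ring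
  have hd : ∀ b d, DifferentiableAt ℝ (fun w ↦ G w b d * A w l d) z := fun b d ↦
    (hG b d).mul (hA l d)
  have hd' : ∀ b d, DifferentiableAt ℝ (fun w ↦ A w j b * (G w b d * A w l d)) z := fun b d ↦
    (hA j b).mul (hd b d)
  rw [h1, pderiv_sum fun b _ ↦ DifferentiableAt.fun_sum fun d _ ↦ hd' b d]
  simp only [pderiv_sum fun d _ ↦ hd' _ d, pderiv_fun_mul (hA j _) (hd _ _),
    pderiv_fun_mul (hG _ _) (hA l _)]
  have h2 : ∑ b, ∑ d, pderiv i (fun w ↦ A w l b) z * G z b d * A z j d =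
      ∑ b, ∑ d, pderiv i (fun w ↦ A w l d) z * G z b d * A z j b := by
    rw [Finset.sum_comm]
    refine Finset.sum_congr rfl fun b _ ↦ Finset.sum_congr rfl fun d _ ↦ ?_
    have : G z d b = G z b d := by
      conv_lhs => rw [← hsymm, Matrix.transpose_apply]
    rw [this]
  rw [h2]
  simp only [← Finset.sum_add_distrib]
  exact Finset.sum_congr rfl fun b _ ↦ Finset.sum_congr rfl fun d _ ↦ by ring

end Koszul

section ChristoffelTransition

attribute [-instance] TopCat.of.chartedSpace

variable {n : ℕ} {M : Type*} [TopologicalSpace M] [ChartedSpace (Eu n) M] [IsManifold (𝓡 n) ∞ M]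

theorem differentiableAt_jac {c c' : M} {z : Eu n} (hz : z ∈ overlap c c') (i k : Fin n) :
    DifferentiableAt ℝ (fun w ↦ jac c c' w i k) z := by
  have h := Region.contDiffOn_pderiv (isOpen_overlap c c') (contDiffOn_transition c c') i
  have h1 := ((h.contDiffAt ((isOpen_overlap c c').mem_nhds hz)).differentiableAt (by simp))
  exact (EuclideanSpace.proj (𝕜 := ℝ) k).differentiableAt.comp z h1

theorem pderiv_jac_symm {c c' : M} {z : Eu n} (hz : z ∈ overlap c c') (i j k : Fin n) :
    pderiv i (fun w ↦ jac c c' w j k) z = pderiv j (fun w ↦ jac c c' w i k) z := by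
  have hc := (contDiffOn_transition c c').contDiffAt ((isOpen_overlap c c').mem_nhds hz)
  have hs := hc.isSymmSndFDerivAt (by
    simp only [minSmoothness_of_isRCLikeNormedField]
    exact WithTop.coe_le_coe.2 (le_top : (2 : ℕ∞) ≤ ⊤))
  have h1 : DifferentiableAt ℝ (fderiv ℝ (transition c c')) z :=
    (hc.fderiv_right (m := 1) (by norm_cast)).differentiableAt (by simp)
  have h2 : ∀ i j, pderiv i (fun w ↦ jac c c' w j k) z =
      (fderiv ℝ (fderiv ℝ (transition c c')) z (EuclideanSpace.single i 1)
        (EuclideanSpace.single j 1)) k := by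
    intro i j
    have h3 : (fun w ↦ jac c c' w j k) = fun w ↦ (EuclideanSpace.proj (𝕜 := ℝ) k)
        (fderiv ℝ (transition c c') w (EuclideanSpace.single j 1)) := rfl
    have h4 : DifferentiableAt ℝ
        (fun w ↦ fderiv ℝ (transition c c') w (EuclideanSpace.single j (1 : ℝ))) z :=
      h1.clm_apply (differentiableAt_const _)
    rw [h3, pderiv]
    let p : Eu n →L[ℝ] ℝ := EuclideanSpace.proj (𝕜 := ℝ) k
    have h5 := (p.hasFDerivAt.comp z h4.hasFDerivAt).fderiv
    simp only [Function.comp_def] at h5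
    change fderiv ℝ (fun w ↦ p (fderiv ℝ (transition c c') w (EuclideanSpace.single j 1))) z
      (EuclideanSpace.single i 1) = _
    rw [h5, ContinuousLinearMap.comp_apply, fderiv_clm_apply h1 (differentiableAt_const _)]
    simp [p]
  rw [h2, h2, hs.eq]

theorem det_jac_ne_zero {c c' : M} {z : Eu n} (hz : z ∈ overlap c c') : (jac c c' z).det ≠ 0 := by
  rw [det_jac]
  intro h0
  have h1 := fderiv_comp z
    (differentiableAt_transition (transition_mem_overlap hz)) (differentiableAt_transition hz)
  have h2 : (transition c' c ∘ transition c c') =ᶠ[𝓝 z] id := by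
    filter_upwards [(isOpen_overlap c c').mem_nhds hz] with w hw using transition_transition hw
  rw [h2.fderiv_eq, fderiv_id] at h1
  have h3 := congrArg ContinuousLinearMap.det h1
  change LinearMap.det (LinearMap.id : Eu n →ₗ[ℝ] Eu n) = LinearMap.det
    ((fderiv ℝ (transition c' c) (transition c c' z) : Eu n →ₗ[ℝ] Eu n) ∘ₗ
      (fderiv ℝ (transition c c') z : Eu n →ₗ[ℝ] Eu n)) at h3
  rw [LinearMap.det_id, LinearMap.det_comp] at h3
  rw [ContinuousLinearMap.det] at h0
  rw [h0, mul_zero] at h3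
  exact one_ne_zero h3

/-- The transformation law of the Christoffel symbols. -/
theorem christoffel_transition {G : M → Eu n → Matrix (Fin n) (Fin n) ℝ} {c c' : M} {z : Eu n}
    (hz : z ∈ overlap c c')
    (hG : ∀ w ∈ overlap c c',
      G c w = jac c c' w * G c' (transition c c' w) * (jac c c' w).transpose)
    (hd : ∀ i j, DifferentiableAt ℝ (fun w ↦ G c' w i j) (transition c c' z))
    (hsymm : (G c' (transition c c' z)).transpose = G c' (transition c c' z))
    (hdet : (G c' (transition c c' z)).det ≠ 0) (a b m : Fin n) :
    ∑ k, christoffel (G c) k a b z * jac c c' z k m =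
      pderiv a (fun w ↦ jac c c' w b m) z +
        ∑ a', ∑ b', jac c c' z a a' * jac c c' z b b' *
          christoffel (G c') m a' b' (transition c c' z) := by
  set J := jac c c' z with hJ
  set G' := G c' (transition c c' z) with hG'
  have hJdet := det_jac_ne_zero hz
  rw [← hJ] at hJdet
  have hGz : G c z = J * G' * J.transpose := hG z hz
  have hsz : (G c z).transpose = G c z := by
    rw [hGz, Matrix.transpose_mul, Matrix.transpose_mul, hsymm, Matrix.transpose_transpose,
      Matrix.mul_assoc]
  have hdz : (G c z).det ≠ 0 := by
    rw [hGz, Matrix.det_mul, Matrix.det_mul, Matrix.det_transpose]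
    exact mul_ne_zero (mul_ne_zero hJdet hdet) hJdet
  set B : Fin n → Fin n → Fin n → ℝ := fun a b m ↦ pderiv a (fun w ↦ jac c c' w b m) z with hB
  set Γ : Fin n → Fin n → Fin n → ℝ :=
    fun m a b ↦ christoffel (G c') m a b (transition c c' z) with hΓ
  have hdG : ∀ i j l, pderiv i (fun w ↦ G c w j l) z =
      ∑ b, ∑ d, B i j b * G' b d * J l d + ∑ b, ∑ d, B i l b * G' b d * J j d +
      ∑ a, ∑ b, ∑ d, J i a * J j b * J l d *
        pderiv a (fun w ↦ G c' w b d) (transition c c' z) := by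
    intro i j l
    have h1 : (fun w ↦ G c w j l) =ᶠ[𝓝 z] fun w ↦ (jac c c' w *
        (fun w ↦ G c' (transition c c' w)) w * (jac c c' w).transpose) j l := by
      filter_upwards [(isOpen_overlap c c').mem_nhds hz] with w hw
      rw [hG w hw]
    have h2 : ∀ b d, DifferentiableAt ℝ (fun w ↦ G c' (transition c c' w) b d) z := fun b d ↦
      (hd b d).comp z (differentiableAt_transition hz)
    rw [pderiv_congr h1, pderiv_congruence (fun i j ↦ differentiableAt_jac hz i j) h2 hsymm]
    congr 1
    simp only [pderiv_comp_transition hz (hd _ _), smul_eq_mul, Finset.mul_sum]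
    calc _ = ∑ b, ∑ a, ∑ d, J j b * J l d *
          (J i a * pderiv a (fun w ↦ G c' w b d) (transition c c' z)) :=
          Finset.sum_congr rfl fun b _ ↦ Finset.sum_comm
      _ = _ := by
          rw [Finset.sum_comm]
          exact Finset.sum_congr rfl fun a _ ↦ Finset.sum_congr rfl fun b _ ↦
            Finset.sum_congr rfl fun d _ ↦ by ring
  have key : ∀ l, ∑ m', ∑ d, (B a b m' + ∑ a', ∑ b', J a a' * J b b' * Γ m' a' b') * G' m' d *
      J l d = ∑ m', ∑ d, (∑ k, christoffel (G c) k a b z * J k m') * G' m' d * J l d := by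
    intro l
    have h1 := koszul_frame (G := G')
      (fun a b d ↦ pderiv a (fun w ↦ G c' w b d) (transition c c' z)) J B Γ
      (fun a b d ↦ sum_christoffel_mul hsymm hdet a b d) _ _ (fun _ _ _ ↦ rfl) (fun _ _ _ ↦ rfl)
      a b l
    have hBs : ∀ i j, B i j = B j i := fun i j ↦ funext fun k ↦ pderiv_jac_symm hz i j k
    rw [← hdG, ← hdG, ← hdG] at h1
    have h2 := sum_christoffel_mul hsz hdz a b l
    have h3 : ∑ m', ∑ d, (∑ k, christoffel (G c) k a b z * J k m') * G' m' d * J l d =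
        ∑ k, christoffel (G c) k a b z * G c z k l := by
      rw [hGz]
      simp only [Matrix.mul_apply, Matrix.transpose_apply, Finset.sum_mul, Finset.mul_sum]
      calc _ = ∑ m', ∑ k, ∑ d, christoffel (G c) k a b z * J k m' * G' m' d * J l d :=
            Finset.sum_congr rfl fun _ _ ↦ Finset.sum_comm
        _ = ∑ k, ∑ m', ∑ d, christoffel (G c) k a b z * J k m' * G' m' d * J l d :=
            Finset.sum_comm
        _ = _ := by
            refine Finset.sum_congr rfl fun k _ ↦ ?_
            rw [Finset.sum_comm]
            exact Finset.sum_congr rfl fun m' _ ↦ Finset.sum_congr rfl fun d _ ↦ by ring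
    rw [h3, h2, lowChr]
    rw [hBs b a, hBs l a, hBs l b] at h1
    linarith
  set v : Fin n → ℝ := fun m ↦ (B a b m + ∑ a', ∑ b', J a a' * J b b' * Γ m a' b') -
    ∑ k, christoffel (G c) k a b z * J k m with hv
  have hv0 : Matrix.vecMul v (G' * J.transpose) = 0 := by
    ext l
    have := key l
    simp only [Matrix.vecMul, dotProduct, Matrix.mul_apply, Matrix.transpose_apply, hv,
      Finset.mul_sum, sub_mul, Finset.sum_sub_distrib, Pi.zero_apply]
    rw [sub_eq_zero]
    simpa only [mul_assoc] using this
  have hdet2 : (G' * J.transpose).det ≠ 0 := by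
    rw [Matrix.det_mul, Matrix.det_transpose]
    exact mul_ne_zero hdet hJdet
  have hv1 : v = 0 := Matrix.eq_zero_of_vecMul_eq_zero hdet2 hv0
  have := congrFun hv1 m
  simp only [hv, Pi.zero_apply] at this
  linarith

end ChristoffelTransition


theorem sum_fin_one_arrow {α β : Type*} [Fintype α] [AddCommMonoid β] (f : (Fin 1 → α) → β) :
    ∑ J, f J = ∑ a, f ![a] := by
  rw [← Equiv.sum_comp (Equiv.funUnique (Fin 1) α).symm]
  refine Finset.sum_congr rfl fun a _ ↦ congrArg f ?_
  ext i
  fin_cases i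
  rfl

theorem sum_fin_two_arrow {α β : Type*} [Fintype α] [AddCommMonoid β] (f : (Fin 2 → α) → β) :
    ∑ J, f J = ∑ a, ∑ b, f ![a, b] := by
  rw [← Equiv.sum_comp (finTwoArrowEquiv α).symm, Fintype.sum_prod_type]
  rfl

section

variable {n : ℕ} {𝕜 : Type*} [RCLike 𝕜]

theorem tmap_zero_rank (A : Matrix (Fin n) (Fin n) ℝ) (s : (Fin 0 → Fin n) → 𝕜) : tmap A s = s := by
  ext I
  simp [tmap, Subsingleton.elim I default]

theorem tmap_one_rank (A : Matrix (Fin n) (Fin n) ℝ) (s : (Fin 1 → Fin n) → 𝕜)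
    (I : Fin 1 → Fin n) : tmap A s I = ∑ k, A (I 0) k • s ![k] := by
  simp [tmap, sum_fin_one_arrow, RCLike.real_smul_eq_coe_mul]

theorem tmap_two_rank (A : Matrix (Fin n) (Fin n) ℝ) (s : (Fin 2 → Fin n) → 𝕜)
    (I : Fin 2 → Fin n) :
    tmap A s I = ∑ a, ∑ b, (A (I 0) a * A (I 1) b) • s ![a, b] := by
  simp [tmap, sum_fin_two_arrow, RCLike.real_smul_eq_coe_mul]

theorem tmap_smul {r : ℕ} (A : Matrix (Fin n) (Fin n) ℝ) (a : ℝ) (s : (Fin r → Fin n) → 𝕜) :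
    tmap A (a • s) = a • tmap A s := by
  ext I
  simp only [tmap, Pi.smul_apply, Finset.smul_sum, RCLike.real_smul_eq_coe_mul]
  exact Finset.sum_congr rfl fun J _ ↦ by ring

end

namespace Region

attribute [-instance] TopCat.of.chartedSpace

variable {n : ℕ} {M : Type*} [TopologicalSpace M] [ChartedSpace (Eu n) M]
  [IsManifold (𝓡 n) ∞ M] [T2Space M] [SigmaCompactSpace M] (S : Region n M)
  {𝕜 : Type*} [RCLike 𝕜]

/-- The components over `Ω` transform as those of a covariant tensor field. -/
def Tensorial {r : ℕ} (s : Comps n M 𝕜 r) : Prop :=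
  ∀ c c' z, z ∈ overlap c c' → (chartAt (Eu n) c).symm z ∈ S.dom →
    s c z = tmap (jac c c' z) (s c' (transition c c' z))

theorem transition_mem_chartDom {c c' : M} {z : Eu n} (hz : z ∈ overlap c c')
    (hz' : (chartAt (Eu n) c).symm z ∈ S.dom) : transition c c' z ∈ S.chartDom c' :=
  ⟨(transition_mem_overlap hz).1, by
    rw [mem_preimage, symm_transition hz]
    exact hz'⟩

theorem tensorial_compsFun (u : M → 𝕜) : S.Tensorial (compsFun (n := n) u) := by
  intro c c' z hz _
  rw [tmap_zero_rank]
  ext I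
  simp only [compsFun]
  rw [symm_transition hz]

theorem tensorial_compsForm (u : ∀ p : M, TangentSpace (𝓡 n) p →L[ℝ] 𝕜) :
    S.Tensorial (compsForm u) := fun _ _ _ hz _ ↦ compsForm_transition u hz

variable {S}

theorem Tensorial.mulFun {r : ℕ} {s : Comps n M 𝕜 r} (hs : S.Tensorial s) (f : M → ℝ) :
    S.Tensorial (mulFun f s) := by
  intro c c' z hz hz'
  have h : ∀ c z, ScatteringGauge.mulFun f s c z = f ((chartAt (Eu n) c).symm z) • s c z :=
    fun _ _ ↦ rfl
  rw [h, h, tmap_smul, symm_transition hz, ← hs c c' z hz hz']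

theorem mem_nhds_overlap_dom {c c' : M} {z : Eu n} (hz : z ∈ overlap c c')
    (hz' : (chartAt (Eu n) c).symm z ∈ S.dom) :
    overlap c c' ∩ S.chartDom c ∈ 𝓝 z :=
  ((isOpen_overlap c c').inter (S.isOpen_chartDom c)).mem_nhds ⟨hz, hz.1, hz'⟩

theorem differentiableAt_of_chartDom {F : Type*} [NormedAddCommGroup F] [NormedSpace ℝ F] {c : M}
    {f : Eu n → F} (hf : ContDiffOn ℝ ∞ f (S.chartDom c)) {z : Eu n} (hz : z ∈ S.chartDom c) :
    DifferentiableAt ℝ f z :=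
  (hf.contDiffAt ((S.isOpen_chartDom c).mem_nhds hz)).differentiableAt (by simp)

theorem Tensorial.gradFun {s : Comps n M 𝕜 0} (hs : S.Tensorial s)
    (hd : ∀ c I, ContDiffOn ℝ ∞ (fun z ↦ s c z I) (S.chartDom c)) :
    S.Tensorial (gradFun s) := by
  intro c c' z hz hz'
  ext I
  rw [tmap_one_rank]
  have h1 : (fun w ↦ s c w ![]) =ᶠ[𝓝 z] fun w ↦ s c' (transition c c' w) ![] := by
    filter_upwards [mem_nhds_overlap_dom hz hz'] with w hw
    rw [hs c c' w hw.1 hw.2.2, tmap_zero_rank]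
  simp only [ScatteringGauge.gradFun]
  rw [pderiv_congr h1, pderiv_comp_transition hz (f := fun w ↦ s c' w ![])
    (differentiableAt_of_chartDom (hd c' ![]) (S.transition_mem_chartDom hz hz'))]
  rfl

/-- A field of metric matrices over `Ω`. -/
structure IsMetric (S : Region n M) (G : M → Eu n → Matrix (Fin n) (Fin n) ℝ) : Prop where
  trans : ∀ c c', ∀ w ∈ overlap c c',
      G c w = jac c c' w * G c' (transition c c' w) * (jac c c' w).transpose
  smooth : ∀ c i j, ContDiffOn ℝ ∞ (fun w ↦ G c w i j) (S.chartDom c)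
  posDef : ∀ c, ∀ w ∈ S.chartDom c, (G c w).PosDef

theorem posDef_transpose {G : Matrix (Fin n) (Fin n) ℝ} (h : G.PosDef) : G.transpose = G := by
  simpa [Matrix.conjTranspose_eq_transpose_of_trivial] using h.isHermitian.eq

theorem Tensorial.gradForm {s : Comps n M 𝕜 1} (hs : S.Tensorial s)
    (hd : ∀ c I, ContDiffOn ℝ ∞ (fun z ↦ s c z I) (S.chartDom c))
    {G : M → Eu n → Matrix (Fin n) (Fin n) ℝ} (hG : S.IsMetric G) :
    S.Tensorial (gradForm G s) := by
  intro c c' z hz hz'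
  ext I
  set a := I 0 with ha
  set b := I 1 with hb
  set J := jac c c' z with hJ
  set z' := transition c c' z with hz'_def
  have hzd := S.transition_mem_chartDom hz hz'
  have hs' : ∀ m : Fin n, DifferentiableAt ℝ (fun w ↦ s c' w ![m]) z' := fun m ↦
    differentiableAt_of_chartDom (hd c' ![m]) hzd
  have hs'' : ∀ m : Fin n, DifferentiableAt ℝ (fun w ↦ s c' (transition c c' w) ![m]) z := fun m ↦
    DifferentiableAt.comp (g := fun w ↦ s c' w ![m]) z (hs' m) (differentiableAt_transition hz)
  have hchr := christoffel_transition hz (hG.trans c c')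
    (fun i j ↦ differentiableAt_of_chartDom (hG.smooth c' i j) hzd)
    (posDef_transpose (hG.posDef c' _ hzd)) (hG.posDef c' _ hzd).det_pos.ne' a b
  simp only [← hJ, ← hz'_def] at hchr
  have h1 : (fun w ↦ s c w ![b]) =ᶠ[𝓝 z]
      fun w ↦ ∑ m, jac c c' w b m • s c' (transition c c' w) ![m] := by
    filter_upwards [mem_nhds_overlap_dom hz hz'] with w hw
    rw [hs c c' w hw.1 hw.2.2, tmap_one_rank]
    rfl
  have h2 : pderiv a (fun w ↦ s c w ![b]) z =
      ∑ m, (J b m • ∑ a', J a a' • pderiv a' (fun w ↦ s c' w ![m]) z' +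
        pderiv a (fun w ↦ jac c c' w b m) z • s c' z' ![m]) := by
    rw [pderiv_congr h1, pderiv_sum
      (f := fun m w ↦ jac c c' w b m • s c' (transition c c' w) ![m])
      fun m _ ↦ (differentiableAt_jac hz b m).fun_smul (hs'' m)]
    refine Finset.sum_congr rfl fun m _ ↦ ?_
    rw [pderiv_fun_smul (differentiableAt_jac hz b m) (hs'' m),
      pderiv_comp_transition hz (f := fun w ↦ s c' w ![m]) (hs' m)]
  have h3 : ∑ k, christoffel (G c) k a b z • s c z ![k] =
      ∑ m, (pderiv a (fun w ↦ jac c c' w b m) z + ∑ a', ∑ b', J a a' * J b b' *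
          christoffel (G c') m a' b' z') • s c' z' ![m] := by
    have e1 : ∀ k, s c z ![k] = ∑ m, J k m • s c' z' ![m] := by
      intro k
      rw [hs c c' z hz hz', tmap_one_rank]
      rfl
    simp only [← hchr, e1, Finset.smul_sum, Finset.sum_smul, smul_smul]
    exact Finset.sum_comm
  change pderiv a (fun w ↦ s c w ![b]) z - ∑ k, christoffel (G c) k a b z • s c z ![k] = _
  rw [h2, h3, tmap_two_rank]
  simp only [ScatteringGauge.gradForm, add_smul, Finset.sum_add_distrib, Matrix.cons_val_zero,
    Matrix.cons_val_one, smul_sub, Finset.sum_sub_distrib]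
  have e2 : ∑ m, J b m • ∑ a', J a a' • pderiv a' (fun w ↦ s c' w ![m]) z' =
      ∑ a', ∑ b', (J a a' * J b b') • pderiv a' (fun w ↦ s c' w ![b']) z' := by
    simp only [Finset.smul_sum, smul_smul]
    rw [Finset.sum_comm]
    exact Finset.sum_congr rfl fun a' _ ↦ Finset.sum_congr rfl fun b' _ ↦ by rw [mul_comm]
  have e3 : ∑ m, (∑ a', ∑ b', J a a' * J b b' * christoffel (G c') m a' b' z') • s c' z' ![m] =
      ∑ a', ∑ b', (J a a' * J b b') • ∑ m, christoffel (G c') m a' b' z' • s c' z' ![m] := by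
    simp only [Finset.smul_sum, Finset.sum_smul, smul_smul]
    rw [Finset.sum_comm]
    exact Finset.sum_congr rfl fun a' _ ↦ Finset.sum_comm
  rw [e2, e3]
  abel

theorem Tensorial.symGrad {s : Comps n M 𝕜 1} (hs : S.Tensorial s)
    (hd : ∀ c I, ContDiffOn ℝ ∞ (fun z ↦ s c z I) (S.chartDom c))
    {G : M → Eu n → Matrix (Fin n) (Fin n) ℝ} (hG : S.IsMetric G) :
    S.Tensorial (symGrad G s) := by
  intro c c' z hz hz'
  ext I
  have h := hs.gradForm hd hG c c' z hz hz'
  set T := ScatteringGauge.gradForm G s c' (transition c c' z) with hT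
  have h1 : ∀ i j, ScatteringGauge.gradForm G s c z ![i, j] =
      ∑ a, ∑ b, (jac c c' z i a * jac c c' z j b) • T ![a, b] := by
    intro i j
    rw [h, tmap_two_rank]
    rfl
  have h2 : ∀ a b, ScatteringGauge.symGrad G s c' (transition c c' z) ![a, b] =
      (1 / 2 : ℝ) • (T ![a, b] + T ![b, a]) := fun _ _ ↦ rfl
  rw [tmap_two_rank]
  simp only [h2, smul_comm _ (1 / 2 : ℝ), ← Finset.smul_sum, smul_add, Finset.sum_add_distrib]
  rw [ScatteringGauge.symGrad, h1, h1, smul_add]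
  congr 2
  rw [Finset.sum_comm]
  refine Finset.sum_congr rfl fun a _ ↦ Finset.sum_congr rfl fun b _ ↦ ?_
  rw [mul_comm]

variable (S)

theorem isMetric_gscMat : S.IsMetric S.gscMat where
  trans _ _ _ hw := bilinMatrix_transition S.gsc hw
  smooth c i j := S.contDiffOn_gscMat c i j
  posDef c _ hw := S.posDef_gscMat c hw

theorem linearIndependent_coordVecEu {c : M} {z : Eu n} (hz : z ∈ (chartAt (Eu n) c).target)
    {a : Fin n → ℝ} (h : ∑ i, a i • coordVecEu c z i = 0) : a = 0 := by
  let L : Eu n →L[ℝ] Eu n := mfderiv (𝓡 n) (𝓡 n) (chartAt (Eu n) c).symm z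
  have h1 : L (∑ i, a i • EuclideanSpace.single i (1 : ℝ)) = 0 := by
    rw [map_sum, ← h]
    exact Finset.sum_congr rfl fun i _ ↦ map_smul L _ _
  have h2 := ((mdifferentiable_chart (I := 𝓡 n) c).symm).ker_mfderiv_eq_bot (x := z) hz
  rw [LinearMap.ker_eq_bot'] at h2
  have h3 : (∑ i, a i • EuclideanSpace.single i (1 : ℝ) : Eu n) = 0 := h2 _ h1
  ext i
  have := congrArg (fun w : Eu n ↦ w i) h3
  simpa [Pi.single_apply] using this

theorem posDef_bilinMatrix
    {B : ∀ p : M, TangentSpace (𝓡 n) p →L[ℝ] TangentSpace (𝓡 n) p →L[ℝ] ℝ} {c : M} {z : Eu n}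
    (hz : z ∈ (chartAt (Eu n) c).target)
    (hsymm : ∀ v w, B ((chartAt (Eu n) c).symm z) v w = B ((chartAt (Eu n) c).symm z) w v)
    (hpos : ∀ v, v ≠ 0 → 0 < B ((chartAt (Eu n) c).symm z) v v) :
    (bilinMatrix B c z).PosDef := by
  let B' : Eu n →L[ℝ] Eu n →L[ℝ] ℝ := B ((chartAt (Eu n) c).symm z)
  have h0 : ∀ i j, bilinMatrix B c z i j = B' (coordVecEu c z i) (coordVecEu c z j) :=
    fun _ _ ↦ rfl
  refine Matrix.PosDef.of_dotProduct_mulVec_pos ?_ fun a ha ↦ ?_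
  · ext i j
    exact hsymm _ _
  · have h5 : star a ⬝ᵥ (bilinMatrix B c z).mulVec a =
        B' (∑ i, a i • coordVecEu c z i) (∑ i, a i • coordVecEu c z i) := by
      simp only [map_sum, map_smul, sum_apply,
        smul_apply, dotProduct, Matrix.mulVec, Finset.mul_sum, smul_eq_mul,
        Pi.star_apply, star_trivial, h0]
      rw [Finset.sum_comm]
      refine Finset.sum_congr rfl fun i _ ↦ Finset.sum_congr rfl fun j _ ↦ ?_
      ring
    rw [h5]
    exact hpos _ fun h ↦ ha (linearIndependent_coordVecEu hz h)

theorem smoothBilin_inner : SmoothBilin n (fun p : M ↦ S.g.inner p) := S.g.contMDiff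

theorem contDiffOn_gMat (c : M) (i j : Fin n) :
    ContDiffOn ℝ ∞ (fun z ↦ S.gMat c z i j) (chartAt (Eu n) c).target :=
  S.smoothBilin_inner.contDiffOn_comp c i j

theorem posDef_gMat (c : M) {z : Eu n} (hz : z ∈ (chartAt (Eu n) c).target) :
    (S.gMat c z).PosDef :=
  posDef_bilinMatrix hz (fun v w ↦ S.g.symm _ v w) fun v hv ↦ S.g.pos _ v hv

theorem isMetric_gMat : S.IsMetric S.gMat where
  trans _ _ _ hw := bilinMatrix_transition S.g.inner hw
  smooth c i j := (S.contDiffOn_gMat c i j).mono inter_subset_left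
  posDef c _ hw := S.posDef_gMat c hw.1

end Region


namespace Region

attribute [-instance] TopCat.of.chartedSpace

variable {n : ℕ} {M : Type*} [TopologicalSpace M] [ChartedSpace (Eu n) M]
  [IsManifold (𝓡 n) ∞ M] [T2Space M] [SigmaCompactSpace M] (S : Region n M)
  {𝕜 : Type*} [RCLike 𝕜] {r : ℕ}

theorem pair_eq_tform (s t : Comps n M 𝕜 r) (c : M) (z : Eu n) :
    S.pair s t c z = tform (S.gscMat c z)⁻¹ (s c z) (t c z) := rfl

/-- The density `|s|² √det G` in the chart at `c`. -/
def dens (s : Comps n M 𝕜 r) (c : M) (z : Eu n) : ℝ :=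
  √(S.gscMat c z).det * RCLike.re (S.pair s s c z)

variable {S}

theorem dens_nonneg (s : Comps n M 𝕜 r) {c : M} {z : Eu n} (hz : z ∈ S.chartDom c) :
    0 ≤ S.dens s c z := by
  obtain ⟨b, hb, hb'⟩ := S.pair_self s hz
  rw [dens, hb', RCLike.ofReal_re]
  positivity

theorem dens_eq_zero {s : Comps n M 𝕜 r} {c : M} {z : Eu n} (h : ∀ I, s c z I = 0) :
    S.dens s c z = 0 := by
  rw [dens, S.pair_eq_zero h, map_zero, mul_zero]

theorem IsTest.dens_eq_zero {s : Comps n M 𝕜 r} (hs : S.IsTest s) {c : M} {z : Eu n}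
    (hz : z ∈ (chartAt (Eu n) c).target) (hz' : (chartAt (Eu n) c).symm z ∉ S.dom) :
    S.dens s c z = 0 := by
  obtain ⟨K, hK, -, h0, -⟩ := hs
  exact Region.dens_eq_zero (h0 c z hz fun h ↦ hz' (hK h))

theorem IsTest.dens_nonneg {s : Comps n M 𝕜 r} (hs : S.IsTest s) {c : M} {z : Eu n}
    (hz : z ∈ (chartAt (Eu n) c).target) : 0 ≤ S.dens s c z := by
  by_cases h : (chartAt (Eu n) c).symm z ∈ S.dom
  · exact Region.dens_nonneg s ⟨hz, h⟩
  · rw [hs.dens_eq_zero hz h]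

theorem Tensorial.dens_transition {s : Comps n M 𝕜 r} (hs : S.Tensorial s) {c c' : M} {z : Eu n}
    (hz : z ∈ overlap c c') (hz' : (chartAt (Eu n) c).symm z ∈ S.dom) :
    S.dens s c z = |(jac c c' z).det| * S.dens s c' (transition c c' z) := by
  set J := jac c c' z with hJ
  have hJd : IsUnit J.det := (det_jac_ne_zero hz).isUnit
  have hG : S.gscMat c z = J * S.gscMat c' (transition c c' z) * J.transpose :=
    S.isMetric_gscMat.trans c c' z hz
  have h1 : J.transpose * (S.gscMat c z)⁻¹ * J = (S.gscMat c' (transition c c' z))⁻¹ := by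
    rw [hG, Matrix.mul_inv_rev, Matrix.mul_inv_rev, ← Matrix.transpose_nonsing_inv,
      ← Matrix.mul_assoc, ← Matrix.transpose_mul, Matrix.nonsing_inv_mul _ hJd,
      Matrix.transpose_one, Matrix.one_mul, Matrix.mul_assoc, Matrix.nonsing_inv_mul _ hJd,
      Matrix.mul_one]
  have h2 : (S.gscMat c z).det = J.det ^ 2 * (S.gscMat c' (transition c c' z)).det := by
    rw [hG, Matrix.det_mul, Matrix.det_mul, Matrix.det_transpose]
    ring
  rw [dens, dens, pair_eq_tform, pair_eq_tform, hs c c' z hz hz', ← hJ, tform_tmap, h1, h2,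
    Real.sqrt_mul (sq_nonneg _), Real.sqrt_sq_eq_abs, mul_assoc]

theorem IsTest.continuousOn_dens {s : Comps n M 𝕜 r} (hs : S.IsTest s) (c : M) :
    ContinuousOn (fun z ↦ S.dens s c z) (S.chartDom c) :=
  (S.continuousOn_sqrt_det c).mul
    (RCLike.continuous_re.comp_continuousOn (S.continuousOn_pair hs hs c))

theorem IsTest.integrableOn_dens {s : Comps n M 𝕜 r} (hs : S.IsTest s) {h : M → ℝ}
    (hc : Continuous h) {c : M} (hsub : tsupport h ⊆ (chartAt (Eu n) c).source) :
    IntegrableOn (fun z ↦ h ((chartAt (Eu n) c).symm z) * S.dens s c z)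
      (chartAt (Eu n) c).target := by
  have hp := hs.continuousOn_dens c
  obtain ⟨K, hK, hKc, h0, -⟩ := hs
  set φ := chartAt (Eu n) c with hφ
  set C : Set (Eu n) := φ '' (K ∩ tsupport h) with hC
  have hCc : IsCompact C := (hKc.inter_right (isClosed_tsupport _)).image_of_continuousOn
    (φ.continuousOn.mono fun p hp ↦ hsub hp.2)
  have hCW : C ⊆ S.chartDom c := by
    rintro _ ⟨p, hp, rfl⟩
    exact ⟨φ.map_source (hsub hp.2), by
      rw [mem_preimage, φ.left_inv (hsub hp.2)]; exact hK hp.1⟩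
  have hcont : ContinuousOn (fun z ↦ h (φ.symm z) * S.dens s c z) (S.chartDom c) :=
    (hc.comp_continuousOn (φ.continuousOn_symm.mono inter_subset_left)).mul hp
  refine ((hcont.mono hCW).integrableOn_compact hCc).of_forall_sdiff_eq_zero
    φ.open_target.measurableSet fun z hz ↦ ?_
  by_cases hzK : φ.symm z ∈ K
  · have : φ.symm z ∉ tsupport h := fun h' ↦
      hz.2 ⟨φ.symm z, ⟨hzK, h'⟩, φ.right_inv hz.1⟩
    rw [image_eq_zero_of_notMem_tsupport this, zero_mul]
  · rw [Region.dens_eq_zero (h0 c z hz.1 hzK), mul_zero]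

theorem integral_dens_transition {s : Comps n M 𝕜 r} (hs : S.IsTest s) (ht : S.Tensorial s)
    {h : M → ℝ} {c c' : M} (hsub : tsupport h ⊆ (chartAt (Eu n) c).source)
    (hsub' : tsupport h ⊆ (chartAt (Eu n) c').source) :
    ∫ z in (chartAt (Eu n) c).target, h ((chartAt (Eu n) c).symm z) * S.dens s c z =
      ∫ z in (chartAt (Eu n) c').target, h ((chartAt (Eu n) c').symm z) * S.dens s c' z := by
  have hred : ∀ c c' : M, tsupport h ⊆ (chartAt (Eu n) c').source →
      ∫ z in (chartAt (Eu n) c).target, h ((chartAt (Eu n) c).symm z) * S.dens s c z =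
        ∫ z in overlap c c', h ((chartAt (Eu n) c).symm z) * S.dens s c z := by
    intro c c' hsub'
    refine setIntegral_eq_of_subset_of_forall_sdiff_eq_zero
      (chartAt (Eu n) c).open_target.measurableSet inter_subset_left fun z hz ↦ ?_
    have : (chartAt (Eu n) c).symm z ∉ tsupport h := fun h' ↦ hz.2 ⟨hz.1, hsub' h'⟩
    rw [image_eq_zero_of_notMem_tsupport this, zero_mul]
  rw [hred c c' hsub', hred c' c hsub, ← image_transition c' c,
    integral_image_eq_integral_abs_det_fderiv_smul volume (isOpen_overlap c' c).measurableSet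
      (f' := fun z ↦ fderiv ℝ (transition c' c) z)
      (fun z hz ↦ (differentiableAt_transition hz).hasFDerivAt.hasFDerivWithinAt)
      (injOn_transition c' c)]
  refine setIntegral_congr_fun (isOpen_overlap c' c).measurableSet fun z hz ↦ ?_
  rw [symm_transition hz, smul_eq_mul, ← det_jac]
  by_cases hz' : (chartAt (Eu n) c').symm z ∈ S.dom
  · rw [ht.dens_transition hz hz']
    ring
  · rw [hs.dens_eq_zero hz.1 hz', hs.dens_eq_zero (transition_mem_overlap hz).1
      (by rwa [symm_transition hz])]
    simp

variable (S) in
/-- The integral of `f |s|²` for the scattering metric and its volume density. -/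
def energy (s : Comps n M 𝕜 r) (f : M → ℝ) : ℝ :=
  ∑ᶠ c : M, ∫ z in (chartAt (Eu n) c).target,
    (chartPartition n M c ((chartAt (Eu n) c).symm z) * f ((chartAt (Eu n) c).symm z)) *
      S.dens s c z

theorem tsupport_chartPartition_mul (c : M) (f : M → ℝ) :
    tsupport (fun p ↦ chartPartition n M c p * f p) ⊆ (chartAt (Eu n) c).source :=
  (tsupport_mul_subset_left).trans (chartPartition_isSubordinate n M c)

theorem continuous_chartPartition (c : M) : Continuous (chartPartition n M c) :=
  (chartPartition n M c).contMDiff.continuous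

theorem IsTest.integrableOn_energy {s : Comps n M 𝕜 r} (hs : S.IsTest s) {f : M → ℝ}
    (hf : Continuous f) (c : M) :
    IntegrableOn (fun z ↦ (chartPartition n M c ((chartAt (Eu n) c).symm z) *
      f ((chartAt (Eu n) c).symm z)) * S.dens s c z) (chartAt (Eu n) c).target :=
  hs.integrableOn_dens (h := fun p ↦ chartPartition n M c p * f p)
    ((continuous_chartPartition c).mul hf) (tsupport_chartPartition_mul c f)

theorem IsTest.exists_finset {s : Comps n M 𝕜 r} (hs : S.IsTest s) :
    ∃ t : Finset M, (∀ c c' : M, c' ∉ t → ∀ z ∈ (chartAt (Eu n) c).target,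
      chartPartition n M c' ((chartAt (Eu n) c).symm z) * S.dens s c z = 0) ∧
      ∀ c : M, ∀ z ∈ (chartAt (Eu n) c).target,
        (∑ c' ∈ t, chartPartition n M c' ((chartAt (Eu n) c).symm z)) * S.dens s c z =
          S.dens s c z := by
  obtain ⟨K, hK, hKc, h0, -⟩ := hs
  have hfin := (chartPartition n M).locallyFinite.finite_nonempty_inter_compact hKc
  have h1 : ∀ c' ∉ hfin.toFinset, ∀ p ∈ K, chartPartition n M c' p = 0 := by
    intro c' hc' p hp
    by_contra h
    exact hc' (hfin.mem_toFinset.2 ⟨p, h, hp⟩)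
  refine ⟨hfin.toFinset, fun c c' hc' z hz ↦ ?_, fun c z hz ↦ ?_⟩
  · by_cases hzK : (chartAt (Eu n) c).symm z ∈ K
    · rw [h1 c' hc' _ hzK, zero_mul]
    · rw [Region.dens_eq_zero (h0 c z hz hzK), mul_zero]
  · by_cases hzK : (chartAt (Eu n) c).symm z ∈ K
    · have h2 := (chartPartition n M).sum_eq_one (mem_univ ((chartAt (Eu n) c).symm z))
      rw [finsum_eq_sum_of_support_subset (s := hfin.toFinset)] at h2
      · rw [h2, one_mul]
      · intro c' hc'
        by_contra h
        exact hc' (h1 c' h _ hzK)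
    · rw [Region.dens_eq_zero (h0 c z hz hzK), mul_zero]

theorem IsTest.energy_eq_sum {s : Comps n M 𝕜 r} (hs : S.IsTest s) :
    ∃ t : Finset M, ∀ f : M → ℝ, S.energy s f = ∑ c ∈ t, ∫ z in (chartAt (Eu n) c).target,
      (chartPartition n M c ((chartAt (Eu n) c).symm z) * f ((chartAt (Eu n) c).symm z)) *
        S.dens s c z := by
  obtain ⟨t, ht, -⟩ := hs.exists_finset
  refine ⟨t, fun f ↦ finsum_eq_sum_of_support_subset _ fun c hc ↦ ?_⟩
  by_contra h
  refine hc (setIntegral_eq_zero_of_forall_eq_zero fun z hz ↦ ?_)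
  have := ht c c h z hz
  calc _ = f ((chartAt (Eu n) c).symm z) *
        (chartPartition n M c ((chartAt (Eu n) c).symm z) * S.dens s c z) := by ring
    _ = 0 := by rw [this, mul_zero]

/-- The energy of a tensor on a set inside of a chart can be computed in the chart. -/
theorem energy_eq_integral {s : Comps n M 𝕜 r} (hs : S.IsTest s) (ht : S.Tensorial s)
    {f : M → ℝ} (hf : Continuous f) {c : M} (hsub : tsupport f ⊆ (chartAt (Eu n) c).source) :
    S.energy s f = ∫ z in (chartAt (Eu n) c).target,
      f ((chartAt (Eu n) c).symm z) * S.dens s c z := by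
  have h1 : S.energy s f = ∑ᶠ c' : M, ∫ z in (chartAt (Eu n) c).target,
      (chartPartition n M c' ((chartAt (Eu n) c).symm z) * f ((chartAt (Eu n) c).symm z)) *
        S.dens s c z :=
    finsum_congr fun c' ↦ integral_dens_transition hs ht
      (h := fun p ↦ chartPartition n M c' p * f p) (tsupport_chartPartition_mul c' f)
      ((tsupport_mul_subset_right).trans hsub)
  obtain ⟨t, ht0, ht1⟩ := hs.exists_finset
  rw [h1, finsum_eq_sum_of_support_subset (s := t), ← integral_finsetSum]
  · refine setIntegral_congr_fun (chartAt (Eu n) c).open_target.measurableSet fun z hz ↦ ?_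
    rw [← Finset.sum_mul, ← Finset.sum_mul, mul_right_comm, ht1 c z hz, mul_comm]
  · intro c' _
    exact hs.integrableOn_dens (h := fun p ↦ chartPartition n M c' p * f p)
      ((continuous_chartPartition c').mul hf) ((tsupport_mul_subset_right).trans hsub)
  · intro c' hc'
    by_contra h
    refine hc' (setIntegral_eq_zero_of_forall_eq_zero fun z hz ↦ ?_)
    rw [mul_right_comm, ht0 c c' h z hz, zero_mul]

theorem energy_add {s : Comps n M 𝕜 r} (hs : S.IsTest s) {f g : M → ℝ} (hf : Continuous f)
    (hg : Continuous g) : S.energy s (fun p ↦ f p + g p) = S.energy s f + S.energy s g := by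
  obtain ⟨t, ht⟩ := hs.energy_eq_sum
  rw [ht, ht, ht, ← Finset.sum_add_distrib]
  refine Finset.sum_congr rfl fun c _ ↦ ?_
  rw [← integral_add (hs.integrableOn_energy hf c) (hs.integrableOn_energy hg c)]
  exact integral_congr_ae (Filter.Eventually.of_forall fun z ↦ by ring)

theorem energy_const_mul {s : Comps n M 𝕜 r} (hs : S.IsTest s) (a : ℝ) (f : M → ℝ) :
    S.energy s (fun p ↦ a * f p) = a * S.energy s f := by
  obtain ⟨t, ht⟩ := hs.energy_eq_sum
  rw [ht, ht, Finset.mul_sum]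
  refine Finset.sum_congr rfl fun c _ ↦ ?_
  rw [← integral_const_mul]
  exact integral_congr_ae (Filter.Eventually.of_forall fun z ↦ by ring)

theorem energy_mono {s : Comps n M 𝕜 r} (hs : S.IsTest s) {f g : M → ℝ} (hf : Continuous f)
    (hg : Continuous g) (h : ∀ p ∈ S.dom, f p ≤ g p) : S.energy s f ≤ S.energy s g := by
  obtain ⟨t, ht⟩ := hs.energy_eq_sum
  rw [ht, ht]
  refine Finset.sum_le_sum fun c _ ↦ setIntegral_mono_on (hs.integrableOn_energy hf c)
    (hs.integrableOn_energy hg c) (chartAt (Eu n) c).open_target.measurableSet fun z hz ↦ ?_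
  have h0 := (chartPartition n M).nonneg c ((chartAt (Eu n) c).symm z)
  by_cases hz' : (chartAt (Eu n) c).symm z ∈ S.dom
  · have h1 := hs.dens_nonneg hz
    have h2 := h _ hz'
    gcongr
  · rw [hs.dens_eq_zero hz hz', mul_zero, mul_zero]

theorem energy_nonneg {s : Comps n M 𝕜 r} (hs : S.IsTest s) {f : M → ℝ}
    (h : ∀ p ∈ S.dom, 0 ≤ f p) : 0 ≤ S.energy s f := by
  obtain ⟨t, ht⟩ := hs.energy_eq_sum
  rw [ht]
  refine Finset.sum_nonneg fun c _ ↦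
    setIntegral_nonneg (chartAt (Eu n) c).open_target.measurableSet fun z hz ↦ ?_
  have h0 := (chartPartition n M).nonneg c ((chartAt (Eu n) c).symm z)
  by_cases hz' : (chartAt (Eu n) c).symm z ∈ S.dom
  · have h1 := hs.dens_nonneg hz
    have h2 := h _ hz'
    positivity
  · rw [hs.dens_eq_zero hz hz', mul_zero]

theorem re_l2_self {s : Comps n M 𝕜 r} (hs : S.IsTest s) :
    RCLike.re (S.l2 s s) = S.energy s (fun _ ↦ 1) := by
  have h1 := (RCLike.re : 𝕜 →+ ℝ).map_finsum (S.finite_support_l2 (s := s) hs)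
  rw [l2, h1, energy]
  refine finsum_congr fun c ↦ ?_
  have h2 := integral_re (S.integrableOn_l2 hs hs c)
  rw [← h2]
  refine integral_congr_ae (Filter.Eventually.of_forall fun z ↦ ?_)
  simp only [RCLike.re_ofReal_mul, dens]
  ring

end Region


section FrameDerivative

variable {n : ℕ}

/-- The derivative along the `i`-th vector field of a frame `A`. -/
def fd {F : Type*} [NormedAddCommGroup F] [NormedSpace ℝ F] (A : Eu n → Matrix (Fin n) (Fin n) ℝ)
    (i : Fin n) (f : Eu n → F) (z : Eu n) : F :=
  ∑ a, A z i a • pderiv a f z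

variable {A : Eu n → Matrix (Fin n) (Fin n) ℝ} {z : Eu n}

theorem fd_mul {f g : Eu n → ℝ} (hf : DifferentiableAt ℝ f z) (hg : DifferentiableAt ℝ g z)
    (i : Fin n) : fd A i (fun y ↦ f y * g y) z = f z * fd A i g z + fd A i f z * g z := by
  simp only [fd, pderiv_fun_mul hf hg, smul_eq_mul, Finset.mul_sum, Finset.sum_mul,
    ← Finset.sum_add_distrib]
  exact Finset.sum_congr rfl fun a _ ↦ by ring

theorem fd_add {f g : Eu n → ℝ} (hf : DifferentiableAt ℝ f z) (hg : DifferentiableAt ℝ g z)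
    (i : Fin n) : fd A i (fun y ↦ f y + g y) z = fd A i f z + fd A i g z := by
  simp only [fd, pderiv_fun_add hf hg, smul_add, Finset.sum_add_distrib]

theorem fd_const_mul {f : Eu n → ℝ} (hf : DifferentiableAt ℝ f z) (a : ℝ)
    (i : Fin n) : fd A i (fun y ↦ a * f y) z = a * fd A i f z := by
  rw [fd_mul (differentiableAt_const a) hf]
  simp [fd, pderiv]

theorem fd_sub {f g : Eu n → ℝ} (hf : DifferentiableAt ℝ f z) (hg : DifferentiableAt ℝ g z)
    (i : Fin n) : fd A i (fun y ↦ f y - g y) z = fd A i f z - fd A i g z := by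
  have h1 : (fun y ↦ f y - g y) = fun y ↦ f y + (-1) * g y := by
    ext y
    ring
  rw [h1, fd_add hf (hg.const_mul _), fd_const_mul hg]
  ring

theorem fd_sum {ι : Type*} {t : Finset ι} {f : ι → Eu n → ℝ}
    (hf : ∀ k, DifferentiableAt ℝ (f k) z) (i : Fin n) :
    fd A i (fun y ↦ ∑ k ∈ t, f k y) z = ∑ k ∈ t, fd A i (f k) z := by
  simp only [fd, pderiv_sum fun k _ ↦ hf k, Finset.smul_sum]
  exact Finset.sum_comm

theorem contDiffOn_fd {Z : Set (Eu n)} (hZ : IsOpen Z)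
    (hA : ∀ i a, ContDiffOn ℝ ∞ (fun z ↦ A z i a) Z) {F : Type*} [NormedAddCommGroup F]
    [NormedSpace ℝ F] {f : Eu n → F} (hf : ContDiffOn ℝ ∞ f Z) (i : Fin n) :
    ContDiffOn ℝ ∞ (fd A i f) Z :=
  ContDiffOn.sum fun a _ ↦ (hA i a).smul (Region.contDiffOn_pderiv hZ hf a)

theorem pderiv_comm {Z : Set (Eu n)} (hZ : IsOpen Z) {f : Eu n → ℝ} (hf : ContDiffOn ℝ ∞ f Z)
    (hz : z ∈ Z) (i j : Fin n) : pderiv i (pderiv j f) z = pderiv j (pderiv i f) z := by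
  have hc := hf.contDiffAt (hZ.mem_nhds hz)
  have hs := hc.isSymmSndFDerivAt (by
    simp only [minSmoothness_of_isRCLikeNormedField]
    exact WithTop.coe_le_coe.2 (le_top : (2 : ℕ∞) ≤ ⊤))
  have h1 : DifferentiableAt ℝ (fderiv ℝ f) z :=
    (hc.fderiv_right (m := 1) (by norm_cast)).differentiableAt (by simp)
  have h2 : ∀ i j : Fin n, pderiv i (pderiv j f) z = fderiv ℝ (fderiv ℝ f) z
      (EuclideanSpace.single i 1) (EuclideanSpace.single j 1) := by
    intro i j
    change fderiv ℝ (fun w ↦ fderiv ℝ f w (EuclideanSpace.single j (1 : ℝ))) z _ = _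
    rw [fderiv_clm_apply h1 (differentiableAt_const _)]
    simp
  rw [h2, h2, hs.eq]

theorem differentiableAt_of_open {F : Type*} [NormedAddCommGroup F] [NormedSpace ℝ F]
    {Z : Set (Eu n)} (hZ : IsOpen Z) {f : Eu n → F}
    (hf : ContDiffOn ℝ ∞ f Z) (hz : z ∈ Z) : DifferentiableAt ℝ f z :=
  (hf.contDiffAt (hZ.mem_nhds hz)).differentiableAt (by simp)

/-- The commutator of two derivatives along a frame. -/
theorem fd_comm {Z : Set (Eu n)} (hZ : IsOpen Z)
    (hA : ∀ i a, ContDiffOn ℝ ∞ (fun z ↦ A z i a) Z)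
    {b : Fin n → Fin n → Fin n → ℝ} (hz : z ∈ Z) {i j : Fin n}
    (hb : ∀ a, fd A i (fun y ↦ A y j a) z - fd A j (fun y ↦ A y i a) z = ∑ k, b i j k * A z k a)
    {f : Eu n → ℝ} (hf : ContDiffOn ℝ ∞ f Z) :
    fd A i (fd A j f) z - fd A j (fd A i f) z = ∑ k, b i j k * fd A k f z := by
  have hd : ∀ a, DifferentiableAt ℝ (pderiv a f) z := fun a ↦
    differentiableAt_of_open hZ (Region.contDiffOn_pderiv hZ hf a) hz
  have hdA : ∀ i a, DifferentiableAt ℝ (fun z ↦ A z i a) z := fun i a ↦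
    differentiableAt_of_open hZ (hA i a) hz
  have h1 : ∀ i j, fd A i (fd A j f) z =
      ∑ a, A z j a * fd A i (pderiv a f) z + ∑ a, fd A i (fun y ↦ A y j a) z * pderiv a f z := by
    intro i j
    have : fd A j f = fun y ↦ ∑ a, A y j a * pderiv a f y := rfl
    rw [this, fd_sum (f := fun a y ↦ A y j a * pderiv a f y) fun a ↦ (hdA j a).fun_mul (hd a), ← Finset.sum_add_distrib]
    exact Finset.sum_congr rfl fun a _ ↦ fd_mul (hdA j a) (hd a) i
  have h2 : ∑ a, A z j a * fd A i (pderiv a f) z = ∑ a, A z i a * fd A j (pderiv a f) z := by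
    simp only [fd, smul_eq_mul, Finset.mul_sum]
    rw [Finset.sum_comm]
    refine Finset.sum_congr rfl fun a _ ↦ Finset.sum_congr rfl fun c _ ↦ ?_
    rw [pderiv_comm hZ hf hz]
    ring
  have h3 : ∑ a, fd A i (fun y ↦ A y j a) z * pderiv a f z -
      ∑ a, fd A j (fun y ↦ A y i a) z * pderiv a f z = ∑ k, b i j k * fd A k f z := by
    rw [← Finset.sum_sub_distrib]
    simp only [← sub_mul, hb]
    simp only [Finset.sum_mul, fd, smul_eq_mul, Finset.mul_sum]
    rw [Finset.sum_comm]
    exact Finset.sum_congr rfl fun a _ ↦ Finset.sum_congr rfl fun c _ ↦ by ring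
  rw [h1 i j, h1 j i, h2, ← h3]
  ring

theorem pderiv_eq_zero_of_off {F : Type*} [NormedAddCommGroup F] [NormedSpace ℝ F]
    {K : Set (Eu n)} (hK : IsClosed K) {f : Eu n → F} (h0 : ∀ z ∉ K, f z = 0) (a : Fin n) :
    ∀ z ∉ K, pderiv a f z = 0 := by
  intro z hz
  have : f =ᶠ[𝓝 z] fun _ ↦ 0 := by
    filter_upwards [hK.isOpen_compl.mem_nhds hz] with w hw using h0 w hw
  rw [pderiv_congr this]
  simp [pderiv]

theorem fd_eq_zero_of_off {F : Type*} [NormedAddCommGroup F] [NormedSpace ℝ F]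
    {K : Set (Eu n)} (hK : IsClosed K) {f : Eu n → F} (h0 : ∀ z ∉ K, f z = 0) (i : Fin n) :
    ∀ z ∉ K, fd A i f z = 0 := by
  intro z hz
  simp [fd, pderiv_eq_zero_of_off hK h0 _ z hz]

theorem contDiff_of_off {F : Type*} [NormedAddCommGroup F] [NormedSpace ℝ F]
    {K Z : Set (Eu n)} (hK : IsClosed K) (hZ : IsOpen Z) (hKZ : K ⊆ Z) {f : Eu n → F}
    (hf : ContDiffOn ℝ ∞ f Z) (h0 : ∀ z ∉ K, f z = 0) : ContDiff ℝ ∞ f := by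
  rw [contDiff_iff_contDiffAt]
  intro z
  by_cases hz : z ∈ K
  · exact hf.contDiffAt (hZ.mem_nhds (hKZ hz))
  · have : f =ᶠ[𝓝 z] fun _ ↦ 0 := by
      filter_upwards [hK.isOpen_compl.mem_nhds hz] with w hw using h0 w hw
    exact contDiffAt_const.congr_of_eventuallyEq this

theorem integrable_of_off {F : Type*} [NormedAddCommGroup F]
    {K Z : Set (Eu n)} (hK : IsCompact K) (hKZ : K ⊆ Z) {f : Eu n → F}
    (hf : ContinuousOn f Z) (h0 : ∀ z ∉ K, f z = 0) : Integrable f := by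
  rw [← integrableOn_univ]
  exact ((hf.mono hKZ).integrableOn_compact hK).of_forall_sdiff_eq_zero MeasurableSet.univ
    fun z hz ↦ h0 z hz.2

theorem integral_pderiv_eq_zero {K Z : Set (Eu n)} (hK : IsCompact K) (hZ : IsOpen Z) (hKZ : K ⊆ Z)
    {f : Eu n → ℝ} (hf : ContDiffOn ℝ ∞ f Z) (h0 : ∀ z ∉ K, f z = 0) (a : Fin n) :
    ∫ z, pderiv a f z = 0 := by
  have hc := contDiff_of_off hK.isClosed hZ hKZ hf h0
  have h1 : Integrable f := integrable_of_off hK (subset_univ K) hc.continuous.continuousOn h0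
  have h2 : Integrable (pderiv a f) := integrable_of_off hK (subset_univ K)
    (Region.contDiffOn_pderiv isOpen_univ hc.contDiffOn a).continuousOn
    (pderiv_eq_zero_of_off hK.isClosed h0 a)
  have h3 := integral_mul_fderiv_eq_neg_fderiv_mul_of_integrable (μ := volume)
    (f := f) (g := fun _ ↦ (1 : ℝ)) (v := EuclideanSpace.single a (1 : ℝ))
    (by simp only [mul_one]; exact h2) (by simp) (by simpa using h1)
    (fun x _ ↦ hc.differentiable (by simp) x) (fun x _ ↦ differentiableAt_const _)
  simp only [fderiv_fun_const, Pi.zero_apply, zero_apply, mul_zero, integral_zero, mul_one] at h3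
  simpa [pderiv] using h3.symm

/-- The divergence theorem in a frame with a weight. -/
theorem integral_divergence {K Z : Set (Eu n)} (hK : IsCompact K) (hZ : IsOpen Z) (hKZ : K ⊆ Z)
    (hA : ∀ i a, ContDiffOn ℝ ∞ (fun z ↦ A z i a) Z) {w : Eu n → ℝ} (hw : ContDiffOn ℝ ∞ w Z)
    {d : Fin n → Eu n → ℝ}
    (hd : ∀ i, ∀ z ∈ Z, ∑ a, pderiv a (fun y ↦ A y i a * w y) z = w z * d i z)
    {Φ : Fin n → Eu n → ℝ} (hΦ : ∀ i, ContDiffOn ℝ ∞ (Φ i) Z) (h0 : ∀ i, ∀ z ∉ K, Φ i z = 0) :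
    ∫ z, w z * ∑ i, (fd A i (Φ i) z + d i z * Φ i z) = 0 := by
  set X : Fin n → Fin n → Eu n → ℝ := fun i a y ↦ (A y i a * w y) * Φ i y with hX
  have hXs : ∀ i a, ContDiffOn ℝ ∞ (X i a) Z := fun i a ↦ ((hA i a).mul hw).mul (hΦ i)
  have hX0 : ∀ i a, ∀ z ∉ K, X i a z = 0 := fun i a z hz ↦ by simp [hX, h0 i z hz]
  have h1 : ∀ z, w z * ∑ i, (fd A i (Φ i) z + d i z * Φ i z) = ∑ i, ∑ a, pderiv a (X i a) z := by
    intro z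
    by_cases hz : z ∈ K
    · have hzZ := hKZ hz
      rw [Finset.mul_sum]
      refine Finset.sum_congr rfl fun i _ ↦ ?_
      have e1 : ∀ a, pderiv a (X i a) z = (A z i a * w z) * pderiv a (Φ i) z +
          pderiv a (fun y ↦ A y i a * w y) z * Φ i z := fun a ↦
        pderiv_fun_mul (differentiableAt_of_open hZ ((hA i a).mul hw) hzZ)
          (differentiableAt_of_open hZ (hΦ i) hzZ) a
      simp only [e1, Finset.sum_add_distrib, ← Finset.sum_mul, hd i z hzZ, fd, smul_eq_mul, mul_add,
        Finset.mul_sum]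
      congr 1
      · exact Finset.sum_congr rfl fun a _ ↦ by ring
      · ring
    · have e1 : ∀ i, fd A i (Φ i) z = 0 := fun i ↦ fd_eq_zero_of_off hK.isClosed (h0 i) i z hz
      have e2 : ∀ i a, pderiv a (X i a) z = 0 := fun i a ↦
        pderiv_eq_zero_of_off hK.isClosed (hX0 i a) a z hz
      simp [e1, e2, h0 _ z hz]
  simp only [h1]
  have hint : ∀ i a, Integrable (pderiv a (X i a)) := fun i a ↦ by
    have hc := contDiff_of_off hK.isClosed hZ hKZ (hXs i a) (hX0 i a)
    exact integrable_of_off hK (subset_univ K)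
      (Region.contDiffOn_pderiv isOpen_univ hc.contDiffOn a).continuousOn
      (pderiv_eq_zero_of_off hK.isClosed (hX0 i a) a)
  rw [integral_finsetSum _ fun i _ ↦ integrable_finsetSum _ fun a _ ↦ hint i a]
  refine Finset.sum_eq_zero fun i _ ↦ ?_
  rw [integral_finsetSum _ fun a _ ↦ hint i a]
  exact Finset.sum_eq_zero fun a _ ↦ integral_pderiv_eq_zero hK hZ hKZ (hXs i a) (hX0 i a) a

end FrameDerivative

section KornAlgebra

variable {n : ℕ}

theorem sum_swap (f : Fin n → Fin n → ℝ) : ∑ i, ∑ j, f j i = ∑ i, ∑ j, f i j := Finset.sum_comm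

/-- The pointwise identity behind Korn's inequality in a frame. -/
theorem korn_identity (F : ℝ) (U α : Fin n → ℝ) (e a : Fin n → Fin n → ℝ)
    (q b : Fin n → Fin n → Fin n → ℝ)
    (hq : ∀ i j k, q i j k - q j i k = ∑ m, b i j m * e m k) :
    ∑ i, ∑ j, ((1 / 2) * (e i j + e j i) - F / 2 * (α i * U j + α j * U i)) ^ 2 =
      ∑ i, ((1 / 2) * ((∑ j, (U j * q i j i + e i j * e j i)) -
          (U i * (∑ j, q i j j) + e i i * ∑ j, e j j)) -
        F * (U i * (∑ j, (α j * e i j + a i j * U j)) + e i i * ∑ j, α j * U j) -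
        F / 2 * (α i * (∑ j, (U j * e i j + e i j * U j)) + a i i * ∑ j, U j * U j)) +
      ((1 / 2) * (∑ i, ∑ j, e i j ^ 2) + F ^ 2 / 2 * ((∑ i, α i ^ 2) * ∑ j, U j ^ 2) +
        (1 / 2) * ((∑ i, e i i) + F * ∑ i, α i * U i) ^ 2) -
      (1 / 2) * (∑ i, ∑ j, ∑ m, U j * (b i j m * e m i)) +
      F * (∑ i, ∑ j, U i * U j * a i j) + F / 2 * ((∑ i, a i i) * ∑ j, U j ^ 2) := by
  set tr := ∑ i, e i i with htr
  set αU := ∑ i, α i * U i with hαU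
  have hN : ∑ j, U j * U j = ∑ j, U j ^ 2 := Finset.sum_congr rfl fun j _ ↦ by ring
  set N := ∑ j, U j ^ 2 with hNdef
  have l1 : ∑ i, ∑ j, ((1 / 2) * (e i j + e j i) - F / 2 * (α i * U j + α j * U i)) ^ 2 =
      (1 / 2) * (∑ i, ∑ j, e i j ^ 2) + (1 / 2) * (∑ i, ∑ j, e i j * e j i) -
      F * (∑ i, ∑ j, α i * U j * e i j) - F * (∑ i, ∑ j, α i * U j * e j i) +
      F ^ 2 / 2 * ((∑ i, α i ^ 2) * N) + F ^ 2 / 2 * αU ^ 2 := by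
    have e1 : (∑ i, α i ^ 2) * N = ∑ i, ∑ j, α i ^ 2 * U j ^ 2 := by
      rw [hNdef, Finset.sum_mul_sum]
    have e2 : αU ^ 2 = ∑ i, ∑ j, (α i * U i) * (α j * U j) := by
      rw [hαU, sq, Finset.sum_mul_sum]
    have e3 : ∑ i, ∑ j, e j i ^ 2 = ∑ i, ∑ j, e i j ^ 2 := sum_swap fun i j ↦ e i j ^ 2
    have e4 : ∑ i, ∑ j, α j * U i * e j i = ∑ i, ∑ j, α i * U j * e i j :=
      sum_swap fun i j ↦ α i * U j * e i j
    have e5 : ∑ i, ∑ j, α j * U i * e i j = ∑ i, ∑ j, α i * U j * e j i :=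
      sum_swap fun i j ↦ α i * U j * e j i
    have e6 : ∑ i, ∑ j, α j ^ 2 * U i ^ 2 = ∑ i, ∑ j, α i ^ 2 * U j ^ 2 :=
      sum_swap fun i j ↦ α i ^ 2 * U j ^ 2
    have expand : ∀ i j, ((1 / 2) * (e i j + e j i) - F / 2 * (α i * U j + α j * U i)) ^ 2 =
        (1 / 4) * e i j ^ 2 + (1 / 4) * e j i ^ 2 + (1 / 2) * (e i j * e j i) +
        (-F / 2) * (α i * U j * e i j) + (-F / 2) * (α j * U i * e j i) +
        (-F / 2) * (α j * U i * e i j) + (-F / 2) * (α i * U j * e j i) +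
        F ^ 2 / 4 * (α i ^ 2 * U j ^ 2) + F ^ 2 / 4 * (α j ^ 2 * U i ^ 2) +
        F ^ 2 / 2 * ((α i * U i) * (α j * U j)) := fun i j ↦ by ring
    simp only [expand, Finset.sum_add_distrib, ← Finset.mul_sum]
    rw [e3, e4, e5, e6, e1, e2]
    simp only [← Finset.mul_sum]
    ring
  have l2 : ∑ i, ((1 / 2) * ((∑ j, (U j * q i j i + e i j * e j i)) -
          (U i * (∑ j, q i j j) + e i i * tr)) -
        F * (U i * (∑ j, (α j * e i j + a i j * U j)) + e i i * αU) -
        F / 2 * (α i * (∑ j, (U j * e i j + e i j * U j)) + a i i * N)) =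
      (1 / 2) * (∑ i, ∑ j, U j * q i j i) + (1 / 2) * (∑ i, ∑ j, e i j * e j i) -
      (1 / 2) * (∑ i, ∑ j, U i * q i j j) - (1 / 2) * tr ^ 2 -
      F * (∑ i, ∑ j, α j * U i * e i j) - F * (∑ i, ∑ j, U i * U j * a i j) - F * (tr * αU) -
      F * (∑ i, ∑ j, α i * U j * e i j) - F / 2 * ((∑ i, a i i) * N) := by
    have e1 : tr * αU = ∑ i, e i i * αU := by rw [htr, Finset.sum_mul]
    have e2 : tr ^ 2 = ∑ i, e i i * tr := by rw [← Finset.sum_mul, sq]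
    rw [e1, e2, Finset.sum_mul]
    simp only [Finset.mul_sum, ← Finset.sum_add_distrib, ← Finset.sum_sub_distrib]
    refine Finset.sum_congr rfl fun i _ ↦ ?_
    have f1 : ∑ j, U i * (α j * e i j + a i j * U j) =
        (∑ j, α j * U i * e i j) + ∑ j, U i * U j * a i j := by
      rw [← Finset.sum_add_distrib]
      exact Finset.sum_congr rfl fun j _ ↦ by ring
    have f2 : ∑ j, α i * (U j * e i j + e i j * U j) = 2 * ∑ j, α i * U j * e i j := by
      rw [Finset.mul_sum]
      exact Finset.sum_congr rfl fun j _ ↦ by ring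
    rw [f1, f2]
    simp only [← Finset.mul_sum, Finset.sum_add_distrib, Finset.sum_sub_distrib]
    ring
  have l3 : (∑ i, ∑ j, U j * q i j i) - ∑ i, ∑ j, U i * q i j j =
      ∑ i, ∑ j, ∑ m, U j * (b i j m * e m i) := by
    rw [← sum_swap fun i j ↦ U i * q i j j]
    simp only [← Finset.sum_sub_distrib, ← Finset.mul_sum, ← mul_sub, hq]
  have l4 : ∑ i, ∑ j, α j * U i * e i j = ∑ i, ∑ j, α i * U j * e j i :=
    sum_swap fun i j ↦ α i * U j * e j i
  rw [hN, l1, l2, ← l3, l4]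
  ring

end KornAlgebra


/-- A frame of vector fields on an open set, with a weight function and a covector field, and with
bounded commutators and divergences. -/
structure Frame (n : ℕ) (Z : Set (Eu n)) where
  /-- the components of the vector fields of the frame -/
  A : Eu n → Matrix (Fin n) (Fin n) ℝ
  /-- the weight -/
  w : Eu n → ℝ
  /-- the components in the frame of a covector field -/
  α : Fin n → Eu n → ℝ
  /-- the divergences of the frame for the weighted measure -/
  div : Fin n → Eu n → ℝ
  /-- the structure functions of the frame -/
  brk : Fin n → Fin n → Fin n → Eu n → ℝ
  /-- a bound -/
  C : ℝ
  isOpen : IsOpen Z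
  A_smooth : ∀ i a, ContDiffOn ℝ ∞ (fun z ↦ A z i a) Z
  w_smooth : ContDiffOn ℝ ∞ w Z
  w_pos : ∀ z ∈ Z, 0 < w z
  α_smooth : ∀ i, ContDiffOn ℝ ∞ (α i) Z
  div_eq : ∀ i, ∀ z ∈ Z, ∑ a, pderiv a (fun y ↦ A y i a * w y) z = w z * div i z
  brk_eq : ∀ i j a, ∀ z ∈ Z, fd A i (fun y ↦ A y j a) z - fd A j (fun y ↦ A y i a) z =
    ∑ k, brk i j k z * A z k a
  C_nonneg : 0 ≤ C
  div_le : ∀ i, ∀ z ∈ Z, |div i z| ≤ C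
  brk_le : ∀ i j k, ∀ z ∈ Z, |brk i j k z| ≤ C
  α_le : ∀ i, ∀ z ∈ Z, |α i z| ≤ C
  dα_le : ∀ i j, ∀ z ∈ Z, |fd A i (α j) z| ≤ C

section KornPointwise

variable {n : ℕ}

theorem abs_sum_le_card {f : Fin n → ℝ} {b : ℝ} (h : ∀ i, |f i| ≤ b) : |∑ i, f i| ≤ n * b := by
  calc |∑ i, f i| ≤ ∑ i, |f i| := Finset.abs_sum_le_sum_abs _ _
    _ ≤ ∑ _i : Fin n, b := Finset.sum_le_sum fun i _ ↦ h i
    _ = n * b := by simp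

theorem abs_half_sub_le {a b c d P Q R : ℝ} (ha : |a| ≤ P) (hb : |b| ≤ P) (hc : |c| ≤ Q)
    (hd : |d| ≤ R) : |(1 / 2) * (a - b) - c - d| ≤ P + Q + R := by
  rw [abs_le] at *
  constructor <;> linarith [ha.1, ha.2, hb.1, hb.2, hc.1, hc.2, hd.1, hd.2]

theorem korn_arith {E Q F Φ D s R R2 R3 N p L M b1 b2 b3 d1 d2 : ℝ} (h1 : R ≤ b1)
    (h2 : D ≤ d1 + d2) (h3 : -(F * b2) ≤ F * R2) (h4 : -(F / 2 * b3) ≤ F / 2 * R3)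
    (h5 : L * p ≤ E / 4 + L * (L + 1) * N) (h6 : (1 / 2) * b1 + d1 = L * p)
    (h7 : F * b2 + F / 2 * b3 + d2 = F * (M * N)) (hs : 0 ≤ s) (hQ : 0 ≤ F ^ 2 * Q)
    (hp1 : 0 ≤ L * (L + 1) * (F * N)) (hp2 : 0 ≤ M * N) :
    E + F ^ 2 * Q + 4 * (Φ + D) ≤
      4 * (Φ + ((1 / 2) * E + F ^ 2 / 2 * Q + (1 / 2) * s) - (1 / 2) * R + F * R2 + F / 2 * R3) +
        4 * (L * (L + 1) + M) * ((1 + F) * N) := by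
  have e : 4 * (L * (L + 1) + M) * ((1 + F) * N) = 4 * (L * (L + 1) * N) +
      4 * (L * (L + 1) * (F * N)) + 4 * (M * N) + 4 * (F * (M * N)) := by ring
  rw [e]
  linarith

/-- The pointwise estimate behind Korn's inequality in a frame. -/
theorem korn_pointwise {C F : ℝ} (hC : 0 ≤ C) (hF : 0 ≤ F) (U α d : Fin n → ℝ)
    (e a : Fin n → Fin n → ℝ) (q b : Fin n → Fin n → Fin n → ℝ)
    (hq : ∀ i j k, q i j k - q j i k = ∑ m, b i j m * e m k)
    (hα : ∀ i, |α i| ≤ C) (hd : ∀ i, |d i| ≤ C) (ha : ∀ i j, |a i j| ≤ C)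
    (hb : ∀ i j k, |b i j k| ≤ C) (L M : ℝ) (hL : L = (n : ℝ) ^ 2 * C + n ^ 3 * C / 2)
    (hM : M = n * C * (n * C + C / 2) + n ^ 2 * C + n * C / 2) :
    (∑ i, ∑ j, e i j ^ 2) + F ^ 2 * ((∑ i, α i ^ 2) * ∑ j, U j ^ 2) +
      4 * (∑ i, (((1 / 2) * ((∑ j, (U j * q i j i + e i j * e j i)) -
          (U i * (∑ j, q i j j) + e i i * ∑ j, e j j)) -
        F * (U i * (∑ j, (α j * e i j + a i j * U j)) + e i i * ∑ j, α j * U j) -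
        F / 2 * (α i * (∑ j, (U j * e i j + e i j * U j)) + a i i * ∑ j, U j * U j)) +
        d i * ((1 / 2) * ((∑ j, U j * e j i) - U i * ∑ j, e j j) - F * (U i * ∑ j, α j * U j) -
          F / 2 * (α i * ∑ j, U j * U j)))) ≤
    4 * (∑ i, ∑ j, ((1 / 2) * (e i j + e j i) - F / 2 * (α i * U j + α j * U i)) ^ 2) +
      4 * (L * (L + 1) + M) * ((1 + F) * ∑ j, U j ^ 2) := by
  have hid := korn_identity F U α e a q b hq
  have hN' : ∑ j, U j * U j = ∑ j, U j ^ 2 := Finset.sum_congr rfl fun j _ ↦ by ring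
  set N := ∑ j, U j ^ 2 with hN
  set E := ∑ i, ∑ j, e i j ^ 2 with hE
  have hN0 : 0 ≤ N := Finset.sum_nonneg fun _ _ ↦ sq_nonneg _
  have hE0 : 0 ≤ E := Finset.sum_nonneg fun _ _ ↦ Finset.sum_nonneg fun _ _ ↦ sq_nonneg _
  have hA0 : 0 ≤ ∑ i, α i ^ 2 := Finset.sum_nonneg fun _ _ ↦ sq_nonneg _
  have hL0 : 0 ≤ L := by rw [hL]; positivity
  have hM0 : 0 ≤ M := by rw [hM]; positivity
  have hUN : ∀ j, U j ^ 2 ≤ N := fun j ↦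
    Finset.single_le_sum (f := fun j ↦ U j ^ 2) (fun _ _ ↦ sq_nonneg _) (Finset.mem_univ j)
  have heE : ∀ i j, e i j ^ 2 ≤ E := fun i j ↦
    (Finset.single_le_sum (f := fun j ↦ e i j ^ 2) (fun _ _ ↦ sq_nonneg _)
      (Finset.mem_univ j)).trans
    (Finset.single_le_sum (f := fun i ↦ ∑ j, e i j ^ 2)
      (fun _ _ ↦ Finset.sum_nonneg fun _ _ ↦ sq_nonneg _) (Finset.mem_univ i))
  set p := E / (4 * (L + 1)) + (L + 1) * N with hp
  have hp0 : 0 ≤ p := by positivity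
  have hUe : ∀ j k i, |U j * e k i| ≤ p := by
    intro j k i
    have h1 : |U j * e k i| ≤ e k i ^ 2 / (4 * (L + 1)) + (L + 1) * U j ^ 2 := by
      rw [abs_mul]
      have h2 : 0 ≤ (|e k i| / (2 * √(L + 1)) - √(L + 1) * |U j|) ^ 2 := sq_nonneg _
      have h3 : √(L + 1) ≠ 0 := (Real.sqrt_pos.2 (by linarith)).ne'
      have h4 : √(L + 1) ^ 2 = L + 1 := Real.sq_sqrt (by linarith)
      have h5 : (|e k i| / (2 * √(L + 1)) - √(L + 1) * |U j|) ^ 2 =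
          |e k i| ^ 2 / (4 * √(L + 1) ^ 2) - |U j| * |e k i| + √(L + 1) ^ 2 * |U j| ^ 2 := by
        field_simp
        ring
      rw [h5, h4, sq_abs, sq_abs] at h2
      linarith
    refine h1.trans (add_le_add ?_ ?_)
    · exact div_le_div_of_nonneg_right (heE k i) (by positivity)
    · exact mul_le_mul_of_nonneg_left (hUN j) (by linarith)
  have hUU : ∀ i j, |U i * U j| ≤ N := by
    intro i j
    rw [abs_mul]
    nlinarith [hUN i, hUN j, sq_nonneg (|U i| - |U j|), sq_abs (U i), sq_abs (U j)]
  have b1 : |∑ i, ∑ j, ∑ m, U j * (b i j m * e m i)| ≤ n * (n * (n * (C * p))) := by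
    refine abs_sum_le_card fun i ↦ abs_sum_le_card fun j ↦ abs_sum_le_card fun m ↦ ?_
    have : U j * (b i j m * e m i) = b i j m * (U j * e m i) := by ring
    rw [this, abs_mul]
    exact mul_le_mul (hb i j m) (hUe _ _ _) (abs_nonneg _) hC
  have b2 : |∑ i, ∑ j, U i * U j * a i j| ≤ n * (n * (N * C)) := by
    refine abs_sum_le_card fun i ↦ abs_sum_le_card fun j ↦ ?_
    rw [abs_mul]
    exact mul_le_mul (hUU i j) (ha i j) (abs_nonneg _) hN0
  have b3 : |(∑ i, a i i) * N| ≤ n * C * N := by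
    rw [abs_mul, abs_of_nonneg hN0]
    exact mul_le_mul_of_nonneg_right (abs_sum_le_card fun i ↦ ha i i) hN0
  have b4 : |∑ i, d i * ((1 / 2) * ((∑ j, U j * e j i) - U i * ∑ j, e j j) -
      F * (U i * ∑ j, α j * U j) - F / 2 * (α i * N))| ≤
      n * (C * (n * p + F * (n * (C * N)) + F / 2 * (C * N))) := by
    refine abs_sum_le_card fun i ↦ ?_
    rw [abs_mul]
    refine mul_le_mul (hd i) ?_ (abs_nonneg _) hC
    have c1 : |∑ j, U j * e j i| ≤ n * p := abs_sum_le_card fun j ↦ hUe _ _ _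
    have c2 : |U i * ∑ j, e j j| ≤ n * p := by
      rw [Finset.mul_sum]
      exact abs_sum_le_card fun j ↦ hUe _ _ _
    have c3 : |U i * ∑ j, α j * U j| ≤ n * (C * N) := by
      rw [Finset.mul_sum]
      refine abs_sum_le_card fun j ↦ ?_
      have : U i * (α j * U j) = α j * (U i * U j) := by ring
      rw [this, abs_mul]
      exact mul_le_mul (hα j) (hUU i j) (abs_nonneg _) hC
    have c4 : |α i * N| ≤ C * N := by
      rw [abs_mul, abs_of_nonneg hN0]
      exact mul_le_mul_of_nonneg_right (hα i) hN0
    have c5 : |F * (U i * ∑ j, α j * U j)| ≤ F * (n * (C * N)) := by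
      rw [abs_mul, abs_of_nonneg hF]
      exact mul_le_mul_of_nonneg_left c3 hF
    have c6 : |F / 2 * (α i * N)| ≤ F / 2 * (C * N) := by
      rw [abs_mul, abs_of_nonneg (by positivity : 0 ≤ F / 2)]
      exact mul_le_mul_of_nonneg_left c4 (by positivity)
    exact abs_half_sub_le c1 c2 c5 c6
  rw [hN'] at hid ⊢
  rw [Finset.sum_add_distrib, hid]
  rw [abs_le] at b1 b2 b3 b4
  clear hid hUe hUU heE hUN
  have hsq : 0 ≤ ((∑ i, e i i) + F * ∑ i, α i * U i) ^ 2 := sq_nonneg _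
  have hpL : L * p ≤ E / 4 + L * (L + 1) * N := by
    have : L * (E / (4 * (L + 1))) ≤ E / 4 := by
      rw [mul_div_assoc', div_le_div_iff₀ (by positivity) (by norm_num)]
      nlinarith
    calc L * p = L * (E / (4 * (L + 1))) + L * (L + 1) * N := by rw [hp]; ring
      _ ≤ _ := by linarith
  refine korn_arith b1.2 (d1 := n * (C * (n * p)))
    (d2 := n * (C * (F * (n * (C * N)) + F / 2 * (C * N)))) (b4.2.trans (le_of_eq (by ring)))
    (b2 := n * (n * (N * C))) (by nlinarith [b2.1]) (b3 := n * C * N) (by nlinarith [b3.1]) hpL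
    (by rw [hL]; ring) (by rw [hM]; ring) hsq (by positivity) (by positivity) (by positivity)

end KornPointwise

namespace Frame

variable {n : ℕ} {Z : Set (Eu n)} (E : Frame n Z)

/-- The symmetrized twisted derivative of a one-form in a frame. -/
def sym {V : Type*} [NormedAddCommGroup V] [NormedSpace ℝ V] (F : ℝ) (U : Fin n → Eu n → V)
    (i j : Fin n) (z : Eu n) : V :=
  (1 / 2 : ℝ) • (fd E.A i (U j) z + fd E.A j (U i) z) -
    (F / 2) • (E.α i z • U j z + E.α j z • U i z)

set_option maxHeartbeats 1000000 in
theorem korn_real : ∃ K, 0 ≤ K ∧ ∀ F : ℝ, 0 ≤ F → ∀ T : Set (Eu n), IsCompact T → T ⊆ Z →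
    ∀ U : Fin n → Eu n → ℝ, (∀ j, ContDiffOn ℝ ∞ (U j) Z) → (∀ j, ∀ z ∉ T, U j z = 0) →
    ∫ z, E.w z * ((∑ i, ∑ j, fd E.A i (U j) z ^ 2) +
      F ^ 2 * ((∑ i, E.α i z ^ 2) * ∑ j, U j z ^ 2)) ≤
    K * (∫ z, E.w z * ∑ i, ∑ j, E.sym F U i j z ^ 2) +
      K * (1 + F) * ∫ z, E.w z * ∑ j, U j z ^ 2 := by
  set L := (n : ℝ) ^ 2 * E.C + n ^ 3 * E.C / 2 with hL
  set M := n * E.C * (n * E.C + E.C / 2) + n ^ 2 * E.C + n * E.C / 2 with hM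
  have hC := E.C_nonneg
  refine ⟨4 + 4 * (L * (L + 1) + M), by positivity, fun F hF T hT hTZ U hU h0 ↦ ?_⟩
  have hL0 : 0 ≤ L := by positivity
  have hM0 : 0 ≤ M := by positivity
  set Φ : Fin n → Eu n → ℝ := fun i y ↦
    (1 / 2) * ((∑ j, U j y * fd E.A j (U i) y) - U i y * ∑ j, fd E.A j (U j) y) -
      F * (U i y * ∑ j, E.α j y * U j y) - F / 2 * (E.α i y * ∑ j, U j y * U j y) with hΦ
  have hfdU : ∀ i j, ContDiffOn ℝ ∞ (fd E.A i (U j)) Z := fun i j ↦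
    contDiffOn_fd E.isOpen E.A_smooth (hU j) i
  have hΦs : ∀ i, ContDiffOn ℝ ∞ (Φ i) Z := by
    intro i
    refine ((contDiffOn_const.mul ((ContDiffOn.sum fun j _ ↦ (hU j).mul (hfdU j i)).sub
      ((hU i).mul (ContDiffOn.sum fun j _ ↦ hfdU j j)))).sub (contDiffOn_const.mul
      ((hU i).mul (ContDiffOn.sum fun j _ ↦ (E.α_smooth j).mul (hU j))))).sub
      (contDiffOn_const.mul ((E.α_smooth i).mul (ContDiffOn.sum fun j _ ↦ (hU j).mul (hU j))))
  have hΦ0 : ∀ i, ∀ z ∉ T, Φ i z = 0 := by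
    intro i z hz
    simp [hΦ, h0 _ z hz]
  have hdiv := integral_divergence hT E.isOpen hTZ E.A_smooth E.w_smooth E.div_eq hΦs hΦ0
  have hfd0 : ∀ i j, ∀ z ∉ T, fd E.A i (U j) z = 0 := fun i j ↦
    fd_eq_zero_of_off hT.isClosed (h0 j) i
  have hw := E.w_smooth.continuousOn
  have int1 : Integrable fun z ↦ E.w z * ((∑ i, ∑ j, fd E.A i (U j) z ^ 2) +
      F ^ 2 * ((∑ i, E.α i z ^ 2) * ∑ j, U j z ^ 2)) := by
    refine integrable_of_off hT hTZ (hw.mul ((continuousOn_finsetSum _ fun i _ ↦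
      continuousOn_finsetSum _ fun j _ ↦ (hfdU i j).continuousOn.pow 2).add
      (continuousOn_const.mul ((continuousOn_finsetSum _ fun i _ ↦
        (E.α_smooth i).continuousOn.pow 2).mul (continuousOn_finsetSum _ fun j _ ↦
        (hU j).continuousOn.pow 2))))) fun z hz ↦ ?_
    simp [h0 _ z hz, hfd0 _ _ z hz]
  have int2 : Integrable fun z ↦ E.w z * ∑ i, (fd E.A i (Φ i) z + E.div i z * Φ i z) := by
    have e : ∀ z, E.w z * ∑ i, (fd E.A i (Φ i) z + E.div i z * Φ i z) =
        ∑ i, (E.w z * fd E.A i (Φ i) z +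
          (∑ a, pderiv a (fun y ↦ E.A y i a * E.w y) z) * Φ i z) := by
      intro z
      by_cases hz : z ∈ T
      · rw [Finset.mul_sum]
        refine Finset.sum_congr rfl fun i _ ↦ ?_
        rw [E.div_eq i z (hTZ hz)]
        ring
      · have : ∀ i, fd E.A i (Φ i) z = 0 := fun i ↦ fd_eq_zero_of_off hT.isClosed (hΦ0 i) i z hz
        simp [hΦ0 _ z hz, this]
    simp only [e]
    refine integrable_of_off hT hTZ (continuousOn_finsetSum _ fun i _ ↦ (hw.mul
      (contDiffOn_fd E.isOpen E.A_smooth (hΦs i) i).continuousOn).add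
      ((continuousOn_finsetSum _ fun a _ ↦ (Region.contDiffOn_pderiv E.isOpen
        ((E.A_smooth i a).mul E.w_smooth) a).continuousOn).mul (hΦs i).continuousOn)) fun z hz ↦ ?_
    have : ∀ i, fd E.A i (Φ i) z = 0 := fun i ↦ fd_eq_zero_of_off hT.isClosed (hΦ0 i) i z hz
    simp [hΦ0 _ z hz, this]
  have hsym : ∀ i j, ContinuousOn (E.sym F U i j) Z := by
    intro i j
    have e : E.sym F U i j = fun z ↦ (1 / 2) * (fd E.A i (U j) z + fd E.A j (U i) z) -
          F / 2 * (E.α i z * U j z + E.α j z * U i z) := rfl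
    rw [e]
    exact (continuousOn_const.mul ((hfdU i j).continuousOn.add (hfdU j i).continuousOn)).sub
      (continuousOn_const.mul (((E.α_smooth i).continuousOn.mul (hU j).continuousOn).add
        ((E.α_smooth j).continuousOn.mul (hU i).continuousOn)))
  have int3 : Integrable fun z ↦ E.w z * ∑ i, ∑ j, E.sym F U i j z ^ 2 := by
    refine integrable_of_off hT hTZ (hw.mul (continuousOn_finsetSum _ fun i _ ↦
      continuousOn_finsetSum _ fun j _ ↦ (hsym i j).pow 2)) fun z hz ↦ ?_
    simp [Frame.sym, h0 _ z hz, hfd0 _ _ z hz]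
  have int4 : Integrable fun z ↦ E.w z * ∑ j, U j z ^ 2 := by
    refine integrable_of_off hT hTZ (hw.mul (continuousOn_finsetSum _ fun j _ ↦
      (hU j).continuousOn.pow 2)) fun z hz ↦ ?_
    simp [h0 _ z hz]
  have key : ∀ z, E.w z * ((∑ i, ∑ j, fd E.A i (U j) z ^ 2) +
      F ^ 2 * ((∑ i, E.α i z ^ 2) * ∑ j, U j z ^ 2)) +
      4 * (E.w z * ∑ i, (fd E.A i (Φ i) z + E.div i z * Φ i z)) ≤
      4 * (E.w z * ∑ i, ∑ j, E.sym F U i j z ^ 2) +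
      4 * (L * (L + 1) + M) * (1 + F) * (E.w z * ∑ j, U j z ^ 2) := by
    intro z
    by_cases hz : z ∈ T
    · have hzZ := hTZ hz
      have hdU : ∀ j, DifferentiableAt ℝ (U j) z := fun j ↦
        differentiableAt_of_open E.isOpen (hU j) hzZ
      have hdα : ∀ j, DifferentiableAt ℝ (E.α j) z := fun j ↦
        differentiableAt_of_open E.isOpen (E.α_smooth j) hzZ
      have hde : ∀ i j, DifferentiableAt ℝ (fd E.A i (U j)) z := fun i j ↦
        differentiableAt_of_open E.isOpen (hfdU i j) hzZ
      have hp := korn_pointwise hC hF (fun j ↦ U j z) (fun i ↦ E.α i z) (fun i ↦ E.div i z)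
        (fun i j ↦ fd E.A i (U j) z) (fun i j ↦ fd E.A i (E.α j) z)
        (fun i j k ↦ fd E.A i (fd E.A j (U k)) z) (fun i j k ↦ E.brk i j k z)
        (fun i j k ↦ fd_comm E.isOpen E.A_smooth (b := fun i j k ↦ E.brk i j k z) hzZ
          (fun a ↦ E.brk_eq i j a z hzZ) (hU k))
        (fun i ↦ E.α_le i z hzZ) (fun i ↦ E.div_le i z hzZ) (fun i j ↦ E.dα_le i j z hzZ)
        (fun i j k ↦ E.brk_le i j k z hzZ) L M hL hM
      have hΦd : ∀ i, fd E.A i (Φ i) z =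
          (1 / 2) * ((∑ j, (U j z * fd E.A i (fd E.A j (U i)) z +
            fd E.A i (U j) z * fd E.A j (U i) z)) -
          (U i z * (∑ j, fd E.A i (fd E.A j (U j)) z) + fd E.A i (U i) z * ∑ j, fd E.A j (U j) z)) -
          F * (U i z * (∑ j, (E.α j z * fd E.A i (U j) z + fd E.A i (E.α j) z * U j z)) +
            fd E.A i (U i) z * ∑ j, E.α j z * U j z) -
          F / 2 * (E.α i z * (∑ j, (U j z * fd E.A i (U j) z + fd E.A i (U j) z * U j z)) +
            fd E.A i (E.α i) z * ∑ j, U j z * U j z) := by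
        intro i
        have d1 : DifferentiableAt ℝ (fun y ↦ ∑ j, U j y * fd E.A j (U i) y) z :=
          DifferentiableAt.fun_sum fun j _ ↦ (hdU j).fun_mul (hde j i)
        have d2 : DifferentiableAt ℝ (fun y ↦ ∑ j, fd E.A j (U j) y) z :=
          DifferentiableAt.fun_sum fun j _ ↦ hde j j
        have d3 : DifferentiableAt ℝ (fun y ↦ ∑ j, E.α j y * U j y) z :=
          DifferentiableAt.fun_sum fun j _ ↦ (hdα j).fun_mul (hdU j)
        have d4 : DifferentiableAt ℝ (fun y ↦ ∑ j, U j y * U j y) z :=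
          DifferentiableAt.fun_sum fun j _ ↦ (hdU j).fun_mul (hdU j)
        have d5 := (hdU i).fun_mul d2
        have d6 := (hdU i).fun_mul d3
        have d7 := (hdα i).fun_mul d4
        rw [fd_sub (((d1.fun_sub d5).const_mul _).fun_sub (d6.const_mul _)) (d7.const_mul _),
          fd_sub ((d1.fun_sub d5).const_mul _) (d6.const_mul _),
          fd_const_mul (d1.fun_sub d5), fd_const_mul d6, fd_const_mul d7, fd_sub d1 d5,
          fd_mul (hdU i) d2, fd_mul (hdU i) d3, fd_mul (hdα i) d4,
          fd_sum (f := fun j y ↦ U j y * fd E.A j (U i) y) fun j ↦ (hdU j).fun_mul (hde j i),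
          fd_sum (f := fun j y ↦ fd E.A j (U j) y) fun j ↦ hde j j,
          fd_sum (f := fun j y ↦ E.α j y * U j y) fun j ↦ (hdα j).fun_mul (hdU j),
          fd_sum (f := fun j y ↦ U j y * U j y) fun j ↦ (hdU j).fun_mul (hdU j)]
        simp only [fd_mul (hdU _) (hde _ _), fd_mul (hdα _) (hdU _), fd_mul (hdU _) (hdU _)]
      have hs : ∀ i j, E.sym F U i j z = (1 / 2) * (fd E.A i (U j) z + fd E.A j (U i) z) -
          F / 2 * (E.α i z * U j z + E.α j z * U i z) := fun i j ↦ rfl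
      simp only [hs, hΦd]
      have := mul_le_mul_of_nonneg_left hp (E.w_pos z hzZ).le
      refine (le_of_eq ?_).trans (this.trans (le_of_eq ?_))
      · ring
      · ring
    · have : ∀ i, fd E.A i (Φ i) z = 0 := fun i ↦ fd_eq_zero_of_off hT.isClosed (hΦ0 i) i z hz
      simp [hΦ0 _ z hz, this, Frame.sym, h0 _ z hz, hfd0 _ _ z hz]
  have hI := integral_mono (int1.add (int2.const_mul 4))
    ((int3.const_mul 4).add (int4.const_mul (4 * (L * (L + 1) + M) * (1 + F)))) key
  simp only [Pi.add_apply] at hI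
  rw [integral_add int1 (int2.const_mul 4), integral_add (int3.const_mul 4) (int4.const_mul _),
    integral_const_mul, integral_const_mul, integral_const_mul, hdiv] at hI
  have p3 : 0 ≤ ∫ z, E.w z * ∑ i, ∑ j, E.sym F U i j z ^ 2 := by
    refine integral_nonneg fun z ↦ ?_
    by_cases hz : z ∈ T
    · exact mul_nonneg (E.w_pos z (hTZ hz)).le
        (Finset.sum_nonneg fun _ _ ↦ Finset.sum_nonneg fun _ _ ↦ sq_nonneg _)
    · simp [Frame.sym, h0 _ z hz, hfd0 _ _ z hz]
  have p4 : 0 ≤ ∫ z, E.w z * ∑ j, U j z ^ 2 := by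
    refine integral_nonneg fun z ↦ ?_
    by_cases hz : z ∈ T
    · exact mul_nonneg (E.w_pos z (hTZ hz)).le (Finset.sum_nonneg fun _ _ ↦ sq_nonneg _)
    · simp [h0 _ z hz]
  have hq : 0 ≤ L * (L + 1) + M := by positivity
  set I3 := ∫ z, E.w z * ∑ i, ∑ j, E.sym F U i j z ^ 2
  set I4 := ∫ z, E.w z * ∑ j, U j z ^ 2
  have q1 : 0 ≤ (4 * (L * (L + 1) + M)) * I3 := by positivity
  have q2 : 0 ≤ 4 * ((1 + F) * I4) := by positivity
  linarith

end Frame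


section Components

variable {n : ℕ} {𝕜 : Type*} [RCLike 𝕜] {A : Eu n → Matrix (Fin n) (Fin n) ℝ} {z : Eu n}

theorem norm_sq_re_im (x : 𝕜) : ‖x‖ ^ 2 = RCLike.re x ^ 2 + RCLike.im x ^ 2 := by
  rw [← RCLike.normSq_eq_def', RCLike.normSq_apply]
  ring

theorem pderiv_re {f : Eu n → 𝕜} (hf : DifferentiableAt ℝ f z) (i : Fin n) :
    pderiv i (fun y ↦ RCLike.re (f y)) z = RCLike.re (pderiv i f z) := by
  have h := ((RCLike.reCLM (K := 𝕜)).hasFDerivAt.comp z hf.hasFDerivAt).fderiv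
  simp only [Function.comp_def, RCLike.reCLM_apply] at h
  rw [pderiv, h]
  rfl

theorem pderiv_im {f : Eu n → 𝕜} (hf : DifferentiableAt ℝ f z) (i : Fin n) :
    pderiv i (fun y ↦ RCLike.im (f y)) z = RCLike.im (pderiv i f z) := by
  have h := ((RCLike.imCLM (K := 𝕜)).hasFDerivAt.comp z hf.hasFDerivAt).fderiv
  simp only [Function.comp_def, RCLike.imCLM_apply] at h
  rw [pderiv, h]
  rfl

theorem fd_re {f : Eu n → 𝕜} (hf : DifferentiableAt ℝ f z) (i : Fin n) :
    fd A i (fun y ↦ RCLike.re (f y)) z = RCLike.re (fd A i f z) := by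
  simp [fd, pderiv_re hf, RCLike.smul_re]

theorem fd_im {f : Eu n → 𝕜} (hf : DifferentiableAt ℝ f z) (i : Fin n) :
    fd A i (fun y ↦ RCLike.im (f y)) z = RCLike.im (fd A i f z) := by
  simp [fd, pderiv_im hf, RCLike.smul_im]

end Components

namespace Frame

variable {n : ℕ} {Z : Set (Eu n)} (E : Frame n Z) {𝕜 : Type*} [RCLike 𝕜]

theorem sym_re {F : ℝ} {U : Fin n → Eu n → 𝕜} {z : Eu n} (hU : ∀ j, DifferentiableAt ℝ (U j) z)
    (i j : Fin n) :
    E.sym F (fun j y ↦ RCLike.re (U j y)) i j z = RCLike.re (E.sym F U i j z) := by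
  simp only [sym, fd_re (hU _), map_sub, map_add, RCLike.smul_re, smul_eq_mul]

theorem sym_im {F : ℝ} {U : Fin n → Eu n → 𝕜} {z : Eu n} (hU : ∀ j, DifferentiableAt ℝ (U j) z)
    (i j : Fin n) :
    E.sym F (fun j y ↦ RCLike.im (U j y)) i j z = RCLike.im (E.sym F U i j z) := by
  simp only [sym, fd_im (hU _), map_sub, map_add, RCLike.smul_im, smul_eq_mul]

theorem integrable_mul {T : Set (Eu n)} (hT : IsCompact T) (hTZ : T ⊆ Z) {f : Eu n → ℝ}
    (hf : ContinuousOn f Z) (h0 : ∀ z ∉ T, f z = 0) : Integrable fun z ↦ E.w z * f z :=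
  integrable_of_off hT hTZ (E.w_smooth.continuousOn.mul hf) fun z hz ↦ by simp [h0 z hz]

theorem continuousOn_sym {V : Type*} [NormedAddCommGroup V] [NormedSpace ℝ V] {F : ℝ}
    {U : Fin n → Eu n → V} (hU : ∀ j, ContDiffOn ℝ ∞ (U j) Z)
    (i j : Fin n) : ContinuousOn (E.sym F U i j) Z := by
  have h1 : ∀ i j, ContinuousOn (fd E.A i (U j)) Z := fun i j ↦
    (contDiffOn_fd E.isOpen E.A_smooth (hU j) i).continuousOn
  have e : E.sym F U i j = fun z ↦ (1 / 2 : ℝ) • (fd E.A i (U j) z + fd E.A j (U i) z) -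
      (F / 2) • (E.α i z • U j z + E.α j z • U i z) := rfl
  rw [e]
  exact (continuousOn_const.smul ((h1 i j).add (h1 j i))).sub
    (continuousOn_const.smul (((E.α_smooth i).continuousOn.smul (hU j).continuousOn).add
      ((E.α_smooth j).continuousOn.smul (hU i).continuousOn)))

theorem sym_eq_zero {V : Type*} [NormedAddCommGroup V] [NormedSpace ℝ V] {F : ℝ}
    {U : Fin n → Eu n → V} {T : Set (Eu n)} (hT : IsCompact T) (h0 : ∀ j, ∀ z ∉ T, U j z = 0)
    (i j : Fin n) {z : Eu n} (hz : z ∉ T) : E.sym F U i j z = 0 := by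
  simp [sym, h0 _ z hz, fd_eq_zero_of_off hT.isClosed (h0 _) _ z hz]

theorem korn : ∃ K, 0 ≤ K ∧ ∀ F : ℝ, 0 ≤ F → ∀ T : Set (Eu n), IsCompact T → T ⊆ Z →
    ∀ U : Fin n → Eu n → 𝕜, (∀ j, ContDiffOn ℝ ∞ (U j) Z) → (∀ j, ∀ z ∉ T, U j z = 0) →
    ∫ z, E.w z * ((∑ i, ∑ j, ‖fd E.A i (U j) z‖ ^ 2) +
      F ^ 2 * ((∑ i, E.α i z ^ 2) * ∑ j, ‖U j z‖ ^ 2)) ≤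
    K * (∫ z, E.w z * ∑ i, ∑ j, ‖E.sym F U i j z‖ ^ 2) +
      K * (1 + F) * ∫ z, E.w z * ∑ j, ‖U j z‖ ^ 2 := by
  obtain ⟨K, hK, h⟩ := E.korn_real
  refine ⟨K, hK, fun F hF T hT hTZ U hU h0 ↦ ?_⟩
  have hre : ∀ j, ContDiffOn ℝ ∞ (fun y ↦ RCLike.re (U j y)) Z := fun j ↦
    (RCLike.reCLM (K := 𝕜)).contDiff.comp_contDiffOn (hU j)
  have him : ∀ j, ContDiffOn ℝ ∞ (fun y ↦ RCLike.im (U j y)) Z := fun j ↦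
    (RCLike.imCLM (K := 𝕜)).contDiff.comp_contDiffOn (hU j)
  have hre0 : ∀ j, ∀ z ∉ T, RCLike.re (U j z) = 0 := fun j z hz ↦ by simp [h0 j z hz]
  have him0 : ∀ j, ∀ z ∉ T, RCLike.im (U j z) = 0 := fun j z hz ↦ by simp [h0 j z hz]
  have k1 := h F hF T hT hTZ (fun j y ↦ RCLike.re (U j y)) hre hre0
  have k2 := h F hF T hT hTZ (fun j y ↦ RCLike.im (U j y)) him him0
  have i1 : ∀ V : Fin n → Eu n → ℝ, (∀ j, ContDiffOn ℝ ∞ (V j) Z) → (∀ j, ∀ z ∉ T, V j z = 0) →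
      Integrable fun z ↦ E.w z * ((∑ i, ∑ j, fd E.A i (V j) z ^ 2) +
      F ^ 2 * ((∑ i, E.α i z ^ 2) * ∑ j, V j z ^ 2)) := by
    intro V hV hV0
    refine E.integrable_mul hT hTZ ((continuousOn_finsetSum _ fun i _ ↦
      continuousOn_finsetSum _ fun j _ ↦
        (contDiffOn_fd E.isOpen E.A_smooth (hV j) i).continuousOn.pow 2).add
      (continuousOn_const.mul ((continuousOn_finsetSum _ fun i _ ↦
        (E.α_smooth i).continuousOn.pow 2).mul (continuousOn_finsetSum _ fun j _ ↦
        (hV j).continuousOn.pow 2)))) fun z hz ↦ ?_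
    simp [hV0 _ z hz, fd_eq_zero_of_off hT.isClosed (hV0 _) _ z hz]
  have i2 : ∀ V : Fin n → Eu n → ℝ, (∀ j, ContDiffOn ℝ ∞ (V j) Z) → (∀ j, ∀ z ∉ T, V j z = 0) →
      Integrable fun z ↦ E.w z * ∑ i, ∑ j, E.sym F V i j z ^ 2 := by
    intro V hV hV0
    refine E.integrable_mul hT hTZ (continuousOn_finsetSum _ fun i _ ↦
      continuousOn_finsetSum _ fun j _ ↦ (E.continuousOn_sym hV i j).pow 2) fun z hz ↦ ?_
    simp [E.sym_eq_zero hT hV0 _ _ hz]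
  have i3 : ∀ V : Fin n → Eu n → ℝ, (∀ j, ContDiffOn ℝ ∞ (V j) Z) → (∀ j, ∀ z ∉ T, V j z = 0) →
      Integrable fun z ↦ E.w z * ∑ j, V j z ^ 2 := by
    intro V hV hV0
    refine E.integrable_mul hT hTZ (continuousOn_finsetSum _ fun j _ ↦
      (hV j).continuousOn.pow 2) fun z hz ↦ ?_
    simp [hV0 _ z hz]
  have hoff : ∀ {z}, z ∉ T → (∀ i j, fd E.A i (U j) z = 0) ∧
      (∀ i j, fd E.A i (fun y ↦ RCLike.re (U j y)) z = 0) ∧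
      ∀ i j, fd E.A i (fun y ↦ RCLike.im (U j y)) z = 0 := fun {z} hz ↦
    ⟨fun i j ↦ fd_eq_zero_of_off hT.isClosed (h0 j) i z hz,
      fun i j ↦ fd_eq_zero_of_off hT.isClosed (hre0 j) i z hz,
      fun i j ↦ fd_eq_zero_of_off hT.isClosed (him0 j) i z hz⟩
  have s1 := integral_add (i1 _ hre hre0) (i1 _ him him0)
  have s2 := integral_add (i2 _ hre hre0) (i2 _ him him0)
  have s3 := integral_add (i3 _ hre hre0) (i3 _ him him0)
  have hd : ∀ {z}, z ∈ T → ∀ j, DifferentiableAt ℝ (U j) z := fun hz j ↦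
    differentiableAt_of_open E.isOpen (hU j) (hTZ hz)
  have e1 : ∀ z, E.w z * ((∑ i, ∑ j, ‖fd E.A i (U j) z‖ ^ 2) +
      F ^ 2 * ((∑ i, E.α i z ^ 2) * ∑ j, ‖U j z‖ ^ 2)) =
      E.w z * ((∑ i, ∑ j, fd E.A i (fun y ↦ RCLike.re (U j y)) z ^ 2) +
      F ^ 2 * ((∑ i, E.α i z ^ 2) * ∑ j, RCLike.re (U j z) ^ 2)) +
      E.w z * ((∑ i, ∑ j, fd E.A i (fun y ↦ RCLike.im (U j y)) z ^ 2) +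
      F ^ 2 * ((∑ i, E.α i z ^ 2) * ∑ j, RCLike.im (U j z) ^ 2)) := by
    intro z
    by_cases hz : z ∈ T
    · simp only [fd_re (hd hz _), fd_im (hd hz _), norm_sq_re_im, Finset.sum_add_distrib]
      ring
    · obtain ⟨a1, a2, a3⟩ := hoff hz
      simp [a1, a2, a3, h0 _ z hz]
  have e2 : ∀ z, E.w z * ∑ i, ∑ j, ‖E.sym F U i j z‖ ^ 2 =
      E.w z * (∑ i, ∑ j, E.sym F (fun j y ↦ RCLike.re (U j y)) i j z ^ 2) +
      E.w z * ∑ i, ∑ j, E.sym F (fun j y ↦ RCLike.im (U j y)) i j z ^ 2 := by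
    intro z
    by_cases hz : z ∈ T
    · simp only [E.sym_re (hd hz), E.sym_im (hd hz), norm_sq_re_im, Finset.sum_add_distrib]
      ring
    · simp [E.sym_eq_zero hT h0 _ _ hz, E.sym_eq_zero hT hre0 _ _ hz, E.sym_eq_zero hT him0 _ _ hz]
  have e3 : ∀ z, E.w z * ∑ j, ‖U j z‖ ^ 2 =
      E.w z * (∑ j, RCLike.re (U j z) ^ 2) + E.w z * ∑ j, RCLike.im (U j z) ^ 2 := by
    intro z
    simp only [norm_sq_re_im, Finset.sum_add_distrib]
    ring
  simp only [e1, e2, e3]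
  rw [s1, s2, s3]
  linarith

/-- The twisted derivative along one vector field of the frame controls the function. -/
theorem integral_twisted (i : Fin n) {F : ℝ} {T : Set (Eu n)} (hT : IsCompact T) (hTZ : T ⊆ Z)
    {u : Eu n → 𝕜} (hu : ContDiffOn ℝ ∞ u Z) (h0 : ∀ z ∉ T, u z = 0) :
    ∫ z, E.w z * (‖fd E.A i u z‖ ^ 2 + F ^ 2 * ‖u z‖ ^ 2) =
      (∫ z, E.w z * ‖fd E.A i u z - F • u z‖ ^ 2) -
        F * ∫ z, E.w z * (E.div i z * ‖u z‖ ^ 2) := by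
  have hre : ContDiffOn ℝ ∞ (fun y ↦ RCLike.re (u y)) Z :=
    (RCLike.reCLM (K := 𝕜)).contDiff.comp_contDiffOn hu
  have him : ContDiffOn ℝ ∞ (fun y ↦ RCLike.im (u y)) Z :=
    (RCLike.imCLM (K := 𝕜)).contDiff.comp_contDiffOn hu
  have hfd := (contDiffOn_fd E.isOpen E.A_smooth hu i).continuousOn
  have hfd0 := fd_eq_zero_of_off hT.isClosed h0 (A := E.A) i
  set N : Eu n → ℝ := fun y ↦ RCLike.re (u y) * RCLike.re (u y) + RCLike.im (u y) * RCLike.im (u y)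
    with hN
  have hNs : ContDiffOn ℝ ∞ N Z := (hre.mul hre).add (him.mul him)
  have hN0 : ∀ z ∉ T, N z = 0 := fun z hz ↦ by simp [hN, h0 z hz]
  have hNn : ∀ z, N z = ‖u z‖ ^ 2 := fun z ↦ by rw [norm_sq_re_im]; ring
  have hdiv := integral_divergence hT E.isOpen hTZ E.A_smooth E.w_smooth E.div_eq
    (Φ := fun j ↦ if j = i then N else fun _ ↦ 0)
    (fun j ↦ by
      by_cases hj : j = i
      · simpa [hj] using hNs
      · simpa [hj] using contDiffOn_const)
    (fun j z hz ↦ by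
      by_cases hj : j = i
      · simpa [hj] using hN0 z hz
      · simp [hj])
  have e0 : ∀ z, ∑ j, (fd E.A j (if j = i then N else fun _ ↦ 0) z +
      E.div j z * (if j = i then N else fun _ ↦ 0) z) = fd E.A i N z + E.div i z * N z := by
    intro z
    rw [Finset.sum_eq_single i]
    · simp
    · intro j _ hj
      simp [hj, fd, pderiv]
    · simp
  simp only [e0] at hdiv
  have hfdN0 := fd_eq_zero_of_off hT.isClosed hN0 (A := E.A) i
  have key : ∀ z, E.w z * (‖fd E.A i u z‖ ^ 2 + F ^ 2 * ‖u z‖ ^ 2) =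
      E.w z * ‖fd E.A i u z - F • u z‖ ^ 2 + F * (E.w z * fd E.A i N z) := by
    intro z
    by_cases hz : z ∈ T
    · have hdu := differentiableAt_of_open E.isOpen hu (hTZ hz)
      have hdr := differentiableAt_of_open E.isOpen hre (hTZ hz)
      have hdi := differentiableAt_of_open E.isOpen him (hTZ hz)
      have e1 : fd E.A i N z = 2 * (RCLike.re (u z) * RCLike.re (fd E.A i u z) +
          RCLike.im (u z) * RCLike.im (fd E.A i u z)) := by
        rw [hN, fd_add (hdr.fun_mul hdr) (hdi.fun_mul hdi), fd_mul hdr hdr, fd_mul hdi hdi,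
          fd_re hdu, fd_im hdu]
        ring
      rw [e1]
      simp only [norm_sq_re_im, map_sub, RCLike.smul_re, RCLike.smul_im]
      ring
    · simp [hfd0 z hz, h0 z hz, hfdN0 z hz]
  simp only [key]
  simp only [← hNn]
  have j1 : Integrable fun z ↦ E.w z * ‖fd E.A i u z - F • u z‖ ^ 2 :=
    E.integrable_mul hT hTZ ((hfd.sub (continuousOn_const.smul hu.continuousOn)).norm.pow 2)
      fun z hz ↦ by simp [hfd0 z hz, h0 z hz]
  have j2 : Integrable fun z ↦ E.w z * fd E.A i N z :=
    E.integrable_mul hT hTZ (contDiffOn_fd E.isOpen E.A_smooth hNs i).continuousOn hfdN0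
  have j3 : Integrable fun z ↦ E.w z * (E.div i z * N z) := by
    have e : ∀ z, E.w z * (E.div i z * N z) =
        (∑ a, pderiv a (fun y ↦ E.A y i a * E.w y) z) * N z := by
      intro z
      by_cases hz : z ∈ T
      · rw [E.div_eq i z (hTZ hz)]
        ring
      · simp [hN0 z hz]
    simp only [e]
    exact integrable_of_off hT hTZ ((continuousOn_finsetSum _ fun a _ ↦
      (Region.contDiffOn_pderiv E.isOpen ((E.A_smooth i a).mul E.w_smooth) a).continuousOn).mul
      hNs.continuousOn) fun z hz ↦ by simp [hN0 z hz]
  simp only [mul_add] at hdiv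
  rw [integral_add j2 j3] at hdiv
  rw [integral_add j1 (j2.const_mul F), integral_const_mul]
  linear_combination F * hdiv

end Frame


section Homothety

variable {n : ℕ}

open scoped ENNReal

theorem lintegral_comp_smul_add_le {B B' : Set (Eu n)} (hB : MeasurableSet B)
    (hB' : MeasurableSet B') {a : ℝ} (ha : 0 < a) (b : Eu n) (h : ∀ z ∈ B, a • z + b ∈ B')
    (F : Eu n → ℝ≥0∞) :
    ∫⁻ z in B, F (a • z + b) ≤ ENNReal.ofReal (a ^ n)⁻¹ * ∫⁻ z in B', F z := by
  let T : Eu n ≃ₜ Eu n := (Homeomorph.smulOfNeZero a ha.ne').trans (Homeomorph.addRight b)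
  have hT : ∀ z, T.toMeasurableEquiv z = a • z + b := fun z ↦ rfl
  have hmap : Measure.map T.toMeasurableEquiv (volume : Measure (Eu n)) =
      ENNReal.ofReal (a ^ n)⁻¹ • volume := by
    have e : (T.toMeasurableEquiv : Eu n → Eu n) = (fun z ↦ z + b) ∘ fun z ↦ a • z := by
      ext1 z
      exact hT z
    rw [e, ← Measure.map_map (measurable_add_const b) (measurable_const_smul a),
      Measure.map_addHaar_smul _ ha.ne', Measure.map_smul, map_add_right_eq_self]
    simp [abs_of_pos ha]
  rw [← lintegral_indicator hB, ← lintegral_indicator hB', ← smul_eq_mul,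
    ← lintegral_smul_measure, ← hmap, lintegral_map_equiv]
  refine lintegral_mono fun z ↦ ?_
  by_cases hz : z ∈ B
  · rw [indicator_of_mem hz, hT, indicator_of_mem (h z hz)]
  · rw [indicator_of_notMem hz]
    exact zero_le

theorem segment_mem_closedBall {q y z : Eu n} {R t : ℝ} (hz : z ∈ Metric.closedBall q R)
    (hy : dist y q ≤ R / 4) (ht : t ∈ Icc (0 : ℝ) (1 / 2)) :
    z + t • (y - z) ∈ Metric.closedBall q R ∧
      (t = 1 / 2 → z + t • (y - z) ∈ Metric.closedBall q (5 * R / 8)) := by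
  rw [Metric.mem_closedBall, dist_eq_norm] at *
  have hR : 0 ≤ R := (norm_nonneg _).trans hz
  have e : z + t • (y - z) - q = (1 - t) • (z - q) + t • (y - q) := by
    module
  have h1 : ‖z + t • (y - z) - q‖ ≤ (1 - t) * R + t * (R / 4) := by
    rw [e]
    refine (norm_add_le _ _).trans ?_
    rw [norm_smul, norm_smul, Real.norm_of_nonneg (by linarith [ht.2]), Real.norm_of_nonneg ht.1]
    exact add_le_add (mul_le_mul_of_nonneg_left hz (by linarith [ht.2]))
      (mul_le_mul_of_nonneg_left hy ht.1)
  refine ⟨h1.trans (by nlinarith [ht.1, ht.2]), fun h ↦ ?_⟩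
  rw [Metric.mem_closedBall, dist_eq_norm]
  refine h1.trans ?_
  rw [h]
  linarith

theorem lintegral_segment_le {q y : Eu n} {R : ℝ} (hy : dist y q ≤ R / 4) {F : Eu n → ℝ≥0∞}
    (hF : Measurable F) :
    ∫⁻ z in Metric.closedBall q R, ∫⁻ t in Icc (0 : ℝ) (1 / 2), F (z + t • (y - z)) ≤
      ENNReal.ofReal (2 ^ n) * ∫⁻ z in Metric.closedBall q R, F z := by
  rw [lintegral_lintegral_swap]
  · calc ∫⁻ t in Icc (0 : ℝ) (1 / 2), ∫⁻ z in Metric.closedBall q R, F (z + t • (y - z))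
        ≤ ∫⁻ _t in Icc (0 : ℝ) (1 / 2),
          ENNReal.ofReal (2 ^ n) * ∫⁻ z in Metric.closedBall q R, F z := by
          refine setLIntegral_mono measurable_const fun t ht ↦ ?_
          have h1 : ∀ z : Eu n, z + t • (y - z) = (1 - t) • z + t • y := fun z ↦ by module
          have h2 : 0 < 1 - t := by linarith [ht.2]
          simp only [h1]
          refine (lintegral_comp_smul_add_le measurableSet_closedBall measurableSet_closedBall
            h2 (t • y) (B' := Metric.closedBall q R) (fun z hz ↦ ?_) F).trans ?_
          · rw [← h1]
            exact (segment_mem_closedBall hz hy ht).1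
          · gcongr
            rw [← inv_pow]
            refine pow_le_pow_left₀ (by positivity) ?_ n
            rw [inv_le_comm₀ h2 (by norm_num)]
            linarith [ht.2]
      _ ≤ _ := by
          rw [setLIntegral_const]
          refine mul_le_of_le_one_right' ?_
          simp only [Real.volume_Icc, sub_zero]
          rw [← ENNReal.ofReal_one]
          exact ENNReal.ofReal_le_ofReal (by norm_num)
  · refine (hF.comp ?_).aemeasurable
    fun_prop

theorem sq_integral_le {P : ℝ → ℝ} (hP : ContinuousOn P (Icc 0 (1 / 2))) :
    (∫ t in (0 : ℝ)..1 / 2, P t) ^ 2 ≤ ∫ t in (0 : ℝ)..1 / 2, P t ^ 2 := by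
  have hu : uIcc (0 : ℝ) (1 / 2) = Icc 0 (1 / 2) := uIcc_of_le (by norm_num)
  have i1 : IntervalIntegrable P volume 0 (1 / 2) := ContinuousOn.intervalIntegrable (by rwa [hu])
  have i2 : IntervalIntegrable (fun t ↦ P t ^ 2) volume 0 (1 / 2) :=
    ContinuousOn.intervalIntegrable (by rw [hu]; exact hP.pow 2)
  set J := ∫ t in (0 : ℝ)..1 / 2, P t with hJ
  have h0 : 0 ≤ ∫ t in (0 : ℝ)..1 / 2, (P t - 2 * J) ^ 2 :=
    intervalIntegral.integral_nonneg (by norm_num) fun t _ ↦ sq_nonneg _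
  have e : ∀ t, (P t - 2 * J) ^ 2 = (P t ^ 2 - 4 * J * P t) + 4 * J ^ 2 := fun t ↦ by ring
  simp only [e] at h0
  rw [intervalIntegral.integral_add (i2.sub (i1.const_mul _)) intervalIntegrable_const,
    intervalIntegral.integral_sub i2 (i1.const_mul _), intervalIntegral.integral_const_mul,
    intervalIntegral.integral_const, ← hJ, smul_eq_mul] at h0
  nlinarith [sq_nonneg J]

theorem norm_le_add_integral {V : Type*} [NormedAddCommGroup V] [NormedSpace ℝ V]
    [CompleteSpace V] {g g' : ℝ → V} {b : ℝ → ℝ}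
    (hg : ∀ t ∈ Icc (0 : ℝ) (1 / 2), HasDerivAt g (g' t) t)
    (hg' : ContinuousOn g' (Icc 0 (1 / 2))) (hb : ContinuousOn b (Icc 0 (1 / 2)))
    (h : ∀ t ∈ Icc (0 : ℝ) (1 / 2), ‖g' t‖ ≤ b t) :
    ‖g 0‖ ≤ ‖g (1 / 2)‖ + ∫ t in (0 : ℝ)..1 / 2, b t := by
  have hu : uIcc (0 : ℝ) (1 / 2) = Icc 0 (1 / 2) := uIcc_of_le (by norm_num)
  have h1 : ∫ t in (0 : ℝ)..1 / 2, g' t = g (1 / 2) - g 0 :=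
    intervalIntegral.integral_eq_sub_of_hasDerivAt (by rwa [hu])
      (ContinuousOn.intervalIntegrable (by rwa [hu]))
  have h2 : ‖∫ t in (0 : ℝ)..1 / 2, g' t‖ ≤ ∫ t in (0 : ℝ)..1 / 2, b t :=
    intervalIntegral.norm_integral_le_of_norm_le (by norm_num)
      (Filter.Eventually.of_forall fun t ht ↦ h t (Ioc_subset_Icc_self ht))
      (ContinuousOn.intervalIntegrable (by rwa [hu]))
  have h3 : g 0 = g (1 / 2) - ∫ t in (0 : ℝ)..1 / 2, g' t := by
    rw [h1]
    abel
  rw [h3]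
  exact (norm_sub_le _ _).trans (by gcongr)

theorem measurable_indicator_ofReal {B : Set (Eu n)} (hB : IsClosed B) {f : Eu n → ℝ}
    (hf : ContinuousOn f B) : Measurable (B.indicator fun z ↦ ENNReal.ofReal (f z)) := by
  classical
  rw [← piecewise_eq_indicator]
  exact ContinuousOn.measurable_piecewise
    (ENNReal.continuous_ofReal.comp_continuousOn hf) continuousOn_const hB.measurableSet

/-- The integral over a ball of a function that is bounded pointwise by its values at the midpoints
of segments to points near the centre, and by integrals over these segments. -/
theorem integral_growth {ι : Type*} [Fintype ι] {q : Eu n} {R a b : ℝ}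
    (ha : 0 ≤ a) (hb : 0 ≤ b) {y : ι → Eu n} (hy : ∀ k, dist (y k) q ≤ R / 4) {N Q : Eu n → ℝ}
    (hN : ContinuousOn N (Metric.closedBall q R)) (hQ : ContinuousOn Q (Metric.closedBall q R))
    (hN0 : ∀ z, 0 ≤ N z) (hQ0 : ∀ z, 0 ≤ Q z)
    (h : ∀ z ∈ Metric.closedBall q R, N z ≤ ∑ k, (a * N (z + (1 / 2 : ℝ) • (y k - z)) +
      b * ∫ t in (0 : ℝ)..1 / 2, Q (z + t • (y k - z)))) :
    ∫ z in Metric.closedBall q R, N z ≤ Fintype.card ι * 2 ^ n *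
      (a * (∫ z in Metric.closedBall q (5 * R / 8), N z) +
        b * ∫ z in Metric.closedBall q R, Q z) := by
  rcases lt_or_ge R 0 with hR | hR
  · rw [Metric.closedBall_eq_empty.2 hR, Metric.closedBall_eq_empty.2 (by linarith)]
    simp
  set B := Metric.closedBall q R with hB
  set B' := Metric.closedBall q (5 * R / 8) with hB'
  have hBB : B' ⊆ B := Metric.closedBall_subset_closedBall (by linarith)
  have hcB : IsCompact B := isCompact_closedBall _ _
  have hcB' : IsCompact B' := isCompact_closedBall _ _
  have iN : IntegrableOn N B := hN.integrableOn_compact hcB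
  have iN' : IntegrableOn N B' := (hN.mono hBB).integrableOn_compact hcB'
  have iQ : IntegrableOn Q B := hQ.integrableOn_compact hcB
  have lN : ∫⁻ z in B, ENNReal.ofReal (N z) = ENNReal.ofReal (∫ z in B, N z) :=
    (ofReal_integral_eq_lintegral_ofReal iN (ae_of_all _ hN0)).symm
  have lN' : ∫⁻ z in B', ENNReal.ofReal (N z) = ENNReal.ofReal (∫ z in B', N z) :=
    (ofReal_integral_eq_lintegral_ofReal iN' (ae_of_all _ hN0)).symm
  have lQ : ∫⁻ z in B, ENNReal.ofReal (Q z) = ENNReal.ofReal (∫ z in B, Q z) :=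
    (ofReal_integral_eq_lintegral_ofReal iQ (ae_of_all _ hQ0)).symm
  set FN := B.indicator fun z ↦ ENNReal.ofReal (N z) with hFN
  set FQ := B.indicator fun z ↦ ENNReal.ofReal (Q z) with hFQ
  have mN : Measurable FN := measurable_indicator_ofReal hcB.isClosed hN
  have mQ : Measurable FQ := measurable_indicator_ofReal hcB.isClosed hQ
  have hmem : ∀ k, ∀ z ∈ B, ∀ t ∈ Icc (0 : ℝ) (1 / 2), z + t • (y k - z) ∈ B :=
    fun k z hz t ht ↦ (segment_mem_closedBall hz (hy k) ht).1
  have hint0 : ∀ k z, 0 ≤ ∫ t in (0 : ℝ)..1 / 2, Q (z + t • (y k - z)) := fun k z ↦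
    intervalIntegral.integral_nonneg (by norm_num) fun t _ ↦ hQ0 _
  have hpt : ∀ z ∈ B, ENNReal.ofReal (N z) ≤
      ∑ k, (ENNReal.ofReal a * FN ((1 / 2 : ℝ) • z + (1 / 2 : ℝ) • y k) +
        ENNReal.ofReal b * ∫⁻ t in Icc (0 : ℝ) (1 / 2), FQ (z + t • (y k - z))) := by
    intro z hz
    refine (ENNReal.ofReal_le_ofReal (h z hz)).trans ?_
    rw [ENNReal.ofReal_sum_of_nonneg fun k _ ↦
      add_nonneg (mul_nonneg ha (hN0 _)) (mul_nonneg hb (hint0 k z))]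
    refine Finset.sum_le_sum fun k _ ↦ ?_
    rw [ENNReal.ofReal_add (mul_nonneg ha (hN0 _)) (mul_nonneg hb (hint0 k z)),
      ENNReal.ofReal_mul ha, ENNReal.ofReal_mul hb]
    refine add_le_add (le_of_eq ?_) (le_of_eq ?_)
    · have e : (1 / 2 : ℝ) • z + (1 / 2 : ℝ) • y k = z + (1 / 2 : ℝ) • (y k - z) := by module
      rw [e, hFN, indicator_of_mem (hmem k z hz _ (by norm_num))]
    · congr 1
      have hc : ContinuousOn (fun t : ℝ ↦ Q (z + t • (y k - z))) (Icc 0 (1 / 2)) :=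
        hQ.comp (by fun_prop) fun t ht ↦ hmem k z hz t ht
      rw [intervalIntegral.integral_of_le (by norm_num), ← integral_Icc_eq_integral_Ioc,
        ofReal_integral_eq_lintegral_ofReal (hc.integrableOn_compact isCompact_Icc)
          (ae_of_all _ fun t ↦ hQ0 _)]
      refine setLIntegral_congr_fun measurableSet_Icc fun t ht ↦ ?_
      simp only [hFQ, indicator_of_mem (hmem k z hz _ ht)]
  have hX0 : 0 ≤ ∫ z in B', N z := integral_nonneg hN0
  have hY0 : 0 ≤ ∫ z in B, Q z := integral_nonneg hQ0
  have hmain : ENNReal.ofReal (∫ z in B, N z) ≤ ENNReal.ofReal (Fintype.card ι * 2 ^ n *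
      (a * (∫ z in B', N z) + b * ∫ z in B, Q z)) := by
    rw [← lN]
    refine (setLIntegral_mono' hcB.measurableSet hpt).trans ?_
    rw [lintegral_finsetSum']
    · calc _ ≤ ∑ _k : ι, (ENNReal.ofReal a * (ENNReal.ofReal (2 ^ n) *
              ENNReal.ofReal (∫ z in B', N z)) +
            ENNReal.ofReal b * (ENNReal.ofReal (2 ^ n) * ENNReal.ofReal (∫ z in B, Q z))) := by
            refine Finset.sum_le_sum fun k _ ↦ ?_
            rw [lintegral_add_left' ?_, lintegral_const_mul' _ _ ENNReal.ofReal_ne_top,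
              lintegral_const_mul' _ _ ENNReal.ofReal_ne_top]
            · gcongr
              · refine (lintegral_comp_smul_add_le hcB.measurableSet hcB'.measurableSet
                  (a := 1 / 2) (by norm_num) _ (fun z hz ↦ ?_) FN).trans ?_
                · have e : (1 / 2 : ℝ) • z + (1 / 2 : ℝ) • y k = z + (1 / 2 : ℝ) • (y k - z) := by
                    module
                  rw [e]
                  exact (segment_mem_closedBall hz (hy k) (by norm_num)).2 rfl
                · rw [← lN']
                  refine mul_le_mul' (le_of_eq ?_) ?_
                  · congr 1
                    simp
                  · exact setLIntegral_mono' hcB'.measurableSet fun z _ ↦ indicator_le_self _ _ z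
              · refine (lintegral_segment_le (hy k) mQ).trans ?_
                rw [← lQ]
                gcongr
                exact indicator_le_self _ _ _
            · refine ((mN.comp ?_).const_mul _).aemeasurable
              fun_prop
        _ = _ := by
            rw [Finset.sum_const, Finset.card_univ, nsmul_eq_mul,
              ENNReal.ofReal_mul (by positivity), ENNReal.ofReal_mul (by positivity),
              ENNReal.ofReal_add (by positivity) (by positivity), ENNReal.ofReal_mul ha,
              ENNReal.ofReal_mul hb, ENNReal.ofReal_natCast]
            ring
    · intro k _
      refine AEMeasurable.add ((mN.comp (by fun_prop)).const_mul _).aemeasurable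
        (Measurable.const_mul ?_ _).aemeasurable
      exact Measurable.lintegral_prod_right' (f := fun p : Eu n × ℝ ↦ FQ (p.1 + p.2 • (y k - p.1)))
        (mQ.comp (by fun_prop))
  exact (ENNReal.ofReal_le_ofReal_iff (by positivity)).1 hmain

/-- A bound for the square integral over a ball, under a pointwise bound as in
`integral_growth`. -/
theorem exists_sq_growth (n : ℕ) (ι : Type*) [Fintype ι] (c C : ℝ) :
    ∃ R₀ K : ℝ, 0 < R₀ ∧ 0 ≤ K ∧ ∀ (q : Eu n) (R : ℝ), 0 < R → R ≤ R₀ → ∀ (y : ι → Eu n),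
      (∀ k, dist (y k) q ≤ R / 4) → ∀ f s : Eu n → ℝ,
      ContinuousOn f (Metric.closedBall q R) → ContinuousOn s (Metric.closedBall q R) →
      (∀ z, 0 ≤ f z) →
      (∀ z ∈ Metric.closedBall q R, f z ≤ c * ∑ k, (f (z + (1 / 2 : ℝ) • (y k - z)) +
        R * ∫ t in (0 : ℝ)..1 / 2,
          (s (z + t • (y k - z)) + C * f (z + t • (y k - z))))) →
      ∫ z in Metric.closedBall q R, f z ^ 2 ≤ K * ((∫ z in Metric.closedBall q (5 * R / 8), f z ^ 2) +
        ∫ z in Metric.closedBall q R, s z ^ 2) := by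
  set m : ℝ := (Fintype.card ι : ℝ) with hm
  set K₁ : ℝ := m * 2 ^ n * (2 * c ^ 2 * m) with hK₁
  have hm0 : 0 ≤ m := Nat.cast_nonneg _
  have hK₁0 : 0 ≤ K₁ := by positivity
  set R₀ : ℝ := min 1 (1 / (4 * (K₁ * C ^ 2 + 1))) with hR₀
  have hR₀0 : 0 < R₀ := lt_min one_pos (by positivity)
  refine ⟨R₀, 4 * K₁, hR₀0, by positivity, fun q R hR hRR y hy f s hf hs hf0 h ↦ ?_⟩
  have hR1 : R ≤ 1 := hRR.trans (min_le_left _ _)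
  have hR2 : K₁ * R ^ 2 * C ^ 2 ≤ 1 / 4 := by
    have h1 : R ^ 2 ≤ R := by nlinarith
    have h2 : R ≤ 1 / (4 * (K₁ * C ^ 2 + 1)) := hRR.trans (min_le_right _ _)
    rw [le_div_iff₀ (by positivity)] at h2
    nlinarith [mul_le_mul_of_nonneg_left h1 (by positivity : 0 ≤ K₁ * C ^ 2)]
  set P : Eu n → ℝ := fun z ↦ s z + C * f z with hP
  have hPc : ContinuousOn P (Metric.closedBall q R) := hs.add (continuousOn_const.mul hf)
  have h1 := integral_growth (n := n) (q := q) (R := R) (a := 2 * c ^ 2 * m)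
    (b := 2 * c ^ 2 * m * R ^ 2) (by positivity) (by positivity) hy (N := fun z ↦ f z ^ 2)
    (Q := fun z ↦ P z ^ 2) (hf.pow 2) (hPc.pow 2) (fun z ↦ sq_nonneg _) (fun z ↦ sq_nonneg _) ?_
  · have hcB : IsCompact (Metric.closedBall q R) := isCompact_closedBall _ _
    have if2 : IntegrableOn (fun z ↦ f z ^ 2) (Metric.closedBall q R) :=
      (hf.pow 2).integrableOn_compact hcB
    have is2 : IntegrableOn (fun z ↦ s z ^ 2) (Metric.closedBall q R) :=
      (hs.pow 2).integrableOn_compact hcB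
    have h2 : ∫ z in Metric.closedBall q R, P z ^ 2 ≤
        2 * (∫ z in Metric.closedBall q R, s z ^ 2) +
          2 * C ^ 2 * ∫ z in Metric.closedBall q R, f z ^ 2 := by
      rw [← integral_const_mul, ← integral_const_mul,
        ← integral_add (is2.const_mul _) (if2.const_mul _)]
      refine integral_mono ((hPc.pow 2).integrableOn_compact hcB)
        ((is2.const_mul _).add (if2.const_mul _)) fun z ↦ ?_
      simp only [hP]
      nlinarith [sq_nonneg (s z - C * f z)]
    set X := ∫ z in Metric.closedBall q R, f z ^ 2 with hX
    set Y := ∫ z in Metric.closedBall q (5 * R / 8), f z ^ 2 with hY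
    set W := ∫ z in Metric.closedBall q R, s z ^ 2 with hW
    set V := ∫ z in Metric.closedBall q R, P z ^ 2 with hV
    have hX0 : 0 ≤ X := integral_nonneg fun z ↦ sq_nonneg _
    have hW0 : 0 ≤ W := integral_nonneg fun z ↦ sq_nonneg _
    have hY0 : 0 ≤ K₁ * Y := mul_nonneg hK₁0 (integral_nonneg fun z ↦ sq_nonneg _)
    have e1 : X ≤ K₁ * Y + K₁ * R ^ 2 * V := by
      refine h1.trans (le_of_eq ?_)
      rw [hK₁, hm]
      ring
    have e2 : K₁ * R ^ 2 * V ≤ K₁ * R ^ 2 * (2 * W + 2 * C ^ 2 * X) :=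
      mul_le_mul_of_nonneg_left h2 (by positivity)
    have e3 : K₁ * R ^ 2 * C ^ 2 * X ≤ 1 / 4 * X := mul_le_mul_of_nonneg_right hR2 hX0
    have e4 : K₁ * R ^ 2 * W ≤ K₁ * W := by
      refine mul_le_mul_of_nonneg_right ?_ hW0
      exact mul_le_of_le_one_right hK₁0 (by nlinarith)
    nlinarith
  · intro z hz
    have hmem : ∀ k, ∀ t ∈ Icc (0 : ℝ) (1 / 2), z + t • (y k - z) ∈ Metric.closedBall q R :=
      fun k t ht ↦ (segment_mem_closedBall hz (hy k) ht).1
    have hcs : ∀ g : ι → ℝ, (∑ k, g k) ^ 2 ≤ m * ∑ k, g k ^ 2 := fun g ↦ sq_sum_le_card_mul_sum_sq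
    refine (pow_le_pow_left₀ (hf0 z) (h z hz) 2).trans ?_
    rw [mul_pow]
    refine (mul_le_mul_of_nonneg_left (hcs _) (sq_nonneg c)).trans ?_
    rw [← mul_assoc, Finset.mul_sum]
    refine Finset.sum_le_sum fun k _ ↦ ?_
    have hc : ContinuousOn (fun t : ℝ ↦ P (z + t • (y k - z))) (Icc 0 (1 / 2)) :=
      hPc.comp (by fun_prop) fun t ht ↦ hmem k t ht
    have hJ := sq_integral_le hc
    set J := ∫ t in (0 : ℝ)..1 / 2, P (z + t • (y k - z)) with hJ_def
    set A := f (z + (1 / 2 : ℝ) • (y k - z)) with hA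
    set J2 := ∫ t in (0 : ℝ)..1 / 2, P (z + t • (y k - z)) ^ 2 with hJ2
    have e1 : (A + R * J) ^ 2 ≤ 2 * (A ^ 2 + R ^ 2 * J2) := by
      nlinarith [sq_nonneg (A - R * J), mul_le_mul_of_nonneg_left hJ (sq_nonneg R)]
    calc c ^ 2 * m * (A + R * J) ^ 2 ≤ c ^ 2 * m * (2 * (A ^ 2 + R ^ 2 * J2)) :=
          mul_le_mul_of_nonneg_left e1 (by positivity)
      _ = _ := by ring

/-- The square integral over a ball is controlled by the one over a smaller ball, if the growth
from the ball with `5 / 8` of the radius is controlled. -/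
theorem exists_growth_of_step (n : ℕ) {K : ℝ} (hK : 0 ≤ K) {R r : ℝ} (hr : 0 < r) (hrR : r ≤ R) :
    ∃ K', 0 ≤ K' ∧ ∀ (q : Eu n) (f s : Eu n → ℝ), ContinuousOn f (Metric.closedBall q R) →
      ContinuousOn s (Metric.closedBall q R) → (∀ R', 0 < R' → R' ≤ R →
        ∫ z in Metric.closedBall q R', f z ^ 2 ≤ K * ((∫ z in Metric.closedBall q (5 * R' / 8), f z ^ 2) +
        ∫ z in Metric.closedBall q R', s z ^ 2)) →
      ∫ z in Metric.closedBall q R, f z ^ 2 ≤ K' * ((∫ z in Metric.closedBall q r, f z ^ 2) +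
        ∫ z in Metric.closedBall q R, s z ^ 2) := by
  have hR : 0 < R := hr.trans_le hrR
  obtain ⟨j, hj⟩ := exists_pow_lt_of_lt_one (y := (5 / 8 : ℝ)) (x := r / R) (by positivity)
    (by norm_num)
  have hjr : (5 / 8 : ℝ) ^ j * R ≤ r := ((lt_div_iff₀ hR).1 hj).le
  have hpos : ∀ i : ℕ, 0 < (5 / 8 : ℝ) ^ i * R := fun i ↦ by positivity
  have hle : ∀ i : ℕ, (5 / 8 : ℝ) ^ i * R ≤ R := fun i ↦
    mul_le_of_le_one_left hR.le (pow_le_one₀ (by norm_num) (by norm_num))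
  have key : ∀ i : ℕ, ∃ K', 0 ≤ K' ∧ ∀ (q : Eu n) (f s : Eu n → ℝ),
      ContinuousOn f (Metric.closedBall q R) →
      ContinuousOn s (Metric.closedBall q R) → (∀ R', 0 < R' → R' ≤ R →
        ∫ z in Metric.closedBall q R', f z ^ 2 ≤ K * ((∫ z in Metric.closedBall q (5 * R' / 8), f z ^ 2) +
        ∫ z in Metric.closedBall q R', s z ^ 2)) →
      ∫ z in Metric.closedBall q R, f z ^ 2 ≤
        K' * ((∫ z in Metric.closedBall q ((5 / 8) ^ i * R), f z ^ 2) +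
          ∫ z in Metric.closedBall q R, s z ^ 2) := by
    intro i
    induction i with
    | zero =>
      refine ⟨1, zero_le_one, fun q f s hf hs h ↦ ?_⟩
      have : 0 ≤ ∫ z in Metric.closedBall q R, s z ^ 2 := integral_nonneg fun z ↦ sq_nonneg _
      simp only [pow_zero, one_mul]
      linarith
    | succ i ih =>
      obtain ⟨K', hK', ih⟩ := ih
      refine ⟨K' * (K + 1), by positivity, fun q f s hf hs h ↦ (ih q f s hf hs h).trans ?_⟩
      have h1 := h _ (hpos i) (hle i)
      have h2 : ∫ z in Metric.closedBall q ((5 / 8) ^ i * R), s z ^ 2 ≤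
          ∫ z in Metric.closedBall q R, s z ^ 2 :=
        setIntegral_mono_set ((hs.pow 2).integrableOn_compact (isCompact_closedBall _ _))
          (ae_of_all _ fun z ↦ sq_nonneg _)
          (Filter.Eventually.of_forall (Metric.closedBall_subset_closedBall (hle i)))
      have e : 5 * ((5 / 8) ^ i * R) / 8 = (5 / 8) ^ (i + 1) * R := by ring
      rw [e] at h1
      have h3 : 0 ≤ ∫ z in Metric.closedBall q ((5 / 8) ^ (i + 1) * R), f z ^ 2 :=
        integral_nonneg fun z ↦ sq_nonneg _
      have h4 : 0 ≤ ∫ z in Metric.closedBall q R, s z ^ 2 := integral_nonneg fun z ↦ sq_nonneg _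
      rw [mul_assoc]
      refine mul_le_mul_of_nonneg_left ?_ hK'
      have h5 := mul_le_mul_of_nonneg_left h2 hK
      nlinarith
  obtain ⟨K', hK', h⟩ := key j
  refine ⟨K', hK', fun q f s hf hs hs' ↦ (h q f s hf hs hs').trans ?_⟩
  refine mul_le_mul_of_nonneg_left (add_le_add_left ?_ _) hK'
  exact setIntegral_mono_set (((hf.mono (Metric.closedBall_subset_closedBall hrR)).pow
    2).integrableOn_compact (isCompact_closedBall _ _)) (ae_of_all _ fun z ↦ sq_nonneg _)
    (Filter.Eventually.of_forall (Metric.closedBall_subset_closedBall hjr))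

variable {𝕜 : Type*} [RCLike 𝕜]

theorem fderiv_eq_sum_pderiv (u : Eu n → 𝕜) (z v : Eu n) :
    fderiv ℝ u z v = ∑ i, v i • pderiv i u z := by
  conv_lhs => rw [eu_eq_sum v]
  rw [map_sum]
  exact Finset.sum_congr rfl fun i _ ↦ map_smul _ _ _

theorem hasDerivAt_line {u : Eu n → 𝕜} {z v : Eu n} {t : ℝ}
    (hu : DifferentiableAt ℝ u (z + t • v)) :
    HasDerivAt (fun t : ℝ ↦ u (z + t • v)) (∑ i, v i • pderiv i u (z + t • v)) t := by
  rw [← fderiv_eq_sum_pderiv]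
  have h : HasDerivAt (fun t : ℝ ↦ z + t • v) v t := by
    simpa using ((hasDerivAt_id t).smul_const v).const_add z
  exact hu.hasFDerivAt.comp_hasDerivAt t h

theorem abs_coord_sub_le {q y z : Eu n} {R : ℝ} (hz : z ∈ Metric.closedBall q R)
    (hy : dist y q ≤ R / 4) (i : Fin n) : |(y - z) i| ≤ 2 * R := by
  have hz' : dist z q ≤ R := hz
  have hR : 0 ≤ R := dist_nonneg.trans hz'
  refine (PiLp.norm_apply_le (y - z) i).trans ?_
  rw [← dist_eq_norm]
  have := dist_triangle_right y z q
  linarith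

/-- Growth of a function whose differential is controlled. -/
theorem exists_growth_fun (n : ℕ) (𝕜 : Type*) [RCLike 𝕜] (C : ℝ) :
    ∃ R₀ : ℝ, 0 < R₀ ∧ ∀ R r : ℝ, 0 < r → r ≤ R → R ≤ R₀ → ∃ K, 0 ≤ K ∧
      ∀ (Z : Set (Eu n)) (q : Eu n), IsOpen Z → Metric.closedBall q R ⊆ Z →
      ∀ (u : Eu n → 𝕜) (s : Fin n → Eu n → 𝕜), ContDiffOn ℝ ∞ u Z → (∀ i, ContinuousOn (s i) Z) →
      (∀ z ∈ Z, ∀ i, ‖pderiv i u z‖ ≤ ‖s i z‖ + C * ‖u z‖) →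
      ∫ z in Metric.closedBall q R, ‖u z‖ ^ 2 ≤ K * ((∫ z in Metric.closedBall q r, ‖u z‖ ^ 2) +
        ∫ z in Metric.closedBall q R, (∑ i, ‖s i z‖) ^ 2) := by
  obtain ⟨R₀, K, hR₀, hK, h⟩ := exists_sq_growth n Unit 2 (n * C)
  refine ⟨R₀, hR₀, fun R r hr hrR hRR ↦ ?_⟩
  obtain ⟨K', hK', h'⟩ := exists_growth_of_step n hK hr hrR
  refine ⟨K', hK', fun Z q hZ hqZ u s hu hs hus ↦ ?_⟩
  have hf : ContinuousOn (fun z ↦ ‖u z‖) Z := hu.continuousOn.norm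
  have hs' : ContinuousOn (fun z ↦ ∑ i, ‖s i z‖) Z := continuousOn_finsetSum _ fun i _ ↦ (hs i).norm
  refine h' q (fun z ↦ ‖u z‖) (fun z ↦ ∑ i, ‖s i z‖) (hf.mono hqZ) (hs'.mono hqZ)
    fun R' hR' hRR' ↦ ?_
  have hsub : Metric.closedBall q R' ⊆ Z := (Metric.closedBall_subset_closedBall hRR').trans hqZ
  refine h q R' hR' (hRR'.trans hRR) (fun _ ↦ q) (fun _ ↦ by simp; positivity) _ _ (hf.mono hsub)
    (hs'.mono hsub) (fun z ↦ norm_nonneg _) fun z hz ↦ ?_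
  have hy : dist q q ≤ R' / 4 := by simp; positivity
  have hmem : ∀ t ∈ Icc (0 : ℝ) (1 / 2), z + t • (q - z) ∈ Z := fun t ht ↦
    hsub (segment_mem_closedBall hz hy ht).1
  have hline : ContinuousOn (fun t : ℝ ↦ z + t • (q - z)) (Icc 0 (1 / 2)) := by fun_prop
  have h1 := norm_le_add_integral (g := fun t : ℝ ↦ u (z + t • (q - z)))
    (g' := fun t ↦ ∑ i, (q - z) i • pderiv i u (z + t • (q - z)))
    (b := fun t ↦ 2 * R' * ((∑ i, ‖s i (z + t • (q - z))‖) + n * C * ‖u (z + t • (q - z))‖))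
    (fun t ht ↦ hasDerivAt_line (differentiableAt_of_open hZ hu (hmem t ht)))
    (continuousOn_finsetSum _ fun i _ ↦ continuousOn_const.smul
      (((Region.contDiffOn_pderiv hZ hu i).continuousOn).comp hline hmem))
    (continuousOn_const.mul ((hs'.comp hline hmem).add
      (continuousOn_const.mul (hf.comp hline hmem)))) fun t ht ↦ ?_
  · simp only [zero_smul, add_zero, intervalIntegral.integral_const_mul] at h1
    simp only [Finset.univ_unique, Finset.sum_const, Finset.card_singleton, one_smul]
    refine h1.trans ?_
    rw [mul_add]
    refine add_le_add (le_mul_of_one_le_left (norm_nonneg _) (by norm_num)) (le_of_eq (by ring))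
  · calc ‖∑ i, (q - z) i • pderiv i u (z + t • (q - z))‖
        ≤ ∑ i, 2 * R' * (‖s i (z + t • (q - z))‖ + C * ‖u (z + t • (q - z))‖) := by
          refine norm_sum_le_of_le _ fun i _ ↦ ?_
          rw [norm_smul]
          exact mul_le_mul (abs_coord_sub_le hz hy i) (hus _ (hmem t ht) i) (norm_nonneg _)
            (by positivity)
      _ = _ := by
          rw [← Finset.mul_sum, Finset.sum_add_distrib]
          simp only [Finset.sum_const, Finset.card_univ, Fintype.card_fin, nsmul_eq_mul]
          ring

/-- Growth of a one-form whose symmetric differential is controlled. -/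
theorem exists_growth_form (n : ℕ) (𝕜 : Type*) [RCLike 𝕜] {C : ℝ} (hC : 0 ≤ C) :
    ∃ R₀ : ℝ, 0 < R₀ ∧ ∀ R r : ℝ, 0 < r → r ≤ R → R ≤ R₀ → ∃ K, 0 ≤ K ∧
      ∀ (Z : Set (Eu n)) (q : Eu n), IsOpen Z → Metric.closedBall q R ⊆ Z →
      ∀ (u : Fin n → Eu n → 𝕜) (s : Fin n → Fin n → Eu n → 𝕜), (∀ i, ContDiffOn ℝ ∞ (u i) Z) →
      (∀ i j, ContinuousOn (s i j) Z) →
      (∀ z ∈ Z, ∀ i j, ‖pderiv i (u j) z + pderiv j (u i) z‖ ≤ ‖s i j z‖ + C * ∑ k, ‖u k z‖) →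
      ∫ z in Metric.closedBall q R, (∑ k, ‖u k z‖) ^ 2 ≤
        K * ((∫ z in Metric.closedBall q r, (∑ k, ‖u k z‖) ^ 2) +
        ∫ z in Metric.closedBall q R, (∑ i, ∑ j, ‖s i j z‖) ^ 2) := by
  obtain ⟨R₀, K, hR₀, hK, h⟩ := exists_sq_growth n (Option (Fin n)) (n * 8) ((n : ℝ) ^ 2 * C)
  refine ⟨R₀, hR₀, fun R r hr hrR hRR ↦ ?_⟩
  obtain ⟨K', hK', h'⟩ := exists_growth_of_step n hK hr hrR
  refine ⟨K', hK', fun Z q hZ hqZ u s hu hs hus ↦ ?_⟩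
  set f : Eu n → ℝ := fun z ↦ ∑ k, ‖u k z‖ with hf_def
  set S : Eu n → ℝ := fun z ↦ ∑ i, ∑ j, ‖s i j z‖ with hS_def
  have hf : ContinuousOn f Z := continuousOn_finsetSum _ fun k _ ↦ (hu k).continuousOn.norm
  have hs' : ContinuousOn S Z := continuousOn_finsetSum _ fun i _ ↦
    continuousOn_finsetSum _ fun j _ ↦ (hs i j).norm
  have hf0 : ∀ z, 0 ≤ f z := fun z ↦ Finset.sum_nonneg fun k _ ↦ norm_nonneg _
  have hS0 : ∀ z, 0 ≤ S z := fun z ↦ Finset.sum_nonneg fun i _ ↦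
    Finset.sum_nonneg fun k _ ↦ norm_nonneg _
  refine h' q f S (hf.mono hqZ) (hs'.mono hqZ) fun R' hR' hRR' ↦ ?_
  have hsub : Metric.closedBall q R' ⊆ Z := (Metric.closedBall_subset_closedBall hRR').trans hqZ
  set y : Option (Fin n) → Eu n := fun k ↦
    k.elim q fun k ↦ q + (R' / 4) • EuclideanSpace.single k (1 : ℝ)
    with hy_def
  have hy : ∀ k, dist (y k) q ≤ R' / 4 := by
    rintro (_ | k)
    · simp [hy_def]
      positivity
    · simp [hy_def, dist_eq_norm, norm_smul, abs_of_pos hR']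
  refine h q R' hR' (hRR'.trans hRR) y hy _ _ (hf.mono hsub) (hs'.mono hsub) hf0 fun z hz ↦ ?_
  have hmem : ∀ k, ∀ t ∈ Icc (0 : ℝ) (1 / 2), z + t • (y k - z) ∈ Z := fun k t ht ↦
    hsub (segment_mem_closedBall hz (hy k) ht).1
  have hline : ∀ k, ContinuousOn (fun t : ℝ ↦ z + t • (y k - z)) (Icc 0 (1 / 2)) := fun k ↦ by
    fun_prop
  have hv := fun k ↦ abs_coord_sub_le hz (hy k)
  set T : Option (Fin n) → ℝ := fun k ↦ f (z + (1 / 2 : ℝ) • (y k - z)) +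
        R' * ∫ t in (0 : ℝ)..1 / 2,
          (S (z + t • (y k - z)) + n ^ 2 * C * f (z + t • (y k - z))) with hT
  have hline_le : ∀ k, ‖∑ j, (y k - z) j • u j z‖ ≤ 2 * R' * T k := by
    intro k
    have h1 := norm_le_add_integral
      (g := fun t : ℝ ↦ ∑ j, (y k - z) j • u j (z + t • (y k - z)))
      (g' := fun t ↦ ∑ j, (y k - z) j • ∑ i, (y k - z) i • pderiv i (u j) (z + t • (y k - z)))
      (b := fun t ↦ 2 * R' ^ 2 * (S (z + t • (y k - z)) + n ^ 2 * C * f (z + t • (y k - z))))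
      (fun t ht ↦ HasDerivAt.fun_sum fun j _ ↦ (hasDerivAt_line
        (differentiableAt_of_open hZ (hu j) (hmem k t ht))).const_smul ((y k - z) j))
      (continuousOn_finsetSum _ fun j _ ↦ continuousOn_const.smul <|
        continuousOn_finsetSum _ fun i _ ↦ continuousOn_const.smul
        (((Region.contDiffOn_pderiv hZ (hu j) i).continuousOn).comp (hline k) (hmem k)))
      (continuousOn_const.mul ((hs'.comp (hline k) (hmem k)).add
        (continuousOn_const.mul (hf.comp (hline k) (hmem k))))) fun t ht ↦ ?_
    · simp only [zero_smul, add_zero, intervalIntegral.integral_const_mul] at h1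
      refine h1.trans ?_
      have h2 : ‖∑ j, (y k - z) j • u j (z + (1 / 2 : ℝ) • (y k - z))‖ ≤
          2 * R' * f (z + (1 / 2 : ℝ) • (y k - z)) := by
        rw [hf_def, Finset.mul_sum]
        refine norm_sum_le_of_le _ fun j _ ↦ ?_
        rw [norm_smul]
        exact mul_le_mul_of_nonneg_right (hv k j) (norm_nonneg _)
      rw [hT, mul_add]
      refine add_le_add h2 (le_of_eq (by ring))
    · set p := z + t • (y k - z) with hp
      set v := y k - z with hv_def
      have e1 : ∑ j, v j • ∑ i, v i • pderiv i (u j) p =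
          (1 / 2 : ℝ) • ∑ i, ∑ j, (v i * v j) • (pderiv i (u j) p + pderiv j (u i) p) := by
        have e2 : ∑ i, ∑ j, (v i * v j) • pderiv j (u i) p =
            ∑ i, ∑ j, (v i * v j) • pderiv i (u j) p := by
          rw [Finset.sum_comm]
          refine Finset.sum_congr rfl fun i _ ↦ Finset.sum_congr rfl fun j _ ↦ ?_
          rw [mul_comm]
        simp only [smul_add, Finset.sum_add_distrib]
        rw [e2, ← smul_add, ← two_smul ℝ, smul_smul]
        norm_num
        simp only [Finset.smul_sum, smul_smul]
        rw [Finset.sum_comm]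
        refine Finset.sum_congr rfl fun i _ ↦ Finset.sum_congr rfl fun j _ ↦ ?_
        rw [mul_comm]
      rw [e1, norm_smul, Real.norm_of_nonneg (by norm_num)]
      have h3 : ‖∑ i, ∑ j, (v i * v j) • (pderiv i (u j) p + pderiv j (u i) p)‖ ≤
          ∑ i, ∑ j, 4 * R' ^ 2 * (‖s i j p‖ + C * f p) := by
        refine norm_sum_le_of_le _ fun i _ ↦ norm_sum_le_of_le _ fun j _ ↦ ?_
        rw [norm_smul, norm_mul]
        refine mul_le_mul ?_ (hus p (hmem k t ht) i j) (norm_nonneg _) (by positivity)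
        calc ‖v i‖ * ‖v j‖ ≤ (2 * R') * (2 * R') :=
              mul_le_mul (hv k i) (hv k j) (norm_nonneg _) (by positivity)
          _ = _ := by ring
      calc (1 / 2 : ℝ) * ‖∑ i, ∑ j, (v i * v j) • (pderiv i (u j) p + pderiv j (u i) p)‖
          ≤ 1 / 2 * ∑ i, ∑ j, 4 * R' ^ 2 * (‖s i j p‖ + C * f p) := by gcongr
        _ = _ := by
          simp only [← Finset.mul_sum, Finset.sum_add_distrib]
          simp [hS_def]
          ring
  have hT0 : ∀ k, 0 ≤ T k := by
    intro k
    refine add_nonneg (hf0 _) (mul_nonneg hR'.le ?_)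
    refine intervalIntegral.integral_nonneg (by norm_num) fun t _ ↦ ?_
    exact add_nonneg (hS0 _) (mul_nonneg (by positivity) (hf0 _))
  have hu_le : ∀ k, ‖u k z‖ ≤ 8 * ∑ l, T l := by
    intro k
    have e1 : (R' / 4) • u k z = ∑ j, (y (some k) - z) j • u j z - ∑ j, (y none - z) j • u j z := by
      rw [← Finset.sum_sub_distrib]
      simp only [← sub_smul]
      have e2 : ∀ j, (y (some k) - z) j - (y none - z) j = if j = k then R' / 4 else 0 := by
        intro j
        simp [hy_def, Pi.single_apply]
      simp only [e2, ite_smul, zero_smul, Finset.sum_ite_eq', Finset.mem_univ, if_true]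
    have h1 : R' / 4 * ‖u k z‖ ≤ 2 * R' * T (some k) + 2 * R' * T none := by
      have := norm_sub_le (∑ j, (y (some k) - z) j • u j z) (∑ j, (y none - z) j • u j z)
      rw [← e1, norm_smul, Real.norm_of_nonneg (by positivity)] at this
      exact this.trans (add_le_add (hline_le _) (hline_le _))
    have h2 : T (some k) + T none ≤ ∑ l, T l := by
      rw [Fintype.sum_option, add_comm]
      exact add_le_add_right (Finset.single_le_sum (f := fun k ↦ T (some k)) (fun _ _ ↦ hT0 _)
        (Finset.mem_univ k)) _
    have h3 : ‖u k z‖ ≤ 8 * (T (some k) + T none) := by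
      by_contra! h
      nlinarith
    linarith
  calc f z ≤ ∑ _k : Fin n, 8 * ∑ l, T l := Finset.sum_le_sum fun k _ ↦ hu_le k
    _ = n * 8 * ∑ l, T l := by
      simp
      ring

end Homothety


section FrameGradient

variable {n : ℕ} {𝕜 : Type*} [RCLike 𝕜]

/-- The components of a one-form in a frame. -/
def frameComp (A : Eu n → Matrix (Fin n) (Fin n) ℝ) (s : Eu n → (Fin 1 → Fin n) → 𝕜) (j : Fin n)
    (z : Eu n) : 𝕜 := ∑ b, A z j b • s z ![b]

theorem tmap_eq_frameComp (A : Eu n → Matrix (Fin n) (Fin n) ℝ) (s : Eu n → (Fin 1 → Fin n) → 𝕜)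
    (z : Eu n) (I : Fin 1 → Fin n) : tmap (A z) (s z) I = frameComp A s (I 0) z :=
  tmap_one_rank _ _ _

/-- The connection coefficients in a frame `A` with inverse matrix `B`. -/
def frameChr (A B : Eu n → Matrix (Fin n) (Fin n) ℝ) (G : Eu n → Matrix (Fin n) (Fin n) ℝ)
    (i j k : Fin n) (z : Eu n) : ℝ :=
  ∑ c, (fd A i (fun y ↦ A y j c) z + ∑ a, ∑ b, A z i a * A z j b * christoffel G c a b z) * B z c k

theorem fd_frameComp {A : Eu n → Matrix (Fin n) (Fin n) ℝ} {s : Eu n → (Fin 1 → Fin n) → 𝕜}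
    {z : Eu n} (hA : ∀ i a, DifferentiableAt ℝ (fun y ↦ A y i a) z)
    (hs : ∀ b, DifferentiableAt ℝ (fun y ↦ s y ![b]) z) (i j : Fin n) :
    fd A i (frameComp A s j) z =
      ∑ a, ∑ b, (A z i a * A z j b) • pderiv a (fun y ↦ s y ![b]) z +
        ∑ b, fd A i (fun y ↦ A y j b) z • s z ![b] := by
  have h1 : ∀ a, pderiv a (frameComp A s j) z = ∑ b, (A z j b • pderiv a (fun y ↦ s y ![b]) z +
      pderiv a (fun y ↦ A y j b) z • s z ![b]) := by
    intro a
    have e : frameComp A s j = fun y ↦ ∑ b, A y j b • s y ![b] := rfl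
    rw [e, pderiv_sum (f := fun b y ↦ A y j b • s y ![b]) fun b _ ↦ (hA j b).fun_smul (hs b)]
    exact Finset.sum_congr rfl fun b _ ↦ pderiv_fun_smul (hA j b) (hs b) a
  simp only [fd, h1, Finset.sum_add_distrib, smul_add, Finset.smul_sum, smul_smul, smul_eq_mul,
    Finset.sum_smul]
  congr 1
  exact Finset.sum_comm

/-- The covariant derivative of a one-form in a frame. -/
theorem tmap_gradForm {M : Type*} (G : M → Eu n → Matrix (Fin n) (Fin n) ℝ) (s : Comps n M 𝕜 1)
    {A B : Eu n → Matrix (Fin n) (Fin n) ℝ} {c : M} {z : Eu n}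
    (hA : ∀ i a, DifferentiableAt ℝ (fun y ↦ A y i a) z)
    (hs : ∀ b, DifferentiableAt ℝ (fun y ↦ s c y ![b]) z) (hBA : B z * A z = 1) (i j : Fin n) :
    tmap (A z) (gradForm G s c z) ![i, j] =
      fd A i (frameComp A (s c) j) z -
        ∑ k, frameChr A B (G c) i j k z • frameComp A (s c) k z := by
  have h1 : ∀ d, ∑ k, B z d k • frameComp A (s c) k z = s c z ![d] := by
    intro d
    have e : ∀ b, ∑ k, B z d k * A z k b = (1 : Matrix (Fin n) (Fin n) ℝ) d b := fun b ↦ by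
      rw [← hBA, Matrix.mul_apply]
    simp only [frameComp, Finset.smul_sum, smul_smul]
    rw [Finset.sum_comm]
    simp only [← Finset.sum_smul, e, Matrix.one_apply]
    simp
  have h2 : ∑ k, frameChr A B (G c) i j k z • frameComp A (s c) k z =
      ∑ d, (fd A i (fun y ↦ A y j d) z +
        ∑ a, ∑ b, A z i a * A z j b * christoffel (G c) d a b z) • s c z ![d] := by
    simp only [← h1, frameChr, Finset.sum_smul, Finset.smul_sum, smul_smul]
    exact Finset.sum_comm
  rw [h2, fd_frameComp hA hs, tmap_two_rank]
  simp only [gradForm, Matrix.cons_val_zero, Matrix.cons_val_one, smul_sub, Finset.sum_sub_distrib,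
    add_smul, Finset.sum_add_distrib]
  have h3 : ∑ a, ∑ b, (A z i a * A z j b) • ∑ k, christoffel (G c) k a b z • s c z ![k] =
      ∑ d, (∑ a, ∑ b, A z i a * A z j b * christoffel (G c) d a b z) • s c z ![d] := by
    simp only [Finset.smul_sum, Finset.sum_smul, smul_smul]
    symm
    rw [Finset.sum_comm]
    exact Finset.sum_congr rfl fun a _ ↦ Finset.sum_comm
  rw [h3]
  abel

theorem tmap_symGrad {M : Type*} (G : M → Eu n → Matrix (Fin n) (Fin n) ℝ) (s : Comps n M 𝕜 1)
    (A : Matrix (Fin n) (Fin n) ℝ) (c : M) (z : Eu n) (i j : Fin n) :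
    tmap A (symGrad G s c z) ![i, j] = (1 / 2 : ℝ) •
      (tmap A (gradForm G s c z) ![i, j] + tmap A (gradForm G s c z) ![j, i]) := by
  simp only [tmap_two_rank, symGrad, Matrix.cons_val_zero, Matrix.cons_val_one,
    smul_comm _ (1 / 2 : ℝ), ← Finset.smul_sum, smul_add, Finset.sum_add_distrib]
  congr 2
  rw [Finset.sum_comm]
  exact Finset.sum_congr rfl fun a _ ↦ Finset.sum_congr rfl fun b _ ↦ by rw [mul_comm]

/-- Bounds for the connection coefficients of a frame in terms of its Gram matrix. -/
theorem abs_frameChr_le {A B G : Eu n → Matrix (Fin n) (Fin n) ℝ} {z : Eu n}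
    (hA : ∀ i a, DifferentiableAt ℝ (fun y ↦ A y i a) z)
    (hG : ∀ i a, DifferentiableAt ℝ (fun y ↦ G y i a) z)
    (hsymm : (G z).transpose = G z) (hdet : (G z).det ≠ 0) (hBA : B z * A z = 1)
    {b : Fin n → Fin n → Fin n → ℝ}
    (hb : ∀ i j a, fd A i (fun y ↦ A y j a) z - fd A j (fun y ↦ A y i a) z = ∑ k, b i j k * A z k a)
    {C₁ C₂ C₃ C₄ : ℝ} (h1 : ∀ i j k, |b i j k| ≤ C₁)
    (h2 : ∀ j l, |(A z * G z * (A z).transpose) j l| ≤ C₂)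
    (h3 : ∀ j l, |(A z * G z * (A z).transpose)⁻¹ j l| ≤ C₃)
    (h4 : ∀ i j l, |fd A i (fun y ↦ (A y * G y * (A y).transpose) j l) z| ≤ C₄) (i j k : Fin n) :
    |frameChr A B G i j k z| ≤ n * ((3 * C₄ + 3 * (n * (C₁ * C₂))) / 2 * C₃) := by
  set H := A z * G z * (A z).transpose with hH
  set N : Fin n → Fin n → Fin n → ℝ := fun i j c ↦ fd A i (fun y ↦ A y j c) z +
    ∑ a, ∑ b, A z i a * A z j b * christoffel G c a b z with hN
  set P : Fin n → Fin n → Fin n → ℝ := fun i j l ↦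
    ∑ c, ∑ d, fd A i (fun y ↦ A y j c) z * G z c d * A z l d with hP
  set Q : Fin n → Fin n → Fin n → ℝ := fun i j l ↦ ∑ a, ∑ b, ∑ d,
    A z i a * A z j b * A z l d * pderiv a (fun w ↦ G w b d) z with hQ
  set X : Fin n → Fin n → Fin n → ℝ := fun i j l ↦ ∑ c, ∑ d, N i j c * G z c d * A z l d with hX
  have hk : ∀ i j l, 2 * X i j l = (P i j l + P i l j + Q i j l) + (P j i l + P j l i + Q j i l)
        - (P l i j + P l j i + Q l i j)
        + (P i j l - P j i l) - (P i l j - P l i j) - (P j l i - P l j i) :=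
    koszul_frame (G := G z) (fun a b d ↦ pderiv a (fun w ↦ G w b d) z) (A z)
      (fun i j c ↦ fd A i (fun y ↦ A y j c) z) (fun c a b ↦ christoffel G c a b z)
      (fun a b d ↦ sum_christoffel_mul hsymm hdet a b d) P Q (fun _ _ _ ↦ rfl) (fun _ _ _ ↦ rfl)
  have hfdH : ∀ i j l, fd A i (fun y ↦ (A y * G y * (A y).transpose) j l) z =
      P i j l + P i l j + Q i j l := by
    intro i j l
    simp only [fd, pderiv_congruence hA hG hsymm, hP, hQ, smul_eq_mul, mul_add,
      Finset.sum_add_distrib, Finset.mul_sum, Finset.sum_mul]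
    congr 1
    · congr 1
      · rw [Finset.sum_comm]
        refine Finset.sum_congr rfl fun c _ ↦ ?_
        rw [Finset.sum_comm]
        exact Finset.sum_congr rfl fun d _ ↦ Finset.sum_congr rfl fun a _ ↦ by ring
      · rw [Finset.sum_comm]
        refine Finset.sum_congr rfl fun c _ ↦ ?_
        rw [Finset.sum_comm]
        exact Finset.sum_congr rfl fun d _ ↦ Finset.sum_congr rfl fun a _ ↦ by ring
    · exact Finset.sum_congr rfl fun a _ ↦ Finset.sum_congr rfl fun c _ ↦
        Finset.sum_congr rfl fun d _ ↦ by ring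
  have hbrk : ∀ i j l, P i j l - P j i l = ∑ m, b i j m * H m l := by
    intro i j l
    simp only [hP, ← Finset.sum_sub_distrib, ← sub_mul, hb, hH, Matrix.mul_apply,
      Matrix.transpose_apply, Finset.sum_mul, Finset.mul_sum]
    calc _ = ∑ c, ∑ m, ∑ d, b i j m * A z m c * G z c d * A z l d :=
          Finset.sum_congr rfl fun c _ ↦ Finset.sum_comm
      _ = ∑ m, ∑ c, ∑ d, b i j m * A z m c * G z c d * A z l d := Finset.sum_comm
      _ = ∑ m, ∑ d, ∑ c, b i j m * A z m c * G z c d * A z l d :=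
          Finset.sum_congr rfl fun m _ ↦ Finset.sum_comm
      _ = _ := Finset.sum_congr rfl fun m _ ↦ Finset.sum_congr rfl fun d _ ↦
          Finset.sum_congr rfl fun c _ ↦ by ring
  have hbrk_le : ∀ i j l, |P i j l - P j i l| ≤ n * (C₁ * C₂) := by
    intro i j l
    rw [hbrk]
    refine abs_sum_le_card fun m ↦ ?_
    rw [abs_mul]
    exact mul_le_mul (h1 i j m) (h2 m l) (abs_nonneg _) ((abs_nonneg _).trans (h1 i j m))
  have hX_le : ∀ i j l, |X i j l| ≤ (3 * C₄ + 3 * (n * (C₁ * C₂))) / 2 := by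
    intro i j l
    have e := hk i j l
    have a1 := h4 i j l
    have a2 := h4 j i l
    have a3 := h4 l i j
    rw [hfdH] at a1 a2 a3
    have a4 := hbrk_le i j l
    have a5 := hbrk_le i l j
    have a6 := hbrk_le j l i
    rw [abs_le] at *
    constructor <;> linarith [a1.1, a1.2, a2.1, a2.2, a3.1, a3.2, a4.1, a4.2, a5.1, a5.2, a6.1, a6.2]
  have hAdet : (A z).det ≠ 0 := by
    intro h
    have := congrArg Matrix.det hBA
    rw [Matrix.det_mul, h, mul_zero, Matrix.det_one] at this
    exact zero_ne_one this
  have hHdet : IsUnit H.det := by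
    rw [hH, Matrix.det_mul, Matrix.det_mul, Matrix.det_transpose]
    exact (mul_ne_zero (mul_ne_zero hAdet hdet) hAdet).isUnit
  have hγN : Matrix.vecMul (fun k ↦ frameChr A B G i j k z) (A z) = N i j := by
    have : (fun k ↦ frameChr A B G i j k z) = Matrix.vecMul (N i j) (B z) := rfl
    rw [this, Matrix.vecMul_vecMul, hBA, Matrix.vecMul_one]
  have hγX : Matrix.vecMul (fun k ↦ frameChr A B G i j k z) H = X i j := by
    rw [hH, Matrix.mul_assoc, ← Matrix.vecMul_vecMul, hγN]
    ext l
    simp only [Matrix.vecMul, dotProduct, Matrix.mul_apply, Matrix.transpose_apply, Finset.mul_sum,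
      hX, mul_assoc]
  have hγ : (fun k ↦ frameChr A B G i j k z) = Matrix.vecMul (X i j) H⁻¹ := by
    rw [← hγX, Matrix.vecMul_vecMul, Matrix.mul_nonsing_inv _ hHdet, Matrix.vecMul_one]
  have : frameChr A B G i j k z = ∑ l, X i j l * H⁻¹ l k := congrFun hγ k
  rw [this]
  refine abs_sum_le_card fun l ↦ ?_
  rw [abs_mul]
  exact mul_le_mul (hX_le i j l) (h3 l k) (abs_nonneg _) ((abs_nonneg _).trans (hX_le i j l))

end FrameGradient

namespace Region

attribute [-instance] TopCat.of.chartedSpace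

variable {n : ℕ} {M : Type*} [TopologicalSpace M] [ChartedSpace (Eu n) M]
  [IsManifold (𝓡 n) ∞ M] [T2Space M] [SigmaCompactSpace M] (S : Region n M)
  {𝕜 : Type*} [RCLike 𝕜]

/-- The function `x` in the chart at `c`. -/
def xi (c : M) (z : Eu n) : ℝ := S.x ((chartAt (Eu n) c).symm z)

theorem contDiffOn_xi (c : M) : ContDiffOn ℝ ∞ (S.xi c) (chartAt (Eu n) c).target :=
  contDiffOn_fun_comp S.x_smooth c

/-- The part of the range of the chart at `c` that lies in `{x > 0}`. -/
def posDom (c : M) : Set (Eu n) := (chartAt (Eu n) c).target ∩ {z | 0 < S.xi c z}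

theorem isOpen_posDom (c : M) : IsOpen (S.posDom c) :=
  (chartAt (Eu n) c).isOpen_inter_preimage_symm
    (isOpen_lt continuous_const S.x_smooth.continuous)

theorem chartDom_subset_posDom (c : M) : S.chartDom c ⊆ S.posDom c := fun _ hz ↦ ⟨hz.1, hz.2.1⟩

theorem contDiffOn_gscMat_posDom (c : M) (i j : Fin n) :
    ContDiffOn ℝ ∞ (fun z ↦ S.gscMat c z i j) (S.posDom c) := by
  have hsub : S.posDom c ⊆ (chartAt (Eu n) c).target := inter_subset_left
  have hx := (S.contDiffOn_xi c).mono hsub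
  have hx0 : ∀ z ∈ S.posDom c, S.xi c z ≠ 0 := fun z hz ↦ hz.2.ne'
  have hd : ∀ i, ContDiffOn ℝ ∞ (fun z ↦ dAt n S.x ((chartAt (Eu n) c).symm z) (coordVec c z i))
      (S.posDom c) := fun i ↦
    ((contDiffOn_pderiv (chartAt (Eu n) c).open_target (contDiffOn_fun_comp S.x_smooth c)
      i).mono hsub).congr fun z hz ↦ dAt_coordVec S.x_smooth c i (hsub hz)
  have hh := (S.h_smooth.contDiffOn_comp c i j).mono hsub
  exact (((hx.pow 4).inv fun z hz ↦ pow_ne_zero _ (hx0 z hz)).mul ((hd i).mul (hd j))).add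
    (((hx.pow 2).inv fun z hz ↦ pow_ne_zero _ (hx0 z hz)).mul hh)

theorem posDef_gscMat_posDom (c : M) {z : Eu n} (hz : z ∈ S.posDom c) :
    (S.gscMat c z).PosDef := by
  refine posDef_bilinMatrix hz.1 (fun v w ↦ ?_) fun v hv ↦ ?_
  · simp [gsc, S.h_symm _ v w, mul_comm]
  · simpa [gsc] using S.sc_pos _ hz.2 v hv

theorem contDiffOn_expWeight (F : ℝ) (c : M) :
    ContDiffOn ℝ ∞ (fun z ↦ S.expWeight F ((chartAt (Eu n) c).symm z)) (S.posDom c) :=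
  (contDiffOn_const.div ((S.contDiffOn_xi c).mono inter_subset_left)
    fun _ hz ↦ ne_of_gt hz.2).exp

theorem pderiv_expWeight (F : ℝ) {c : M} {z : Eu n} (hz : z ∈ S.posDom c) (i : Fin n) :
    pderiv i (fun y ↦ S.expWeight F ((chartAt (Eu n) c).symm y)) z =
      S.expWeight F ((chartAt (Eu n) c).symm z) * (-F * (pderiv i (S.xi c) z / S.xi c z ^ 2)) := by
  have hx := differentiableAt_of_open (S.isOpen_posDom c)
    ((S.contDiffOn_xi c).mono inter_subset_left) hz
  have h0 : S.xi c z ≠ 0 := ne_of_gt hz.2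
  have h1 : HasFDerivAt (fun y ↦ Real.exp (F / S.xi c y))
      (Real.exp (F / S.xi c z) • (F • (-(S.xi c z ^ 2)⁻¹ • fderiv ℝ (S.xi c) z))) z := by
    have h2 := ((hasDerivAt_inv h0).comp_hasFDerivAt z hx.hasFDerivAt).const_mul F
    simp only [div_eq_mul_inv]
    exact h2.exp
  have e : (fun y ↦ S.expWeight F ((chartAt (Eu n) c).symm y)) =
      fun y ↦ Real.exp (F / S.xi c y) := rfl
  rw [e, pderiv, h1.fderiv]
  simp only [smul_apply, smul_eq_mul, pderiv, expWeight, xi]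
  ring

theorem expWeight_neg_mul (F : ℝ) (p : M) : S.expWeight (-F) p * S.expWeight F p = 1 := by
  rw [expWeight, expWeight, ← Real.exp_add, neg_div, neg_add_cancel, Real.exp_zero]

theorem contDiffOn_comps_fun (u : S.TestFun 𝕜) (c : M) (I : Fin 0 → Fin n) :
    ContDiffOn ℝ ∞ (fun z ↦ u.comps c z I) (chartAt (Eu n) c).target :=
  contDiffOn_fun_comp u.2.1 c

theorem contDiffOn_comps_form (u : S.TestForm 𝕜) (c : M) (I : Fin 1 → Fin n) :
    ContDiffOn ℝ ∞ (fun z ↦ u.comps c z I) (chartAt (Eu n) c).target :=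
  u.2.1.contDiffOn_comp c (I 0)

theorem contDiffOn_mulFun_expWeight {r : ℕ} {s : Comps n M 𝕜 r}
    (hs : ∀ c I, ContDiffOn ℝ ∞ (fun z ↦ s c z I) (chartAt (Eu n) c).target) (F : ℝ) (c : M)
    (I : Fin r → Fin n) :
    ContDiffOn ℝ ∞ (fun z ↦ mulFun (S.expWeight F) s c z I) (S.posDom c) :=
  (S.contDiffOn_expWeight F c).smul ((hs c I).mono inter_subset_left)

theorem dFun_apply (F : ℝ) (u : S.TestFun 𝕜) {c : M} {z : Eu n} (hz : z ∈ S.posDom c)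
    (I : Fin 1 → Fin n) : S.dFun F u c z I =
      gradFun u.comps c z I - (F * (pderiv (I 0) (S.xi c) z / S.xi c z ^ 2)) • u.comps c z ![] := by
  have h1 : S.dFun F u c z I = S.expWeight (-F) ((chartAt (Eu n) c).symm z) •
      pderiv (I 0) (fun y ↦ S.expWeight F ((chartAt (Eu n) c).symm y) • u.comps c y ![]) z := rfl
  rw [h1, pderiv_fun_smul (differentiableAt_of_open (S.isOpen_posDom c) (S.contDiffOn_expWeight F c) hz)
    (differentiableAt_of_open (S.isOpen_posDom c) ((S.contDiffOn_comps_fun u c _).mono inter_subset_left) hz),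
    S.pderiv_expWeight F hz, smul_add, smul_smul, smul_smul, ← mul_assoc, expWeight_neg_mul,
    one_smul, one_mul, neg_mul, neg_smul, ← sub_eq_add_neg]
  rfl

theorem gradForm_mulFun_expWeight (G : M → Eu n → Matrix (Fin n) (Fin n) ℝ) (F : ℝ)
    (u : S.TestForm 𝕜) {c : M} {z : Eu n} (hz : z ∈ S.posDom c) (I : Fin 2 → Fin n) :
    gradForm G (mulFun (S.expWeight F) u.comps) c z I =
      S.expWeight F ((chartAt (Eu n) c).symm z) • (gradForm G u.comps c z I -
        (F * (pderiv (I 0) (S.xi c) z / S.xi c z ^ 2)) • u.comps c z ![I 1]) := by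
  have h1 : gradForm G (mulFun (S.expWeight F) u.comps) c z I =
      pderiv (I 0) (fun y ↦ S.expWeight F ((chartAt (Eu n) c).symm y) • u.comps c y ![I 1]) z -
        ∑ k, christoffel (G c) k (I 0) (I 1) z •
          (S.expWeight F ((chartAt (Eu n) c).symm z) • u.comps c z ![k]) := rfl
  rw [h1, pderiv_fun_smul (differentiableAt_of_open (S.isOpen_posDom c) (S.contDiffOn_expWeight F c) hz)
    (differentiableAt_of_open (S.isOpen_posDom c) ((S.contDiffOn_comps_form u c _).mono inter_subset_left) hz),
    S.pderiv_expWeight F hz]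
  simp only [smul_comm _ (S.expWeight F ((chartAt (Eu n) c).symm z)), ← Finset.smul_sum, gradForm,
    smul_sub, mul_smul, neg_mul, neg_smul]
  module

theorem dForm_apply (F : ℝ) (u : S.TestForm 𝕜) {c : M} {z : Eu n} (hz : z ∈ S.posDom c)
    (I : Fin 2 → Fin n) : S.dForm F u c z I =
      symGrad S.gMat u.comps c z I - (F / 2) •
        ((pderiv (I 0) (S.xi c) z / S.xi c z ^ 2) • u.comps c z ![I 1] +
          (pderiv (I 1) (S.xi c) z / S.xi c z ^ 2) • u.comps c z ![I 0]) := by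
  have h1 : S.dForm F u c z I = S.expWeight (-F) ((chartAt (Eu n) c).symm z) • (1 / 2 : ℝ) •
      (gradForm S.gMat (mulFun (S.expWeight F) u.comps) c z ![I 0, I 1] +
        gradForm S.gMat (mulFun (S.expWeight F) u.comps) c z ![I 1, I 0]) := rfl
  rw [h1, S.gradForm_mulFun_expWeight _ F u hz, S.gradForm_mulFun_expWeight _ F u hz, ← smul_add,
    smul_comm (1 / 2 : ℝ), smul_smul, expWeight_neg_mul, one_smul, symGrad]
  simp only [Matrix.cons_val_zero, Matrix.cons_val_one]
  module

section IsTest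

theorem isTest_dFun (F : ℝ) (u : S.TestFun 𝕜) : S.IsTest (S.dFun F u) := by
  have hs := fun c I ↦ (S.contDiffOn_mulFun_expWeight (fun c I ↦ S.contDiffOn_comps_fun u c I) F c
    I).mono (S.chartDom_subset_posDom c)
  obtain ⟨K, hK, hKc, h0, -⟩ := S.isTest_comps_fun u
  refine ⟨K, hK, hKc, fun c z hz hzK I ↦ ?_, fun c I ↦ ?_⟩
  · have : gradFun (mulFun (S.expWeight F) u.comps) c z I = 0 :=
      pderiv_eq_zero hKc.isClosed (fun w hw hwK ↦ by simp [mulFun, h0 c w hw hwK]) hz hzK _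
    simp only [dFun, mulFun] at this ⊢
    rw [this, smul_zero]
  · exact ((S.contDiffOn_expWeight (-F) c).continuousOn.mono (S.chartDom_subset_posDom c)).smul
      (contDiffOn_pderiv (S.isOpen_chartDom c) (hs c ![]) (I 0)).continuousOn

theorem gradForm_eq_zero (G : M → Eu n → Matrix (Fin n) (Fin n) ℝ) {s : Comps n M 𝕜 1} {K : Set M}
    (hK : IsClosed K) (h0 : ∀ c, ∀ z ∈ (chartAt (Eu n) c).target,
      (chartAt (Eu n) c).symm z ∉ K → ∀ I, s c z I = 0) {c : M} {z : Eu n}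
    (hz : z ∈ (chartAt (Eu n) c).target) (hzK : (chartAt (Eu n) c).symm z ∉ K)
    (I : Fin 2 → Fin n) : gradForm G s c z I = 0 := by
  simp only [gradForm, h0 c z hz hzK, smul_zero, Finset.sum_const_zero, sub_zero]
  exact pderiv_eq_zero hK (fun w hw hwK ↦ h0 c w hw hwK _) hz hzK _

theorem IsMetric.continuousOn_christoffel {G : M → Eu n → Matrix (Fin n) (Fin n) ℝ}
    (hG : S.IsMetric G) (c : M) (k i j : Fin n) :
    ContinuousOn (fun z ↦ christoffel (G c) k i j z) (S.chartDom c) := by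
  have hp : ∀ a b d, ContinuousOn (fun z ↦ pderiv a (fun w ↦ G c w b d) z)
      (S.chartDom c) := fun a b d ↦
    (contDiffOn_pderiv (S.isOpen_chartDom c) (hG.smooth c b d) a).continuousOn
  have hinv : ∀ k l, ContinuousOn (fun z ↦ (G c z)⁻¹ k l) (S.chartDom c) := by
    intro k l
    have h0 : ContinuousOn (fun z ↦ G c z) (S.chartDom c) :=
      continuousOn_pi.2 fun i ↦ continuousOn_pi.2 fun j ↦ (hG.smooth c i j).continuousOn
    rw [continuousOn_iff_continuous_domRestrict] at h0 ⊢
    have h1 : ∀ z : S.chartDom c, (G c z).det ≠ 0 := fun z ↦ (hG.posDef c z z.2).det_pos.ne'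
    have h2 := (h0.matrix_det.inv₀ h1).mul (h0.matrix_adjugate.matrix_elem k l)
    refine h2.congr fun z ↦ ?_
    simp [Matrix.inv_def]
  exact continuousOn_const.mul (continuousOn_finsetSum _ fun l _ ↦
    (hinv k l).mul (((hp i j l).add (hp j i l)).sub (hp l i j)))

theorem IsMetric.continuousOn_gradForm {G : M → Eu n → Matrix (Fin n) (Fin n) ℝ}
    (hG : S.IsMetric G) {s : Comps n M 𝕜 1}
    (hs : ∀ c I, ContDiffOn ℝ ∞ (fun z ↦ s c z I) (S.chartDom c)) (c : M) (I : Fin 2 → Fin n) :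
    ContinuousOn (fun z ↦ gradForm G s c z I) (S.chartDom c) :=
  (contDiffOn_pderiv (S.isOpen_chartDom c) (hs c ![I 1]) (I 0)).continuousOn.sub
    (continuousOn_finsetSum _ fun k _ ↦ (hG.continuousOn_christoffel S c k (I 0) (I 1)).smul
      (hs c ![k]).continuousOn)

theorem isTest_dForm (F : ℝ) (u : S.TestForm 𝕜) : S.IsTest (S.dForm F u) := by
  have hs := fun c I ↦ (S.contDiffOn_mulFun_expWeight (fun c I ↦ S.contDiffOn_comps_form u c I) F c
    I).mono (S.chartDom_subset_posDom c)
  obtain ⟨K, hK, hKc, h0, -⟩ := S.isTest_comps_form u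
  refine ⟨K, hK, hKc, fun c z hz hzK I ↦ ?_, fun c I ↦ ?_⟩
  · have h : ∀ I, gradForm S.gMat (mulFun (S.expWeight F) u.comps) c z I = 0 :=
      gradForm_eq_zero _ hKc.isClosed (fun c w hw hwK I ↦ by simp [mulFun, h0 c w hw hwK]) hz hzK
    simp only [dForm, mulFun, symGrad] at h ⊢
    simp [h]
  · exact ((S.contDiffOn_expWeight (-F) c).continuousOn.mono (S.chartDom_subset_posDom c)).smul (continuousOn_const.smul
      ((S.isMetric_gMat.continuousOn_gradForm S hs c _).add
        (S.isMetric_gMat.continuousOn_gradForm S hs c _)))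

theorem tensorial_gradFun (u : S.TestFun 𝕜) : S.Tensorial (gradFun u.comps) :=
  (S.tensorial_compsFun u.1).gradFun fun c I ↦
    (S.contDiffOn_comps_fun u c I).mono inter_subset_left

theorem tensorial_gradForm (u : S.TestForm 𝕜) : S.Tensorial (gradForm S.gscMat u.comps) :=
  (S.tensorial_compsForm u.1).gradForm (fun c I ↦
    (S.contDiffOn_comps_form u c I).mono inter_subset_left) S.isMetric_gscMat

theorem tensorial_dFun (F : ℝ) (u : S.TestFun 𝕜) : S.Tensorial (S.dFun F u) :=
  (((S.tensorial_compsFun u.1).mulFun _).gradFun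
    fun c I ↦ (S.contDiffOn_mulFun_expWeight (fun c I ↦ S.contDiffOn_comps_fun u c I) F c
      I).mono (S.chartDom_subset_posDom c)).mulFun _

theorem tensorial_dForm (F : ℝ) (u : S.TestForm 𝕜) : S.Tensorial (S.dForm F u) :=
  (((S.tensorial_compsForm u.1).mulFun _).symGrad
    (fun c I ↦ (S.contDiffOn_mulFun_expWeight (fun c I ↦ S.contDiffOn_comps_form u c I) F c
      I).mono (S.chartDom_subset_posDom c)) S.isMetric_gMat).mulFun _

theorem IsTest.continuousOn {r : ℕ} {s : Comps n M 𝕜 r} (hs : S.IsTest s) (c : M)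
    (I : Fin r → Fin n) : ContinuousOn (fun z ↦ s c z I) (chartAt (Eu n) c).target := by
  obtain ⟨K, hK, hKc, h0, hs⟩ := hs
  intro z hz
  by_cases hzK : (chartAt (Eu n) c).symm z ∈ K
  · exact ((hs c I).continuousAt ((S.isOpen_chartDom c).mem_nhds ⟨hz, hK hzK⟩)).continuousWithinAt
  · have ho := (chartAt (Eu n) c).isOpen_inter_preimage_symm hKc.isClosed.isOpen_compl
    have : (fun z ↦ s c z I) =ᶠ[𝓝 z] fun _ ↦ 0 := by
      filter_upwards [ho.mem_nhds ⟨hz, hzK⟩] with w hw using h0 c w hw.1 hw.2 I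
    exact (continuousAt_const.congr this.symm).continuousWithinAt

end IsTest

end Region


theorem sqn_zero_rank {n : ℕ} {𝕜 : Type*} [RCLike 𝕜] (s : (Fin 0 → Fin n) → 𝕜) :
    sqn s = ‖s ![]‖ ^ 2 := by
  simp only [sqn, Finset.univ_unique, Finset.sum_singleton]
  rw [Subsingleton.elim (default : Fin 0 → Fin n) ![]]

theorem sqn_one_rank {n : ℕ} {𝕜 : Type*} [RCLike 𝕜] (s : (Fin 1 → Fin n) → 𝕜) :
    sqn s = ∑ i, ‖s ![i]‖ ^ 2 := sum_fin_one_arrow _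

theorem sqn_two_rank {n : ℕ} {𝕜 : Type*} [RCLike 𝕜] (s : (Fin 2 → Fin n) → 𝕜) :
    sqn s = ∑ i, ∑ j, ‖s ![i, j]‖ ^ 2 := sum_fin_two_arrow _

namespace Region

attribute [-instance] TopCat.of.chartedSpace

variable {n : ℕ} {M : Type*} [TopologicalSpace M] [ChartedSpace (Eu n) M]

open Classical in
/-- The function on `M` that is given by `β` in the chart at `c`, and vanishes elsewhere. -/
def chartLift (c : M) (β : Eu n → ℝ) (p : M) : ℝ :=
  if p ∈ (chartAt (Eu n) c).source then β (chartAt (Eu n) c p) else 0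

theorem chartLift_symm {c : M} {β : Eu n → ℝ} {z : Eu n} (hz : z ∈ (chartAt (Eu n) c).target) :
    chartLift c β ((chartAt (Eu n) c).symm z) = β z := by
  rw [chartLift, if_pos ((chartAt (Eu n) c).map_target hz), (chartAt (Eu n) c).right_inv hz]

theorem chartLift_nonneg {c : M} {β : Eu n → ℝ} (h : ∀ z, 0 ≤ β z) (p : M) :
    0 ≤ chartLift c β p := by
  rw [chartLift]
  split_ifs
  exacts [h _, le_rfl]

theorem chartLift_self_pos {c : M} {β : Eu n → ℝ} {p : M} (hp : p ∈ (chartAt (Eu n) c).source)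
    (h : 0 < β (chartAt (Eu n) c p)) : 0 < chartLift c β p := by
  rwa [chartLift, if_pos hp]

variable [T2Space M]

theorem chartLift_eq_zero {c : M} {β : Eu n → ℝ} {T : Set (Eu n)} (h0 : ∀ z ∉ T, β z = 0) {p : M}
    (hp : p ∉ (chartAt (Eu n) c).symm '' T) : chartLift c β p = 0 := by
  rw [chartLift]
  split_ifs with h
  · exact h0 _ fun h' ↦ hp ⟨_, h', (chartAt (Eu n) c).left_inv h⟩
  · rfl

theorem isClosed_symm_image {c : M} {T : Set (Eu n)} (hT : IsCompact T)
    (hTc : T ⊆ (chartAt (Eu n) c).target) : IsClosed ((chartAt (Eu n) c).symm '' T) :=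
  (hT.image_of_continuousOn ((chartAt (Eu n) c).continuousOn_symm.mono hTc)).isClosed

theorem continuous_chartLift {c : M} {β : Eu n → ℝ} (hβ : Continuous β) {T : Set (Eu n)}
    (hT : IsCompact T) (hTc : T ⊆ (chartAt (Eu n) c).target) (h0 : ∀ z ∉ T, β z = 0) :
    Continuous (chartLift c β) := by
  rw [continuous_iff_continuousAt]
  intro p
  by_cases hp : p ∈ (chartAt (Eu n) c).source
  · have h1 : chartLift c β =ᶠ[𝓝 p] β ∘ chartAt (Eu n) c := by
      filter_upwards [(chartAt (Eu n) c).open_source.mem_nhds hp] with q hq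
      rw [chartLift, if_pos hq, Function.comp]
    exact (hβ.continuousAt.comp ((chartAt (Eu n) c).continuousAt hp)).congr h1.symm
  · have hp' : p ∉ (chartAt (Eu n) c).symm '' T := by
      rintro ⟨z, hz, rfl⟩
      exact hp ((chartAt (Eu n) c).map_target (hTc hz))
    have h1 : chartLift c β =ᶠ[𝓝 p] fun _ ↦ 0 := by
      filter_upwards [(isClosed_symm_image hT hTc).isOpen_compl.mem_nhds hp'] with q hq
      exact chartLift_eq_zero h0 hq
    exact continuousAt_const.congr h1.symm

theorem tsupport_chartLift_subset {c : M} {β : Eu n → ℝ} {T : Set (Eu n)}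
    (hT : IsCompact T) (hTc : T ⊆ (chartAt (Eu n) c).target) (h0 : ∀ z ∉ T, β z = 0) :
    tsupport (chartLift c β) ⊆ (chartAt (Eu n) c).source := by
  refine (closure_minimal (fun p hp ↦ ?_) (isClosed_symm_image hT hTc)).trans ?_
  · by_contra h
    exact hp (chartLift_eq_zero h0 h)
  · rintro _ ⟨z, hz, rfl⟩
    exact (chartAt (Eu n) c).map_target (hTc hz)

theorem isCompact_inter_symm_preimage {c : M} {T : Set (Eu n)} (hT : IsCompact T)
    (hTc : T ⊆ (chartAt (Eu n) c).target) {K : Set M} (hK : IsCompact K) :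
    IsCompact (T ∩ (chartAt (Eu n) c).symm ⁻¹' K) :=
  hT.of_isClosed_subset (((chartAt (Eu n) c).continuousOn_symm.mono
    hTc).preimage_isClosed_of_isClosed hT.isClosed hK.isClosed) inter_subset_left

variable [IsManifold (𝓡 n) ∞ M] [SigmaCompactSpace M] (S : Region n M) {𝕜 : Type*} [RCLike 𝕜]

variable {S} in
theorem energy_chartLift {r : ℕ} {s : Comps n M 𝕜 r} (hs : S.IsTest s) (ht : S.Tensorial s)
    {c : M} {β : Eu n → ℝ} (hβ : Continuous β) {T : Set (Eu n)}
    (hT : IsCompact T) (hTc : T ⊆ (chartAt (Eu n) c).target) (h0 : ∀ z ∉ T, β z = 0) :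
    IntegrableOn (fun z ↦ β z * S.dens s c z) (chartAt (Eu n) c).target ∧
    S.energy s (chartLift c β) = ∫ z in (chartAt (Eu n) c).target, β z * S.dens s c z := by
  have hm := (chartAt (Eu n) c).open_target.measurableSet
  have hc := continuous_chartLift hβ hT hTc h0
  have hsub := tsupport_chartLift_subset hT hTc h0
  have e : EqOn (fun z ↦ chartLift c β ((chartAt (Eu n) c).symm z) * S.dens s c z)
      (fun z ↦ β z * S.dens s c z) (chartAt (Eu n) c).target := fun z hz ↦ by
    simp only [chartLift_symm hz]
  exact ⟨(hs.integrableOn_dens hc hsub).congr_fun e hm,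
    (energy_eq_integral hs ht hc hsub).trans (setIntegral_congr_fun hm e)⟩

/-- A frame over a part of a chart in which the two metrics are controlled. -/
structure ScFrame (c : M) (O : Set (Eu n)) extends Frame n (O ∩ {z | 0 < S.xi c z}) where
  /-- the inverse matrix -/
  inv : Eu n → Matrix (Fin n) (Fin n) ℝ
  /-- a bound -/
  b : ℝ
  subset_target : O ⊆ (chartAt (Eu n) c).target
  inv_mul : ∀ z ∈ O ∩ {z | 0 < S.xi c z}, inv z * A z = 1
  α_eq : ∀ i, ∀ z ∈ O ∩ {z | 0 < S.xi c z},
    α i z = ∑ a, A z i a * (pderiv a (S.xi c) z / S.xi c z ^ 2)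
  b_nonneg : 0 ≤ b
  gram_le : ∀ i, ∀ z ∈ O ∩ {z | 0 < S.xi c z}, (A z * S.gscMat c z * (A z).transpose) i i ≤ b
  gram_inv_le : ∀ i, ∀ z ∈ O ∩ {z | 0 < S.xi c z},
    (A z * S.gscMat c z * (A z).transpose)⁻¹ i i ≤ b
  sqrt_det_le : ∀ z ∈ O ∩ {z | 0 < S.xi c z}, √(S.gscMat c z).det ≤ b * w z
  le_sqrt_det : ∀ z ∈ O ∩ {z | 0 < S.xi c z}, w z ≤ b * √(S.gscMat c z).det
  chr_le : ∀ i j k, ∀ z ∈ O ∩ {z | 0 < S.xi c z}, |frameChr A inv (S.gscMat c) i j k z| ≤ b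
  chr_g_le : ∀ i j k, ∀ z ∈ O ∩ {z | 0 < S.xi c z}, |frameChr A inv (S.gMat c) i j k z| ≤ b

namespace ScFrame

variable {S} {c : M} {O : Set (Eu n)} (E : S.ScFrame c O)

theorem subset_posDom (E : S.ScFrame c O) : O ∩ {z | 0 < S.xi c z} ⊆ S.posDom c :=
  inter_subset_inter_left _ E.subset_target

/-- The square norm of a tensor in the frame. -/
def nsq {r : ℕ} (s : Comps n M 𝕜 r) (z : Eu n) : ℝ := sqn (tmap (E.A z) (s c z))

theorem nsq_nonneg {r : ℕ} (s : Comps n M 𝕜 r) (z : Eu n) : 0 ≤ E.nsq s z := sqn_nonneg _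

theorem pair_self_eq {r : ℕ} (s : Comps n M 𝕜 r) {z : Eu n} (hz : z ∈ O ∩ {z | 0 < S.xi c z}) :
    S.pair s s c z = tform (E.A z * S.gscMat c z * (E.A z).transpose)⁻¹ (tmap (E.A z) (s c z))
      (tmap (E.A z) (s c z)) := by
  have hu : IsUnit (E.A z).det := by
    refine IsUnit.of_mul_eq_one_right (E.inv z).det ?_
    rw [← Matrix.det_mul, E.inv_mul z hz, Matrix.det_one]
  rw [tform_tmap, pair_eq_tform, Matrix.mul_inv_rev, Matrix.mul_inv_rev, ← Matrix.mul_assoc,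
    ← Matrix.transpose_nonsing_inv, ← Matrix.transpose_mul, Matrix.nonsing_inv_mul _ hu,
    Matrix.transpose_one, Matrix.one_mul, Matrix.mul_assoc, Matrix.nonsing_inv_mul _ hu,
    Matrix.mul_one]

theorem posDef_gram {z : Eu n} (hz : z ∈ O ∩ {z | 0 < S.xi c z}) :
    (E.A z * S.gscMat c z * (E.A z).transpose).PosDef := by
  have hG := S.posDef_gscMat_posDom c (E.subset_posDom hz)
  have hu : IsUnit (E.A z).det := by
    refine IsUnit.of_mul_eq_one_right (E.inv z).det ?_
    rw [← Matrix.det_mul, E.inv_mul z hz, Matrix.det_one]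
  have := hG.mul_mul_conjTranspose_same (B := E.A z)
    (Matrix.vecMul_injective_iff_isUnit.2 ((Matrix.isUnit_iff_isUnit_det _).2 hu))
  rwa [Matrix.conjTranspose_eq_transpose_of_trivial] at this

/-- The density of a tensor is comparable with the weighted square norm in the frame. -/
theorem exists_dens_bounds (r : ℕ) : ∃ K, 0 ≤ K ∧ ∀ s : Comps n M 𝕜 r,
    ∀ z ∈ O ∩ {z | 0 < S.xi c z}, S.dens s c z ≤ K * (E.w z * E.nsq s z) ∧
      E.w z * E.nsq s z ≤ K * S.dens s c z := by
  have hb := E.b_nonneg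
  refine ⟨E.b * ((Fintype.card (Fin r → Fin n)) ^ 2 * E.b ^ r), by positivity, fun s z hz ↦ ?_⟩
  obtain ⟨h1, h2⟩ := tform_inv_bounds (E.posDef_gram hz) (fun i ↦ E.gram_le i z hz)
    (fun i ↦ E.gram_inv_le i z hz) (tmap (E.A z) (s c z))
  rw [← E.pair_self_eq s hz] at h1 h2
  have h3 := E.sqrt_det_le z hz
  have h4 := E.le_sqrt_det z hz
  have hw := E.w_pos z hz
  have hN := E.nsq_nonneg s z
  set N : ℝ := (Fintype.card (Fin r → Fin n)) ^ 2 * E.b ^ r with hN_def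
  have hN0 : 0 ≤ N := by positivity
  set X := RCLike.re (S.pair s s c z) with hX
  change X ≤ N * E.nsq s z at h1
  change E.nsq s z ≤ N * X at h2
  have hd : S.dens s c z = √(S.gscMat c z).det * X := rfl
  rw [hd]
  constructor
  · calc √(S.gscMat c z).det * X ≤ √(S.gscMat c z).det * (N * E.nsq s z) :=
          mul_le_mul_of_nonneg_left h1 (Real.sqrt_nonneg _)
      _ ≤ (E.b * E.w z) * (N * E.nsq s z) := mul_le_mul_of_nonneg_right h3 (by positivity)
      _ = _ := by ring
  · calc E.w z * E.nsq s z ≤ (E.b * √(S.gscMat c z).det) * E.nsq s z :=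
          mul_le_mul_of_nonneg_right h4 hN
      _ ≤ (E.b * √(S.gscMat c z).det) * (N * X) := mul_le_mul_of_nonneg_left h2 (by positivity)
      _ = _ := by ring

theorem continuousOn_nsq {r : ℕ} {s : Comps n M 𝕜 r} (hs : S.IsTest s) :
    ContinuousOn (E.nsq s) (O ∩ {z | 0 < S.xi c z}) := by
  refine continuousOn_finsetSum _ fun I _ ↦ (ContinuousOn.norm ?_).pow 2
  refine continuousOn_finsetSum _ fun J _ ↦ ContinuousOn.mul ?_
    ((hs.continuousOn S c J).mono (inter_subset_left.trans E.subset_target))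
  exact RCLike.continuous_ofReal.comp_continuousOn
    (continuousOn_finsetProd _ fun k _ ↦ (E.A_smooth _ _).continuousOn)

theorem nsq_eq_zero {r : ℕ} {s : Comps n M 𝕜 r} {z : Eu n} (h : ∀ I, s c z I = 0) :
    E.nsq s z = 0 := by
  simp [nsq, sqn, tmap, h]

theorem integrable_nsq {r : ℕ} {s : Comps n M 𝕜 r} (hs : S.IsTest s) {β : Eu n → ℝ}
    (hβ : Continuous β) {T : Set (Eu n)}
    (hT : IsCompact T) (hTO : T ⊆ O) (h0 : ∀ z ∉ T, β z = 0) :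
    Integrable fun z ↦ E.w z * (β z * E.nsq s z) := by
  have hc := E.continuousOn_nsq hs
  obtain ⟨K, hK, hKc, hK0, -⟩ := hs
  refine E.integrable_mul
    (isCompact_inter_symm_preimage (c := c) hT (hTO.trans E.subset_target) hKc)
    (fun z hz ↦ ⟨hTO hz.1, (hK hz.2).1⟩) (hβ.continuousOn.mul hc) fun z hz ↦ ?_
  by_cases hzT : z ∈ T
  · have : ∀ I, s c z I = 0 := hK0 c z (E.subset_target (hTO hzT)) fun h ↦ hz ⟨hzT, h⟩
    rw [E.nsq_eq_zero this, mul_zero]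
  · rw [h0 z hzT, zero_mul]

/-- The energy of a tensor on a part of the chart is comparable with the weighted integral of the
square norm in the frame. -/
theorem exists_energy_bounds (𝕜 : Type*) [RCLike 𝕜] (r : ℕ) : ∃ K, 0 ≤ K ∧ ∀ s : Comps n M 𝕜 r,
    S.IsTest s → S.Tensorial s → ∀ β : Eu n → ℝ, Continuous β → (∀ z, 0 ≤ β z) →
    ∀ T : Set (Eu n), IsCompact T → T ⊆ O → (∀ z ∉ T, β z = 0) →
    S.energy s (chartLift c β) ≤ K * (∫ z, E.w z * (β z * E.nsq s z)) ∧
      ∫ z, E.w z * (β z * E.nsq s z) ≤ K * S.energy s (chartLift c β) := by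
  obtain ⟨K, hK, h⟩ := E.exists_dens_bounds (𝕜 := 𝕜) r
  refine ⟨K, hK, fun s hs ht β hβ hβ0 T hT hTO h0 ↦ ?_⟩
  have hTc := hTO.trans E.subset_target
  obtain ⟨hi, he⟩ := energy_chartLift hs ht hβ hT hTc h0
  have hi' := E.integrable_nsq hs hβ hT hTO h0
  have e : ∫ z, E.w z * (β z * E.nsq s z) =
      ∫ z in (chartAt (Eu n) c).target, E.w z * (β z * E.nsq s z) := by
    symm
    refine setIntegral_eq_integral_of_forall_compl_eq_zero fun z hz ↦ ?_
    rw [h0 z fun h ↦ hz (hTc h), zero_mul, mul_zero]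
  have hm := (chartAt (Eu n) c).open_target.measurableSet
  have key : ∀ z ∈ (chartAt (Eu n) c).target,
      β z * S.dens s c z ≤ K * (E.w z * (β z * E.nsq s z)) ∧
        E.w z * (β z * E.nsq s z) ≤ K * (β z * S.dens s c z) := by
    intro z hz
    by_cases hzT : z ∈ T
    · by_cases hz' : 0 < S.xi c z
      · obtain ⟨h1, h2⟩ := h s z ⟨hTO hzT, hz'⟩
        constructor
        · calc _ ≤ β z * (K * (E.w z * E.nsq s z)) := mul_le_mul_of_nonneg_left h1 (hβ0 z)
            _ = _ := by ring
        · calc _ = β z * (E.w z * E.nsq s z) := by ring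
            _ ≤ β z * (K * S.dens s c z) := mul_le_mul_of_nonneg_left h2 (hβ0 z)
            _ = _ := by ring
      · have hd : (chartAt (Eu n) c).symm z ∉ S.dom := fun hd ↦ hz' hd.1
        have h0' : ∀ I, s c z I = 0 := by
          obtain ⟨K, hK, -, hK0, -⟩ := hs
          exact hK0 c z hz fun h ↦ hd (hK h)
        rw [hs.dens_eq_zero hz hd, E.nsq_eq_zero h0']
        simp
    · rw [h0 z hzT]
      simp
  rw [he, e, ← integral_const_mul, ← integral_const_mul]
  exact ⟨setIntegral_mono_on hi (hi'.integrableOn.const_mul K) hm fun z hz ↦ (key z hz).1,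
    setIntegral_mono_on hi'.integrableOn (hi.const_mul K) hm fun z hz ↦ (key z hz).2⟩

end ScFrame

end Region


theorem fd_fun_smul {n : ℕ} {V : Type*} [NormedAddCommGroup V] [NormedSpace ℝ V]
    {A : Eu n → Matrix (Fin n) (Fin n) ℝ} {z : Eu n} {f : Eu n → ℝ} {g : Eu n → V}
    (hf : DifferentiableAt ℝ f z) (hg : DifferentiableAt ℝ g z) (i : Fin n) :
    fd A i (fun y ↦ f y • g y) z = f z • fd A i g z + fd A i f z • g z := by
  simp only [fd, pderiv_fun_smul hf hg, smul_add, Finset.sum_add_distrib, Finset.smul_sum,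
    Finset.sum_smul, smul_smul, smul_eq_mul]
  congr 1
  exact Finset.sum_congr rfl fun a _ ↦ by rw [mul_comm]

section NormSq

variable {V : Type*} [NormedAddCommGroup V] [NormedSpace ℝ V]

theorem norm_add_sq_le_two (a b : V) : ‖a + b‖ ^ 2 ≤ 2 * ‖a‖ ^ 2 + 2 * ‖b‖ ^ 2 := by
  have h := pow_le_pow_left₀ (norm_nonneg _) (norm_add_le a b) 2
  nlinarith [sq_nonneg (‖a‖ - ‖b‖)]

theorem norm_add_sq_le_three (a b c : V) :
    ‖a + b + c‖ ^ 2 ≤ 3 * ‖a‖ ^ 2 + 3 * ‖b‖ ^ 2 + 3 * ‖c‖ ^ 2 := by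
  have h := pow_le_pow_left₀ (norm_nonneg _) (norm_add₃_le (a := a) (b := b) (c := c)) 2
  nlinarith [sq_nonneg (‖a‖ - ‖b‖), sq_nonneg (‖a‖ - ‖c‖), sq_nonneg (‖b‖ - ‖c‖)]

theorem norm_smul_sq (a : ℝ) (v : V) : ‖a • v‖ ^ 2 = a ^ 2 * ‖v‖ ^ 2 := by
  rw [norm_smul, mul_pow, Real.norm_eq_abs, sq_abs]

theorem norm_sum_smul_sq_le {n : ℕ} {b : ℝ} {g : Fin n → ℝ} (hg : ∀ k, |g k| ≤ b) (U : Fin n → V) :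
    ‖∑ k, g k • U k‖ ^ 2 ≤ n * b ^ 2 * ∑ k, ‖U k‖ ^ 2 := by
  have h1 : ‖∑ k, g k • U k‖ ≤ ∑ k, ‖g k • U k‖ := norm_sum_le _ _
  have h2 := pow_le_pow_left₀ (norm_nonneg _) h1 2
  have h3 : (∑ k, ‖g k • U k‖) ^ 2 ≤ (Finset.univ : Finset (Fin n)).card * ∑ k, ‖g k • U k‖ ^ 2 :=
    sq_sum_le_card_mul_sum_sq
  refine h2.trans (h3.trans ?_)
  have h4 : ∑ k, ‖g k • U k‖ ^ 2 ≤ b ^ 2 * ∑ k, ‖U k‖ ^ 2 := by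
    rw [Finset.mul_sum]
    refine Finset.sum_le_sum fun k _ ↦ ?_
    rw [norm_smul_sq]
    have hk := abs_le.1 (hg k)
    exact mul_le_mul_of_nonneg_right (sq_le_sq' hk.1 hk.2) (sq_nonneg _)
  rw [Finset.card_univ, Fintype.card_fin, mul_assoc]
  exact mul_le_mul_of_nonneg_left h4 (Nat.cast_nonneg _)

end NormSq

namespace Region

attribute [-instance] TopCat.of.chartedSpace

variable {n : ℕ} {M : Type*} [TopologicalSpace M] [ChartedSpace (Eu n) M]
  [IsManifold (𝓡 n) ∞ M] [T2Space M] [SigmaCompactSpace M] {S : Region n M}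
  {𝕜 : Type*} [RCLike 𝕜]

namespace ScFrame

variable {c : M} {O : Set (Eu n)} (E : S.ScFrame c O)

/-- The components of a test one-form in the frame. -/
def comp (u : S.TestForm 𝕜) (j : Fin n) (z : Eu n) : 𝕜 := frameComp E.A (u.comps c) j z

theorem contDiffOn_comp (u : S.TestForm 𝕜) (j : Fin n) :
    ContDiffOn ℝ ∞ (E.comp u j) (O ∩ {z | 0 < S.xi c z}) :=
  ContDiffOn.sum (s := Finset.univ) (f := fun b z ↦ E.A z j b • u.comps c z ![b]) fun b _ ↦ (E.A_smooth j b).smul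
    ((S.contDiffOn_comps_form u c _).mono (inter_subset_left.trans E.subset_target))

theorem contDiffOn_fun (E : S.ScFrame c O) (u : S.TestFun 𝕜) :
    ContDiffOn ℝ ∞ (fun z ↦ u.comps c z ![]) (O ∩ {z | 0 < S.xi c z}) :=
  (S.contDiffOn_comps_fun u c _).mono (inter_subset_left.trans E.subset_target)

theorem nsq_form (u : S.TestForm 𝕜) (z : Eu n) : E.nsq u.comps z = ∑ j, ‖E.comp u j z‖ ^ 2 := by
  rw [nsq, sqn_one_rank]
  exact Finset.sum_congr rfl fun j _ ↦ by rw [tmap_eq_frameComp]; rfl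

theorem nsq_fun (u : S.TestFun 𝕜) (z : Eu n) : E.nsq u.comps z = ‖u.comps c z ![]‖ ^ 2 := by
  rw [nsq, sqn_zero_rank, tmap_zero_rank]

variable {z : Eu n}

theorem differentiableAt_A (hz : z ∈ O ∩ {z | 0 < S.xi c z}) (i a : Fin n) :
    DifferentiableAt ℝ (fun y ↦ E.A y i a) z :=
  differentiableAt_of_open E.isOpen (E.A_smooth i a) hz

theorem tmap_gradForm_eq (u : S.TestForm 𝕜) (hz : z ∈ O ∩ {z | 0 < S.xi c z})
    (G : M → Eu n → Matrix (Fin n) (Fin n) ℝ) (i j : Fin n) :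
    tmap (E.A z) (gradForm G u.comps c z) ![i, j] = fd E.A i (E.comp u j) z -
      ∑ k, frameChr E.A E.inv (G c) i j k z • E.comp u k z :=
  tmap_gradForm G u.comps (E.differentiableAt_A hz)
    (fun b ↦ differentiableAt_of_open E.isOpen ((S.contDiffOn_comps_form u c ![b]).mono
      (inter_subset_left.trans E.subset_target)) hz) (E.inv_mul z hz) i j

theorem tmap_dForm_eq (F : ℝ) (u : S.TestForm 𝕜) (hz : z ∈ O ∩ {z | 0 < S.xi c z}) (i j : Fin n) :
    tmap (E.A z) (S.dForm F u c z) ![i, j] = E.sym F (E.comp u) i j z -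
      ∑ k, ((1 / 2) * (frameChr E.A E.inv (S.gMat c) i j k z +
        frameChr E.A E.inv (S.gMat c) j i k z)) • E.comp u k z := by
  have h1 : S.dForm F u c z = fun I ↦ symGrad S.gMat u.comps c z I - (F / 2) •
        ((pderiv (I 0) (S.xi c) z / S.xi c z ^ 2) • u.comps c z ![I 1] +
          (pderiv (I 1) (S.xi c) z / S.xi c z ^ 2) • u.comps c z ![I 0]) :=
    funext fun I ↦ S.dForm_apply F u (E.subset_posDom hz) I
  have h2 : tmap (E.A z) (S.dForm F u c z) ![i, j] =
      tmap (E.A z) (symGrad S.gMat u.comps c z) ![i, j] -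
        (F / 2) • (E.α i z • E.comp u j z + E.α j z • E.comp u i z) := by
    have h3 : ∀ i j, ∑ a, ∑ b, (E.A z i a * E.A z j b) •
        ((pderiv a (S.xi c) z / S.xi c z ^ 2) • u.comps c z ![b]) =
        E.α i z • E.comp u j z := by
      intro i j
      simp only [E.α_eq i z hz, comp, frameComp, Finset.smul_sum, Finset.sum_smul, smul_smul,
        Finset.sum_mul]
      rw [Finset.sum_comm]
      refine Finset.sum_congr rfl fun a _ ↦ Finset.sum_congr rfl fun b _ ↦ ?_
      congr 1
      ring
    have h4 : ∑ a, ∑ b, (E.A z i a * E.A z j b) •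
        ((pderiv b (S.xi c) z / S.xi c z ^ 2) • u.comps c z ![a]) =
        E.α j z • E.comp u i z := by
      rw [← h3 j i, Finset.sum_comm]
      refine Finset.sum_congr rfl fun a _ ↦ Finset.sum_congr rfl fun b _ ↦ ?_
      rw [mul_comm]
    rw [h1, tmap_two_rank, tmap_two_rank, ← h3, ← h4]
    simp only [Matrix.cons_val_zero, Matrix.cons_val_one, smul_sub, Finset.sum_sub_distrib,
      smul_add, Finset.sum_add_distrib, smul_comm _ (F / 2), ← Finset.smul_sum]
  rw [h2, tmap_symGrad, E.tmap_gradForm_eq u hz, E.tmap_gradForm_eq u hz, Frame.sym]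
  simp only [mul_smul, ← Finset.smul_sum, add_smul, Finset.sum_add_distrib]
  module

theorem tmap_gradFun_eq (u : S.TestFun 𝕜) (z : Eu n) (i : Fin n) :
    tmap (E.A z) (gradFun u.comps c z) ![i] = fd E.A i (fun z ↦ u.comps c z ![]) z := by
  rw [tmap_one_rank]
  rfl

theorem tmap_dFun_eq (F : ℝ) (u : S.TestFun 𝕜) (hz : z ∈ O ∩ {z | 0 < S.xi c z}) (i : Fin n) :
    tmap (E.A z) (S.dFun F u c z) ![i] = fd E.A i (fun z ↦ u.comps c z ![]) z -
      (F * E.α i z) • u.comps c z ![] := by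
  have h1 : S.dFun F u c z = fun I ↦ gradFun u.comps c z I -
      (F * (pderiv (I 0) (S.xi c) z / S.xi c z ^ 2)) • u.comps c z ![] :=
    funext fun I ↦ S.dFun_apply F u (E.subset_posDom hz) I
  rw [← E.tmap_gradFun_eq, h1, tmap_one_rank, tmap_one_rank, E.α_eq i z hz]
  simp only [smul_sub, Finset.sum_sub_distrib, Finset.mul_sum, Finset.sum_smul, smul_smul]
  congr 1
  refine Finset.sum_congr rfl fun a _ ↦ ?_
  congr 1
  simp only [Matrix.cons_val_zero]
  ring

theorem nsq_gradFun_le (F : ℝ) (u : S.TestFun 𝕜) (hz : z ∈ O ∩ {z | 0 < S.xi c z}) :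
    E.nsq (gradFun u.comps) z ≤ 2 * E.nsq (S.dFun F u) z +
      n * (2 * (F ^ 2 * E.C ^ 2)) * E.nsq u.comps z := by
  rw [nsq_fun, nsq, nsq, sqn_one_rank, sqn_one_rank, Finset.mul_sum]
  have h : ∀ i : Fin n, ‖tmap (E.A z) (gradFun u.comps c z) ![i]‖ ^ 2 ≤
      2 * ‖tmap (E.A z) (S.dFun F u c z) ![i]‖ ^ 2 +
        2 * (F ^ 2 * E.C ^ 2) * ‖u.comps c z ![]‖ ^ 2 := by
    intro i
    have e : tmap (E.A z) (gradFun u.comps c z) ![i] = tmap (E.A z) (S.dFun F u c z) ![i] +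
        (F * E.α i z) • u.comps c z ![] := by
      rw [tmap_dFun_eq E F u hz, tmap_gradFun_eq]
      abel
    rw [e]
    refine (norm_add_sq_le_two _ _).trans ?_
    rw [norm_smul_sq, mul_pow, mul_assoc 2]
    have := sq_le_sq' (abs_le.1 (E.α_le i z hz)).1 (abs_le.1 (E.α_le i z hz)).2
    gcongr
  refine (Finset.sum_le_sum fun i _ ↦ h i).trans (le_of_eq ?_)
  rw [Finset.sum_add_distrib, Finset.sum_const, Finset.card_univ, Fintype.card_fin, nsmul_eq_mul]
  ring

theorem nsq_dFun_le (F : ℝ) (u : S.TestFun 𝕜) (hz : z ∈ O ∩ {z | 0 < S.xi c z}) :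
    E.nsq (S.dFun F u) z ≤ 2 * E.nsq (gradFun u.comps) z +
      n * (2 * (F ^ 2 * E.C ^ 2)) * E.nsq u.comps z := by
  rw [nsq_fun, nsq, nsq, sqn_one_rank, sqn_one_rank, Finset.mul_sum]
  have h : ∀ i : Fin n, ‖tmap (E.A z) (S.dFun F u c z) ![i]‖ ^ 2 ≤
      2 * ‖tmap (E.A z) (gradFun u.comps c z) ![i]‖ ^ 2 +
        2 * (F ^ 2 * E.C ^ 2) * ‖u.comps c z ![]‖ ^ 2 := by
    intro i
    have e : tmap (E.A z) (S.dFun F u c z) ![i] = tmap (E.A z) (gradFun u.comps c z) ![i] +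
        (-F * E.α i z) • u.comps c z ![] := by
      rw [tmap_dFun_eq E F u hz, tmap_gradFun_eq]
      module
    rw [e]
    refine (norm_add_sq_le_two _ _).trans ?_
    rw [norm_smul_sq, mul_pow, mul_assoc 2, neg_sq]
    have := sq_le_sq' (abs_le.1 (E.α_le i z hz)).1 (abs_le.1 (E.α_le i z hz)).2
    gcongr
  refine (Finset.sum_le_sum fun i _ ↦ h i).trans (le_of_eq ?_)
  rw [Finset.sum_add_distrib, Finset.sum_const, Finset.card_univ, Fintype.card_fin, nsmul_eq_mul]
  ring

theorem norm_comp_sq_le (u : S.TestForm 𝕜) (z : Eu n) (j : Fin n) :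
    ‖E.comp u j z‖ ^ 2 ≤ E.nsq u.comps z := by
  rw [nsq_form]
  exact Finset.single_le_sum (f := fun j ↦ ‖E.comp u j z‖ ^ 2) (fun _ _ ↦ sq_nonneg _)
    (Finset.mem_univ j)

theorem norm_chr_sq_le (u : S.TestForm 𝕜) (z : Eu n) {g : Fin n → ℝ} (hg : ∀ k, |g k| ≤ E.b) :
    ‖∑ k, g k • E.comp u k z‖ ^ 2 ≤ n * E.b ^ 2 * E.nsq u.comps z := by
  rw [nsq_form]
  exact norm_sum_smul_sq_le hg _

theorem abs_half_chr_le (hz : z ∈ O ∩ {z | 0 < S.xi c z}) (i j k : Fin n) :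
    |(1 / 2) * (frameChr E.A E.inv (S.gMat c) i j k z +
        frameChr E.A E.inv (S.gMat c) j i k z)| ≤ E.b := by
  have h1 := abs_le.1 (E.chr_g_le i j k z hz)
  have h2 := abs_le.1 (E.chr_g_le j i k z hz)
  rw [abs_le]
  constructor <;> linarith [h1.1, h1.2, h2.1, h2.2]

theorem sum_sum_const (a : ℝ) : ∑ _i : Fin n, ∑ _j : Fin n, a = n ^ 2 * a := by
  simp
  ring

/-- The twisted symmetric differential is controlled by the covariant derivative. -/
theorem nsq_dForm_le (F : ℝ) (u : S.TestForm 𝕜) (hz : z ∈ O ∩ {z | 0 < S.xi c z}) :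
    E.nsq (S.dForm F u) z ≤ 6 * E.nsq (gradForm S.gscMat u.comps) z +
      n ^ 2 * (12 * n * E.b ^ 2 + 3 * F ^ 2 * E.C ^ 2) * E.nsq u.comps z := by
  set N := E.nsq u.comps z with hN
  rw [nsq, nsq, sqn_two_rank, sqn_two_rank]
  set G : Fin n → Fin n → 𝕜 := fun i j ↦ tmap (E.A z) (gradForm S.gscMat u.comps c z) ![i, j] with hG
  have h : ∀ i j : Fin n, ‖tmap (E.A z) (S.dForm F u c z) ![i, j]‖ ^ 2 ≤
      3 * (‖G i j‖ ^ 2 + ‖G j i‖ ^ 2) + (12 * n * E.b ^ 2 + 3 * F ^ 2 * E.C ^ 2) * N := by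
    intro i j
    set X : 𝕜 := ∑ k, ((1 / 2) * (frameChr E.A E.inv (S.gscMat c) i j k z +
      frameChr E.A E.inv (S.gscMat c) j i k z)) • E.comp u k z with hX
    set Y : 𝕜 := ∑ k, ((1 / 2) * (frameChr E.A E.inv (S.gMat c) i j k z +
      frameChr E.A E.inv (S.gMat c) j i k z)) • E.comp u k z with hY
    have e : tmap (E.A z) (S.dForm F u c z) ![i, j] = (1 / 2 : ℝ) • (G i j + G j i) +
        (X - Y) + (-(F / 2)) • (E.α i z • E.comp u j z + E.α j z • E.comp u i z) := by
      rw [tmap_dForm_eq E F u hz, Frame.sym]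
      simp only [hG, hX, hY, tmap_gradForm_eq E u hz, mul_smul, ← Finset.smul_sum, add_smul,
        Finset.sum_add_distrib]
      module
    have h1 := norm_add_sq_le_three ((1 / 2 : ℝ) • (G i j + G j i)) (X - Y)
      ((-(F / 2)) • (E.α i z • E.comp u j z + E.α j z • E.comp u i z))
    rw [← e, norm_smul_sq, norm_smul_sq] at h1
    have h2 := norm_add_sq_le_two (G i j) (G j i)
    have h3 := norm_add_sq_le_two (E.α i z • E.comp u j z) (E.α j z • E.comp u i z)
    rw [norm_smul_sq, norm_smul_sq] at h3
    have h4 : ‖X‖ ^ 2 ≤ n * E.b ^ 2 * N := E.norm_chr_sq_le u z fun k ↦ by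
      have h1 := abs_le.1 (E.chr_le i j k z hz)
      have h2 := abs_le.1 (E.chr_le j i k z hz)
      rw [abs_le]
      constructor <;> linarith [h1.1, h1.2, h2.1, h2.2]
    have h5 : ‖Y‖ ^ 2 ≤ n * E.b ^ 2 * N := E.norm_chr_sq_le u z fun k ↦ E.abs_half_chr_le hz i j k
    have h6 : ‖X - Y‖ ^ 2 ≤ 2 * ‖X‖ ^ 2 + 2 * ‖Y‖ ^ 2 := by
      have := norm_add_sq_le_two X (-Y)
      rwa [← sub_eq_add_neg, norm_neg] at this
    have h7 : ∀ i j, E.α i z ^ 2 * ‖E.comp u j z‖ ^ 2 ≤ E.C ^ 2 * N := fun i j ↦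
      mul_le_mul (sq_le_sq' (abs_le.1 (E.α_le i z hz)).1 (abs_le.1 (E.α_le i z hz)).2)
        (E.norm_comp_sq_le u z j) (sq_nonneg _) (sq_nonneg _)
    have h8 := h7 i j
    have h9 := h7 j i
    have h10 : (-(F / 2)) ^ 2 * ‖E.α i z • E.comp u j z + E.α j z • E.comp u i z‖ ^ 2 ≤
        (-(F / 2)) ^ 2 * (4 * (E.C ^ 2 * N)) :=
      mul_le_mul_of_nonneg_left (by linarith) (sq_nonneg _)
    have hb : 0 ≤ n * E.b ^ 2 * N := (sq_nonneg _).trans h5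
    nlinarith [sq_nonneg ‖G i j‖, sq_nonneg ‖G j i‖]
  have hsw : ∑ i, ∑ j, ‖G j i‖ ^ 2 = ∑ i, ∑ j, ‖G i j‖ ^ 2 := Finset.sum_comm
  refine (Finset.sum_le_sum fun i _ ↦ Finset.sum_le_sum fun j _ ↦ h i j).trans (le_of_eq ?_)
  simp only [Finset.sum_add_distrib, ← Finset.mul_sum, hsw, sum_sum_const]
  ring

section Cutoff

variable {β σ : Eu n → ℝ} (u : S.TestForm 𝕜)

theorem fd_cutoff (hβ : ContDiff ℝ ∞ β) (hz : z ∈ O ∩ {z | 0 < S.xi c z}) (i j : Fin n) :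
    fd E.A i (fun y ↦ β y • E.comp u j y) z =
      β z • fd E.A i (E.comp u j) z + fd E.A i β z • E.comp u j z :=
  fd_fun_smul (hβ.differentiable (by simp) z)
    (differentiableAt_of_open E.isOpen (E.contDiffOn_comp u j) hz) i

theorem cutoff_grad_le (hβ : ContDiff ℝ ∞ β) (hz : z ∈ O ∩ {z | 0 < S.xi c z})
    (hσ : ∀ i, fd E.A i β z ^ 2 ≤ σ z) :
    β z ^ 2 * E.nsq (gradForm S.gscMat u.comps) z ≤
      3 * (∑ i, ∑ j, ‖fd E.A i (fun y ↦ β y • E.comp u j y) z‖ ^ 2) +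
        n ^ 2 * (3 * n * E.b ^ 2 + 3) * (β z ^ 2 * E.nsq u.comps z + σ z * E.nsq u.comps z) := by
  set N := E.nsq u.comps z with hN
  have hN0 : 0 ≤ N := E.nsq_nonneg _ z
  have h0 : β z ^ 2 * E.nsq (gradForm S.gscMat u.comps) z =
      ∑ i, ∑ j, β z ^ 2 * ‖tmap (E.A z) (gradForm S.gscMat u.comps c z) ![i, j]‖ ^ 2 := by
    rw [nsq, sqn_two_rank]
    simp only [Finset.mul_sum]
  rw [h0]
  have h : ∀ i j : Fin n, β z ^ 2 * ‖tmap (E.A z) (gradForm S.gscMat u.comps c z) ![i, j]‖ ^ 2 ≤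
      3 * ‖fd E.A i (fun y ↦ β y • E.comp u j y) z‖ ^ 2 +
        (3 * n * E.b ^ 2 + 3) * (β z ^ 2 * N + σ z * N) := by
    intro i j
    rw [← norm_smul_sq]
    have e : β z • tmap (E.A z) (gradForm S.gscMat u.comps c z) ![i, j] =
        fd E.A i (fun y ↦ β y • E.comp u j y) z + (-fd E.A i β z) • E.comp u j z +
          (-β z) • ∑ k, frameChr E.A E.inv (S.gscMat c) i j k z • E.comp u k z := by
      rw [E.fd_cutoff u hβ hz, E.tmap_gradForm_eq u hz]
      module
    rw [e]
    refine (norm_add_sq_le_three _ _ _).trans ?_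
    rw [norm_smul_sq, norm_smul_sq, neg_sq, neg_sq]
    have h1 := E.norm_chr_sq_le u z fun k ↦ E.chr_le i j k z hz
    have h2 : fd E.A i β z ^ 2 * ‖E.comp u j z‖ ^ 2 ≤ σ z * N :=
      mul_le_mul (hσ i) (E.norm_comp_sq_le u z j) (sq_nonneg _) ((sq_nonneg _).trans (hσ i))
    have h3 := mul_le_mul_of_nonneg_left h1 (sq_nonneg (β z))
    have h4 : 0 ≤ σ z * N := mul_nonneg ((sq_nonneg _).trans (hσ i)) hN0
    have h5 : 0 ≤ β z ^ 2 * N := mul_nonneg (sq_nonneg _) hN0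
    have h6 : 0 ≤ n * E.b ^ 2 * (σ z * N) := by positivity
    nlinarith
  refine (Finset.sum_le_sum fun i _ ↦ Finset.sum_le_sum fun j _ ↦ h i j).trans (le_of_eq ?_)
  simp only [Finset.sum_add_distrib, ← Finset.mul_sum, sum_sum_const]
  ring

theorem cutoff_sym_le (F : ℝ) (hβ : ContDiff ℝ ∞ β) (hz : z ∈ O ∩ {z | 0 < S.xi c z})
    (hσ : ∀ i, fd E.A i β z ^ 2 ≤ σ z) :
    ∑ i, ∑ j, ‖E.sym F (fun j y ↦ β y • E.comp u j y) i j z‖ ^ 2 ≤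
      3 * (β z ^ 2 * E.nsq (S.dForm F u) z) +
        n ^ 2 * (3 * n * E.b ^ 2 + 3) * (β z ^ 2 * E.nsq u.comps z + σ z * E.nsq u.comps z) := by
  set N := E.nsq u.comps z with hN
  have hN0 : 0 ≤ N := E.nsq_nonneg _ z
  have h : ∀ i j : Fin n, ‖E.sym F (fun j y ↦ β y • E.comp u j y) i j z‖ ^ 2 ≤
      3 * (β z ^ 2 * ‖tmap (E.A z) (S.dForm F u c z) ![i, j]‖ ^ 2) +
        (3 * n * E.b ^ 2 + 3) * (β z ^ 2 * N + σ z * N) := by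
    intro i j
    have e : E.sym F (fun j y ↦ β y • E.comp u j y) i j z =
        β z • tmap (E.A z) (S.dForm F u c z) ![i, j] +
        β z • (∑ k, ((1 / 2) * (frameChr E.A E.inv (S.gMat c) i j k z +
          frameChr E.A E.inv (S.gMat c) j i k z)) • E.comp u k z) +
        (1 / 2 : ℝ) • (fd E.A i β z • E.comp u j z + fd E.A j β z • E.comp u i z) := by
      rw [E.tmap_dForm_eq F u hz, Frame.sym, Frame.sym, E.fd_cutoff u hβ hz, E.fd_cutoff u hβ hz]
      module
    rw [e]
    refine (norm_add_sq_le_three _ _ _).trans ?_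
    rw [norm_smul_sq, norm_smul_sq, norm_smul_sq]
    have h1 := E.norm_chr_sq_le u z fun k ↦ E.abs_half_chr_le hz i j k
    have h2 : ∀ i j, fd E.A i β z ^ 2 * ‖E.comp u j z‖ ^ 2 ≤ σ z * N := fun i j ↦
      mul_le_mul (hσ i) (E.norm_comp_sq_le u z j) (sq_nonneg _) ((sq_nonneg _).trans (hσ i))
    have h3 := mul_le_mul_of_nonneg_left h1 (sq_nonneg (β z))
    have h7 := norm_add_sq_le_two (fd E.A i β z • E.comp u j z) (fd E.A j β z • E.comp u i z)
    rw [norm_smul_sq, norm_smul_sq] at h7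
    have h8 := h2 i j
    have h9 := h2 j i
    have h4 : 0 ≤ σ z * N := mul_nonneg ((sq_nonneg _).trans (hσ i)) hN0
    have h5 : 0 ≤ β z ^ 2 * N := mul_nonneg (sq_nonneg _) hN0
    have h6 : 0 ≤ n * E.b ^ 2 * (σ z * N) := by positivity
    nlinarith
  refine (Finset.sum_le_sum fun i _ ↦ Finset.sum_le_sum fun j _ ↦ h i j).trans (le_of_eq ?_)
  rw [nsq, sqn_two_rank]
  simp only [Finset.sum_add_distrib, ← Finset.mul_sum, sum_sum_const]
  ring

end Cutoff

end ScFrame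

end Region


namespace Region

attribute [-instance] TopCat.of.chartedSpace

variable {n : ℕ} {M : Type*} [TopologicalSpace M] [ChartedSpace (Eu n) M]
  [IsManifold (𝓡 n) ∞ M] [T2Space M] [SigmaCompactSpace M] {S : Region n M}
  {𝕜 : Type*} [RCLike 𝕜]

namespace ScFrame

variable {c : M} {O : Set (Eu n)} (E : S.ScFrame c O)

/-- A cutoff function `β` over `O`, and a function `σ` that dominates the squares of the
derivatives of `β` along the frame. -/
structure Cutoff (β σ : Eu n → ℝ) (T : Set (Eu n)) : Prop where
  isCompact : IsCompact T
  subset : T ⊆ O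
  smooth : ContDiff ℝ ∞ β
  continuous : Continuous σ
  nonneg : ∀ z, 0 ≤ σ z
  eq_zero : ∀ z ∉ T, β z = 0
  eq_zero' : ∀ z ∉ T, σ z = 0
  fd_le : ∀ i, ∀ z ∈ O ∩ {z | 0 < S.xi c z}, fd E.A i β z ^ 2 ≤ σ z

variable {E} {β σ : Eu n → ℝ} {T : Set (Eu n)}

theorem Cutoff.sq_eq_zero (hc : E.Cutoff β σ T) : ∀ z ∉ T, β z ^ 2 = 0 := fun z hz ↦ by
  rw [hc.eq_zero z hz, zero_pow two_ne_zero]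

theorem Cutoff.continuous_sq (hc : E.Cutoff β σ T) : Continuous fun z ↦ β z ^ 2 :=
  hc.smooth.continuous.pow 2

/-- Korn's inequality for a test one-form in a frame, with a cutoff function. -/
theorem exists_korn_form (E : S.ScFrame c O) (𝕜 : Type*) [RCLike 𝕜] :
    ∃ K, 0 ≤ K ∧ ∀ F : ℝ, 0 ≤ F → ∀ (β σ : Eu n → ℝ) (T : Set (Eu n)), E.Cutoff β σ T →
      ∀ a : ℝ, (∀ z ∈ O ∩ {z | 0 < S.xi c z}, a ≤ ∑ i, E.α i z ^ 2) → ∀ u : S.TestForm 𝕜,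
      (∫ z, E.w z * (β z ^ 2 * E.nsq (gradForm S.gscMat u.comps) z)) +
        F ^ 2 * a * (∫ z, E.w z * (β z ^ 2 * E.nsq u.comps z)) ≤
      K * (∫ z, E.w z * (β z ^ 2 * E.nsq (S.dForm F u) z)) +
        K * (1 + F) * (∫ z, E.w z * (β z ^ 2 * E.nsq u.comps z)) +
        K * (1 + F) * ∫ z, E.w z * (σ z * E.nsq u.comps z) := by
  obtain ⟨K, hK, hkorn⟩ := E.korn (𝕜 := 𝕜)
  set k₁ : ℝ := n ^ 2 * (3 * n * E.b ^ 2 + 3) with hk₁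
  have hk₁0 : 0 ≤ k₁ := by positivity
  refine ⟨3 * K * 3 + 3 * K * k₁ + 3 * K + k₁, by positivity, fun F hF β σ T hc a ha u ↦ ?_⟩
  have hu0 := S.isTest_comps_form u
  have hG0 := S.isTest_gradForm u
  have hD0 := S.isTest_dForm F u
  have iG := E.integrable_nsq hG0 hc.continuous_sq hc.isCompact hc.subset hc.sq_eq_zero
  have iU := E.integrable_nsq hu0 hc.continuous_sq hc.isCompact hc.subset hc.sq_eq_zero
  have iD := E.integrable_nsq hD0 hc.continuous_sq hc.isCompact hc.subset hc.sq_eq_zero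
  have iσ := E.integrable_nsq hu0 hc.continuous hc.isCompact hc.subset hc.eq_zero'
  obtain ⟨Kc, hKc, hKcc, hz0⟩ : ∃ K ⊆ S.dom, IsCompact K ∧ ∀ p ∉ K, u.1 p = 0 := u.2.2
  have hu_off : ∀ z, (chartAt (Eu n) c).symm z ∉ Kc → ∀ I, u.comps c z I = 0 := fun z hz I ↦ by
    simp [TestForm.comps, compsForm, hz0 _ hz]
  have hTc : T ⊆ (chartAt (Eu n) c).target := hc.subset.trans E.subset_target
  set T' := T ∩ (chartAt (Eu n) c).symm ⁻¹' Kc with hT'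
  have hT'c : IsCompact T' := isCompact_inter_symm_preimage hc.isCompact hTc hKcc
  have hT'Z : T' ⊆ O ∩ {z | 0 < S.xi c z} := fun z hz ↦ ⟨hc.subset hz.1, (hKc hz.2).1⟩
  set V : Fin n → Eu n → 𝕜 := fun j y ↦ β y • E.comp u j y with hV
  have hVs : ∀ j, ContDiffOn ℝ ∞ (V j) (O ∩ {z | 0 < S.xi c z}) := fun j ↦
    hc.smooth.contDiffOn.smul (E.contDiffOn_comp u j)
  have hV0 : ∀ j, ∀ z ∉ T', V j z = 0 := by
    intro j z hz
    by_cases hzT : z ∈ T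
    · have h : E.comp u j z = 0 := by
        simp [comp, frameComp, hu_off z fun h ↦ hz ⟨hzT, h⟩]
      simp only [hV, h, smul_zero]
    · simp only [hV, hc.eq_zero z hzT, zero_smul]
  have hk := hkorn F hF T' hT'c hT'Z V hVs hV0
  have hfd0 : ∀ i j, ∀ z ∉ T', fd E.A i (V j) z = 0 := fun i j ↦
    fd_eq_zero_of_off hT'c.isClosed (hV0 j) i
  have hfdc : ∀ i j, ContinuousOn (fd E.A i (V j)) (O ∩ {z | 0 < S.xi c z}) := fun i j ↦
    (contDiffOn_fd E.isOpen E.A_smooth (hVs j) i).continuousOn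
  have iL : Integrable fun z ↦ E.w z * ((∑ i, ∑ j, ‖fd E.A i (V j) z‖ ^ 2) +
      F ^ 2 * ((∑ i, E.α i z ^ 2) * ∑ j, ‖V j z‖ ^ 2)) := by
    refine E.integrable_mul hT'c hT'Z ?_ fun z hz ↦ by simp [hfd0 _ _ z hz, hV0 _ z hz]
    refine ContinuousOn.add (continuousOn_finsetSum _ fun i _ ↦ continuousOn_finsetSum _ fun j _ ↦
      (hfdc i j).norm.pow 2) (continuousOn_const.mul (ContinuousOn.mul
        (continuousOn_finsetSum _ fun i _ ↦ (E.α_smooth i).continuousOn.pow 2)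
        (continuousOn_finsetSum _ fun j _ ↦ (hVs j).continuousOn.norm.pow 2)))
  have iR : Integrable fun z ↦ E.w z * ∑ i, ∑ j, ‖E.sym F V i j z‖ ^ 2 := by
    refine E.integrable_mul hT'c hT'Z ?_ fun z hz ↦ by simp [E.sym_eq_zero hT'c hV0 _ _ hz]
    exact continuousOn_finsetSum _ fun i _ ↦ continuousOn_finsetSum _ fun j _ ↦
      (E.continuousOn_sym hVs i j).norm.pow 2
  have hVN : ∀ z, ∑ j, ‖V j z‖ ^ 2 = β z ^ 2 * E.nsq u.comps z := by
    intro z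
    rw [nsq_form, Finset.mul_sum]
    exact Finset.sum_congr rfl fun j _ ↦ norm_smul_sq _ _
  -- off `O ∩ {x > 0}` all the integrands vanish
  have hoff : ∀ z ∉ O ∩ {z | 0 < S.xi c z}, z ∉ T' ∧ (z ∉ T ∨ (E.nsq u.comps z = 0 ∧
      E.nsq (gradForm S.gscMat u.comps) z = 0 ∧ E.nsq (S.dForm F u) z = 0)) := by
    intro z hz
    refine ⟨fun h ↦ hz (hT'Z h), ?_⟩
    by_cases hzT : z ∈ T
    · right
      have hd : (chartAt (Eu n) c).symm z ∉ S.dom := fun h ↦ hz ⟨hc.subset hzT, h.1⟩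
      have key : ∀ {r : ℕ} {s : Comps n M 𝕜 r}, S.IsTest s → E.nsq s z = 0 := by
        rintro r s ⟨K, hK, -, h0, -⟩
        exact E.nsq_eq_zero (h0 c z (hTc hzT) fun h ↦ hd (hK h))
      exact ⟨key hu0, key hG0, key hD0⟩
    · exact Or.inl hzT
  have p1 : ∀ z, E.w z * (β z ^ 2 * E.nsq (gradForm S.gscMat u.comps) z) +
      F ^ 2 * a * (E.w z * (β z ^ 2 * E.nsq u.comps z)) ≤
      3 * (E.w z * ((∑ i, ∑ j, ‖fd E.A i (V j) z‖ ^ 2) +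
        F ^ 2 * ((∑ i, E.α i z ^ 2) * ∑ j, ‖V j z‖ ^ 2))) +
      (k₁ * (E.w z * (β z ^ 2 * E.nsq u.comps z)) + k₁ * (E.w z * (σ z * E.nsq u.comps z))) := by
    intro z
    by_cases hz : z ∈ O ∩ {z | 0 < S.xi c z}
    · have h1 := E.cutoff_grad_le u hc.smooth hz (fun i ↦ hc.fd_le i z hz)
      have hw := E.w_pos z hz
      have hN : 0 ≤ β z ^ 2 * E.nsq u.comps z := mul_nonneg (sq_nonneg _) (E.nsq_nonneg _ z)
      have h2 : F ^ 2 * a * (β z ^ 2 * E.nsq u.comps z) ≤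
          3 * (F ^ 2 * ((∑ i, E.α i z ^ 2) * ∑ j, ‖V j z‖ ^ 2)) := by
        rw [hVN]
        have h3 := mul_le_mul_of_nonneg_left (mul_le_mul_of_nonneg_right (ha z hz) hN) (sq_nonneg F)
        have h4 : 0 ≤ F ^ 2 * ((∑ i, E.α i z ^ 2) * (β z ^ 2 * E.nsq u.comps z)) :=
          mul_nonneg (sq_nonneg _) (mul_nonneg (Finset.sum_nonneg fun _ _ ↦ sq_nonneg _) hN)
        linarith
      have h5 := mul_le_mul_of_nonneg_left (add_le_add h1 h2) hw.le
      linarith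
    · obtain ⟨h1, h2 | ⟨h2, h3, h4⟩⟩ := hoff z hz
      · simp [hfd0 _ _ z h1, hV0 _ z h1, hc.eq_zero z h2, hc.eq_zero' z h2]
      · simp [hfd0 _ _ z h1, hV0 _ z h1, h2, h3]
  have p2 : ∀ z, E.w z * (∑ i, ∑ j, ‖E.sym F V i j z‖ ^ 2) ≤
      3 * (E.w z * (β z ^ 2 * E.nsq (S.dForm F u) z)) +
      (k₁ * (E.w z * (β z ^ 2 * E.nsq u.comps z)) + k₁ * (E.w z * (σ z * E.nsq u.comps z))) := by
    intro z
    by_cases hz : z ∈ O ∩ {z | 0 < S.xi c z}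
    · have h1 := E.cutoff_sym_le u F hc.smooth hz (fun i ↦ hc.fd_le i z hz)
      have h5 := mul_le_mul_of_nonneg_left h1 (E.w_pos z hz).le
      linarith
    · obtain ⟨h1, h2 | ⟨h2, h3, h4⟩⟩ := hoff z hz
      · simp [E.sym_eq_zero hT'c hV0 _ _ h1, hc.eq_zero z h2, hc.eq_zero' z h2]
      · simp [E.sym_eq_zero hT'c hV0 _ _ h1, h2, h4]
  have iS : Integrable fun z ↦ k₁ * (E.w z * (β z ^ 2 * E.nsq u.comps z)) +
      k₁ * (E.w z * (σ z * E.nsq u.comps z)) := (iU.const_mul k₁).add (iσ.const_mul k₁)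
  have q1 := integral_mono (iG.add (iU.const_mul (F ^ 2 * a))) ((iL.const_mul 3).add iS) p1
  have q2 := integral_mono iR ((iD.const_mul 3).add iS) p2
  simp only [Pi.add_apply] at q1 q2
  rw [integral_add iG (iU.const_mul (F ^ 2 * a)), integral_const_mul,
    integral_add (iL.const_mul 3) iS,
    integral_const_mul 3, integral_add (iU.const_mul k₁) (iσ.const_mul k₁), integral_const_mul k₁,
    integral_const_mul k₁] at q1
  rw [integral_add (iD.const_mul 3) iS,
    integral_const_mul 3, integral_add (iU.const_mul k₁) (iσ.const_mul k₁), integral_const_mul k₁,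
    integral_const_mul k₁] at q2
  simp only [hVN] at hk q1
  have nonneg : ∀ {r : ℕ} {s : Comps n M 𝕜 r} {f : Eu n → ℝ}, S.IsTest s → (∀ z, 0 ≤ f z) →
      (∀ z ∉ T, f z = 0) → 0 ≤ ∫ z, E.w z * (f z * E.nsq s z) := by
    intro r s f hs hf hf0
    refine integral_nonneg fun z ↦ ?_
    by_cases hz : z ∈ O ∩ {z | 0 < S.xi c z}
    · exact mul_nonneg (E.w_pos z hz).le (mul_nonneg (hf z) (E.nsq_nonneg _ z))
    · by_cases hzT : z ∈ T
      · have hd : (chartAt (Eu n) c).symm z ∉ S.dom := fun h ↦ hz ⟨hc.subset hzT, h.1⟩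
        obtain ⟨K, hK, -, h0, -⟩ := hs
        simp [E.nsq_eq_zero (h0 c z (hTc hzT) fun h ↦ hd (hK h))]
      · simp [hf0 z hzT]
  have n1 := nonneg hD0 (fun z ↦ sq_nonneg (β z)) hc.sq_eq_zero
  have n2 := nonneg hu0 (fun z ↦ sq_nonneg (β z)) hc.sq_eq_zero
  have n3 := nonneg hu0 hc.nonneg hc.eq_zero'
  set IG := ∫ z, E.w z * (β z ^ 2 * E.nsq (gradForm S.gscMat u.comps) z)
  set IU := ∫ z, E.w z * (β z ^ 2 * E.nsq u.comps z)
  set ID := ∫ z, E.w z * (β z ^ 2 * E.nsq (S.dForm F u) z)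
  set Iσ := ∫ z, E.w z * (σ z * E.nsq u.comps z)
  have q3 := mul_le_mul_of_nonneg_left q2 hK
  have hFU : 0 ≤ F * IU := mul_nonneg hF n2
  have hFσ : 0 ≤ F * Iσ := mul_nonneg hF n3
  have hKk := mul_nonneg hK hk₁0
  linarith [mul_nonneg hKk n1, mul_nonneg hK n1, mul_nonneg hk₁0 n1, mul_nonneg hK n2,
    mul_nonneg hKk hFU, mul_nonneg hK hFU, mul_nonneg hk₁0 hFU, mul_nonneg hK n3,
    mul_nonneg hKk hFσ, mul_nonneg hK hFσ, mul_nonneg hk₁0 hFσ]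

/-- The weighted integral of `β² |u|²` for a function is controlled, if the twisting covector field
is a unit covector field of the frame. -/
theorem twisted_fun_le {i₀ : Fin n} (hα : ∀ z ∈ O ∩ {z | 0 < S.xi c z}, E.α i₀ z = 1) {B : ℝ}
    (hdiv : ∀ z ∈ O ∩ {z | 0 < S.xi c z}, |E.div i₀ z| ≤ B * S.xi c z)
    (hc : E.Cutoff β σ T) (hξ : ∀ z ∈ O ∩ {z | 0 < S.xi c z}, S.xi c z ^ 2 * β z ^ 2 ≤ σ z)
    {F : ℝ} (hF : 0 ≤ F) (u : S.TestFun 𝕜) :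
    F ^ 2 * (∫ z, E.w z * (β z ^ 2 * E.nsq u.comps z)) ≤
      4 * (∫ z, E.w z * (β z ^ 2 * E.nsq (S.dFun F u) z)) +
        (4 + B ^ 2) * ∫ z, E.w z * (σ z * E.nsq u.comps z) := by
  have hu0 := S.isTest_comps_fun u
  have hD0 := S.isTest_dFun F u
  have iU := E.integrable_nsq hu0 hc.continuous_sq hc.isCompact hc.subset hc.sq_eq_zero
  have iD := E.integrable_nsq hD0 hc.continuous_sq hc.isCompact hc.subset hc.sq_eq_zero
  have iσ := E.integrable_nsq hu0 hc.continuous hc.isCompact hc.subset hc.eq_zero'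
  obtain ⟨Kc, hKc, hKcc, hz0⟩ : ∃ K ⊆ S.dom, IsCompact K ∧ ∀ p ∉ K, u.1 p = 0 := u.2.2
  have hu_off : ∀ z, (chartAt (Eu n) c).symm z ∉ Kc → ∀ I, u.comps c z I = 0 := fun z hz I ↦
    hz0 _ hz
  have hTc : T ⊆ (chartAt (Eu n) c).target := hc.subset.trans E.subset_target
  set T' := T ∩ (chartAt (Eu n) c).symm ⁻¹' Kc with hT'
  have hT'c : IsCompact T' := isCompact_inter_symm_preimage hc.isCompact hTc hKcc
  have hT'Z : T' ⊆ O ∩ {z | 0 < S.xi c z} := fun z hz ↦ ⟨hc.subset hz.1, (hKc hz.2).1⟩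
  set V : Eu n → 𝕜 := fun y ↦ β y • u.comps c y ![] with hV
  have hVs : ContDiffOn ℝ ∞ V (O ∩ {z | 0 < S.xi c z}) :=
    hc.smooth.contDiffOn.smul (E.contDiffOn_fun u)
  have hV0 : ∀ z ∉ T', V z = 0 := by
    intro z hz
    by_cases hzT : z ∈ T
    · simp only [hV, hu_off z fun h ↦ hz ⟨hzT, h⟩, smul_zero]
    · simp only [hV, hc.eq_zero z hzT, zero_smul]
  have htw := E.integral_twisted i₀ (F := F) hT'c hT'Z hVs hV0
  have hfd0 := fd_eq_zero_of_off hT'c.isClosed hV0 (A := E.A) i₀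
  have hfdc : ContinuousOn (fd E.A i₀ V) (O ∩ {z | 0 < S.xi c z}) :=
    (contDiffOn_fd E.isOpen E.A_smooth hVs i₀).continuousOn
  have hVN : ∀ z, ‖V z‖ ^ 2 = β z ^ 2 * E.nsq u.comps z := fun z ↦ by
    rw [nsq_fun]
    exact norm_smul_sq _ _
  have hdivc : ContinuousOn (E.div i₀) (O ∩ {z | 0 < S.xi c z}) := by
    have h : ContinuousOn (fun z ↦ (∑ a, pderiv a (fun y ↦ E.A y i₀ a * E.w y) z) / E.w z)
        (O ∩ {z | 0 < S.xi c z}) :=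
      (continuousOn_finsetSum _ fun a _ ↦ (contDiffOn_pderiv E.isOpen
        ((E.A_smooth i₀ a).mul E.w_smooth) a).continuousOn).div E.w_smooth.continuousOn
        fun z hz ↦ (E.w_pos z hz).ne'
    refine h.congr fun z hz ↦ ?_
    exact (eq_div_iff (E.w_pos z hz).ne').2 (by rw [mul_comm]; exact (E.div_eq i₀ z hz).symm)
  have i1 : Integrable fun z ↦ E.w z * (‖fd E.A i₀ V z‖ ^ 2 + F ^ 2 * ‖V z‖ ^ 2) :=
    E.integrable_mul hT'c hT'Z ((hfdc.norm.pow 2).add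
      (continuousOn_const.mul (hVs.continuousOn.norm.pow 2))) fun z hz ↦ by
        simp [hfd0 z hz, hV0 z hz]
  have i2 : Integrable fun z ↦ E.w z * ‖fd E.A i₀ V z - F • V z‖ ^ 2 :=
    E.integrable_mul hT'c hT'Z ((hfdc.sub (hVs.continuousOn.const_smul F)).norm.pow 2)
      fun z hz ↦ by simp [hfd0 z hz, hV0 z hz]
  have i3 : Integrable fun z ↦ E.w z * (E.div i₀ z * ‖V z‖ ^ 2) :=
    E.integrable_mul hT'c hT'Z (hdivc.mul (hVs.continuousOn.norm.pow 2))
      fun z hz ↦ by simp [hV0 z hz]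
  have hoff : ∀ z ∉ O ∩ {z | 0 < S.xi c z}, z ∉ T' ∧ (z ∉ T ∨ (E.nsq u.comps z = 0 ∧
      E.nsq (S.dFun F u) z = 0)) := by
    intro z hz
    refine ⟨fun h ↦ hz (hT'Z h), ?_⟩
    by_cases hzT : z ∈ T
    · right
      have hd : (chartAt (Eu n) c).symm z ∉ S.dom := fun h ↦ hz ⟨hc.subset hzT, h.1⟩
      have key : ∀ {r : ℕ} {s : Comps n M 𝕜 r}, S.IsTest s → E.nsq s z = 0 := by
        rintro r s ⟨K, hK, -, h0, -⟩
        exact E.nsq_eq_zero (h0 c z (hTc hzT) fun h ↦ hd (hK h))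
      exact ⟨key hu0, key hD0⟩
    · exact Or.inl hzT
  have p1 : ∀ z, F ^ 2 * (E.w z * (β z ^ 2 * E.nsq u.comps z)) ≤
      E.w z * (‖fd E.A i₀ V z‖ ^ 2 + F ^ 2 * ‖V z‖ ^ 2) := by
    intro z
    rw [hVN]
    by_cases hz : z ∈ O ∩ {z | 0 < S.xi c z}
    · have := mul_nonneg (E.w_pos z hz).le (sq_nonneg ‖fd E.A i₀ V z‖)
      linarith
    · obtain ⟨h1, h2 | ⟨h2, h3⟩⟩ := hoff z hz
      · simp [hfd0 z h1, hc.eq_zero z h2]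
      · simp [hfd0 z h1, h2]
  have p2 : ∀ z, E.w z * ‖fd E.A i₀ V z - F • V z‖ ^ 2 - F * (E.w z * (E.div i₀ z * ‖V z‖ ^ 2)) ≤
      2 * (E.w z * (β z ^ 2 * E.nsq (S.dFun F u) z)) +
        (F ^ 2 / 2 * (E.w z * (β z ^ 2 * E.nsq u.comps z)) +
          (2 + B ^ 2 / 2) * (E.w z * (σ z * E.nsq u.comps z))) := by
    intro z
    by_cases hz : z ∈ O ∩ {z | 0 < S.xi c z}
    · have hw := E.w_pos z hz
      set N := E.nsq u.comps z with hN
      have hN0 : 0 ≤ N := E.nsq_nonneg _ z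
      have e : fd E.A i₀ V z - F • V z = β z • tmap (E.A z) (S.dFun F u c z) ![i₀] +
          fd E.A i₀ β z • u.comps c z ![] := by
        rw [E.tmap_dFun_eq F u hz, hα z hz, hV, fd_fun_smul
          (hc.smooth.differentiable (by simp) z)
          (differentiableAt_of_open E.isOpen (E.contDiffOn_fun u) hz)]
        module
      have h1 := norm_add_sq_le_two (β z • tmap (E.A z) (S.dFun F u c z) ![i₀])
        (fd E.A i₀ β z • u.comps c z ![])
      rw [← e, norm_smul_sq, norm_smul_sq, ← E.nsq_fun, ← hN] at h1
      have h2 : ‖tmap (E.A z) (S.dFun F u c z) ![i₀]‖ ^ 2 ≤ E.nsq (S.dFun F u) z := by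
        rw [nsq, sqn_one_rank]
        exact Finset.single_le_sum (f := fun i ↦ ‖tmap (E.A z) (S.dFun F u c z) ![i]‖ ^ 2)
          (fun _ _ ↦ sq_nonneg _) (Finset.mem_univ i₀)
      have h3 := mul_le_mul_of_nonneg_left h2 (sq_nonneg (β z))
      have h4 := mul_le_mul_of_nonneg_right (hc.fd_le i₀ z hz) hN0
      have h5 : -(F * (E.div i₀ z * (β z ^ 2 * N))) ≤
          F ^ 2 / 2 * (β z ^ 2 * N) + B ^ 2 / 2 * (σ z * N) := by
        have h6 : -(F * E.div i₀ z) ≤ F ^ 2 / 2 + B ^ 2 / 2 * S.xi c z ^ 2 := by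
          have h7 := (abs_le.1 (hdiv z hz)).1
          nlinarith [sq_nonneg (F - B * S.xi c z)]
        have h8 := mul_le_mul_of_nonneg_right h6 (mul_nonneg (sq_nonneg (β z)) hN0)
        have h9 := mul_le_mul_of_nonneg_left (mul_le_mul_of_nonneg_right (hξ z hz) hN0)
          (by positivity : 0 ≤ B ^ 2 / 2)
        linarith
      rw [hVN]
      have h10 : ‖fd E.A i₀ V z - F • V z‖ ^ 2 - F * (E.div i₀ z * (β z ^ 2 * N)) ≤
          2 * (β z ^ 2 * E.nsq (S.dFun F u) z) + (F ^ 2 / 2 * (β z ^ 2 * N) +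
            (2 + B ^ 2 / 2) * (σ z * N)) := by linarith
      have h11 := mul_le_mul_of_nonneg_left h10 hw.le
      linarith
    · obtain ⟨h1, h2 | ⟨h2, h3⟩⟩ := hoff z hz
      · simp [hfd0 z h1, hV0 z h1, hc.eq_zero z h2, hc.eq_zero' z h2]
      · simp [hfd0 z h1, hV0 z h1, h2, h3]
  have iS : Integrable fun z ↦ F ^ 2 / 2 * (E.w z * (β z ^ 2 * E.nsq u.comps z)) +
      (2 + B ^ 2 / 2) * (E.w z * (σ z * E.nsq u.comps z)) :=
    (iU.const_mul (F ^ 2 / 2)).add (iσ.const_mul (2 + B ^ 2 / 2))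
  have q1 := integral_mono (iU.const_mul (F ^ 2)) i1 p1
  have q2 := integral_mono (i2.sub (i3.const_mul F)) ((iD.const_mul 2).add iS) p2
  simp only [Pi.add_apply, Pi.sub_apply] at q2
  rw [integral_const_mul] at q1
  rw [integral_sub i2 (i3.const_mul F), integral_const_mul F, integral_add (iD.const_mul 2) iS,
    integral_const_mul 2,
    integral_add (iU.const_mul (F ^ 2 / 2)) (iσ.const_mul (2 + B ^ 2 / 2)),
    integral_const_mul, integral_const_mul] at q2
  linarith

end ScFrame

end Region


theorem exists_eventually_abs_le {X ι : Type*} [TopologicalSpace X] [Finite ι] {f : ι → X → ℝ}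
    {z₀ : X} (h : ∀ i, ContinuousAt (f i) z₀) :
    ∃ b, 0 ≤ b ∧ ∀ᶠ z in 𝓝 z₀, ∀ i, |f i z| ≤ b := by
  cases nonempty_fintype ι
  refine ⟨∑ i, (|f i z₀| + 1), by positivity, ?_⟩
  rw [Filter.eventually_all]
  intro i
  have h1 := (h i).abs.eventually (gt_mem_nhds (lt_add_one _))
  filter_upwards [h1] with z hz
  exact hz.le.trans (Finset.single_le_sum (f := fun i ↦ |f i z₀| + 1) (fun _ _ ↦ by positivity)
    (Finset.mem_univ i))

section Matrices

variable {n : ℕ} {G : Eu n → Matrix (Fin n) (Fin n) ℝ} {z₀ : Eu n}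

theorem continuousAt_matrix (h : ∀ i j, ContinuousAt (fun z ↦ G z i j) z₀) : ContinuousAt G z₀ :=
  continuousAt_pi.2 fun i ↦ continuousAt_pi.2 fun j ↦ h i j

theorem continuousAt_matrix_det (h : ∀ i j, ContinuousAt (fun z ↦ G z i j) z₀) :
    ContinuousAt (fun z ↦ (G z).det) z₀ :=
  ContinuousAt.comp (g := Matrix.det) (continuous_id.matrix_det).continuousAt
    (continuousAt_matrix h)

theorem continuousAt_matrix_inv (h : ∀ i j, ContinuousAt (fun z ↦ G z i j) z₀)
    (hdet : (G z₀).det ≠ 0) (i j : Fin n) : ContinuousAt (fun z ↦ (G z)⁻¹ i j) z₀ := by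
  have h1 : ContinuousAt (fun z ↦ (G z).adjugate i j) z₀ :=
    ContinuousAt.comp (g := fun A : Matrix (Fin n) (Fin n) ℝ ↦ A.adjugate i j)
      (continuous_id.matrix_adjugate.matrix_elem i j).continuousAt (continuousAt_matrix h)
  have h2 := ((continuousAt_matrix_det h).inv₀ hdet).mul h1
  refine h2.congr (Filter.Eventually.of_forall fun z ↦ ?_)
  simp [Matrix.inv_def]

theorem continuousAt_of_open {F : Type*} [NormedAddCommGroup F] [NormedSpace ℝ F]
    {Z : Set (Eu n)} (hZ : IsOpen Z) {f : Eu n → F} (hf : ContDiffOn ℝ ∞ f Z) (hz : z₀ ∈ Z) :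
    ContinuousAt f z₀ := hf.continuousOn.continuousAt (hZ.mem_nhds hz)

theorem continuousAt_christoffel {Z : Set (Eu n)} (hZ : IsOpen Z)
    (h : ∀ i j, ContDiffOn ℝ ∞ (fun z ↦ G z i j) Z) (hz : z₀ ∈ Z) (hdet : (G z₀).det ≠ 0)
    (k i j : Fin n) : ContinuousAt (christoffel G k i j) z₀ := by
  have hp : ∀ a b d, ContinuousAt (fun z ↦ pderiv a (fun w ↦ G w b d) z) z₀ := fun a b d ↦
    continuousAt_of_open hZ (Region.contDiffOn_pderiv hZ (h b d) a) hz
  have hi := continuousAt_matrix_inv (fun i j ↦ continuousAt_of_open hZ (h i j) hz) hdet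
  exact continuousAt_const.mul (tendsto_finsetSum _ fun l _ ↦
    (hi k l).mul (((hp i j l).add (hp j i l)).sub (hp l i j)))

end Matrices

namespace Region

attribute [-instance] TopCat.of.chartedSpace

variable {n : ℕ} {M : Type*} [TopologicalSpace M] [ChartedSpace (Eu n) M]
  [IsManifold (𝓡 n) ∞ M] [T2Space M] [SigmaCompactSpace M] (S : Region n M)

theorem frameChr_one (G : Eu n → Matrix (Fin n) (Fin n) ℝ) (i j k : Fin n) (z : Eu n) :
    frameChr (fun _ ↦ 1) (fun _ ↦ 1) G i j k z = christoffel G k i j z := by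
  simp [frameChr, fd, pderiv, Matrix.one_apply]

theorem fd_one {F : Type*} [NormedAddCommGroup F] [NormedSpace ℝ F] (i : Fin n) (f : Eu n → F)
    (z : Eu n) : fd (fun _ ↦ 1) i f z = pderiv i f z := by
  simp [fd, Matrix.one_apply]

/-- Near an interior point the coordinate vector fields are a frame. -/
theorem exists_frame_interior {p : M} (hp : 0 < S.x p) :
    ∃ R > 0, ∃ E : S.ScFrame p (Metric.ball (chartAt (Eu n) p p) R),
      Metric.ball (chartAt (Eu n) p p) R ⊆ S.posDom p ∧ E.A = (fun _ ↦ 1) ∧ E.w = fun _ ↦ 1 := by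
  set z₀ := chartAt (Eu n) p p with hz₀
  have hpU : z₀ ∈ S.posDom p := by
    refine ⟨mem_chart_target _ p, ?_⟩
    simpa [xi, hz₀] using hp
  have hU := S.isOpen_posDom p
  have hξ := (S.contDiffOn_xi p).mono (inter_subset_left : S.posDom p ⊆ _)
  set α : Fin n → Eu n → ℝ := fun i z ↦ pderiv i (S.xi p) z / S.xi p z ^ 2 with hα
  have hαs : ∀ i, ContDiffOn ℝ ∞ (α i) (S.posDom p) := fun i ↦
    (contDiffOn_pderiv hU hξ i).div (hξ.pow 2) fun z hz ↦ pow_ne_zero _ (ne_of_gt hz.2)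
  have hG : ∀ i j, ContDiffOn ℝ ∞ (fun z ↦ S.gscMat p z i j) (S.posDom p) := fun i j ↦
    S.contDiffOn_gscMat_posDom p i j
  have hg : ∀ i j, ContDiffOn ℝ ∞ (fun z ↦ S.gMat p z i j) (S.posDom p) := fun i j ↦
    (S.contDiffOn_gMat p i j).mono inter_subset_left
  have hG0 := (S.posDef_gscMat_posDom p hpU).det_pos
  have hGc := fun i j ↦ continuousAt_of_open hU (hG i j) hpU
  obtain ⟨b₁, hb₁, e₁⟩ := exists_eventually_abs_le fun i ↦ continuousAt_of_open hU (hαs i) hpU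
  obtain ⟨b₂, hb₂, e₂⟩ := exists_eventually_abs_le fun q : Fin n × Fin n ↦
    continuousAt_of_open hU (contDiffOn_pderiv hU (hαs q.2) q.1) hpU
  obtain ⟨b₃, hb₃, e₃⟩ := exists_eventually_abs_le fun i ↦ hGc i i
  obtain ⟨b₄, hb₄, e₄⟩ := exists_eventually_abs_le fun i ↦ continuousAt_matrix_inv hGc hG0.ne' i i
  obtain ⟨b₅, hb₅, e₅⟩ := exists_eventually_abs_le (f := fun _ : Unit ↦ fun z ↦
    √(S.gscMat p z).det) fun _ ↦ (continuousAt_matrix_det hGc).sqrt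
  obtain ⟨b₆, hb₆, e₆⟩ := exists_eventually_abs_le (f := fun _ : Unit ↦ fun z ↦
    (√(S.gscMat p z).det)⁻¹) fun _ ↦ (continuousAt_matrix_det hGc).sqrt.inv₀
      (Real.sqrt_pos.2 hG0).ne'
  obtain ⟨b₇, hb₇, e₇⟩ := exists_eventually_abs_le fun q : Fin n × Fin n × Fin n ↦
    continuousAt_christoffel hU hG hpU hG0.ne' q.2.2 q.1 q.2.1
  obtain ⟨b₈, hb₈, e₈⟩ := exists_eventually_abs_le fun q : Fin n × Fin n × Fin n ↦
    continuousAt_christoffel hU hg hpU (S.posDef_gMat p hpU.1).det_pos.ne' q.2.2 q.1 q.2.1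
  obtain ⟨R, hR, hball⟩ := Metric.eventually_nhds_iff_ball.1
    ((Filter.eventually_of_mem (hU.mem_nhds hpU) (fun _ h ↦ h) : ∀ᶠ z in 𝓝 z₀, z ∈ S.posDom p).and (e₁.and (e₂.and (e₃.and (e₄.and
      (e₅.and (e₆.and (e₇.and e₈))))))))
  have hsub : Metric.ball z₀ R ⊆ S.posDom p := fun z hz ↦ (hball z hz).1
  have hsub' : Metric.ball z₀ R ∩ {z | 0 < S.xi p z} ⊆ S.posDom p := inter_subset_left.trans hsub
  set b := b₃ + b₄ + b₅ + b₆ + b₇ + b₈ with hb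
  refine ⟨R, hR, {
    A := fun _ ↦ 1, w := fun _ ↦ 1, α := α, div := fun _ _ ↦ 0, brk := fun _ _ _ _ ↦ 0
    C := b₁ + b₂
    isOpen := ?_
    A_smooth := fun _ _ ↦ contDiffOn_const
    w_smooth := contDiffOn_const
    w_pos := fun _ _ ↦ one_pos
    α_smooth := fun i ↦ (hαs i).mono hsub'
    div_eq := fun i z _ ↦ by simp [pderiv]
    brk_eq := fun i j a z _ ↦ by simp [fd, pderiv]
    C_nonneg := by positivity
    div_le := fun i z _ ↦ by simp only [abs_zero]; positivity
    brk_le := fun i j k z _ ↦ by simp only [abs_zero]; positivity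
    α_le := fun i z hz ↦ ((hball z hz.1).2.1 i).trans (by linarith)
    dα_le := fun i j z hz ↦ by
      rw [fd_one]
      exact ((hball z hz.1).2.2.1 (i, j)).trans (by linarith)
    inv := fun _ ↦ 1
    b := b
    subset_target := hsub.trans inter_subset_left
    inv_mul := fun _ _ ↦ one_mul 1
    α_eq := fun i z _ ↦ by simp [hα, Matrix.one_apply]
    b_nonneg := by positivity
    gram_le := fun i z hz ↦ by
      have := (le_abs_self _).trans ((hball z hz.1).2.2.2.1 i)
      simp only [Matrix.one_mul, Matrix.transpose_one, Matrix.mul_one]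
      linarith
    gram_inv_le := fun i z hz ↦ by
      have := (le_abs_self _).trans ((hball z hz.1).2.2.2.2.1 i)
      simp only [Matrix.one_mul, Matrix.transpose_one, Matrix.mul_one]
      linarith
    sqrt_det_le := fun z hz ↦ by
      have := (le_abs_self _).trans ((hball z hz.1).2.2.2.2.2.1 ())
      linarith
    le_sqrt_det := fun z hz ↦ by
      have h1 := (le_abs_self _).trans ((hball z hz.1).2.2.2.2.2.2.1 ())
      have h2 : 0 < √(S.gscMat p z).det :=
        Real.sqrt_pos.2 (S.posDef_gscMat_posDom p (hsub hz.1)).det_pos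
      rw [← div_le_iff₀ h2, one_div]
      linarith
    chr_le := fun i j k z hz ↦ by
      rw [frameChr_one]
      have := (hball z hz.1).2.2.2.2.2.2.2.1 (i, j, k)
      simp only at this
      linarith
    chr_g_le := fun i j k z hz ↦ by
      rw [frameChr_one]
      have := (hball z hz.1).2.2.2.2.2.2.2.2 (i, j, k)
      simp only at this
      linarith }, hsub, rfl, rfl⟩
  have : Metric.ball z₀ R ∩ {z | 0 < S.xi p z} = Metric.ball z₀ R :=
    inter_eq_left.2 (hsub.trans inter_subset_right)
  rw [this]
  exact Metric.isOpen_ball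

end Region

section BoundaryFrame

variable {n : ℕ} (i₀ : Fin n) (f : Eu n → ℝ)

/-- The matrix `W` of the frame `f W` of vector fields at the hypersurface `f = 0`: the vector
fields `W_i`, `i ≠ i₀`, are tangent to the level sets of `f`, and `W_{i₀} f = f`. -/
def bdryMat (z : Eu n) : Matrix (Fin n) (Fin n) ℝ := Matrix.of fun i a ↦
  if a = i₀ then (if i = i₀ then f z else -pderiv i f z) * (pderiv i₀ f z)⁻¹
  else if i = a then 1 else 0

/-- The matrix `V` with `V W = f`. -/
def bdryCoMat (z : Eu n) : Matrix (Fin n) (Fin n) ℝ := Matrix.of fun a k ↦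
  if k = i₀ then pderiv a f z else if a = k then f z else 0

variable {i₀ f}

theorem sum_bdryMat_mul (z : Eu n) (i : Fin n) (h : Fin n → ℝ) :
    ∑ a, bdryMat i₀ f z i a * h a =
      (if i = i₀ then f z else -pderiv i f z) * (pderiv i₀ f z)⁻¹ * h i₀ +
        if i = i₀ then 0 else h i := by
  have e : ∀ a, bdryMat i₀ f z i a * h a =
      (if a = i₀ then (if i = i₀ then f z else -pderiv i f z) * (pderiv i₀ f z)⁻¹ * h i₀ else 0) +
        if i = a then (if i = i₀ then 0 else h i) else 0 := by
    intro a
    simp only [bdryMat, Matrix.of_apply]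
    by_cases h1 : a = i₀
    · subst h1
      simp +contextual
    · by_cases h2 : i = a
      · subst h2
        simp [h1]
      · simp [h1, h2]
  simp only [e, Finset.sum_add_distrib, Finset.sum_ite_eq, Finset.sum_ite_eq', Finset.mem_univ,
    if_true]

theorem sum_bdryMat_mul_pderiv {z : Eu n} (hf : pderiv i₀ f z ≠ 0) (i : Fin n) :
    ∑ a, bdryMat i₀ f z i a * pderiv a f z = if i = i₀ then f z else 0 := by
  rw [sum_bdryMat_mul, inv_mul_cancel_right₀ hf]
  split_ifs <;> ring

theorem bdryCoMat_mul_bdryMat {z : Eu n} (hf : pderiv i₀ f z ≠ 0) :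
    bdryCoMat i₀ f z * bdryMat i₀ f z = f z • 1 := by
  ext a b
  have e : ∀ k, bdryCoMat i₀ f z a k * bdryMat i₀ f z k b =
      (if k = i₀ then pderiv a f z * bdryMat i₀ f z i₀ b else 0) +
        if a = k then (if a = i₀ then 0 else f z * bdryMat i₀ f z a b) else 0 := by
    intro k
    simp only [bdryCoMat, Matrix.of_apply]
    by_cases h1 : k = i₀
    · subst h1
      simp +contextual
    · by_cases h2 : a = k
      · subst h2
        simp [h1]
      · simp [h1, h2]
  rw [Matrix.mul_apply]
  simp only [e, Finset.sum_add_distrib, Finset.sum_ite_eq, Finset.sum_ite_eq', Finset.mem_univ,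
    if_true, Matrix.smul_apply, smul_eq_mul, Matrix.one_apply]
  simp only [bdryMat, Matrix.of_apply, if_true]
  by_cases h1 : b = i₀
  · subst h1
    by_cases h2 : a = b
    · subst h2
      simp only [if_true]
      field_simp
      ring
    · simp only [if_true, h2, if_false]
      ring
  · by_cases h2 : a = b
    · subst h2
      simp [h1, Ne.symm h1]
    · simp [h1, h2, Ne.symm h1]

theorem det_bdryMat (z : Eu n) : (bdryMat i₀ f z).det = f z * (pderiv i₀ f z)⁻¹ := by
  have e : bdryMat i₀ f z = (1 : Matrix (Fin n) (Fin n) ℝ).updateCol i₀ fun i ↦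
      (if i = i₀ then f z else -pderiv i f z) * (pderiv i₀ f z)⁻¹ := by
    ext i a
    simp only [bdryMat, Matrix.of_apply, Matrix.updateCol_apply, Matrix.one_apply]
  rw [e, ← Matrix.cramer_apply, Matrix.cramer_one]
  simp

variable {U : Set (Eu n)}

theorem contDiffOn_bdryMat (hU : IsOpen U) (hf : ContDiffOn ℝ ∞ f U)
    (h0 : ∀ z ∈ U, pderiv i₀ f z ≠ 0) (i a : Fin n) :
    ContDiffOn ℝ ∞ (fun z ↦ bdryMat i₀ f z i a) U := by
  have hp := fun i ↦ Region.contDiffOn_pderiv hU hf i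
  simp only [bdryMat, Matrix.of_apply]
  split_ifs
  · exact hf.mul ((hp i₀).inv h0)
  · exact (hp i).neg.mul ((hp i₀).inv h0)
  · exact contDiffOn_const
  · exact contDiffOn_const

theorem contDiffOn_bdryCoMat (hU : IsOpen U) (hf : ContDiffOn ℝ ∞ f U) (i a : Fin n) :
    ContDiffOn ℝ ∞ (fun z ↦ bdryCoMat i₀ f z i a) U := by
  simp only [bdryCoMat, Matrix.of_apply]
  split_ifs
  · exact Region.contDiffOn_pderiv hU hf i
  · exact hf
  · exact contDiffOn_const

/-- The derivatives of the components of `W` along `W`. -/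
def bdryDeriv (i₀ : Fin n) (f : Eu n → ℝ) (i j a : Fin n) (z : Eu n) : ℝ :=
  fd (bdryMat i₀ f) i (fun y ↦ bdryMat i₀ f y j a) z

theorem fd_smul_bdryMat (hU : IsOpen U) (hf : ContDiffOn ℝ ∞ f U)
    (h0 : ∀ z ∈ U, pderiv i₀ f z ≠ 0) {z : Eu n} (hz : z ∈ U) (i j a : Fin n) :
    fd (fun z ↦ f z • bdryMat i₀ f z) i (fun y ↦ (f y • bdryMat i₀ f y) j a) z =
      f z ^ 2 * ((if i = i₀ then bdryMat i₀ f z j a else 0) + bdryDeriv i₀ f i j a z) := by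
  have e : ∀ g : Eu n → ℝ, fd (fun z ↦ f z • bdryMat i₀ f z) i g z =
      f z * fd (bdryMat i₀ f) i g z := fun g ↦ by
    simp only [fd, Matrix.smul_apply, smul_eq_mul, Finset.mul_sum, mul_assoc]
  have e2 : fd (bdryMat i₀ f) i f z = if i = i₀ then f z else 0 := by
    simp only [fd, smul_eq_mul]
    exact sum_bdryMat_mul_pderiv (h0 z hz) i
  simp only [Matrix.smul_apply, smul_eq_mul]
  rw [e, fd_mul (differentiableAt_of_open hU hf hz)
    (differentiableAt_of_open hU (contDiffOn_bdryMat hU hf h0 j a) hz), e2, bdryDeriv]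
  split_ifs <;> ring

/-- The structure functions of the frame at the boundary. -/
def bdryBrk (i₀ : Fin n) (f : Eu n → ℝ) (i j k : Fin n) (z : Eu n) : ℝ :=
  f z * ((if i = i₀ then (if j = k then 1 else 0) else 0) -
    (if j = i₀ then (if i = k then 1 else 0) else 0)) +
    ∑ c, (bdryDeriv i₀ f i j c z - bdryDeriv i₀ f j i c z) * bdryCoMat i₀ f z c k

theorem bdryBrk_eq (hU : IsOpen U) (hf : ContDiffOn ℝ ∞ f U)
    (h0 : ∀ z ∈ U, pderiv i₀ f z ≠ 0) {z : Eu n} (hz : z ∈ U) (i j a : Fin n) :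
    fd (fun z ↦ f z • bdryMat i₀ f z) i (fun y ↦ (f y • bdryMat i₀ f y) j a) z -
      fd (fun z ↦ f z • bdryMat i₀ f z) j (fun y ↦ (f y • bdryMat i₀ f y) i a) z =
      ∑ k, bdryBrk i₀ f i j k z * (f z • bdryMat i₀ f z) k a := by
  rw [fd_smul_bdryMat hU hf h0 hz, fd_smul_bdryMat hU hf h0 hz]
  have h1 : ∀ c, ∑ k, bdryCoMat i₀ f z c k * bdryMat i₀ f z k a = if c = a then f z else 0 := by
    intro c
    rw [← Matrix.mul_apply, bdryCoMat_mul_bdryMat (h0 z hz)]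
    simp [Matrix.one_apply]
  have h2 : ∑ k, (∑ c, (bdryDeriv i₀ f i j c z - bdryDeriv i₀ f j i c z) * bdryCoMat i₀ f z c k) *
      (f z * bdryMat i₀ f z k a) =
      f z ^ 2 * (bdryDeriv i₀ f i j a z - bdryDeriv i₀ f j i a z) := by
    calc _ = ∑ c, f z * (bdryDeriv i₀ f i j c z - bdryDeriv i₀ f j i c z) *
          ∑ k, bdryCoMat i₀ f z c k * bdryMat i₀ f z k a := by
          simp only [Finset.sum_mul, Finset.mul_sum]
          rw [Finset.sum_comm]
          exact Finset.sum_congr rfl fun _ _ ↦ Finset.sum_congr rfl fun _ _ ↦ by ring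
      _ = _ := by
          simp only [h1, mul_ite, mul_zero, Finset.sum_ite_eq', Finset.mem_univ, if_true]
          ring
  have h3 : ∀ j, ∑ k, (if j = k then (1 : ℝ) else 0) * (f z * bdryMat i₀ f z k a) =
      f z * bdryMat i₀ f z j a := fun j ↦ by simp
  simp only [bdryBrk, add_mul, Finset.sum_add_distrib, Matrix.smul_apply, smul_eq_mul]
  rw [h2]
  have h4 : ∑ k, f z * ((if i = i₀ then (if j = k then (1 : ℝ) else 0) else 0) -
      (if j = i₀ then (if i = k then 1 else 0) else 0)) * (f z * bdryMat i₀ f z k a) =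
      f z * ((if i = i₀ then f z * bdryMat i₀ f z j a else 0) -
        (if j = i₀ then f z * bdryMat i₀ f z i a else 0)) := by
    rw [← h3 i, ← h3 j]
    simp only [mul_assoc, ← Finset.mul_sum, sub_mul, Finset.sum_sub_distrib, ite_mul, zero_mul]
    congr 2 <;> split_ifs <;> simp
  rw [h4]
  split_ifs <;> ring

/-- The divergences of the frame at the boundary. -/
def bdryDiv (i₀ : Fin n) (f : Eu n → ℝ) (i : Fin n) (z : Eu n) : ℝ :=
  (∑ a, pderiv a (fun y ↦ bdryMat i₀ f y i a) z) - if i = i₀ then (n : ℝ) else 0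

theorem bdryDiv_eq (hU : IsOpen U) (hf : ContDiffOn ℝ ∞ f U)
    (h0 : ∀ z ∈ U, pderiv i₀ f z ≠ 0) {z : Eu n} (hz : z ∈ U) (hfz : 0 < f z) (i : Fin n) :
    ∑ a, pderiv a (fun y ↦ (f y • bdryMat i₀ f y) i a * (f y ^ (n + 1))⁻¹) z =
      (f z ^ (n + 1))⁻¹ * (f z * bdryDiv i₀ f i z) := by
  have hfd := differentiableAt_of_open hU hf hz
  have hev : ∀ᶠ y in 𝓝 z, 0 < f y := hfd.continuousAt.eventually (lt_mem_nhds hfz)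
  have hw : ∀ a, pderiv a (fun y ↦ (f y ^ n)⁻¹) z = -(n * (f z ^ (n + 1))⁻¹) * pderiv a f z := by
    intro a
    have h1 : HasDerivAt (fun t : ℝ ↦ (t ^ n)⁻¹) (-(n * f z ^ (n - 1)) / (f z ^ n) ^ 2) (f z) :=
      (hasDerivAt_pow n (f z)).inv (pow_ne_zero _ hfz.ne')
    have h2 := h1.comp_hasFDerivAt z hfd.hasFDerivAt
    have e : (fun y ↦ (f y ^ n)⁻¹) = (fun t : ℝ ↦ (t ^ n)⁻¹) ∘ f := rfl
    rw [pderiv, e, h2.fderiv]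
    simp only [smul_apply, smul_eq_mul, pderiv]
    congr 1
    cases n with
    | zero => simp
    | succ m =>
      simp only [Nat.add_sub_cancel]
      field_simp
      ring
  have hwd : DifferentiableAt ℝ (fun y ↦ (f y ^ n)⁻¹) z :=
    (hfd.pow n).inv (pow_ne_zero _ hfz.ne')
  have h1 : ∀ a, pderiv a (fun y ↦ (f y • bdryMat i₀ f y) i a * (f y ^ (n + 1))⁻¹) z =
      (f z ^ (n + 1))⁻¹ * (f z * pderiv a (fun y ↦ bdryMat i₀ f y i a) z -
        n * (bdryMat i₀ f z i a * pderiv a f z)) := by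
    intro a
    have e : (fun y ↦ (f y • bdryMat i₀ f y) i a * (f y ^ (n + 1))⁻¹) =ᶠ[𝓝 z]
        fun y ↦ bdryMat i₀ f y i a * (f y ^ n)⁻¹ := by
      filter_upwards [hev] with y hy
      simp only [Matrix.smul_apply, smul_eq_mul]
      field_simp
      ring
    rw [pderiv_congr e, pderiv_fun_mul (differentiableAt_of_open hU
      (contDiffOn_bdryMat hU hf h0 i a) hz) hwd, hw]
    field_simp
    ring
  simp only [h1, ← Finset.mul_sum, Finset.sum_sub_distrib]
  rw [sum_bdryMat_mul_pderiv (h0 z hz), bdryDiv]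
  congr 1
  split_ifs <;> ring

theorem continuousAt_bdryDeriv (hU : IsOpen U) (hf : ContDiffOn ℝ ∞ f U)
    (h0 : ∀ z ∈ U, pderiv i₀ f z ≠ 0) {z₀ : Eu n} (hz : z₀ ∈ U) (i j a : Fin n) :
    ContinuousAt (bdryDeriv i₀ f i j a) z₀ :=
  continuousAt_of_open hU (contDiffOn_fd hU (contDiffOn_bdryMat hU hf h0)
    (contDiffOn_bdryMat hU hf h0 j a) i) hz

theorem continuousAt_bdryBrk (hU : IsOpen U) (hf : ContDiffOn ℝ ∞ f U)
    (h0 : ∀ z ∈ U, pderiv i₀ f z ≠ 0) {z₀ : Eu n} (hz : z₀ ∈ U) (i j a : Fin n) :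
    ContinuousAt (bdryBrk i₀ f i j a) z₀ :=
  ((continuousAt_of_open hU hf hz).mul continuousAt_const).add
    (tendsto_finsetSum _ fun c _ ↦ ((continuousAt_bdryDeriv hU hf h0 hz i j c).sub
      (continuousAt_bdryDeriv hU hf h0 hz j i c)).mul
        (continuousAt_of_open hU (contDiffOn_bdryCoMat hU hf c a) hz))

theorem continuousAt_bdryDiv (hU : IsOpen U) (hf : ContDiffOn ℝ ∞ f U)
    (h0 : ∀ z ∈ U, pderiv i₀ f z ≠ 0) {z₀ : Eu n} (hz : z₀ ∈ U) (i : Fin n) :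
    ContinuousAt (bdryDiv i₀ f i) z₀ :=
  ContinuousAt.sub (tendsto_finsetSum _ fun a _ ↦ continuousAt_of_open hU
    (Region.contDiffOn_pderiv hU (contDiffOn_bdryMat hU hf h0 i a) a) hz) continuousAt_const

/-- The connection coefficients of a smooth metric in the frame at the boundary. -/
theorem frameChr_bdry (hU : IsOpen U) (hf : ContDiffOn ℝ ∞ f U)
    (h0 : ∀ z ∈ U, pderiv i₀ f z ≠ 0) {z : Eu n} (hz : z ∈ U) (hfz : 0 < f z)
    (G : Eu n → Matrix (Fin n) (Fin n) ℝ) (i j k : Fin n) :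
    frameChr (fun z ↦ f z • bdryMat i₀ f z) (fun z ↦ (f z ^ 2)⁻¹ • bdryCoMat i₀ f z) G i j k z =
      ∑ c, ((if i = i₀ then bdryMat i₀ f z j c else 0) + bdryDeriv i₀ f i j c z +
        ∑ a, ∑ b, bdryMat i₀ f z i a * bdryMat i₀ f z j b * christoffel G c a b z) *
          bdryCoMat i₀ f z c k := by
  refine Finset.sum_congr rfl fun c _ ↦ ?_
  rw [fd_smul_bdryMat hU hf h0 hz]
  have e : ∑ a, ∑ b, (f z • bdryMat i₀ f z) i a * (f z • bdryMat i₀ f z) j b *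
      christoffel G c a b z =
      f z ^ 2 * ∑ a, ∑ b, bdryMat i₀ f z i a * bdryMat i₀ f z j b * christoffel G c a b z := by
    simp only [Finset.mul_sum, Matrix.smul_apply, smul_eq_mul]
    exact Finset.sum_congr rfl fun _ _ ↦ Finset.sum_congr rfl fun _ _ ↦ by ring
  rw [e]
  change _ * ((f z ^ 2)⁻¹ * bdryCoMat i₀ f z c k) = _
  field_simp

theorem continuousAt_frameChr_bdry (hU : IsOpen U) (hf : ContDiffOn ℝ ∞ f U)
    (h0 : ∀ z ∈ U, pderiv i₀ f z ≠ 0) {z₀ : Eu n} (hz : z₀ ∈ U)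
    {G : Eu n → Matrix (Fin n) (Fin n) ℝ} (hG : ∀ i j, ContDiffOn ℝ ∞ (fun z ↦ G z i j) U)
    (hdet : (G z₀).det ≠ 0) (i j k : Fin n) :
    ContinuousAt (fun z ↦ ∑ c, ((if i = i₀ then bdryMat i₀ f z j c else 0) +
      bdryDeriv i₀ f i j c z +
        ∑ a, ∑ b, bdryMat i₀ f z i a * bdryMat i₀ f z j b * christoffel G c a b z) *
          bdryCoMat i₀ f z c k) z₀ := by
  have hW := fun i a ↦ continuousAt_of_open hU (contDiffOn_bdryMat hU hf h0 i a) hz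
  refine tendsto_finsetSum _ fun c _ ↦ ContinuousAt.mul (((?_ : ContinuousAt _ _).add
    (continuousAt_bdryDeriv hU hf h0 hz i j c)).add (tendsto_finsetSum _ fun a _ ↦
      tendsto_finsetSum _ fun b _ ↦ ((hW i a).mul (hW j b)).mul
        (continuousAt_christoffel hU hG hz hdet c a b)))
    (continuousAt_of_open hU (contDiffOn_bdryCoMat hU hf c k) hz)
  split_ifs
  · exact hW j c
  · exact continuousAt_const

end BoundaryFrame


namespace Region

attribute [-instance] TopCat.of.chartedSpace

variable {n : ℕ} {M : Type*} [TopologicalSpace M] [ChartedSpace (Eu n) M]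
  [IsManifold (𝓡 n) ∞ M] [T2Space M] [SigmaCompactSpace M] (S : Region n M)

/-- The matrix of the cotensor `h` in the chart at `c`. -/
def hMat (c : M) (z : Eu n) : Matrix (Fin n) (Fin n) ℝ := bilinMatrix S.h c z

theorem dAt_coordVec_x {c : M} {z : Eu n} (hz : z ∈ (chartAt (Eu n) c).target) (i : Fin n) :
    dAt n S.x ((chartAt (Eu n) c).symm z) (coordVec c z i) = pderiv i (S.xi c) z :=
  dAt_coordVec S.x_smooth c i hz

theorem gscMat_apply {c : M} {z : Eu n} (hz : z ∈ (chartAt (Eu n) c).target) (i j : Fin n) :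
    S.gscMat c z i j = (S.xi c z ^ 4)⁻¹ * (pderiv i (S.xi c) z * pderiv j (S.xi c) z) +
      (S.xi c z ^ 2)⁻¹ * S.hMat c z i j := by
  rw [← S.dAt_coordVec_x hz, ← S.dAt_coordVec_x hz]
  rfl

/-- The Gram matrix of the frame at the boundary for the scattering metric. -/
def bdryGram (c : M) (i₀ : Fin n) (z : Eu n) : Matrix (Fin n) (Fin n) ℝ :=
  Matrix.of fun i j ↦ (if i = i₀ then if j = i₀ then 1 else 0 else 0) +
    ∑ a, ∑ b, bdryMat i₀ (S.xi c) z i a * bdryMat i₀ (S.xi c) z j b * S.hMat c z a b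

variable {S} in
theorem bdryGram_eq {c : M} {i₀ : Fin n} {z : Eu n} (hz : z ∈ S.posDom c)
    (h0 : pderiv i₀ (S.xi c) z ≠ 0) :
    S.xi c z • bdryMat i₀ (S.xi c) z * S.gscMat c z *
      (S.xi c z • bdryMat i₀ (S.xi c) z).transpose = S.bdryGram c i₀ z := by
  have hx : S.xi c z ≠ 0 := ne_of_gt hz.2
  ext i j
  set f := S.xi c with hf
  set W := bdryMat i₀ f z with hW
  have e1 : (f z • W * S.gscMat c z * (f z • W).transpose) i j =
      (f z ^ 2)⁻¹ * ((∑ a, W i a * pderiv a f z) * ∑ b, W j b * pderiv b f z) +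
        ∑ a, ∑ b, W i a * W j b * S.hMat c z a b := by
    rw [Finset.sum_mul_sum]
    simp only [Matrix.mul_apply, Matrix.transpose_apply, Matrix.smul_apply, smul_eq_mul,
      Finset.mul_sum, Finset.sum_mul, ← Finset.sum_add_distrib]
    rw [Finset.sum_comm]
    refine Finset.sum_congr rfl fun a _ ↦ Finset.sum_congr rfl fun b _ ↦ ?_
    rw [S.gscMat_apply hz.1, ← hf]
    field_simp
  rw [e1, sum_bdryMat_mul_pderiv h0, sum_bdryMat_mul_pderiv h0]
  simp only [bdryGram, Matrix.of_apply]
  congr 1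
  split_ifs
  · field_simp
  all_goals simp

variable {S} in
theorem posDef_bdryGram {c : M} {i₀ : Fin n} {z : Eu n} (hz : z ∈ (chartAt (Eu n) c).target)
    (hx : S.xi c z = 0) (h0 : pderiv i₀ (S.xi c) z ≠ 0) : (S.bdryGram c i₀ z).PosDef := by
  set f := S.xi c with hf
  set W := bdryMat i₀ f z with hW
  let q : M := (chartAt (Eu n) c).symm z
  let B : Eu n →L[ℝ] Eu n →L[ℝ] ℝ := S.h q
  let D : Eu n →L[ℝ] ℝ := dAt n S.x q
  have hB : ∀ i j, S.hMat c z i j = B (coordVecEu c z i) (coordVecEu c z j) := fun _ _ ↦ rfl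
  have hsymm : ∀ a b, S.hMat c z a b = S.hMat c z b a := fun a b ↦ S.h_symm q _ _
  refine Matrix.PosDef.of_dotProduct_mulVec_pos ?_ fun v hv ↦ ?_
  · ext i j
    simp only [bdryGram, Matrix.conjTranspose_apply, Matrix.of_apply, star_trivial]
    congr 1
    · split_ifs <;> rfl
    · rw [Finset.sum_comm]
      refine Finset.sum_congr rfl fun a _ ↦ Finset.sum_congr rfl fun b _ ↦ ?_
      rw [hsymm b a]
      ring
  · set a : Fin n → ℝ := fun b ↦ ∑ i, v i * W i b with ha
    have e1 : star v ⬝ᵥ (S.bdryGram c i₀ z).mulVec v =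
        v i₀ ^ 2 + B (∑ i, a i • coordVecEu c z i) (∑ i, a i • coordVecEu c z i) := by
      have e2 : B (∑ i, a i • coordVecEu c z i) (∑ i, a i • coordVecEu c z i) =
          ∑ p, ∑ q, a p * a q * S.hMat c z p q := by
        simp only [map_sum, map_smul, sum_apply, smul_apply, Finset.mul_sum, smul_eq_mul, hB]
        rw [Finset.sum_comm]
        exact Finset.sum_congr rfl fun i _ ↦ Finset.sum_congr rfl fun j _ ↦ by ring
      have e3 : ∑ p, ∑ q, a p * a q * S.hMat c z p q =
          ∑ i, ∑ j, v i * ((∑ p, ∑ q, W i p * W j q * S.hMat c z p q) * v j) := by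
        simp only [ha, Finset.sum_mul_sum]
        simp only [Finset.mul_sum, Finset.sum_mul]
        calc _ = ∑ p, ∑ i, ∑ q, ∑ j, v i * W i p * (v j * W j q) * S.hMat c z p q :=
              Finset.sum_congr rfl fun p _ ↦ Finset.sum_comm
          _ = ∑ i, ∑ p, ∑ q, ∑ j, v i * W i p * (v j * W j q) * S.hMat c z p q :=
              Finset.sum_comm
          _ = ∑ i, ∑ p, ∑ j, ∑ q, v i * W i p * (v j * W j q) * S.hMat c z p q :=
              Finset.sum_congr rfl fun i _ ↦ Finset.sum_congr rfl fun p _ ↦ Finset.sum_comm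
          _ = ∑ i, ∑ j, ∑ p, ∑ q, v i * W i p * (v j * W j q) * S.hMat c z p q :=
              Finset.sum_congr rfl fun i _ ↦ Finset.sum_comm
          _ = _ := by
              refine Finset.sum_congr rfl fun i _ ↦ Finset.sum_congr rfl fun j _ ↦
                Finset.sum_congr rfl fun p _ ↦ Finset.sum_congr rfl fun q _ ↦ by ring
      rw [e2, e3]
      simp only [dotProduct, Matrix.mulVec, Pi.star_apply, star_trivial, bdryGram, Matrix.of_apply,
        add_mul, Finset.sum_add_distrib, mul_add, Finset.mul_sum, ite_mul, zero_mul, mul_ite,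
        mul_zero, one_mul, mul_assoc]
      congr 1
      rw [Finset.sum_eq_single i₀ (fun b _ hb ↦ by simp [hb]) (by simp)]
      simp [sq]
    rw [e1]
    have hDa : D (∑ i, a i • coordVecEu c z i) = 0 := by
      have e2 : D (∑ i, a i • coordVecEu c z i) = ∑ i, v i * ∑ b, W i b * pderiv b f z := by
        simp only [map_sum, map_smul, smul_eq_mul, ha, Finset.sum_mul, Finset.mul_sum]
        rw [Finset.sum_comm]
        refine Finset.sum_congr rfl fun i _ ↦ Finset.sum_congr rfl fun b _ ↦ ?_
        rw [hf, ← S.dAt_coordVec_x hz]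
        exact mul_assoc _ _ _
      rw [e2]
      simp only [hW, sum_bdryMat_mul_pderiv h0, hx]
      simp
    by_cases h : ∑ i, a i • coordVecEu c z i = 0
    · have ha0 := linearIndependent_coordVecEu hz h
      have hvb : ∀ b, b ≠ i₀ → v b = 0 := by
        intro b hb
        have h1 : a b = 0 := congrFun ha0 b
        rw [← h1, ha]
        simp [hW, bdryMat, hb]
      have hv0 : v i₀ ≠ 0 := fun h0 ↦ hv (funext fun b ↦ by
        by_cases hb : b = i₀
        · rw [hb, h0, Pi.zero_apply]
        · exact hvb b hb)
      rw [h, map_zero]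
      positivity
    · have h1 : 0 < B (∑ i, a i • coordVecEu c z i) (∑ i, a i • coordVecEu c z i) :=
        S.sc_pos_boundary q hx _ h hDa
      positivity

/-- Near a point of the artificial boundary there is a frame adapted to the scattering metric. -/
theorem exists_frame_boundary {p : M} (hp : S.x p = 0) :
    ∃ R > 0, ∃ E : S.ScFrame p (Metric.ball (chartAt (Eu n) p p) R), ∃ i₀ : Fin n, ∃ B : ℝ, 0 ≤ B ∧
      ∀ z ∈ Metric.ball (chartAt (Eu n) p p) R ∩ {z | 0 < S.xi p z},
        (∀ i, E.α i z = if i = i₀ then 1 else 0) ∧ (∀ i, |E.div i z| ≤ B * S.xi p z) ∧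
        ∀ i a, |E.A z i a| ≤ B * S.xi p z := by
  set z₀ := chartAt (Eu n) p p with hz₀
  have hzt : z₀ ∈ (chartAt (Eu n) p).target := mem_chart_target _ p
  have hsymm : (chartAt (Eu n) p).symm z₀ = p :=
    (chartAt (Eu n) p).left_inv (mem_chart_source _ p)
  have hx0 : S.xi p z₀ = 0 := by rw [xi, hsymm, hp]
  set f := S.xi p with hf
  obtain ⟨i₀, hi₀⟩ : ∃ i, pderiv i f z₀ ≠ 0 := by
    by_contra! h
    have h1 : S.x ((chartAt (Eu n) p).symm z₀) = 0 := hx0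
    have h2 : fderiv ℝ f z₀ = 0 := by
      ext v
      rw [fderiv_eq_sum_pderiv]
      simp [h]
    have h3 := mfderiv_comp (I := 𝓡 n) (I' := 𝓡 n) (I'' := 𝓘(ℝ, ℝ)) ((chartAt (Eu n) p).symm z₀)
      (g := f) (f := chartAt (Eu n) p) (by
        rw [(chartAt (Eu n) p).right_inv hzt]
        exact (differentiableAt_of_open (chartAt (Eu n) p).open_target (S.contDiffOn_xi p)
          hzt).mdifferentiableAt)
      (mdifferentiableAt_atlas (chart_mem_atlas _ p) ((chartAt (Eu n) p).map_target hzt))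
    rw [(chartAt (Eu n) p).right_inv hzt, mfderiv_eq_fderiv, h2] at h3
    refine S.x_regular _ h1 ?_
    have h4 : S.x =ᶠ[𝓝 ((chartAt (Eu n) p).symm z₀)] f ∘ chartAt (Eu n) p := by
      filter_upwards [(chartAt (Eu n) p).open_source.mem_nhds
        ((chartAt (Eu n) p).map_target hzt)] with q hq
      simp [hf, xi, (chartAt (Eu n) p).left_inv hq]
    rw [dAt, h4.mfderiv_eq, h3]
    exact ContinuousLinearMap.zero_comp _
  set U : Set (Eu n) := (chartAt (Eu n) p).target ∩ {z | pderiv i₀ f z ≠ 0} with hUdef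
  have hT := (chartAt (Eu n) p).open_target
  have hU : IsOpen U := (contDiffOn_pderiv hT (S.contDiffOn_xi p) i₀).continuousOn.isOpen_inter_preimage
    hT isOpen_ne
  have hz₀U : z₀ ∈ U := ⟨hzt, hi₀⟩
  have hfU : ContDiffOn ℝ ∞ f U := (S.contDiffOn_xi p).mono inter_subset_left
  have h0 : ∀ z ∈ U, pderiv i₀ f z ≠ 0 := fun z hz ↦ hz.2
  have hWs := contDiffOn_bdryMat hU hfU h0
  have hHs : ∀ i j, ContDiffOn ℝ ∞ (fun z ↦ S.bdryGram p i₀ z i j) U := by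
    intro i j
    simp only [bdryGram, Matrix.of_apply]
    refine contDiffOn_const.add (ContDiffOn.sum fun a _ ↦ ContDiffOn.sum fun b _ ↦
      ((hWs i a).mul (hWs j b)).mul ?_)
    exact (S.h_smooth.contDiffOn_comp p a b).mono inter_subset_left
  have hHc := fun i j ↦ continuousAt_of_open hU (hHs i j) hz₀U
  have hH0 := (posDef_bdryGram hzt hx0 hi₀).det_pos
  have hHd := continuousAt_matrix_det hHc
  have hηc : ContinuousAt (fun z ↦ pderiv i₀ f z) z₀ :=
    continuousAt_of_open hU (contDiffOn_pderiv hU hfU i₀) hz₀U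
  have hgs : ∀ i j, ContDiffOn ℝ ∞ (fun z ↦ S.gMat p z i j) U := fun i j ↦
    (S.contDiffOn_gMat p i j).mono inter_subset_left
  obtain ⟨b₁, hb₁, e₁⟩ := exists_eventually_abs_le fun i ↦ continuousAt_bdryDiv hU hfU h0 hz₀U i
  obtain ⟨b₂, hb₂, e₂⟩ := exists_eventually_abs_le fun q : Fin n × Fin n × Fin n ↦
    continuousAt_bdryBrk hU hfU h0 hz₀U q.1 q.2.1 q.2.2
  obtain ⟨b₃, hb₃, e₃⟩ := exists_eventually_abs_le fun q : Fin n × Fin n ↦ hHc q.1 q.2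
  obtain ⟨b₄, hb₄, e₄⟩ := exists_eventually_abs_le fun q : Fin n × Fin n ↦
    continuousAt_matrix_inv hHc hH0.ne' q.1 q.2
  obtain ⟨b₅, hb₅, e₅⟩ := exists_eventually_abs_le (f := fun _ : Unit ↦ fun z ↦
    √(S.bdryGram p i₀ z).det * pderiv i₀ f z) fun _ ↦ hHd.sqrt.mul hηc
  obtain ⟨b₆, hb₆, e₆⟩ := exists_eventually_abs_le (f := fun _ : Unit ↦ fun z ↦
    (√(S.bdryGram p i₀ z).det * pderiv i₀ f z)⁻¹) fun _ ↦ (hHd.sqrt.mul hηc).inv₀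
      (mul_ne_zero (Real.sqrt_pos.2 hH0).ne' hi₀)
  obtain ⟨b₇, hb₇, e₇⟩ := exists_eventually_abs_le fun q : Fin n × Fin n × Fin n ↦
    continuousAt_of_open hU (contDiffOn_fd hU hWs (hHs q.2.1 q.2.2) q.1) hz₀U
  obtain ⟨b₈, hb₈, e₈⟩ := exists_eventually_abs_le fun q : Fin n × Fin n × Fin n ↦
    continuousAt_frameChr_bdry hU hfU h0 hz₀U hgs (S.posDef_gMat p hzt).det_pos.ne' q.1 q.2.1 q.2.2
  obtain ⟨b₉, hb₉, e₉⟩ := exists_eventually_abs_le fun q : Fin n × Fin n ↦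
    continuousAt_of_open hU (hWs q.1 q.2) hz₀U
  have e₀ : ∀ᶠ z in 𝓝 z₀, f z < 1 := (continuousAt_of_open hU hfU hz₀U).eventually
    (gt_mem_nhds (by rw [hx0]; exact one_pos))
  obtain ⟨R, hR, hball⟩ := Metric.eventually_nhds_iff_ball.1
    ((Filter.eventually_of_mem (hU.mem_nhds hz₀U) (fun _ h ↦ h) : ∀ᶠ z in 𝓝 z₀, z ∈ U).and
      (e₀.and (e₁.and (e₂.and (e₃.and (e₄.and (e₅.and (e₆.and (e₇.and (e₈.and e₉))))))))))
  have hsub : Metric.ball z₀ R ⊆ U := fun z hz ↦ (hball z hz).1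
  set Z := Metric.ball z₀ R ∩ {z | 0 < f z} with hZ
  have hZU : Z ⊆ U := inter_subset_left.trans hsub
  have hZp : Z ⊆ S.posDom p := fun z hz ↦ ⟨(hZU hz).1, hz.2⟩
  have hZo : IsOpen Z := (hfU.mono hsub).continuousOn.isOpen_inter_preimage Metric.isOpen_ball
    isOpen_Ioi
  have hf1 : ∀ z ∈ Z, f z ≤ 1 := fun z hz ↦ (hball z hz.1).2.1.le
  set A : Eu n → Matrix (Fin n) (Fin n) ℝ := fun z ↦ f z • bdryMat i₀ f z with hA
  have hAs : ∀ i a, ContDiffOn ℝ ∞ (fun z ↦ A z i a) Z := fun i a ↦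
    (hfU.mul (hWs i a)).mono hZU
  have hGram : ∀ z ∈ Z, A z * S.gscMat p z * (A z).transpose = S.bdryGram p i₀ z := fun z hz ↦
    bdryGram_eq (hZp hz) (h0 z (hZU hz))
  have hinv : ∀ z ∈ Z, (f z ^ 2)⁻¹ • bdryCoMat i₀ f z * A z = 1 := fun z hz ↦ by
    have hz0 : f z ≠ 0 := ne_of_gt hz.2
    rw [hA, Matrix.smul_mul, Matrix.mul_smul, bdryCoMat_mul_bdryMat (h0 z (hZU hz)), smul_smul,
      smul_smul, mul_assoc]
    have : (f z ^ 2)⁻¹ * (f z * f z) = 1 := by field_simp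
    rw [this, one_smul]
  have hdet : ∀ z ∈ Z, √(S.bdryGram p i₀ z).det * |pderiv i₀ f z| =
      f z ^ (n + 1) * √(S.gscMat p z).det := by
    intro z hz
    have hz0 : (0 : ℝ) < f z := hz.2
    have hη := h0 z (hZU hz)
    have e : (S.bdryGram p i₀ z).det =
        (f z ^ (n + 1) * (pderiv i₀ f z)⁻¹) ^ 2 * (S.gscMat p z).det := by
      rw [← hGram z hz, Matrix.det_mul, Matrix.det_mul, Matrix.det_transpose, hA, Matrix.det_smul,
        det_bdryMat, Fintype.card_fin]
      ring
    rw [e, Real.sqrt_mul (sq_nonneg _), Real.sqrt_sq_eq_abs, abs_mul, abs_inv,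
      abs_of_pos (pow_pos hz0 _)]
    have := abs_pos.2 hη
    field_simp
  have hαe : ∀ i, ∀ z ∈ Z, (if i = i₀ then (1 : ℝ) else 0) =
      ∑ a, A z i a * (pderiv a f z / f z ^ 2) := by
    intro i z hz
    have hz0 : f z ≠ 0 := ne_of_gt hz.2
    have e : ∑ a, A z i a * (pderiv a f z / f z ^ 2) =
        (f z)⁻¹ * ∑ a, bdryMat i₀ f z i a * pderiv a f z := by
      rw [Finset.mul_sum]
      refine Finset.sum_congr rfl fun a _ ↦ ?_
      simp only [hA, Matrix.smul_apply, smul_eq_mul]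
      field_simp
    rw [e, sum_bdryMat_mul_pderiv (h0 z (hZU hz))]
    split_ifs
    · field_simp
    · simp
  have hbrk := fun i j a z (hz : z ∈ Z) ↦ bdryBrk_eq hU hfU h0 (hZU hz) i j a
  have hfd : ∀ i j l, ∀ z ∈ Z,
      |fd A i (fun y ↦ (A y * S.gscMat p y * (A y).transpose) j l) z| ≤ b₇ := by
    intro i j l z hz
    have hz0 : (0 : ℝ) < f z := hz.2
    have e : (fun y ↦ (A y * S.gscMat p y * (A y).transpose) j l) =ᶠ[𝓝 z]
        fun y ↦ S.bdryGram p i₀ y j l := by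
      filter_upwards [hZo.mem_nhds hz] with y hy
      rw [hGram y hy]
    have e' : fd A i (fun y ↦ (A y * S.gscMat p y * (A y).transpose) j l) z =
        f z * fd (bdryMat i₀ f) i (fun y ↦ S.bdryGram p i₀ y j l) z := by
      simp only [fd, pderiv_congr e, smul_eq_mul, Finset.mul_sum]
      exact Finset.sum_congr rfl fun a _ ↦ mul_assoc _ _ _
    rw [e', abs_mul, abs_of_pos hz0]
    have h1 := (hball z hz.1).2.2.2.2.2.2.2.2.1 (i, j, l)
    calc _ ≤ 1 * b₇ := mul_le_mul (hf1 z hz) h1 (abs_nonneg _) zero_le_one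
      _ = b₇ := one_mul _
  set k := n * ((3 * b₇ + 3 * (n * (b₂ * b₃))) / 2 * b₄) with hk
  have hk0 : 0 ≤ k := by positivity
  refine ⟨R, hR, {
    A := A, w := fun z ↦ (f z ^ (n + 1))⁻¹, α := fun i _ ↦ if i = i₀ then 1 else 0
    div := fun i z ↦ f z * bdryDiv i₀ f i z, brk := bdryBrk i₀ f
    C := b₁ + b₂ + 1
    isOpen := hZo
    A_smooth := hAs
    w_smooth := ((hfU.mono hZU).pow (n + 1)).inv fun z hz ↦ pow_ne_zero _ (ne_of_gt hz.2)
    w_pos := fun z hz ↦ inv_pos.2 (pow_pos hz.2 _)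
    α_smooth := fun i ↦ contDiffOn_const
    div_eq := fun i z hz ↦ bdryDiv_eq hU hfU h0 (hZU hz) hz.2 i
    brk_eq := hbrk
    C_nonneg := by positivity
    div_le := fun i z hz ↦ by
      have hz0 : (0 : ℝ) < f z := hz.2
      rw [abs_mul, abs_of_pos hz0]
      have := mul_le_mul (hf1 z hz) ((hball z hz.1).2.2.1 i) (abs_nonneg _) zero_le_one
      linarith
    brk_le := fun i j k z hz ↦ by
      have := (hball z hz.1).2.2.2.1 (i, j, k)
      simp only at this
      linarith
    α_le := fun i z hz ↦ by
      split_ifs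
      · rw [abs_one]; linarith
      · rw [abs_zero]; positivity
    dα_le := fun i j z hz ↦ by
      simp only [fd, pderiv, fderiv_const_apply, zero_apply, smul_zero, Finset.sum_const_zero,
        abs_zero]
      positivity
    inv := fun z ↦ (f z ^ 2)⁻¹ • bdryCoMat i₀ f z
    b := b₃ + b₄ + b₅ + b₆ + b₈ + k
    subset_target := hsub.trans inter_subset_left
    inv_mul := hinv
    α_eq := hαe
    b_nonneg := by positivity
    gram_le := fun i z hz ↦ by
      have := (le_abs_self _).trans ((hball z hz.1).2.2.2.2.1 (i, i))
      rw [hGram z hz]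
      simp only at this
      linarith
    gram_inv_le := fun i z hz ↦ by
      have := (le_abs_self _).trans ((hball z hz.1).2.2.2.2.2.1 (i, i))
      rw [hGram z hz]
      simp only at this
      linarith
    sqrt_det_le := fun z hz ↦ by
      have h1 := (hball z hz.1).2.2.2.2.2.2.1 ()
      have h2 : 0 < f z ^ (n + 1) := pow_pos hz.2 _
      rw [abs_mul, abs_of_nonneg (Real.sqrt_nonneg _), hdet z hz] at h1
      rw [← div_eq_mul_inv, le_div_iff₀ h2, mul_comm]
      linarith
    le_sqrt_det := fun z hz ↦ by
      have h1 := (hball z hz.1).2.2.2.2.2.2.2.1 ()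
      have h2 : 0 < f z ^ (n + 1) := pow_pos hz.2 _
      have h3 : 0 < √(S.gscMat p z).det :=
        Real.sqrt_pos.2 (S.posDef_gscMat_posDom p (hZp hz)).det_pos
      rw [abs_inv, abs_mul, abs_of_nonneg (Real.sqrt_nonneg _), hdet z hz, mul_inv,
        ← div_eq_mul_inv, div_le_iff₀ h3] at h1
      refine h1.trans (mul_le_mul_of_nonneg_right ?_ h3.le)
      linarith
    chr_le := fun i j l z hz ↦ by
      have h1 := abs_frameChr_le (A := A) (B := fun z ↦ (f z ^ 2)⁻¹ • bdryCoMat i₀ f z)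
        (fun i a ↦ differentiableAt_of_open hZo (hAs i a) hz)
        (fun i a ↦ differentiableAt_of_open (S.isOpen_posDom p) (S.contDiffOn_gscMat_posDom p i a)
          (hZp hz))
        (posDef_transpose (S.posDef_gscMat_posDom p (hZp hz)))
        (S.posDef_gscMat_posDom p (hZp hz)).det_pos.ne' (hinv z hz)
        (b := fun i j k ↦ bdryBrk i₀ f i j k z) (fun i j a ↦ hbrk i j a z hz)
        (C₁ := b₂) (C₂ := b₃) (C₃ := b₄) (C₄ := b₇)
        (fun i j k ↦ (hball z hz.1).2.2.2.1 (i, j, k))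
        (fun j l ↦ by rw [hGram z hz]; exact (hball z hz.1).2.2.2.2.1 (j, l))
        (fun j l ↦ by rw [hGram z hz]; exact (hball z hz.1).2.2.2.2.2.1 (j, l))
        (fun i j l ↦ hfd i j l z hz) i j l
      linarith
    chr_g_le := fun i j l z hz ↦ by
      have h1 := (hball z hz.1).2.2.2.2.2.2.2.2.2.1 (i, j, l)
      simp only at h1
      rw [hA, frameChr_bdry hU hfU h0 (hZU hz) hz.2]
      linarith }, i₀, b₁ + b₉, by positivity, fun z hz ↦ ⟨fun i ↦ rfl, fun i ↦ ?_, fun i a ↦ ?_⟩⟩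
  · have hz0 : (0 : ℝ) < f z := hz.2
    have := mul_le_mul_of_nonneg_right ((hball z hz.1).2.2.1 i) hz0.le
    simp only [abs_mul, abs_of_pos hz0]
    nlinarith
  · have hz0 : (0 : ℝ) < f z := hz.2
    have h1 := (hball z hz.1).2.2.2.2.2.2.2.2.2.2 (i, a)
    have := mul_le_mul_of_nonneg_right h1 hz0.le
    simp only [hA, Matrix.smul_apply, smul_eq_mul, abs_mul, abs_of_pos hz0]
    nlinarith

end Region


/-- A property of nonnegative continuous functions that is closed under sums, and that holds for
functions that are positive at a given point of a compact set, holds for a function that is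
positive on the compact set. -/
theorem exists_pos_of_local {X : Type*} [TopologicalSpace X] {K : Set X} (hK : IsCompact K)
    {P : (X → ℝ) → Prop} (h0 : P fun _ ↦ 0)
    (hadd : ∀ f g, Continuous f → Continuous g → P f → P g → P fun p ↦ f p + g p)
    (hloc : ∀ p ∈ K, ∃ f, Continuous f ∧ (∀ q, 0 ≤ f q) ∧ 0 < f p ∧ P f) :
    ∃ f, Continuous f ∧ (∀ q, 0 ≤ f q) ∧ (∀ p ∈ K, 0 < f p) ∧ P f := by
  refine hK.induction_on (p := fun s ↦ ∃ f, Continuous f ∧ (∀ q, 0 ≤ f q) ∧ (∀ p ∈ s, 0 < f p) ∧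
    P f) ⟨fun _ ↦ 0, continuous_const, fun _ ↦ le_rfl, fun _ h ↦ h.elim, h0⟩ ?_ ?_ ?_
  · rintro s t hst ⟨f, h1, h2, h3, h4⟩
    exact ⟨f, h1, h2, fun p hp ↦ h3 p (hst hp), h4⟩
  · rintro s t ⟨f, h1, h2, h3, h4⟩ ⟨g, k1, k2, k3, k4⟩
    refine ⟨fun p ↦ f p + g p, h1.add k1, fun q ↦ add_nonneg (h2 q) (k2 q), ?_,
      hadd f g h1 k1 h4 k4⟩
    rintro p (hp | hp)
    · exact add_pos_of_pos_of_nonneg (h3 p hp) (k2 p)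
    · exact add_pos_of_nonneg_of_pos (h2 p) (k3 p hp)
  · intro p hp
    obtain ⟨f, h1, h2, h3, h4⟩ := hloc p hp
    exact ⟨{q | 0 < f q}, mem_nhdsWithin_of_mem_nhds (h1.continuousAt.eventually
      (lt_mem_nhds h3)), f, h1, h2, fun _ h ↦ h, h4⟩

theorem exists_pos_le_of_isCompact {X : Type*} [TopologicalSpace X] {K : Set X} (hK : IsCompact K)
    {f : X → ℝ} (hf : Continuous f) (h : ∀ p ∈ K, 0 < f p) : ∃ δ, 0 < δ ∧ ∀ p ∈ K, δ ≤ f p := by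
  rcases K.eq_empty_or_nonempty with rfl | hne
  · exact ⟨1, one_pos, fun _ h ↦ h.elim⟩
  · obtain ⟨p, hp, hmin⟩ := hK.exists_isMinOn hne hf.continuousOn
    exact ⟨f p, h p hp, fun q hq ↦ hmin hq⟩

theorem eventually_pos_of_hasDerivAt {f : ℝ → ℝ} {f' : ℝ} (h : HasDerivAt f f' 0) (h0 : 0 ≤ f 0)
    (hf : 0 < f') : ∀ᶠ t in 𝓝[>] (0 : ℝ), 0 < f t := by
  have h1 := (hasDerivAt_iff_tendsto_slope_zero.1 h).eventually (lt_mem_nhds hf)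
  have h2 : ∀ᶠ t in 𝓝[>] (0 : ℝ), 0 < t⁻¹ • (f (0 + t) - f 0) :=
    h1.filter_mono (nhdsWithin_mono _ fun t ht ↦ ne_of_gt ht)
  filter_upwards [h2, self_mem_nhdsWithin] with t ht (ht0 : 0 < t)
  rw [zero_add, smul_eq_mul] at ht
  have := (pos_iff_pos_of_mul_pos ht).1 (inv_pos.2 ht0)
  linarith

namespace Region

attribute [-instance] TopCat.of.chartedSpace

variable {n : ℕ} {M : Type*} [TopologicalSpace M] [ChartedSpace (Eu n) M]
  [IsManifold (𝓡 n) ∞ M] [T2Space M] [SigmaCompactSpace M]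

theorem dAt_eq_fderiv {f : M → ℝ} (hf : ContMDiff (𝓡 n) 𝓘(ℝ, ℝ) ∞ f) (q : M) :
    ∃ L : TangentSpace (𝓡 n) q →L[ℝ] Eu n, dAt n f q =
      (fderiv ℝ (fun z ↦ f ((chartAt (Eu n) q).symm z)) (chartAt (Eu n) q q)).comp L ∧
      L = mfderiv (𝓡 n) (𝓡 n) (chartAt (Eu n) q) q := by
  refine ⟨_, ?_, rfl⟩
  have hq := mem_chart_source (Eu n) q
  have h1 : f =ᶠ[𝓝 q] (fun z ↦ f ((chartAt (Eu n) q).symm z)) ∘ chartAt (Eu n) q := by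
    filter_upwards [(chartAt (Eu n) q).open_source.mem_nhds hq] with y hy
    simp [(chartAt (Eu n) q).left_inv hy]
  have h2 := mfderiv_comp (I := 𝓡 n) (I' := 𝓡 n) (I'' := 𝓘(ℝ, ℝ)) q
    (g := fun z ↦ f ((chartAt (Eu n) q).symm z)) (f := chartAt (Eu n) q)
    (differentiableAt_of_open (chartAt (Eu n) q).open_target (contDiffOn_fun_comp hf q)
      (mem_chart_target _ q)).mdifferentiableAt
    (mdifferentiableAt_atlas (chart_mem_atlas _ q) hq)
  rw [mfderiv_eq_fderiv] at h2
  rw [dAt, h1.mfderiv_eq]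
  exact h2

theorem hasDerivAt_chart_line {f : M → ℝ} (hf : ContMDiff (𝓡 n) 𝓘(ℝ, ℝ) ∞ f) (q : M) (v : Eu n) :
    HasDerivAt (fun t : ℝ ↦ f ((chartAt (Eu n) q).symm (chartAt (Eu n) q q + t • v)))
      (fderiv ℝ (fun z ↦ f ((chartAt (Eu n) q).symm z)) (chartAt (Eu n) q q) v) 0 := by
  have h1 := (differentiableAt_of_open (chartAt (Eu n) q).open_target (contDiffOn_fun_comp hf q)
    (mem_chart_target _ q)).hasFDerivAt
  have h2 : HasDerivAt (fun t : ℝ ↦ chartAt (Eu n) q q + t • v) v 0 := by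
    simpa using ((hasDerivAt_id (0 : ℝ)).smul_const v).const_add (chartAt (Eu n) q q)
  have h3 : HasFDerivAt (fun z ↦ f ((chartAt (Eu n) q).symm z))
      (fderiv ℝ (fun z ↦ f ((chartAt (Eu n) q).symm z)) (chartAt (Eu n) q q))
      (chartAt (Eu n) q q + (0 : ℝ) • v) := by simpa using h1
  exact h3.comp_hasDerivAt 0 h2

theorem tendsto_chart_line (q : M) (v : Eu n) :
    Filter.Tendsto (fun t : ℝ ↦ (chartAt (Eu n) q).symm (chartAt (Eu n) q q + t • v))
      (𝓝[>] 0) (𝓝 q) := by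
  have h1 : ContinuousAt (fun t : ℝ ↦ chartAt (Eu n) q q + t • v) 0 := by fun_prop
  have h2 := (chartAt (Eu n) q).continuousAt_symm (mem_chart_target (Eu n) q)
  have h3 : ContinuousAt (chartAt (Eu n) q).symm (chartAt (Eu n) q q + (0 : ℝ) • v) := by
    simpa using h2
  have h4 := (ContinuousAt.comp (f := fun t : ℝ ↦ chartAt (Eu n) q q + t • v) h3 h1).tendsto
  simp only [Function.comp, zero_smul, add_zero,
    (chartAt (Eu n) q).left_inv (mem_chart_source (Eu n) q)] at h4
  exact h4.mono_left nhdsWithin_le_nhds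

variable (S : Region n M)

/-- Near the interior boundary there are points outside of the region. -/
theorem frequently_exterior {q : M} (hx : 0 ≤ S.x q) (hρ : S.rho q = 0) :
    ∃ᶠ y in 𝓝 q, 0 < S.x y ∧ S.rho y < 0 := by
  obtain ⟨L, hL, hL'⟩ := dAt_eq_fderiv S.x_smooth q
  obtain ⟨L₂, hL₂, hL₂'⟩ := dAt_eq_fderiv S.rho_smooth q
  subst hL' hL₂'
  obtain ⟨w, hw1, hw2⟩ : ∃ w, dAt n S.rho q w < 0 ∧ (S.x q = 0 → 0 < dAt n S.x q w) := by
    rcases hx.eq_or_lt with hx0 | hx0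
    · have hli := LinearIndependent.pair_iff.1 (S.transversal q hx0.symm hρ)
      obtain ⟨w₂, hw₂⟩ : ∃ w, dAt n S.x q w ≠ 0 := by
        by_contra! h
        exact S.x_regular q hx0.symm (ContinuousLinearMap.ext h)
      obtain ⟨w₁, hw₁, hw₁'⟩ : ∃ w, dAt n S.x q w = 0 ∧ dAt n S.rho q w ≠ 0 := by
        by_contra! h
        have := hli (-(dAt n S.rho q w₂)) (dAt n S.x q w₂) (by
          ext w
          have h1 := h (dAt n S.x q w₂ • w - dAt n S.x q w • w₂) (by
            simp only [map_sub, map_smul, smul_eq_mul]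
            ring)
          simp only [map_sub, map_smul, smul_eq_mul] at h1
          simp only [add_apply, smul_apply, smul_eq_mul, zero_apply]
          linarith)
        exact hw₂ this.2
      refine ⟨(dAt n S.x q w₂)⁻¹ • w₂ +
        (-(1 + (dAt n S.x q w₂)⁻¹ * dAt n S.rho q w₂) * (dAt n S.rho q w₁)⁻¹) • w₁, ?_, fun _ ↦ ?_⟩
      · simp only [map_add, map_smul, smul_eq_mul]
        rw [inv_mul_cancel_right₀ hw₁']
        linarith
      · simp only [map_add, map_smul, smul_eq_mul, hw₁, mul_zero, add_zero]
        rw [inv_mul_cancel₀ hw₂]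
        exact one_pos
    · obtain ⟨w, hw⟩ : ∃ w, dAt n S.rho q w ≠ 0 := by
        by_contra! h
        exact S.rho_regular q hx hρ (ContinuousLinearMap.ext h)
      refine ⟨-(dAt n S.rho q w)⁻¹ • w, ?_, fun h ↦ absurd h hx0.ne'⟩
      simp only [map_smul, smul_eq_mul, neg_mul]
      rw [inv_mul_cancel₀ hw]
      norm_num
  set v : Eu n := mfderiv (𝓡 n) (𝓡 n) (chartAt (Eu n) q) q w with hv
  rw [hL₂] at hw1
  have hsq : (chartAt (Eu n) q).symm (chartAt (Eu n) q q) = q :=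
    (chartAt (Eu n) q).left_inv (mem_chart_source (Eu n) q)
  have h1 : ∀ᶠ t in 𝓝[>] (0 : ℝ),
      0 < -S.rho ((chartAt (Eu n) q).symm (chartAt (Eu n) q q + t • v)) :=
    eventually_pos_of_hasDerivAt (hasDerivAt_chart_line S.rho_smooth q v).neg
      (by simp [hsq, hρ]) (neg_pos.2 hw1)
  have h2 : ∀ᶠ t in 𝓝[>] (0 : ℝ),
      0 < S.x ((chartAt (Eu n) q).symm (chartAt (Eu n) q q + t • v)) := by
    rcases hx.eq_or_lt with hx0 | hx0
    · have hw3 := hw2 hx0.symm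
      rw [hL] at hw3
      exact eventually_pos_of_hasDerivAt (hasDerivAt_chart_line S.x_smooth q v)
        (by simp [hsq, ← hx0]) hw3
    · exact (tendsto_chart_line q v).eventually
        (S.x_smooth.continuous.continuousAt.eventually (lt_mem_nhds hx0))
  refine (tendsto_chart_line q v).frequently (Filter.Eventually.frequently ?_)
  filter_upwards [h1, h2] with t ht1 ht2
  exact ⟨ht2, neg_pos.1 ht1⟩

/-- Near the artificial boundary the interior is connected. -/
theorem exists_connected_near_boundary {q : M} (hq : S.x q = 0) :
    ∃ q₁, 0 < S.x q₁ ∧ ∀ᶠ a in 𝓝 q, 0 < S.x a →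
      ∃ s : Set M, IsPreconnected s ∧ s ⊆ {p | 0 < S.x p} ∧ a ∈ s ∧ q₁ ∈ s := by
  obtain ⟨L, hL, -⟩ := dAt_eq_fderiv S.x_smooth q
  set φ := chartAt (Eu n) q with hφ
  set ξ : Eu n → ℝ := fun z ↦ S.x (φ.symm z) with hξ
  set z₀ := φ q with hz₀
  have hT := φ.open_target
  have hs : ContDiffOn ℝ ∞ ξ φ.target := contDiffOn_fun_comp S.x_smooth q
  have hzt : z₀ ∈ φ.target := mem_chart_target _ q
  obtain ⟨v, hv⟩ : ∃ v, 0 < fderiv ℝ ξ z₀ v := by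
    have h1 : fderiv ℝ ξ z₀ ≠ 0 := fun h ↦ S.x_regular q hq (by rw [hL, h]; exact ContinuousLinearMap.zero_comp _)
    obtain ⟨w, hw⟩ : ∃ w, fderiv ℝ ξ z₀ w ≠ 0 := by
      by_contra! h
      exact h1 (ContinuousLinearMap.ext h)
    refine ⟨(fderiv ℝ ξ z₀ w)⁻¹ • w, ?_⟩
    rw [map_smul, smul_eq_mul, inv_mul_cancel₀ hw]
    exact one_pos
  have hdc : ContinuousAt (fderiv ℝ ξ) z₀ :=
    (hs.continuousOn_fderiv_of_isOpen hT (by simp)).continuousAt (hT.mem_nhds hzt)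
  -- near `(z₀, v)` the derivative of `ξ` is positive
  have hpos : ∀ᶠ y : Eu n × Eu n in 𝓝 (z₀, v), 0 < fderiv ℝ ξ y.1 y.2 := by
    have h1 : ContinuousAt (fun y : Eu n × Eu n ↦ fderiv ℝ ξ y.1 y.2) (z₀, v) :=
      (ContinuousAt.comp (g := fderiv ℝ ξ) (f := Prod.fst) hdc continuousAt_fst).clm_apply
        continuousAt_snd
    exact h1.eventually (lt_mem_nhds hv)
  obtain ⟨R, hR, hball⟩ := Metric.eventually_nhds_iff_ball.1
    (hpos.and (continuousAt_fst.eventually (Filter.eventually_of_mem (hT.mem_nhds hzt) fun _ h ↦ h) :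
      ∀ᶠ y : Eu n × Eu n in 𝓝 (z₀, v), y.1 ∈ φ.target))
  have hb : ∀ y w, dist y z₀ < R → dist w v < R → 0 < fderiv ℝ ξ y w ∧ y ∈ φ.target :=
    fun y w h1 h2 ↦ hball (y, w) (by rw [Metric.mem_ball, Prod.dist_eq]; exact max_lt h1 h2)
  set s : ℝ := R / (2 * (‖v‖ + 1)) with hs_def
  have hs0 : 0 < s := by positivity
  have hsv : s * ‖v‖ < R / 2 := by
    rw [hs_def, div_mul_eq_mul_div, div_lt_div_iff₀ (by positivity) two_pos]
    nlinarith [norm_nonneg v]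
  set z₁ := z₀ + s • v with hz₁
  have key : ∀ a, dist a z₀ < min (R / 2) (s * R) → ∀ t ∈ Icc (0 : ℝ) 1,
      a + t • (z₁ - a) ∈ φ.target ∧ 0 < fderiv ℝ ξ (a + t • (z₁ - a)) (z₁ - a) := by
    intro a ha t ht
    have ha1 := lt_of_lt_of_le ha (min_le_left _ _)
    have ha2 := lt_of_lt_of_le ha (min_le_right _ _)
    have e1 : z₁ - a = s • (v + s⁻¹ • (z₀ - a)) := by
      rw [smul_add, smul_smul, mul_inv_cancel₀ hs0.ne', one_smul, hz₁]
      abel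
    have h1 : dist (a + t • (z₁ - a)) z₀ < R := by
      have e2 : a + t • (z₁ - a) - z₀ = (1 - t) • (a - z₀) + t • (s • v) := by
        rw [hz₁]
        module
      rw [dist_eq_norm, e2]
      rw [dist_eq_norm] at ha1
      have n1 : ‖(1 - t) • (a - z₀)‖ ≤ ‖a - z₀‖ := by
        rw [norm_smul, Real.norm_eq_abs, abs_of_nonneg (by linarith [ht.2])]
        exact mul_le_of_le_one_left (norm_nonneg _) (by linarith [ht.1])
      have n2 : ‖t • (s • v)‖ ≤ s * ‖v‖ := by
        rw [norm_smul, norm_smul, Real.norm_eq_abs, Real.norm_eq_abs, abs_of_nonneg ht.1,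
          abs_of_pos hs0]
        exact mul_le_of_le_one_left (by positivity) ht.2
      linarith [norm_add_le ((1 - t) • (a - z₀)) (t • (s • v))]
    have h2 : dist (v + s⁻¹ • (z₀ - a)) v < R := by
      rw [dist_eq_norm, add_sub_cancel_left, norm_smul, norm_inv, Real.norm_eq_abs, abs_of_pos hs0,
        ← dist_eq_norm, dist_comm, inv_mul_lt_iff₀ hs0]
      exact ha2
    obtain ⟨h3, h4⟩ := hb _ _ h1 h2
    refine ⟨h4, ?_⟩
    rw [e1, map_smul, smul_eq_mul, ← e1]
    exact mul_pos hs0 h3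
  have hmono : ∀ a, dist a z₀ < min (R / 2) (s * R) →
      StrictMonoOn (fun t : ℝ ↦ ξ (a + t • (z₁ - a))) (Icc 0 1) := by
    intro a ha
    have hd : ∀ t ∈ Icc (0 : ℝ) 1, HasDerivAt (fun t : ℝ ↦ ξ (a + t • (z₁ - a)))
        (fderiv ℝ ξ (a + t • (z₁ - a)) (z₁ - a)) t := by
      intro t ht
      have h1 := (differentiableAt_of_open hT hs (key a ha t ht).1).hasFDerivAt
      have h2 : HasDerivAt (fun t : ℝ ↦ a + t • (z₁ - a)) (z₁ - a) t := by
        simpa using ((hasDerivAt_id t).smul_const (z₁ - a)).const_add a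
      exact h1.comp_hasDerivAt t h2
    refine strictMonoOn_of_deriv_pos (convex_Icc 0 1)
      (fun t ht ↦ (hd t ht).continuousAt.continuousWithinAt) fun t ht ↦ ?_
    have ht' := interior_subset ht
    rw [(hd t ht').deriv]
    exact (key a ha t ht').2
  have hr0 : 0 < min (R / 2) (s * R) := lt_min (by positivity) (by positivity)
  refine ⟨φ.symm z₁, ?_, ?_⟩
  · have h1 := hmono z₀ (by rwa [dist_self]) (left_mem_Icc.2 zero_le_one)
      (right_mem_Icc.2 zero_le_one) one_pos
    simp only [zero_smul, add_zero, one_smul, add_sub_cancel] at h1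
    have h2 : ξ z₀ = 0 := by
      simp only [hξ, hz₀]
      rw [φ.left_inv (mem_chart_source _ q), hq]
    rw [h2] at h1
    exact h1
  · have h1 : ∀ᶠ a in 𝓝 q, dist (φ a) z₀ < min (R / 2) (s * R) :=
      (φ.continuousAt (mem_chart_source _ q)).eventually (Metric.ball_mem_nhds _ hr0)
    filter_upwards [h1, φ.open_source.mem_nhds (mem_chart_source _ q)] with a ha has hxa
    refine ⟨(fun t : ℝ ↦ φ.symm (φ a + t • (z₁ - φ a))) '' Icc 0 1, ?_, ?_, ?_, ?_⟩
    · refine isPreconnected_Icc.image _ (ContinuousOn.comp φ.continuousOn_symm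
        (t := φ.target) (by fun_prop) fun t ht ↦ (key _ ha t ht).1)
    · rintro _ ⟨t, ht, rfl⟩
      have h2 := (hmono _ ha).monotoneOn (left_mem_Icc.2 zero_le_one) ht ht.1
      simp only [zero_smul, add_zero] at h2
      have h3 : ξ (φ a) = S.x a := by simp only [hξ, φ.left_inv has]
      exact lt_of_lt_of_le (by rw [h3]; exact hxa) h2
    · exact ⟨0, left_mem_Icc.2 zero_le_one, by simp [φ.left_inv has]⟩
    · exact ⟨1, right_mem_Icc.2 zero_le_one, by simp⟩

/-- An open and relatively closed set of the interior that contains the points outside of the region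
contains the region. -/
theorem subset_of_isOpen_of_closed {G : Set M} (hG : IsOpen G)
    (hcl : ∀ p, 0 < S.x p → p ∈ closure G → p ∈ G) (hρ : ∀ p, S.rho p < 0 → p ∈ G) {p : M}
    (hp : 0 < S.x p) : p ∈ G := by
  rcases lt_or_ge (S.rho p) 0 with h | hρp
  · exact hρ p h
  have hconn : ∀ s : Set M, IsPreconnected s → s ⊆ {p | 0 < S.x p} → ∀ a ∈ s, a ∈ G → s ⊆ G :=
    fun s hs hsx a ha haG ↦ hs.subset_of_closure_inter_subset hG ⟨a, ha, haG⟩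
      fun y hy ↦ hcl y (hsx hy.2) hy.1
  set H₁ := {q | ∀ᶠ y in 𝓝 q, 0 < S.x y → y ∈ G} with hH₁
  set H₂ := {q | ∀ᶠ y in 𝓝 q, 0 < S.x y → y ∉ G} with hH₂
  have o₁ : IsOpen H₁ := isOpen_iff_mem_nhds.2 fun q hq ↦ eventually_eventually_nhds.2 hq
  have o₂ : IsOpen H₂ := isOpen_iff_mem_nhds.2 fun q hq ↦ eventually_eventually_nhds.2 hq
  have hcov : {p : M | 0 ≤ S.x p ∧ 0 ≤ S.rho p} ⊆ H₁ ∪ H₂ := by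
    rintro q ⟨hq, -⟩
    rcases hq.eq_or_lt with hq0 | hq0
    · obtain ⟨q₁, hq₁, hev⟩ := S.exists_connected_near_boundary hq0.symm
      by_cases hqG : q₁ ∈ G
      · left
        filter_upwards [hev] with a ha hxa
        obtain ⟨s, h1, h2, h3, h4⟩ := ha hxa
        exact hconn s h1 h2 q₁ h4 hqG h3
      · right
        filter_upwards [hev] with a ha hxa haG
        obtain ⟨s, h1, h2, h3, h4⟩ := ha hxa
        exact hqG (hconn s h1 h2 a h3 haG h4)
    · by_cases hqG : q ∈ G
      · left
        filter_upwards [hG.mem_nhds hqG] with a ha _ using ha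
      · right
        have : q ∉ closure G := fun h ↦ hqG (hcl q hq0 h)
        filter_upwards [isClosed_closure.isOpen_compl.mem_nhds this] with a ha _ h
        exact ha (subset_closure h)
  have hfreq : ∀ q ∈ {p : M | 0 ≤ S.x p ∧ 0 ≤ S.rho p}, ∃ᶠ y in 𝓝 q, 0 < S.x y := by
    rintro q ⟨hq, -⟩
    rcases hq.eq_or_lt with hq0 | hq0
    · obtain ⟨L, hL, -⟩ := dAt_eq_fderiv S.x_smooth q
      obtain ⟨v, hv⟩ : ∃ v, 0 < fderiv ℝ (fun z ↦ S.x ((chartAt (Eu n) q).symm z))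
          (chartAt (Eu n) q q) v := by
        by_contra! h
        refine S.x_regular q hq0.symm ?_
        rw [hL]
        ext w
        exact le_antisymm (h _) (by simpa using h (-(L w)))
      refine (tendsto_chart_line q v).frequently (Filter.Eventually.frequently ?_)
      refine eventually_pos_of_hasDerivAt (hasDerivAt_chart_line S.x_smooth q v) ?_ hv
      simp [(chartAt (Eu n) q).left_inv (mem_chart_source (Eu n) q), ← hq0]
    · exact (S.x_smooth.continuous.continuousAt.eventually (lt_mem_nhds hq0)).frequently
  set K := connectedComponentIn {p : M | 0 ≤ S.x p ∧ 0 ≤ S.rho p} p with hK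
  have hKs : K ⊆ {p : M | 0 ≤ S.x p ∧ 0 ≤ S.rho p} := connectedComponentIn_subset _ _
  obtain ⟨q, hqK, hq0⟩ := S.meets p hp.le hρp
  have hq₁ : q ∈ H₁ := by
    rcases hcov (hKs hqK) with h | h
    · exact h
    · exfalso
      obtain ⟨y, ⟨hy1, hy2⟩, hy3⟩ :=
        ((S.frequently_exterior (hKs hqK).1 hq0).and_eventually h).exists
      exact hy3 hy1 (hρ y hy2)
  have hKH : K ⊆ H₁ := by
    have hd : K ∩ (H₁ ∩ H₂) = ∅ := by
      refine eq_empty_of_forall_notMem fun y hy ↦ ?_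
      obtain ⟨a, ha, ha1, ha2⟩ := ((hfreq y (hKs hy.1)).and_eventually
        ((show ∀ᶠ y in 𝓝 y, _ from hy.2.1).and (show ∀ᶠ y in 𝓝 y, _ from hy.2.2))).exists
      exact ha2 ha (ha1 ha)
    rcases isPreconnected_iff_subset_of_disjoint.1 (isPreconnected_connectedComponentIn (x := p)
      (F := {p : M | 0 ≤ S.x p ∧ 0 ≤ S.rho p})) H₁ H₂ o₁ o₂ (hKs.trans hcov) hd with h | h
    · exact h
    · exact absurd ⟨hqK, hq₁, h hqK⟩ (eq_empty_iff_forall_notMem.1 hd q)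
  exact (hKH (mem_connectedComponentIn ⟨hp.le, hρp⟩)).self_of_nhds hp

end Region


namespace Region

attribute [-instance] TopCat.of.chartedSpace

variable {n : ℕ} {M : Type*} [TopologicalSpace M] [ChartedSpace (Eu n) M]
  [IsManifold (𝓡 n) ∞ M] [T2Space M] [SigmaCompactSpace M] (S : Region n M)
  {𝕜 : Type*} [RCLike 𝕜]

/-- The closed region. -/
def closedDom : Set M := {p | 0 ≤ S.x p ∧ 0 ≤ S.rho p}

theorem dom_subset_closedDom : S.dom ⊆ S.closedDom := fun _ hp ↦ ⟨hp.1.le, hp.2.le⟩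

variable {S} in
theorem energy_zero {r : ℕ} {s : Comps n M 𝕜 r} (hs : S.IsTest s) :
    S.energy s (fun _ ↦ 0) = 0 := by
  simpa using energy_const_mul hs 0 (fun _ ↦ 0)

/-- Near `p` the tensors `s u` are controlled by `Φ u`. -/
def LocalBound {U : Type*} {r : ℕ} (s : U → Comps n M 𝕜 r) (Φ : U → ℝ) (p : M) : Prop :=
  ∃ f : M → ℝ, Continuous f ∧ (∀ q, 0 ≤ f q) ∧ 0 < f p ∧ ∃ C, 0 ≤ C ∧
    ∀ u, S.energy (s u) f ≤ C * Φ u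

/-- `p` is a good point for a family of pairs of tensors if the first one is controlled by the
second one near `p`. -/
def Good {U : Type*} {r r' : ℕ} (s : U → Comps n M 𝕜 r) (t : U → Comps n M 𝕜 r') : M → Prop :=
  S.LocalBound s fun u ↦ S.energy (t u) fun _ ↦ 1

section Patch

variable {S} {U : Type*} {r r' : ℕ} {s : U → Comps n M 𝕜 r} {t : U → Comps n M 𝕜 r'}

theorem good_of_pos (hs : ∀ u, S.IsTest (s u))
    (hg : ∀ p, 0 < S.x p → ∃ N ∈ 𝓝 p, ∀ q ∈ N, S.Good s t q → S.Good s t p) {p : M}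
    (hp : 0 < S.x p) : S.Good s t p := by
  refine S.subset_of_isOpen_of_closed (G := {p | S.Good s t p}) ?_ ?_ ?_ hp
  · refine isOpen_iff_mem_nhds.2 ?_
    rintro q ⟨f, h1, h2, h3, h4⟩
    filter_upwards [h1.continuousAt.eventually (lt_mem_nhds h3)] with y hy
    exact ⟨f, h1, h2, hy, h4⟩
  · intro q hq hcl
    obtain ⟨N, hN, h⟩ := hg q hq
    obtain ⟨y, hy1, hy2⟩ := mem_closure_iff_nhds.1 hcl N hN
    exact h y hy1 hy2
  · intro q hq
    have hc : Continuous fun y ↦ max (-S.rho y) 0 := S.rho_smooth.continuous.neg.max continuous_const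
    refine ⟨fun y ↦ max (-S.rho y) 0, hc, fun y ↦ le_max_right _ _, lt_max_of_lt_left (neg_pos.2 hq),
      0, le_rfl, fun u ↦ ?_⟩
    rw [zero_mul]
    exact (energy_mono (hs u) hc continuous_const fun y hy ↦
      max_le (by linarith [hy.2]) le_rfl).trans (energy_zero (hs u)).le

/-- Bounds that hold near all the points of the closed region hold on the region. -/
theorem exists_energy_le_of_local (hs : ∀ u, S.IsTest (s u)) {Φ : U → ℝ}
    (h : ∀ p ∈ S.closedDom, S.LocalBound s Φ p) :
    ∃ C, 0 ≤ C ∧ ∀ u, S.energy (s u) (fun _ ↦ 1) ≤ C * Φ u := by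
  obtain ⟨f, hf, -, hpos, C, hC, hb⟩ := exists_pos_of_local S.compact
    (P := fun f ↦ ∃ C, 0 ≤ C ∧ ∀ u, S.energy (s u) f ≤ C * Φ u)
    ⟨0, le_rfl, fun u ↦ by rw [energy_zero (hs u), zero_mul]⟩ (by
      rintro f g hf hg ⟨C, hC, h1⟩ ⟨D, hD, h2⟩
      refine ⟨C + D, add_nonneg hC hD, fun u ↦ ?_⟩
      rw [energy_add (hs u) hf hg, add_mul]
      exact add_le_add (h1 u) (h2 u)) h
  obtain ⟨δ, hδ, hδf⟩ := exists_pos_le_of_isCompact S.compact hf hpos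
  refine ⟨δ⁻¹ * C, by positivity, fun u ↦ ?_⟩
  calc S.energy (s u) (fun _ ↦ 1) ≤ S.energy (s u) fun p ↦ δ⁻¹ * f p := by
        refine energy_mono (hs u) continuous_const (continuous_const.mul hf) fun p hp ↦ ?_
        rw [← div_eq_inv_mul, one_le_div hδ]
        exact hδf p (S.dom_subset_closedDom hp)
    _ = δ⁻¹ * S.energy (s u) f := energy_const_mul (hs u) _ _
    _ ≤ δ⁻¹ * (C * Φ u) := mul_le_mul_of_nonneg_left (hb u) (by positivity)
    _ = _ := by ring

theorem exists_sq_x_le (S : Region n M) : ∃ m, 0 ≤ m ∧ ∀ p ∈ S.closedDom, S.x p ^ 2 ≤ m := by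
  obtain ⟨m, hm⟩ := (S.compact.image (S.x_smooth.continuous.pow 2)).bddAbove
  exact ⟨max m 0, le_max_right _ _, fun p hp ↦ (hm ⟨p, hp, rfl⟩).trans (le_max_left _ _)⟩

/-- The weighted energy is controlled up to a small multiple of the energy. -/
theorem exists_energy_sq_x_le (hs : ∀ u, S.IsTest (s u))
    (hg : ∀ p, 0 < S.x p → S.Good s t p) {ε : ℝ} (hε : 0 < ε) :
    ∃ C, 0 ≤ C ∧ ∀ u, S.energy (s u) (fun p ↦ S.x p ^ 2) ≤
      ε * S.energy (s u) (fun _ ↦ 1) + C * S.energy (t u) fun _ ↦ 1 := by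
  have hxc := S.x_smooth.continuous
  have hK : IsCompact (S.closedDom ∩ {p | ε ≤ S.x p ^ 2}) :=
    S.compact.inter_right (isClosed_le continuous_const (hxc.pow 2))
  obtain ⟨f, hf, hf0, hpos, C, hC, hb⟩ := exists_pos_of_local hK
    (P := fun f ↦ ∃ C, 0 ≤ C ∧ ∀ u, S.energy (s u) f ≤ C * S.energy (t u) fun _ ↦ 1)
    ⟨0, le_rfl, fun u ↦ by rw [energy_zero (hs u), zero_mul]⟩ (by
      rintro f g hf hg ⟨C, hC, h1⟩ ⟨D, hD, h2⟩
      refine ⟨C + D, add_nonneg hC hD, fun u ↦ ?_⟩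
      rw [energy_add (hs u) hf hg, add_mul]
      exact add_le_add (h1 u) (h2 u)) (by
      rintro p ⟨⟨hp, -⟩, hp2⟩
      refine hg p (hp.lt_of_ne fun h ↦ ?_)
      rw [mem_ofPred_eq, ← h] at hp2
      linarith)
  obtain ⟨δ, hδ, hδf⟩ := exists_pos_le_of_isCompact hK hf hpos
  obtain ⟨m, hm, hmx⟩ := exists_sq_x_le S
  refine ⟨m * δ⁻¹ * C, by positivity, fun u ↦ ?_⟩
  have h1 : S.energy (s u) (fun p ↦ S.x p ^ 2) ≤
      S.energy (s u) fun p ↦ ε * 1 + m * δ⁻¹ * f p := by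
    refine energy_mono (hs u) (hxc.pow 2)
      ((continuous_const.mul continuous_const).add (continuous_const.mul hf)) fun p hp ↦ ?_
    have hpc := S.dom_subset_closedDom hp
    by_cases h : ε ≤ S.x p ^ 2
    · have h2 := hδf p ⟨hpc, h⟩
      have h3 : m * 1 ≤ m * (δ⁻¹ * f p) := mul_le_mul_of_nonneg_left
        (by rwa [← div_eq_inv_mul, one_le_div hδ]) hm
      linarith [hmx p hpc]
    · have h3 : 0 ≤ m * δ⁻¹ * f p := mul_nonneg (by positivity) (hf0 p)
      linarith
  rw [energy_add (hs u) (f := fun _ ↦ ε * 1) (g := fun p ↦ m * δ⁻¹ * f p) continuous_const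
    (continuous_const.mul hf), energy_const_mul (hs u) ε (fun _ ↦ 1), energy_const_mul (hs u)] at h1
  have h2 := mul_le_mul_of_nonneg_left (hb u) (by positivity : 0 ≤ m * δ⁻¹)
  linarith

/-- The energy is controlled, if it is controlled near the artificial boundary up to the weighted
energy. -/
theorem exists_energy_le_of_boundary (hs : ∀ u, S.IsTest (s u))
    (hg : ∀ p, 0 < S.x p → S.Good s t p)
    (hb : ∀ p ∈ S.closedDom, S.x p = 0 → S.LocalBound s (fun u ↦ S.energy (t u) (fun _ ↦ 1) +
      S.energy (s u) fun p ↦ S.x p ^ 2) p) :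
    ∃ C, 0 ≤ C ∧ ∀ u, S.energy (s u) (fun _ ↦ 1) ≤ C * S.energy (t u) fun _ ↦ 1 := by
  have hx : ∀ u, 0 ≤ S.energy (s u) fun p ↦ S.x p ^ 2 := fun u ↦
    energy_nonneg (hs u) fun p _ ↦ sq_nonneg _
  obtain ⟨C, hC, h1⟩ := exists_energy_le_of_local hs (Φ := fun u ↦ S.energy (t u) (fun _ ↦ 1) +
    S.energy (s u) fun p ↦ S.x p ^ 2) (by
      rintro p ⟨hp, hp'⟩
      rcases hp.eq_or_lt with h | h
      · exact hb p ⟨hp, hp'⟩ h.symm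
      · obtain ⟨f, k1, k2, k3, C, hC, k4⟩ := hg p h
        refine ⟨f, k1, k2, k3, C, hC, fun u ↦ (k4 u).trans (mul_le_mul_of_nonneg_left ?_ hC)⟩
        linarith [hx u])
  obtain ⟨D, hD, h2⟩ := exists_energy_sq_x_le hs hg (ε := 1 / (2 * (C + 1))) (by positivity)
  refine ⟨2 * (C + C * D), by positivity, fun u ↦ ?_⟩
  have h3 := mul_le_mul_of_nonneg_left (h2 u) hC
  have h4 : C * (1 / (2 * (C + 1)) * S.energy (s u) fun _ ↦ 1) ≤
      (1 / 2) * S.energy (s u) fun _ ↦ 1 := by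
    rw [← mul_assoc]
    refine mul_le_mul_of_nonneg_right ?_ (energy_nonneg (hs u) fun p _ ↦ zero_le_one)
    rw [mul_one_div, div_le_div_iff₀ (by positivity) two_pos]
    linarith
  have h5 := h1 u
  linarith

end Patch

end Region


theorem abs_pderiv_le {n : ℕ} (f : Eu n → ℝ) (a : Fin n) (z : Eu n) :
    |pderiv a f z| ≤ ‖fderiv ℝ f z‖ := by
  rw [← Real.norm_eq_abs, pderiv]
  refine (ContinuousLinearMap.le_opNorm _ _).trans ?_
  simp

/-- A cutoff function that is supported in a ball, and that is equal to one on a smaller ball. -/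
theorem exists_bump {n : ℕ} (z₀ : Eu n) {r R : ℝ} (hr : 0 < r) (hrR : r < R) :
    ∃ β : Eu n → ℝ, ContDiff ℝ ∞ β ∧ (∀ z, 0 ≤ β z) ∧ (∀ z, β z ≤ 1) ∧
      (∀ z ∈ Metric.closedBall z₀ r, β z = 1) ∧ ∀ z ∉ Metric.closedBall z₀ R, β z = 0 := by
  let b : ContDiffBump z₀ := ⟨r, R, hr, hrR⟩
  refine ⟨b, b.contDiff, fun z ↦ b.nonneg, fun z ↦ b.le_one,
    fun z hz ↦ b.one_of_mem_closedBall hz, fun z hz ↦ b.zero_of_le_dist ?_⟩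
  rw [Metric.mem_closedBall, not_le] at hz
  exact hz.le

namespace Region

attribute [-instance] TopCat.of.chartedSpace

variable {n : ℕ} {M : Type*} [TopologicalSpace M] [ChartedSpace (Eu n) M]
  [IsManifold (𝓡 n) ∞ M] [T2Space M] [SigmaCompactSpace M] {S : Region n M}
  {𝕜 : Type*} [RCLike 𝕜]

namespace ScFrame

/-- Cutoff functions at the center of a ball on which the frame has the size of a function `y`. -/
theorem exists_cutoff {c : M} {z₀ : Eu n} {R : ℝ} (hR : 0 < R)
    (E : S.ScFrame c (Metric.ball z₀ R)) {y : M → ℝ} (hy : ContMDiff (𝓡 n) 𝓘(ℝ, ℝ) ∞ y) {B : ℝ}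
    (hA : ∀ z ∈ Metric.ball z₀ R ∩ {z | 0 < S.xi c z}, ∀ i a,
      |E.A z i a| ≤ B * y ((chartAt (Eu n) c).symm z)) :
    ∃ (β σ : Eu n → ℝ) (T : Set (Eu n)) (K : ℝ), 0 ≤ K ∧ E.Cutoff β σ T ∧ β z₀ = 1 ∧
      (∀ z, β z ^ 2 ≤ 1) ∧ (∀ z, σ z ≤ K * y ((chartAt (Eu n) c).symm z) ^ 2) ∧
      ∀ z, y ((chartAt (Eu n) c).symm z) ^ 2 * β z ^ 2 ≤ σ z := by
  set τ : Eu n → ℝ := fun z ↦ y ((chartAt (Eu n) c).symm z) with hτ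
  obtain ⟨β, hβs, hβ0, hβ1, hβz, hβoff⟩ := exists_bump z₀ (r := R / 4) (R := R / 2)
    (by linarith) (by linarith)
  obtain ⟨β', hβs', hβ0', hβ1', hβz', hβoff'⟩ := exists_bump z₀ (r := R / 2) (R := 3 * R / 4)
    (by linarith) (by linarith)
  set T := Metric.closedBall z₀ (3 * R / 4) with hT
  have hTO : T ⊆ Metric.ball z₀ R := Metric.closedBall_subset_ball (by linarith)
  have hTc : IsCompact T := isCompact_closedBall _ _
  obtain ⟨L, hL⟩ : ∃ L, ∀ z, ‖fderiv ℝ β z‖ ≤ L := by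
    have h1 : HasCompactSupport β := HasCompactSupport.intro (isCompact_closedBall z₀ (R / 2))
      fun z hz ↦ hβoff z hz
    exact (hβs.continuous_fderiv (by simp)).bounded_above_of_compact_support
      (h1.fderiv (𝕜 := ℝ))
  set K : ℝ := (n * (B * L)) ^ 2 + 1 with hK
  have hK0 : 0 ≤ K := by positivity
  have hle : ∀ z, β z ^ 2 ≤ β' z := by
    intro z
    by_cases hz : z ∈ Metric.closedBall z₀ (R / 2)
    · rw [hβz' z hz]
      exact pow_le_one₀ (hβ0 z) (hβ1 z)
    · rw [hβoff z hz]
      simpa using hβ0' z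
  have hsm : ContDiff ℝ ∞ fun z ↦ K * (τ z ^ 2 * β' z) := by
    refine contDiff_of_off hTc.isClosed (chartAt (Eu n) c).open_target
      (hTO.trans E.subset_target) ?_ fun z hz ↦ by rw [hβoff' z hz]; simp
    exact contDiffOn_const.mul (((contDiffOn_fun_comp hy c).pow 2).mul hβs'.contDiffOn)
  refine ⟨β, fun z ↦ K * (τ z ^ 2 * β' z), T, K, hK0, ?_,
    hβz z₀ (Metric.mem_closedBall_self (by linarith)), fun z ↦ pow_le_one₀ (hβ0 z) (hβ1 z),
    fun z ↦ ?_, fun z ↦ ?_⟩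
  · refine ⟨hTc, hTO, hβs, hsm.continuous,
      fun z ↦ mul_nonneg hK0 (mul_nonneg (sq_nonneg _) (hβ0' z)), fun z hz ↦ ?_,
      fun z hz ↦ by rw [hβoff' z hz]; simp, fun i z hz ↦ ?_⟩
    · exact hβoff z fun h ↦ hz (Metric.closedBall_subset_closedBall (by linarith) h)
    · by_cases hz' : z ∈ Metric.closedBall z₀ (R / 2)
      · rw [hβz' z hz', mul_one]
        have h1 : |fd E.A i β z| ≤ n * (B * τ z * L) := by
          refine abs_sum_le_card fun a ↦ ?_
          rw [smul_eq_mul, abs_mul]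
          exact mul_le_mul (hA z hz i a) ((abs_pderiv_le β a z).trans (hL z)) (abs_nonneg _)
            ((abs_nonneg _).trans (hA z hz i a))
        calc fd E.A i β z ^ 2 = |fd E.A i β z| ^ 2 := (sq_abs _).symm
          _ ≤ (n * (B * τ z * L)) ^ 2 := pow_le_pow_left₀ (abs_nonneg _) h1 2
          _ = (n * (B * L)) ^ 2 * τ z ^ 2 := by ring
          _ ≤ K * τ z ^ 2 := mul_le_mul_of_nonneg_right (by rw [hK]; linarith) (sq_nonneg _)
      · rw [fd_eq_zero_of_off (isCompact_closedBall z₀ (R / 2)).isClosed hβoff i z hz', zero_pow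
          two_ne_zero]
        exact mul_nonneg hK0 (mul_nonneg (sq_nonneg _) (hβ0' z))
  · have := mul_le_mul_of_nonneg_left (hβ1' z) (sq_nonneg (τ z))
    rw [mul_one] at this
    exact mul_le_mul_of_nonneg_left this hK0
  · have h1 := mul_le_mul_of_nonneg_left (hle z) (sq_nonneg (τ z))
    have h2 : 0 ≤ τ z ^ 2 * β' z := mul_nonneg (sq_nonneg _) (hβ0' z)
    have h3 : 1 * (τ z ^ 2 * β' z) ≤ K * (τ z ^ 2 * β' z) :=
      mul_le_mul_of_nonneg_right (by rw [hK]; linarith [sq_nonneg ((n : ℝ) * (B * L))]) h2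
    linarith

variable {c : M} {O : Set (Eu n)} (E : S.ScFrame c O) {β σ : Eu n → ℝ} {T : Set (Eu n)}

theorem energy_lift_le_one {r : ℕ} {s : Comps n M 𝕜 r} (hs : S.IsTest s) {γ : Eu n → ℝ}
    (hγ : Continuous γ) (hT : IsCompact T) (hTc : T ⊆ (chartAt (Eu n) c).target)
    (h0 : ∀ z ∉ T, γ z = 0) {m : ℝ} (hm : 0 ≤ m) {y : M → ℝ} (hy : Continuous y)
    (hγm : ∀ z, γ z ≤ m * y ((chartAt (Eu n) c).symm z)) (hy0 : ∀ q, 0 ≤ y q) :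
    S.energy s (chartLift c γ) ≤ m * S.energy s y := by
  rw [← energy_const_mul hs]
  refine energy_mono hs (continuous_chartLift hγ hT hTc h0) (continuous_const.mul hy) fun q _ ↦ ?_
  rw [chartLift]
  split_ifs with hq
  · have := hγm (chartAt (Eu n) c q)
    rwa [(chartAt (Eu n) c).left_inv hq] at this
  · exact mul_nonneg hm (hy0 q)

theorem Cutoff.exists_bound {E : S.ScFrame c O} (hc : E.Cutoff β σ T) :
    ∃ m, 0 ≤ m ∧ ∀ z, σ z ≤ m := by
  have h1 : HasCompactSupport σ := HasCompactSupport.intro hc.isCompact fun z hz ↦ hc.eq_zero' z hz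
  obtain ⟨m, hm⟩ := hc.continuous.bounded_above_of_compact_support h1
  exact ⟨m, (norm_nonneg _).trans (hm 0), fun z ↦ (le_abs_self _).trans (hm z)⟩

theorem integral_nsq_nonneg {r : ℕ} {s : Comps n M 𝕜 r} (hs : S.IsTest s) {γ : Eu n → ℝ}
    (hγ : ∀ z, 0 ≤ γ z) (hTO : T ⊆ O) (h0 : ∀ z ∉ T, γ z = 0) :
    0 ≤ ∫ z, E.w z * (γ z * E.nsq s z) := by
  refine integral_nonneg fun z ↦ ?_
  by_cases hzT : z ∈ T
  · by_cases hz : 0 < S.xi c z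
    · exact mul_nonneg (E.w_pos z ⟨hTO hzT, hz⟩).le (mul_nonneg (hγ z) (E.nsq_nonneg _ z))
    · have hd : (chartAt (Eu n) c).symm z ∉ S.dom := fun h ↦ hz h.1
      obtain ⟨K, hK, -, hK0, -⟩ := hs
      simp [E.nsq_eq_zero (hK0 c z (E.subset_target (hTO hzT)) fun h ↦ hd (hK h))]
  · simp [h0 z hzT]

/-- A pointwise estimate in a frame gives an estimate of energies. -/
theorem exists_energy_lift_le {U : Type*} {r r₁ r₂ : ℕ} {s : U → Comps n M 𝕜 r}
    {t₁ : U → Comps n M 𝕜 r₁} {t₂ : U → Comps n M 𝕜 r₂}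
    (hs : ∀ u, S.IsTest (s u)) (hs' : ∀ u, S.Tensorial (s u))
    (h₁ : ∀ u, S.IsTest (t₁ u)) (h₁' : ∀ u, S.Tensorial (t₁ u))
    (h₂ : ∀ u, S.IsTest (t₂ u)) (h₂' : ∀ u, S.Tensorial (t₂ u)) {a b : ℝ} (ha : 0 ≤ a) (hb : 0 ≤ b)
    (h : ∀ u, ∀ z ∈ O ∩ {z | 0 < S.xi c z},
      E.nsq (s u) z ≤ a * E.nsq (t₁ u) z + b * E.nsq (t₂ u) z) :
    ∃ C, 0 ≤ C ∧ ∀ γ : Eu n → ℝ, Continuous γ → (∀ z, 0 ≤ γ z) → ∀ T : Set (Eu n), IsCompact T →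
      T ⊆ O → (∀ z ∉ T, γ z = 0) → ∀ u, S.energy (s u) (chartLift c γ) ≤
        C * (S.energy (t₁ u) (chartLift c γ) + S.energy (t₂ u) (chartLift c γ)) := by
  obtain ⟨K, hK, e⟩ := E.exists_energy_bounds 𝕜 r
  obtain ⟨K₁, hK₁, e₁⟩ := E.exists_energy_bounds 𝕜 r₁
  obtain ⟨K₂, hK₂, e₂⟩ := E.exists_energy_bounds 𝕜 r₂
  refine ⟨K * (a * K₁ + b * K₂), by positivity, fun γ hγ hγ0 T hT hTO h0 u ↦ ?_⟩
  have b0 := (e (s u) (hs u) (hs' u) γ hγ hγ0 T hT hTO h0).1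
  have b1 := (e₁ (t₁ u) (h₁ u) (h₁' u) γ hγ hγ0 T hT hTO h0).2
  have b2 := (e₂ (t₂ u) (h₂ u) (h₂' u) γ hγ hγ0 T hT hTO h0).2
  have i0 := E.integrable_nsq (hs u) hγ hT hTO h0
  have i1 := E.integrable_nsq (h₁ u) hγ hT hTO h0
  have i2 := E.integrable_nsq (h₂ u) hγ hT hTO h0
  have p : ∀ z, E.w z * (γ z * E.nsq (s u) z) ≤ a * (E.w z * (γ z * E.nsq (t₁ u) z)) +
      b * (E.w z * (γ z * E.nsq (t₂ u) z)) := by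
    intro z
    by_cases hzT : z ∈ T
    · by_cases hz : 0 < S.xi c z
      · have h1 := mul_le_mul_of_nonneg_left (mul_le_mul_of_nonneg_left (h u z ⟨hTO hzT, hz⟩)
          (hγ0 z)) (E.w_pos z ⟨hTO hzT, hz⟩).le
        linarith
      · have hd : (chartAt (Eu n) c).symm z ∉ S.dom := fun h ↦ hz h.1
        have key : ∀ {r : ℕ} {s : Comps n M 𝕜 r}, S.IsTest s → E.nsq s z = 0 := by
          rintro r s ⟨K, hK, -, h0, -⟩
          exact E.nsq_eq_zero (h0 c z (E.subset_target (hTO hzT)) fun h ↦ hd (hK h))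
        simp [key (hs u), key (h₁ u), key (h₂ u)]
    · simp [h0 z hzT]
  have q := integral_mono i0 ((i1.const_mul a).add (i2.const_mul b)) p
  simp only [Pi.add_apply] at q
  rw [integral_add (i1.const_mul a) (i2.const_mul b), integral_const_mul, integral_const_mul] at q
  have hf := chartLift_nonneg (c := c) hγ0
  have n1 := energy_nonneg (h₁ u) (f := chartLift c γ) fun q _ ↦ hf q
  have n2 := energy_nonneg (h₂ u) (f := chartLift c γ) fun q _ ↦ hf q
  set e1 := S.energy (t₁ u) (chartLift c γ)
  set e2 := S.energy (t₂ u) (chartLift c γ)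
  have c1 := mul_le_mul_of_nonneg_left b1 ha
  have c2 := mul_le_mul_of_nonneg_left b2 hb
  refine b0.trans ?_
  rw [mul_assoc]
  refine mul_le_mul_of_nonneg_left ?_ hK
  have m1 : 0 ≤ a * K₁ * e2 := by positivity
  have m2 : 0 ≤ b * K₂ * e1 := by positivity
  linarith

/-- Korn's inequality for the energies. -/
theorem exists_korn_energy (𝕜 : Type*) [RCLike 𝕜] :
    ∃ K, 0 ≤ K ∧ ∀ F : ℝ, 0 ≤ F → ∀ (β σ : Eu n → ℝ) (T : Set (Eu n)), E.Cutoff β σ T →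
      ∀ a : ℝ, 0 ≤ a → (∀ z ∈ O ∩ {z | 0 < S.xi c z}, a ≤ ∑ i, E.α i z ^ 2) →
      ∀ u : S.TestForm 𝕜,
      S.energy (gradForm S.gscMat u.comps) (chartLift c fun z ↦ β z ^ 2) +
        F ^ 2 * a * S.energy u.comps (chartLift c fun z ↦ β z ^ 2) ≤
      K * (S.energy (S.dForm F u) (chartLift c fun z ↦ β z ^ 2) +
        (1 + F) * (S.energy u.comps (chartLift c fun z ↦ β z ^ 2) +
          S.energy u.comps (chartLift c σ))) := by
  obtain ⟨K, hK, hk⟩ := E.exists_korn_form 𝕜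
  obtain ⟨K₁, hK₁, e₁⟩ := E.exists_energy_bounds 𝕜 1
  obtain ⟨K₂, hK₂, e₂⟩ := E.exists_energy_bounds 𝕜 2
  refine ⟨(K₁ + K₂) * (K * (K₁ + K₂)), by positivity, fun F hF β σ T hc a ha hα u ↦ ?_⟩
  have h := hk F hF β σ T hc a hα u
  have hb0 : ∀ z, 0 ≤ β z ^ 2 := fun z ↦ sq_nonneg _
  have bG := (e₂ _ (S.isTest_gradForm u) (S.tensorial_gradForm u) _ hc.continuous_sq hb0 T
    hc.isCompact hc.subset hc.sq_eq_zero).1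
  have bD := (e₂ _ (S.isTest_dForm F u) (S.tensorial_dForm F u) _ hc.continuous_sq hb0 T
    hc.isCompact hc.subset hc.sq_eq_zero).2
  have tU : S.Tensorial u.comps := S.tensorial_compsForm u.1
  have bU := e₁ u.comps (S.isTest_comps_form u) tU _ hc.continuous_sq hb0 T
    hc.isCompact hc.subset hc.sq_eq_zero
  have bσ := (e₁ u.comps (S.isTest_comps_form u) tU _ hc.continuous hc.nonneg T
    hc.isCompact hc.subset hc.eq_zero').2
  have nG := E.integral_nsq_nonneg (S.isTest_gradForm u) hb0 hc.subset hc.sq_eq_zero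
  have nU := E.integral_nsq_nonneg (S.isTest_comps_form u) hb0 hc.subset hc.sq_eq_zero
  have hf := chartLift_nonneg (c := c) hb0
  have nD' := energy_nonneg (S.isTest_dForm F u) (f := chartLift c fun z ↦ β z ^ 2) fun q _ ↦ hf q
  have nU' := energy_nonneg (S.isTest_comps_form u) (f := chartLift c fun z ↦ β z ^ 2)
    fun q _ ↦ hf q
  have nσ' := energy_nonneg (S.isTest_comps_form u) (f := chartLift c σ)
    fun q _ ↦ chartLift_nonneg (c := c) hc.nonneg q
  set IG := ∫ z, E.w z * (β z ^ 2 * E.nsq (gradForm S.gscMat u.comps) z)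
  set ID := ∫ z, E.w z * (β z ^ 2 * E.nsq (S.dForm F u) z)
  set Iσ := ∫ z, E.w z * (σ z * E.nsq u.comps z)
  set eG := S.energy (gradForm S.gscMat u.comps) (chartLift c fun z ↦ β z ^ 2)
  set eD := S.energy (S.dForm F u) (chartLift c fun z ↦ β z ^ 2)
  set eU := S.energy u.comps (chartLift c fun z ↦ β z ^ 2)
  set eσ := S.energy u.comps (chartLift c σ)
  obtain ⟨bU1, bU2⟩ := bU
  set IU := ∫ z, E.w z * (β z ^ 2 * E.nsq u.comps z)
  have hFa : 0 ≤ F ^ 2 * a := by positivity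
  have s1 : eG + F ^ 2 * a * eU ≤ (K₁ + K₂) * (IG + F ^ 2 * a * IU) := by
    have h1 := mul_le_mul_of_nonneg_left bU1 hFa
    have h2 : 0 ≤ K₁ * IG := mul_nonneg hK₁ nG
    have h3 : 0 ≤ K₂ * (F ^ 2 * a * IU) := mul_nonneg hK₂ (mul_nonneg hFa nU)
    linarith
  have s2 : K * ID + K * (1 + F) * IU + K * (1 + F) * Iσ ≤
      K * (K₁ + K₂) * (eD + (1 + F) * (eU + eσ)) := by
    have hKF : 0 ≤ K * (1 + F) := by positivity
    have h1 := mul_le_mul_of_nonneg_left bD hK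
    have h2 := mul_le_mul_of_nonneg_left bU2 hKF
    have h3 := mul_le_mul_of_nonneg_left bσ hKF
    have h4 : 0 ≤ K * K₁ * eD := by positivity
    have h5 : 0 ≤ K * (1 + F) * K₂ * eU := by positivity
    have h6 : 0 ≤ K * (1 + F) * K₂ * eσ := by positivity
    linarith
  have s3 := mul_le_mul_of_nonneg_left (h.trans s2) (add_nonneg hK₁ hK₂)
  linarith

end ScFrame

end Region


theorem sq_sum_le_card_mul {n : ℕ} (f : Fin n → ℝ) : (∑ i, f i) ^ 2 ≤ n * ∑ i, f i ^ 2 := by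
  have := sq_sum_le_card_mul_sum_sq (s := Finset.univ) (f := f)
  simpa using this

namespace Region

attribute [-instance] TopCat.of.chartedSpace

variable {n : ℕ} {M : Type*} [TopologicalSpace M] [ChartedSpace (Eu n) M]
  [IsManifold (𝓡 n) ∞ M] [T2Space M] [SigmaCompactSpace M] {S : Region n M}
  {𝕜 : Type*} [RCLike 𝕜]

namespace ScFrame

variable {c : M} {O : Set (Eu n)} (E : S.ScFrame c O)

/-- On small balls the first tensors are controlled by the second ones and by the first ones on
smaller balls. -/
def HasGrowth {U : Type*} {r r' : ℕ} (s : U → Comps n M 𝕜 r) (t : U → Comps n M 𝕜 r') : Prop :=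
  ∃ R₀ : ℝ, 0 < R₀ ∧ ∀ R r : ℝ, 0 < r → r ≤ R → R ≤ R₀ → ∃ K, 0 ≤ K ∧
    ∀ q, Metric.closedBall q R ⊆ O ∩ {z | 0 < S.xi c z} → ∀ u,
      ∫ z in Metric.closedBall q R, E.nsq (s u) z ≤ K * ((∫ z in Metric.closedBall q r,
        E.nsq (s u) z) + ∫ z in Metric.closedBall q R, E.nsq (t u) z)

theorem integrableOn_nsq {r : ℕ} {s : Comps n M 𝕜 r} (hs : S.IsTest s) {q : Eu n} {R : ℝ}
    (hq : Metric.closedBall q R ⊆ O ∩ {z | 0 < S.xi c z}) :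
    IntegrableOn (E.nsq s) (Metric.closedBall q R) :=
  ((E.continuousOn_nsq hs).mono hq).integrableOn_compact (isCompact_closedBall _ _)

theorem hasGrowth_fun (hA : E.A = fun _ ↦ 1) {F : ℝ} (hF : 0 ≤ F) :
    E.HasGrowth (fun u : S.TestFun 𝕜 ↦ u.comps) (S.dFun F) := by
  obtain ⟨R₀, hR₀, h⟩ := exists_growth_fun n 𝕜 (F * E.C)
  refine ⟨R₀, hR₀, fun R r hr hrR hRR ↦ ?_⟩
  obtain ⟨K, hK, h'⟩ := h R r hr hrR hRR
  refine ⟨K * (n + 1), by positivity, fun q hq u ↦ ?_⟩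
  have h1 := h' _ q E.isOpen hq (fun z ↦ u.comps c z ![]) (fun i z ↦ S.dFun F u c z ![i])
    (E.contDiffOn_fun u) (fun i ↦ ((S.isTest_dFun F u).continuousOn S c _).mono
      (inter_subset_left.trans E.subset_target)) (fun z hz i ↦ by
      have h2 := E.tmap_dFun_eq F u hz i
      simp only [hA, tmap_one, fd_one] at h2
      rw [eq_add_of_sub_eq h2.symm]
      refine (norm_add_le _ _).trans (add_le_add le_rfl ?_)
      rw [norm_smul, Real.norm_eq_abs, abs_mul, abs_of_nonneg hF]
      exact mul_le_mul_of_nonneg_right (mul_le_mul_of_nonneg_left (E.α_le i z hz) hF)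
        (norm_nonneg _))
  have e0 : ∀ z, E.nsq u.comps z = ‖u.comps c z ![]‖ ^ 2 := E.nsq_fun u
  have h2 : ∫ z in Metric.closedBall q R, (∑ i, ‖S.dFun F u c z ![i]‖) ^ 2 ≤
      n * ∫ z in Metric.closedBall q R, E.nsq (S.dFun F u) z := by
    rw [← integral_const_mul]
    refine setIntegral_mono_on ?_ ((E.integrableOn_nsq (S.isTest_dFun F u) hq).const_mul _)
      Metric.isClosed_closedBall.measurableSet fun z hz ↦ ?_
    · refine ContinuousOn.integrableOn_compact (isCompact_closedBall _ _) ?_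
      exact (continuousOn_finsetSum _ fun i _ ↦ (((S.isTest_dFun F u).continuousOn S c _).mono
        ((hq.trans inter_subset_left).trans E.subset_target)).norm).pow 2
    · refine (sq_sum_le_card_mul _).trans (mul_le_mul_of_nonneg_left ?_ (by positivity))
      rw [nsq, hA, tmap_one, sqn_one_rank]
  simp only [e0]
  have n1 : 0 ≤ ∫ z in Metric.closedBall q r, ‖u.comps c z ![]‖ ^ 2 :=
    integral_nonneg fun z ↦ sq_nonneg _
  have n2 : 0 ≤ ∫ z in Metric.closedBall q R, E.nsq (S.dFun F u) z :=
    integral_nonneg fun z ↦ E.nsq_nonneg _ _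
  refine h1.trans ?_
  rw [mul_assoc]
  refine mul_le_mul_of_nonneg_left ?_ hK
  have n3 : 0 ≤ (n : ℝ) * ∫ z in Metric.closedBall q r, ‖u.comps c z ![]‖ ^ 2 := by positivity
  linarith

theorem hasGrowth_form (hA : E.A = fun _ ↦ 1) {F : ℝ} (hF : 0 ≤ F) :
    E.HasGrowth (fun u : S.TestForm 𝕜 ↦ u.comps) (S.dForm F) := by
  have hb := E.b_nonneg
  have hC := E.C_nonneg
  obtain ⟨R₀, hR₀, h⟩ := exists_growth_form n 𝕜 (C := 2 * E.b + 2 * (F * E.C)) (by positivity)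
  refine ⟨R₀, hR₀, fun R r hr hrR hRR ↦ ?_⟩
  obtain ⟨K, hK, h'⟩ := h R r hr hrR hRR
  refine ⟨K * (n + 4 * n ^ 2), by positivity, fun q hq u ↦ ?_⟩
  have hDc : ∀ i j, ContinuousOn (fun z ↦ (2 : ℝ) • S.dForm F u c z ![i, j])
      (O ∩ {z | 0 < S.xi c z}) := fun i j ↦
    (((S.isTest_dForm F u).continuousOn S c _).mono
      (inter_subset_left.trans E.subset_target)).const_smul (2 : ℝ)
  have hUc : ∀ k, ContinuousOn (E.comp u k) (O ∩ {z | 0 < S.xi c z}) := fun k ↦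
    (E.contDiffOn_comp u k).continuousOn
  have h1 := h' _ q E.isOpen hq (E.comp u) (fun i j z ↦ (2 : ℝ) • S.dForm F u c z ![i, j])
    (E.contDiffOn_comp u) hDc (fun z hz i j ↦ by
      have h2 := E.tmap_dForm_eq F u hz i j
      simp only [hA, tmap_one, fd_one, Frame.sym] at h2
      set N := ∑ k, ‖E.comp u k z‖ with hN
      have hle : ∀ k, ‖E.comp u k z‖ ≤ N := fun k ↦ Finset.single_le_sum
        (f := fun k ↦ ‖E.comp u k z‖) (fun _ _ ↦ norm_nonneg _) (Finset.mem_univ k)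
      set X := ∑ k, ((1 / 2) * (frameChr (fun _ ↦ 1) E.inv (S.gMat c) i j k z +
        frameChr (fun _ ↦ 1) E.inv (S.gMat c) j i k z)) • E.comp u k z with hX
      have hXle : ‖X‖ ≤ E.b * N := by
        refine (norm_sum_le _ _).trans ?_
        rw [hN, Finset.mul_sum]
        refine Finset.sum_le_sum fun k _ ↦ ?_
        rw [norm_smul, Real.norm_eq_abs]
        have := E.abs_half_chr_le hz i j k
        rw [hA] at this
        exact mul_le_mul_of_nonneg_right this (norm_nonneg _)
      have e : pderiv i (E.comp u j) z + pderiv j (E.comp u i) z =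
          (2 : ℝ) • S.dForm F u c z ![i, j] + ((2 : ℝ) • X +
            (F • (E.α i z • E.comp u j z) + F • (E.α j z • E.comp u i z))) := by
        rw [h2]
        module
      have hα : ∀ i j, ‖F • (E.α i z • E.comp u j z)‖ ≤ F * E.C * N := by
        intro i j
        rw [norm_smul, norm_smul, Real.norm_eq_abs, Real.norm_eq_abs, abs_of_nonneg hF, mul_assoc]
        exact mul_le_mul_of_nonneg_left (mul_le_mul (E.α_le i z hz) (hle j) (norm_nonneg _) hC) hF
      rw [e]
      refine (norm_add_le _ _).trans (add_le_add le_rfl ?_)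
      refine (norm_add_le _ _).trans ?_
      have h3 := norm_add_le (F • (E.α i z • E.comp u j z)) (F • (E.α j z • E.comp u i z))
      have h4 : ‖(2 : ℝ) • X‖ = 2 * ‖X‖ := by rw [norm_smul]; norm_num
      rw [h4]
      linarith [hα i j, hα j i])
  have e0 : ∀ z, E.nsq u.comps z = ∑ k, ‖E.comp u k z‖ ^ 2 := E.nsq_form u
  have hms : ∀ R, MeasurableSet (Metric.closedBall q R) := fun R ↦
    Metric.isClosed_closedBall.measurableSet
  have hqr : Metric.closedBall q r ⊆ O ∩ {z | 0 < S.xi c z} :=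
    (Metric.closedBall_subset_closedBall hrR).trans hq
  have iU : ∀ R, Metric.closedBall q R ⊆ O ∩ {z | 0 < S.xi c z} →
      IntegrableOn (fun z ↦ (∑ k, ‖E.comp u k z‖) ^ 2) (Metric.closedBall q R) := fun R hq ↦
    ContinuousOn.integrableOn_compact (isCompact_closedBall _ _) ((continuousOn_finsetSum _ fun k _ ↦
      ((hUc k).mono hq).norm).pow 2)
  have h2 : ∫ z in Metric.closedBall q R, (∑ i, ∑ j, ‖(2 : ℝ) • S.dForm F u c z ![i, j]‖) ^ 2 ≤
      (4 * n ^ 2) * ∫ z in Metric.closedBall q R, E.nsq (S.dForm F u) z := by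
    rw [← integral_const_mul]
    refine setIntegral_mono_on ?_ ((E.integrableOn_nsq (S.isTest_dForm F u) hq).const_mul _)
      (hms R) fun z hz ↦ ?_
    · refine ContinuousOn.integrableOn_compact (isCompact_closedBall _ _) ?_
      exact (continuousOn_finsetSum _ fun i _ ↦ continuousOn_finsetSum _ fun j _ ↦
        ((hDc i j).mono hq).norm).pow 2
    · rw [nsq, hA, tmap_one, sqn_two_rank]
      refine (sq_sum_le_card_mul _).trans ?_
      calc (n : ℝ) * ∑ i, (∑ j, ‖(2 : ℝ) • S.dForm F u c z ![i, j]‖) ^ 2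
          ≤ n * ∑ i, n * ∑ j, ‖(2 : ℝ) • S.dForm F u c z ![i, j]‖ ^ 2 := by
            gcongr with i
            exact sq_sum_le_card_mul _
        _ = _ := by
            simp only [norm_smul_sq, ← Finset.mul_sum]
            ring
  have h3 : ∫ z in Metric.closedBall q R, E.nsq u.comps z ≤
      ∫ z in Metric.closedBall q R, (∑ k, ‖E.comp u k z‖) ^ 2 := by
    refine setIntegral_mono_on (E.integrableOn_nsq (S.isTest_comps_form u) hq) (iU R hq) (hms R)
      fun z hz ↦ ?_
    rw [e0]
    exact Finset.sum_sq_le_sq_sum_of_nonneg fun k _ ↦ norm_nonneg _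
  have h4 : ∫ z in Metric.closedBall q r, (∑ k, ‖E.comp u k z‖) ^ 2 ≤
      n * ∫ z in Metric.closedBall q r, E.nsq u.comps z := by
    rw [← integral_const_mul]
    refine setIntegral_mono_on (iU r hqr)
      ((E.integrableOn_nsq (S.isTest_comps_form u) hqr).const_mul _) (hms r) fun z hz ↦ ?_
    rw [e0]
    exact sq_sum_le_card_mul _
  have n1 : 0 ≤ ∫ z in Metric.closedBall q r, E.nsq u.comps z :=
    integral_nonneg fun z ↦ E.nsq_nonneg _ _
  have n2 : 0 ≤ ∫ z in Metric.closedBall q R, E.nsq (S.dForm F u) z :=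
    integral_nonneg fun z ↦ E.nsq_nonneg _ _
  refine (h3.trans h1).trans ?_
  rw [mul_assoc]
  refine mul_le_mul_of_nonneg_left ?_ hK
  have n3 : 0 ≤ (4 * n ^ 2 : ℝ) * ∫ z in Metric.closedBall q r, E.nsq u.comps z := by positivity
  have n4 : 0 ≤ (n : ℝ) * ∫ z in Metric.closedBall q R, E.nsq (S.dForm F u) z := by positivity
  linarith

theorem integral_nsq_le_closedBall (hw : E.w = fun _ ↦ 1) {r : ℕ} {s : Comps n M 𝕜 r}
    (hs : S.IsTest s) {γ : Eu n → ℝ} {q : Eu n} {R : ℝ} (hγ : Continuous γ) (hγ1 : ∀ z, γ z ≤ 1)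
    (hoff : ∀ z ∉ Metric.closedBall q R, γ z = 0)
    (hq : Metric.closedBall q R ⊆ O ∩ {z | 0 < S.xi c z}) :
    ∫ z, E.w z * (γ z * E.nsq s z) ≤ ∫ z in Metric.closedBall q R, E.nsq s z := by
  have h1 : ∫ z, E.w z * (γ z * E.nsq s z) =
      ∫ z in Metric.closedBall q R, E.w z * (γ z * E.nsq s z) := by
    symm
    refine setIntegral_eq_integral_of_forall_compl_eq_zero fun z hz ↦ ?_
    rw [hoff z hz, zero_mul, mul_zero]
  rw [h1]
  refine setIntegral_mono_on (E.integrable_nsq hs hγ (isCompact_closedBall q R)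
    (hq.trans inter_subset_left) hoff).integrableOn (E.integrableOn_nsq hs hq)
    Metric.isClosed_closedBall.measurableSet fun z hz ↦ ?_
  rw [hw, one_mul]
  exact mul_le_of_le_one_left (E.nsq_nonneg _ _) (hγ1 z)

theorem closedBall_le_integral_nsq (hw : E.w = fun _ ↦ 1) {r : ℕ} {s : Comps n M 𝕜 r}
    (hs : S.IsTest s) {γ : Eu n → ℝ} {q : Eu n} {R R₂ : ℝ} (hγ : Continuous γ)
    (hγ0 : ∀ z, 0 ≤ γ z) (hγ1 : ∀ z ∈ Metric.closedBall q R, γ z = 1)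
    (hoff : ∀ z ∉ Metric.closedBall q R₂, γ z = 0) (hq : Metric.closedBall q R₂ ⊆ O) :
    ∫ z in Metric.closedBall q R, E.nsq s z ≤ ∫ z, E.w z * (γ z * E.nsq s z) := by
  have h1 : ∫ z in Metric.closedBall q R, E.nsq s z =
      ∫ z in Metric.closedBall q R, E.w z * (γ z * E.nsq s z) := by
    refine setIntegral_congr_fun Metric.isClosed_closedBall.measurableSet fun z hz ↦ ?_
    simp only [hw, hγ1 z hz, one_mul]
  rw [h1]
  refine setIntegral_le_integral (E.integrable_nsq hs hγ (isCompact_closedBall q R₂) hq hoff)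
    (Filter.Eventually.of_forall fun z ↦ ?_)
  simp only [hw, one_mul, Pi.zero_apply]
  exact mul_nonneg (hγ0 z) (E.nsq_nonneg _ _)

/-- Points near a given point have a good neighbourhood only if the given point does. -/
theorem exists_nhds_good {p : M} {z₀ : Eu n} (hz₀ : z₀ = chartAt (Eu n) p p) {R' : ℝ}
    (hR' : 0 < R') (E : S.ScFrame p (Metric.ball z₀ R'))
    (hsub : Metric.ball z₀ R' ⊆ S.posDom p) (hw : E.w = fun _ ↦ 1)
    {U : Type*} {r r' : ℕ} {s : U → Comps n M 𝕜 r} {t : U → Comps n M 𝕜 r'}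
    (hs : ∀ u, S.IsTest (s u)) (hs' : ∀ u, S.Tensorial (s u)) (ht : ∀ u, S.IsTest (t u))
    (ht' : ∀ u, S.Tensorial (t u)) (hg : E.HasGrowth s t) :
    ∃ N ∈ 𝓝 p, ∀ q ∈ N, S.Good s t q → S.Good s t p := by
  obtain ⟨R₀, hR₀, hg⟩ := hg
  obtain ⟨K₁, hK₁, e₁⟩ := E.exists_energy_bounds 𝕜 r
  obtain ⟨K₂, hK₂, e₂⟩ := E.exists_energy_bounds 𝕜 r'
  obtain ⟨R, hR0, hRR₀, hRR⟩ : ∃ R, 0 < R ∧ R ≤ R₀ ∧ R ≤ R' / 4 :=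
    ⟨min R₀ (R' / 4), lt_min hR₀ (by linarith), min_le_left _ _, min_le_right _ _⟩
  have hZ : Metric.ball z₀ R' ∩ {z | 0 < S.xi p z} = Metric.ball z₀ R' :=
    inter_eq_left.2 (hsub.trans inter_subset_right)
  have hpT : Metric.ball z₀ R' ⊆ (chartAt (Eu n) p).target := hsub.trans inter_subset_left
  refine ⟨(chartAt (Eu n) p).source ∩ chartAt (Eu n) p ⁻¹' Metric.ball z₀ (R / 2), ((chartAt (Eu n) p).isOpen_inter_preimage
    Metric.isOpen_ball).mem_nhds ⟨mem_chart_source _ p, by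
      rw [mem_preimage, ← hz₀]
      exact Metric.mem_ball_self (by linarith)⟩, ?_⟩
  rintro q ⟨hqs, hqb⟩ ⟨f, hf, hf0, hfq, C, hC, hfC⟩
  rw [mem_preimage, Metric.mem_ball] at hqb
  have hball : ∀ ρ : ℝ, ρ ≤ 2 * R → Metric.closedBall (chartAt (Eu n) p q) ρ ⊆ Metric.ball z₀ R' := by
    intro ρ hρ z hz
    rw [Metric.mem_closedBall] at hz
    rw [Metric.mem_ball]
    linarith [dist_triangle z (chartAt (Eu n) p q) z₀]
  -- a small ball on which `f` is bounded from below
  obtain ⟨r, hr, hrR, hrf⟩ : ∃ r, 0 < r ∧ r ≤ R ∧ ∀ z ∈ Metric.closedBall (chartAt (Eu n) p q) (2 * r),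
      f q / 2 ≤ f ((chartAt (Eu n) p).symm z) := by
    have h1 : ContinuousAt (fun z ↦ f ((chartAt (Eu n) p).symm z)) (chartAt (Eu n) p q) :=
      hf.continuousAt.comp ((chartAt (Eu n) p).continuousAt_symm ((chartAt (Eu n) p).map_source hqs))
    have h2 : ∀ᶠ z in 𝓝 (chartAt (Eu n) p q), f q / 2 < f ((chartAt (Eu n) p).symm z) := h1.eventually
      (lt_mem_nhds (by simp only [(chartAt (Eu n) p).left_inv hqs]; linarith))
    obtain ⟨ε, hε, hb⟩ := Metric.eventually_nhds_iff_ball.1 h2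
    refine ⟨min R (ε / 4), lt_min hR0 (by linarith), min_le_left _ _, fun z hz ↦ (hb z ?_).le⟩
    rw [Metric.mem_closedBall] at hz
    rw [Metric.mem_ball]
    linarith [min_le_right R (ε / 4)]
  obtain ⟨K, hK, hgK⟩ := hg R r hr hrR hRR₀
  obtain ⟨γ₁, a1, a2, a3, a4, a5⟩ := exists_bump (chartAt (Eu n) p q) hr (by linarith : r < 2 * r)
  obtain ⟨γ₂, b1, b2, b3, b4, b5⟩ := exists_bump (chartAt (Eu n) p q) hR0 (by linarith : R < 2 * R)
  obtain ⟨β, c1, c2, c3, c4, c5⟩ := exists_bump z₀ (by linarith : 0 < R / 4)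
    (by linarith : R / 4 < R / 2)
  have hc6 : ∀ z ∉ Metric.closedBall (chartAt (Eu n) p q) R, β z = 0 := fun z hz ↦ c5 z fun h ↦ hz (by
    rw [Metric.mem_closedBall] at h ⊢
    linarith [dist_triangle_right z (chartAt (Eu n) p q) z₀])
  have hβT := (hball R (by linarith))
  have hγ₁T := hball (2 * r) (by linarith)
  have hγ₂T := hball (2 * R) le_rfl
  refine ⟨chartLift p β, continuous_chartLift c1.continuous (isCompact_closedBall _ _)
    (hβT.trans hpT) hc6, chartLift_nonneg c2, chartLift_self_pos (mem_chart_source _ p) (by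
      rw [← hz₀, c4 _ (Metric.mem_closedBall_self (by linarith))]; exact one_pos),
    K₁ * (K * (K₁ * ((f q / 2)⁻¹ * C) + K₂)), by positivity, fun u ↦ ?_⟩
  have u1 := (e₁ (s u) (hs u) (hs' u) β c1.continuous c2 _ (isCompact_closedBall _ _) hβT hc6).1
  have u2 := E.integral_nsq_le_closedBall hw (hs u) c1.continuous c3 hc6 (by rw [hZ]; exact hβT)
  have u3 := hgK (chartAt (Eu n) p q) (by rw [hZ]; exact hβT) u
  have u4 := E.closedBall_le_integral_nsq hw (hs u) a1.continuous a2 a4 a5 hγ₁T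
  have u5 := (e₁ (s u) (hs u) (hs' u) γ₁ a1.continuous a2 _ (isCompact_closedBall _ _) hγ₁T a5).2
  have u6 : S.energy (s u) (chartLift p γ₁) ≤ (f q / 2)⁻¹ * S.energy (s u) f := by
    refine energy_lift_le_one (hs u) a1.continuous (isCompact_closedBall _ _) (hγ₁T.trans hpT) a5
      (by positivity) hf (fun z ↦ ?_) hf0
    by_cases hz : z ∈ Metric.closedBall (chartAt (Eu n) p q) (2 * r)
    · refine (a3 z).trans ?_
      rw [← div_eq_inv_mul, one_le_div (by positivity)]
      exact hrf z hz
    · rw [a5 z hz]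
      exact mul_nonneg (by positivity) (hf0 _)
  have u7 := E.closedBall_le_integral_nsq hw (ht u) b1.continuous b2 b4 b5 hγ₂T
  have u8 := (e₂ (t u) (ht u) (ht' u) γ₂ b1.continuous b2 _ (isCompact_closedBall _ _) hγ₂T b5).2
  have u9 : S.energy (t u) (chartLift p γ₂) ≤ 1 * S.energy (t u) fun _ ↦ 1 :=
    energy_lift_le_one (ht u) b1.continuous (isCompact_closedBall _ _) (hγ₂T.trans hpT) b5
      zero_le_one continuous_const (fun z ↦ by simpa using b3 z) fun _ ↦ zero_le_one
  rw [one_mul] at u9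
  have v1 : ∫ z in Metric.closedBall (chartAt (Eu n) p q) r, E.nsq (s u) z ≤
      K₁ * ((f q / 2)⁻¹ * C) * S.energy (t u) fun _ ↦ 1 := by
    have h1 := mul_le_mul_of_nonneg_left (hfC u) (by positivity : 0 ≤ (f q / 2)⁻¹)
    have h2 := mul_le_mul_of_nonneg_left (u6.trans h1) hK₁
    linarith
  have v2 : ∫ z in Metric.closedBall (chartAt (Eu n) p q) R, E.nsq (t u) z ≤ K₂ * S.energy (t u) fun _ ↦ 1 :=
    (u7.trans u8).trans (mul_le_mul_of_nonneg_left u9 hK₂)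
  calc S.energy (s u) (chartLift p β) ≤ K₁ * (K * (K₁ * ((f q / 2)⁻¹ * C) *
        (S.energy (t u) fun _ ↦ 1) + K₂ * S.energy (t u) fun _ ↦ 1)) :=
        u1.trans (mul_le_mul_of_nonneg_left (u2.trans (u3.trans (mul_le_mul_of_nonneg_left
          (add_le_add v1 v2) hK))) hK₁)
    _ = _ := by ring

end ScFrame

end Region


namespace Region

attribute [-instance] TopCat.of.chartedSpace

variable {n : ℕ} {M : Type*} [TopologicalSpace M] [ChartedSpace (Eu n) M]
  [IsManifold (𝓡 n) ∞ M] [T2Space M] [SigmaCompactSpace M] {S : Region n M}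
  {𝕜 : Type*} [RCLike 𝕜]

namespace ScFrame

variable {c : M} {O : Set (Eu n)} {E : S.ScFrame c O} {β σ : Eu n → ℝ} {T : Set (Eu n)}

theorem Cutoff.continuous_lift (hc : E.Cutoff β σ T) : Continuous (chartLift c fun z ↦ β z ^ 2) :=
  continuous_chartLift hc.continuous_sq hc.isCompact (hc.subset.trans E.subset_target)
    hc.sq_eq_zero

theorem Cutoff.energy_lift_le (hc : E.Cutoff β σ T) (hβ : ∀ z, β z ^ 2 ≤ 1) {r : ℕ}
    {s : Comps n M 𝕜 r} (hs : S.IsTest s) :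
    S.energy s (chartLift c fun z ↦ β z ^ 2) ≤ S.energy s fun _ ↦ 1 := by
  have h := energy_lift_le_one hs hc.continuous_sq hc.isCompact (hc.subset.trans E.subset_target)
    hc.sq_eq_zero zero_le_one continuous_const (y := fun _ ↦ 1) (fun z ↦ by simpa using hβ z)
    fun _ ↦ zero_le_one
  rwa [one_mul] at h

theorem Cutoff.exists_energy_lift_le (hc : E.Cutoff β σ T) : ∃ m, 0 ≤ m ∧ ∀ (r : ℕ)
    (s : Comps n M 𝕜 r), S.IsTest s → S.energy s (chartLift c σ) ≤ m * S.energy s fun _ ↦ 1 := by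
  obtain ⟨m, hm, h⟩ := hc.exists_bound
  exact ⟨m, hm, fun r s hs ↦ energy_lift_le_one hs hc.continuous hc.isCompact
    (hc.subset.trans E.subset_target) hc.eq_zero' hm continuous_const (y := fun _ ↦ 1)
    (fun z ↦ by simpa using h z) fun _ ↦ zero_le_one⟩

/-- Around every point of `{x ≥ 0}` there is a frame with a cutoff. -/
theorem exists_frame_cutoff (S : Region n M) {p : M} (hp : 0 ≤ S.x p) :
    ∃ (O : Set (Eu n)) (E : S.ScFrame p O) (β σ : Eu n → ℝ) (T : Set (Eu n)), E.Cutoff β σ T ∧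
      (∀ z, β z ^ 2 ≤ 1) ∧ 0 < chartLift p (fun z ↦ β z ^ 2) p := by
  have key : ∀ (β : Eu n → ℝ), β (chartAt (Eu n) p p) = 1 →
      0 < chartLift p (fun z ↦ β z ^ 2) p := fun β h ↦
    chartLift_self_pos (mem_chart_source _ p) (by rw [h]; norm_num)
  rcases hp.eq_or_lt with hp | hp
  · obtain ⟨R, hR, E, i₀, B, hB, h⟩ := S.exists_frame_boundary hp.symm
    obtain ⟨β, σ, T, K, hK, hc, h1, h2, -⟩ := exists_cutoff hR E S.x_smooth
      (fun z hz ↦ (h z hz).2.2)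
    exact ⟨_, E, β, σ, T, hc, h2, key β h1⟩
  · obtain ⟨R, hR, E, hsub, hA, hw⟩ := S.exists_frame_interior hp
    obtain ⟨β, σ, T, K, hK, hc, h1, h2, -⟩ := exists_cutoff hR E
      (contMDiff_const (c := (1 : ℝ))) (B := 1) (fun z hz i a ↦ by
        rw [hA]
        change |(1 : Matrix (Fin n) (Fin n) ℝ) i a| ≤ 1 * 1
        rw [Matrix.one_apply]
        split_ifs <;> norm_num)
    exact ⟨_, E, β, σ, T, hc, h2, key β h1⟩

end ScFrame

open ScFrame

theorem localBound_of_nsq_le {U : Type*} {r r₁ r₂ : ℕ} {s : U → Comps n M 𝕜 r}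
    {t₁ : U → Comps n M 𝕜 r₁} {t₂ : U → Comps n M 𝕜 r₂}
    (hs : ∀ u, S.IsTest (s u)) (hs' : ∀ u, S.Tensorial (s u))
    (h₁ : ∀ u, S.IsTest (t₁ u)) (h₁' : ∀ u, S.Tensorial (t₁ u))
    (h₂ : ∀ u, S.IsTest (t₂ u)) (h₂' : ∀ u, S.Tensorial (t₂ u)) {p : M} (hp : 0 ≤ S.x p)
    (h : ∀ (O : Set (Eu n)) (E : S.ScFrame p O), ∃ a b : ℝ, 0 ≤ a ∧ 0 ≤ b ∧
      ∀ u, ∀ z ∈ O ∩ {z | 0 < S.xi p z},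
        E.nsq (s u) z ≤ a * E.nsq (t₁ u) z + b * E.nsq (t₂ u) z) :
    S.LocalBound s (fun u ↦ S.energy (t₁ u) (fun _ ↦ 1) + S.energy (t₂ u) fun _ ↦ 1) p := by
  obtain ⟨O, E, β, σ, T, hc, hβ, hpos⟩ := exists_frame_cutoff S hp
  obtain ⟨a, b, ha, hb, hab⟩ := h O E
  obtain ⟨C, hC, hCb⟩ := E.exists_energy_lift_le hs hs' h₁ h₁' h₂ h₂' ha hb hab
  refine ⟨_, hc.continuous_lift, chartLift_nonneg fun z ↦ sq_nonneg _, hpos, C, hC, fun u ↦ ?_⟩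
  exact (hCb _ hc.continuous_sq (fun z ↦ sq_nonneg _) T hc.isCompact hc.subset hc.sq_eq_zero
    u).trans (mul_le_mul_of_nonneg_left (add_le_add (hc.energy_lift_le hβ (h₁ u))
      (hc.energy_lift_le hβ (h₂ u))) hC)

theorem tensorial_comps_fun (u : S.TestFun 𝕜) : S.Tensorial u.comps := S.tensorial_compsFun u.1

theorem tensorial_comps_form (u : S.TestForm 𝕜) : S.Tensorial u.comps := S.tensorial_compsForm u.1

theorem localBound_gradFun (F : ℝ) {p : M} (hp : 0 ≤ S.x p) :
    S.LocalBound (fun u : S.TestFun 𝕜 ↦ gradFun u.comps) (fun u ↦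
      S.energy (S.dFun F u) (fun _ ↦ 1) + S.energy u.comps fun _ ↦ 1) p :=
  localBound_of_nsq_le (t₁ := fun u : S.TestFun 𝕜 ↦ S.dFun F u) (t₂ := fun u ↦ u.comps)
    S.isTest_gradFun S.tensorial_gradFun (S.isTest_dFun F) (S.tensorial_dFun F)
    S.isTest_comps_fun tensorial_comps_fun hp fun O E ↦ ⟨2, n * (2 * (F ^ 2 * E.C ^ 2)),
      by norm_num, by positivity, fun u _ hz ↦ E.nsq_gradFun_le F u hz⟩

theorem localBound_dFun (F : ℝ) {p : M} (hp : 0 ≤ S.x p) :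
    S.LocalBound (fun u : S.TestFun 𝕜 ↦ S.dFun F u) (fun u ↦
      S.energy (gradFun u.comps) (fun _ ↦ 1) + S.energy u.comps fun _ ↦ 1) p :=
  localBound_of_nsq_le (t₁ := fun u : S.TestFun 𝕜 ↦ gradFun u.comps) (t₂ := fun u ↦ u.comps)
    (S.isTest_dFun F) (S.tensorial_dFun F) S.isTest_gradFun S.tensorial_gradFun
    S.isTest_comps_fun tensorial_comps_fun hp fun O E ↦ ⟨2, n * (2 * (F ^ 2 * E.C ^ 2)),
      by norm_num, by positivity, fun u _ hz ↦ E.nsq_dFun_le F u hz⟩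

theorem localBound_dForm (F : ℝ) {p : M} (hp : 0 ≤ S.x p) :
    S.LocalBound (fun u : S.TestForm 𝕜 ↦ S.dForm F u) (fun u ↦
      S.energy (gradForm S.gscMat u.comps) (fun _ ↦ 1) + S.energy u.comps fun _ ↦ 1) p :=
  localBound_of_nsq_le (t₁ := fun u : S.TestForm 𝕜 ↦ gradForm S.gscMat u.comps)
    (t₂ := fun u ↦ u.comps) (S.isTest_dForm F) (S.tensorial_dForm F) S.isTest_gradForm
    S.tensorial_gradForm S.isTest_comps_form tensorial_comps_form hp fun O E ↦
      ⟨6, n ^ 2 * (12 * n * E.b ^ 2 + 3 * F ^ 2 * E.C ^ 2), by norm_num, by positivity,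
        fun u _ hz ↦ E.nsq_dForm_le F u hz⟩

theorem localBound_gradForm {F : ℝ} (hF : 0 ≤ F) {p : M} (hp : 0 ≤ S.x p) :
    S.LocalBound (fun u : S.TestForm 𝕜 ↦ gradForm S.gscMat u.comps) (fun u ↦
      S.energy (S.dForm F u) (fun _ ↦ 1) + S.energy u.comps fun _ ↦ 1) p := by
  obtain ⟨O, E, β, σ, T, hc, hβ, hpos⟩ := exists_frame_cutoff S hp
  obtain ⟨K, hK, hk⟩ := E.exists_korn_energy 𝕜
  obtain ⟨m, hm, h⟩ := hc.exists_energy_lift_le (𝕜 := 𝕜)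
  refine ⟨_, hc.continuous_lift, chartLift_nonneg fun z ↦ sq_nonneg _, hpos,
    K * (1 + (1 + F) * (1 + m)), by positivity, fun u ↦ ?_⟩
  have h1 := hk F hF β σ T hc 0 le_rfl (fun z _ ↦ Finset.sum_nonneg fun i _ ↦ sq_nonneg _) u
  rw [mul_zero, zero_mul, add_zero] at h1
  have h2 := hc.energy_lift_le hβ (S.isTest_dForm F u)
  have h3 := hc.energy_lift_le hβ (S.isTest_comps_form u)
  have h4 := h 1 _ (S.isTest_comps_form u)
  have n2 := energy_nonneg (S.isTest_dForm F u) (f := fun _ ↦ 1) fun _ _ ↦ zero_le_one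
  have n3 := energy_nonneg (S.isTest_comps_form u) (f := fun _ ↦ 1) fun _ _ ↦ zero_le_one
  refine h1.trans ?_
  rw [mul_assoc]
  refine mul_le_mul_of_nonneg_left ?_ hK
  have h5 := mul_le_mul_of_nonneg_left (add_le_add h3 h4) (by positivity : 0 ≤ 1 + F)
  have h6 : 0 ≤ (1 + F) * (1 + m) * S.energy (S.dForm F u) fun _ ↦ 1 := by positivity
  linarith

/-- Functions and their twisted differentials near the artificial boundary. -/
theorem localBound_fun_boundary {F : ℝ} (hF : 0 < F) {p : M} (hp : S.x p = 0) :
    S.LocalBound (fun u : S.TestFun 𝕜 ↦ u.comps) (fun u ↦ S.energy (S.dFun F u) (fun _ ↦ 1) +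
      S.energy u.comps fun q ↦ S.x q ^ 2) p := by
  obtain ⟨R, hR, E, i₀, B, hB, h⟩ := S.exists_frame_boundary hp
  obtain ⟨β, σ, T, K, hK, hc, h1, h2, h3, h4⟩ := exists_cutoff hR E S.x_smooth
    (fun z hz ↦ (h z hz).2.2)
  obtain ⟨K₀, hK₀, e₀⟩ := E.exists_energy_bounds 𝕜 0
  obtain ⟨K₁, hK₁, e₁⟩ := E.exists_energy_bounds 𝕜 1
  refine ⟨_, hc.continuous_lift, chartLift_nonneg fun z ↦ sq_nonneg _,
    chartLift_self_pos (mem_chart_source _ p) (by rw [h1]; norm_num),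
    K₀ * ((F ^ 2)⁻¹ * (4 * K₁ + (4 + B ^ 2) * (K₀ * K))), by positivity, fun u ↦ ?_⟩
  have b0 : ∀ z, 0 ≤ β z ^ 2 := fun z ↦ sq_nonneg _
  have t := E.twisted_fun_le (i₀ := i₀) (fun z hz ↦ by rw [(h z hz).1, if_pos rfl])
    (fun z hz ↦ (h z hz).2.1 i₀) hc (fun z _ ↦ h4 z) hF.le u
  have tU : S.Tensorial u.comps := tensorial_comps_fun u
  have u1 := (e₀ _ (S.isTest_comps_fun u) tU _ hc.continuous_sq b0 T hc.isCompact hc.subset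
    hc.sq_eq_zero).1
  have u2 := (e₀ _ (S.isTest_comps_fun u) tU _ hc.continuous hc.nonneg T hc.isCompact hc.subset
    hc.eq_zero').2
  have u3 := (e₁ _ (S.isTest_dFun F u) (S.tensorial_dFun F u) _ hc.continuous_sq b0 T hc.isCompact
    hc.subset hc.sq_eq_zero).2
  have u4 := hc.energy_lift_le h2 (S.isTest_dFun F u)
  have u5 := energy_lift_le_one (S.isTest_comps_fun u) hc.continuous hc.isCompact
    (hc.subset.trans E.subset_target) hc.eq_zero' hK (y := fun q ↦ S.x q ^ 2) (S.x_smooth.continuous.pow 2) h3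
    fun _ ↦ sq_nonneg _
  have n2 := energy_nonneg (S.isTest_dFun F u) (f := fun _ ↦ 1) fun _ _ ↦ zero_le_one
  have n3 := energy_nonneg (S.isTest_comps_fun u) (f := fun q ↦ S.x q ^ 2) fun _ _ ↦ sq_nonneg _
  refine u1.trans ?_
  rw [mul_assoc]
  refine mul_le_mul_of_nonneg_left ?_ hK₀
  rw [mul_assoc, ← div_eq_inv_mul, le_div_iff₀' (by positivity)]
  refine t.trans ?_
  have v1 := u3.trans (mul_le_mul_of_nonneg_left u4 hK₁)
  have v2 := mul_le_mul_of_nonneg_left (u2.trans (mul_le_mul_of_nonneg_left u5 hK₀))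
    (by positivity : 0 ≤ 4 + B ^ 2)
  have v3 : 0 ≤ K₁ * S.energy u.comps fun q ↦ S.x q ^ 2 := by positivity
  have v4 : 0 ≤ (4 + B ^ 2) * (K₀ * K) * S.energy (S.dFun F u) fun _ ↦ 1 := by positivity
  linarith

/-- One-forms and their twisted symmetric differentials near the artificial boundary, for large
twists. -/
theorem exists_bound_form_boundary (𝕜 : Type*) [RCLike 𝕜] {p : M} (hp : S.x p = 0) :
    ∃ f : M → ℝ, Continuous f ∧ (∀ q, 0 ≤ f q) ∧ 0 < f p ∧ ∃ F₀ : ℝ, ∀ F, F₀ ≤ F → ∃ C, 0 ≤ C ∧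
      ∀ u : S.TestForm 𝕜, S.energy u.comps f ≤ C * (S.energy (S.dForm F u) (fun _ ↦ 1) +
        S.energy u.comps fun q ↦ S.x q ^ 2) := by
  obtain ⟨R, hR, E, i₀, B, hB, h⟩ := S.exists_frame_boundary hp
  obtain ⟨β, σ, T, m, hm, hc, h1, h2, h3, h4⟩ := exists_cutoff hR E S.x_smooth
    (fun z hz ↦ (h z hz).2.2)
  obtain ⟨K, hK, hk⟩ := E.exists_korn_energy 𝕜
  refine ⟨_, hc.continuous_lift, chartLift_nonneg fun z ↦ sq_nonneg _,
    chartLift_self_pos (mem_chart_source _ p) (by rw [h1]; norm_num), 1 + 2 * K, fun F hF ↦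
      ⟨K * (1 + (1 + F) * m), by have : 0 ≤ F := (by positivity : 0 ≤ 1 + 2 * K).trans hF; positivity,
        fun u ↦ ?_⟩⟩
  have hF0 : 0 ≤ F := (by positivity : 0 ≤ 1 + 2 * K).trans hF
  have k := hk F hF0 β σ T hc 1 zero_le_one (fun z hz ↦ by
    rw [Finset.sum_congr rfl fun i _ ↦ by rw [(h z hz).1 i]]
    simp) u
  rw [mul_one] at k
  have u4 := hc.energy_lift_le h2 (S.isTest_dForm F u)
  have u5 := energy_lift_le_one (S.isTest_comps_form u) hc.continuous hc.isCompact
    (hc.subset.trans E.subset_target) hc.eq_zero' hm (y := fun q ↦ S.x q ^ 2) (S.x_smooth.continuous.pow 2) h3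
    fun _ ↦ sq_nonneg _
  have hf := chartLift_nonneg (c := p) (β := fun z ↦ β z ^ 2) fun z ↦ sq_nonneg _
  have n1 := energy_nonneg (S.isTest_gradForm u) (f := chartLift p fun z ↦ β z ^ 2)
    fun q _ ↦ hf q
  have n2 := energy_nonneg (S.isTest_dForm F u) (f := fun _ ↦ 1) fun _ _ ↦ zero_le_one
  have n3 := energy_nonneg (S.isTest_comps_form u) (f := fun q ↦ S.x q ^ 2) fun _ _ ↦ sq_nonneg _
  have n4 := energy_nonneg (S.isTest_comps_form u) (f := chartLift p fun z ↦ β z ^ 2)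
    fun q _ ↦ hf q
  have v1 : S.energy u.comps (chartLift p fun z ↦ β z ^ 2) ≤
      (F ^ 2 - K * (1 + F)) * S.energy u.comps (chartLift p fun z ↦ β z ^ 2) :=
    le_mul_of_one_le_left n4 (by nlinarith)
  have v2 := mul_le_mul_of_nonneg_left u4 hK
  have v3 := mul_le_mul_of_nonneg_left u5 (by positivity : 0 ≤ K * (1 + F))
  have v4 : 0 ≤ K * (1 + F) * m * S.energy (S.dForm F u) fun _ ↦ 1 := by positivity
  have v5 : 0 ≤ K * S.energy u.comps fun q ↦ S.x q ^ 2 := by positivity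
  linarith

theorem exists_nhds_good_fun {F : ℝ} (hF : 0 ≤ F) {p : M} (hp : 0 < S.x p) : ∃ N ∈ 𝓝 p, ∀ q ∈ N,
    S.Good (fun u : S.TestFun 𝕜 ↦ u.comps) (S.dFun F) q →
      S.Good (fun u : S.TestFun 𝕜 ↦ u.comps) (S.dFun F) p := by
  obtain ⟨R, hR, E, hsub, hA, hw⟩ := S.exists_frame_interior hp
  exact exists_nhds_good rfl hR E hsub hw S.isTest_comps_fun tensorial_comps_fun (S.isTest_dFun F)
    (S.tensorial_dFun F) (E.hasGrowth_fun hA hF)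

theorem exists_nhds_good_form {F : ℝ} (hF : 0 ≤ F) {p : M} (hp : 0 < S.x p) : ∃ N ∈ 𝓝 p, ∀ q ∈ N,
    S.Good (fun u : S.TestForm 𝕜 ↦ u.comps) (S.dForm F) q →
      S.Good (fun u : S.TestForm 𝕜 ↦ u.comps) (S.dForm F) p := by
  obtain ⟨R, hR, E, hsub, hA, hw⟩ := S.exists_frame_interior hp
  exact exists_nhds_good rfl hR E hsub hw S.isTest_comps_form tensorial_comps_form
    (S.isTest_dForm F) (S.tensorial_dForm F) (E.hasGrowth_form hA hF)

variable (S 𝕜)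

theorem exists_energy_fun_le {F : ℝ} (hF : 0 < F) : ∃ C, 0 ≤ C ∧ ∀ u : S.TestFun 𝕜,
    S.energy u.comps (fun _ ↦ 1) ≤ C * S.energy (S.dFun F u) fun _ ↦ 1 :=
  exists_energy_le_of_boundary (s := fun u : S.TestFun 𝕜 ↦ u.comps) (t := S.dFun F)
    S.isTest_comps_fun
    (fun _ hp ↦ good_of_pos S.isTest_comps_fun
      (fun _ hq ↦ exists_nhds_good_fun hF.le hq) hp)
    fun _ _ hp ↦ localBound_fun_boundary hF hp

theorem exists_energy_form_le : ∃ F₀ : ℝ, 0 < F₀ ∧ ∀ F, F₀ ≤ F → ∃ C, 0 ≤ C ∧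
    ∀ u : S.TestForm 𝕜, S.energy u.comps (fun _ ↦ 1) ≤ C * S.energy (S.dForm F u) fun _ ↦ 1 := by
  have hcl : IsClosed {p | S.x p = 0} := isClosed_eq S.x_smooth.continuous continuous_const
  have hK : IsCompact (S.closedDom ∩ {p | S.x p = 0}) := IsCompact.inter_right S.compact hcl
  obtain ⟨f, hf, hf0, hpos, F₀, hF₀⟩ := exists_pos_of_local hK
    (P := fun f ↦ ∃ F₀ : ℝ, ∀ F, F₀ ≤ F → ∃ C, 0 ≤ C ∧ ∀ u : S.TestForm 𝕜, S.energy u.comps f ≤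
      C * (S.energy (S.dForm F u) (fun _ ↦ 1) + S.energy u.comps fun q ↦ S.x q ^ 2))
    ⟨0, fun F _ ↦ ⟨0, le_rfl, fun u ↦ by
      rw [zero_mul]
      exact (energy_zero (S.isTest_comps_form u)).le⟩⟩
    (fun f g hf hg ⟨a, ha⟩ ⟨b, hb⟩ ↦ ⟨max a b, fun F hF ↦ by
      obtain ⟨A, hA, h1⟩ := ha F ((le_max_left _ _).trans hF)
      obtain ⟨B, hB, h2⟩ := hb F ((le_max_right _ _).trans hF)
      refine ⟨A + B, add_nonneg hA hB, fun u ↦ ?_⟩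
      rw [energy_add (S.isTest_comps_form u) hf hg, add_mul]
      exact add_le_add (h1 u) (h2 u)⟩)
    (fun p hp ↦ exists_bound_form_boundary 𝕜 hp.2)
  refine ⟨max F₀ 1, lt_max_of_lt_right one_pos, fun F hF ↦ ?_⟩
  have hF' : 0 ≤ F := zero_le_one.trans ((le_max_right _ _).trans hF)
  obtain ⟨C, hC, hb⟩ := hF₀ F ((le_max_left _ _).trans hF)
  exact exists_energy_le_of_boundary (s := fun u : S.TestForm 𝕜 ↦ u.comps) (t := S.dForm F)
    S.isTest_comps_form
    (fun _ hp ↦ good_of_pos S.isTest_comps_form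
      (fun _ hq ↦ exists_nhds_good_form hF' hq) hp)
    fun p hp hx ↦ ⟨f, hf, hf0, hpos p ⟨hp, hx⟩, C, hC, hb⟩

end Region


namespace Region

attribute [-instance] TopCat.of.chartedSpace

variable {n : ℕ} {M : Type*} [TopologicalSpace M] [ChartedSpace (Eu n) M]
  [IsManifold (𝓡 n) ∞ M] [T2Space M] [SigmaCompactSpace M] {S : Region n M}
  {𝕜 : Type*} [RCLike 𝕜]

theorem norm_sq_testFun (u : S.TestFun 𝕜) :
    ‖u‖ ^ 2 = S.energy u.comps (fun _ ↦ 1) + S.energy (gradFun u.comps) fun _ ↦ 1 := by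
  rw [← re_l2_self (S.isTest_comps_fun u), ← re_l2_self (S.isTest_gradFun u), ← map_add]
  exact norm_sq_eq_re_inner (𝕜 := 𝕜) u

theorem norm_sq_testForm (u : S.TestForm 𝕜) :
    ‖u‖ ^ 2 = S.energy u.comps (fun _ ↦ 1) +
      S.energy (gradForm S.gscMat u.comps) fun _ ↦ 1 := by
  rw [← re_l2_self (S.isTest_comps_form u), ← re_l2_self (S.isTest_gradForm u), ← map_add]
  exact norm_sq_eq_re_inner (𝕜 := 𝕜) u

theorem gradFun_add (u v : S.TestFun 𝕜) {c : M} {z : Eu n} (hz : z ∈ (chartAt (Eu n) c).target)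
    (I : Fin 1 → Fin n) :
    gradFun (u + v).comps c z I = gradFun u.comps c z I + gradFun v.comps c z I :=
  pderiv_add (contDiffOn_fun_comp u.2.1 c) (contDiffOn_fun_comp v.2.1 c) hz _

theorem gradFun_smul (a : 𝕜) (u : S.TestFun 𝕜) {c : M} {z : Eu n}
    (hz : z ∈ (chartAt (Eu n) c).target) (I : Fin 1 → Fin n) :
    gradFun (a • u).comps c z I = a * gradFun u.comps c z I :=
  pderiv_smul a (contDiffOn_fun_comp u.2.1 c) hz _

theorem gradForm_add (G : M → Eu n → Matrix (Fin n) (Fin n) ℝ) (u v : S.TestForm 𝕜) {c : M}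
    {z : Eu n} (hz : z ∈ (chartAt (Eu n) c).target) (I : Fin 2 → Fin n) :
    gradForm G (u + v).comps c z I = gradForm G u.comps c z I + gradForm G v.comps c z I := by
  have h1 : pderiv (I 0) (fun w ↦ (u + v).comps c w ![I 1]) z =
      pderiv (I 0) (fun w ↦ u.comps c w ![I 1]) z + pderiv (I 0) (fun w ↦ v.comps c w ![I 1]) z :=
    pderiv_add (u.2.1.contDiffOn_comp c (I 1)) (v.2.1.contDiffOn_comp c (I 1)) hz (I 0)
  have h2 : ∀ k, (u + v).comps c z ![k] = u.comps c z ![k] + v.comps c z ![k] := fun k ↦ rfl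
  simp only [gradForm]
  rw [h1, Finset.sum_congr rfl fun k _ ↦ by rw [h2 k, smul_add], Finset.sum_add_distrib]
  ring

theorem gradForm_smul (G : M → Eu n → Matrix (Fin n) (Fin n) ℝ) (a : 𝕜) (u : S.TestForm 𝕜) {c : M}
    {z : Eu n} (hz : z ∈ (chartAt (Eu n) c).target) (I : Fin 2 → Fin n) :
    gradForm G (a • u).comps c z I = a * gradForm G u.comps c z I := by
  have h1 := pderiv_smul a (u.2.1.contDiffOn_comp c (I 1)) hz (I 0)
  have h2 : ∀ k, (a • u).comps c z ![k] = a * u.comps c z ![k] := fun k ↦ rfl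
  simp only [gradForm, h2, ← mul_smul_comm, ← Finset.mul_sum, mul_sub]
  congr 1

theorem IsTest.eq_zero_of_notMem {r : ℕ} {s : Comps n M 𝕜 r} (hs : S.IsTest s) {c : M} {z : Eu n}
    (hz : z ∈ (chartAt (Eu n) c).target) (hz' : z ∉ S.posDom c) (I : Fin r → Fin n) :
    s c z I = 0 := by
  obtain ⟨K, hK, -, h0, -⟩ := hs
  exact h0 c z hz (fun h ↦ hz' ⟨hz, (hK h).1⟩) I

theorem dFun_add (F : ℝ) (u v : S.TestFun 𝕜) {c : M} {z : Eu n}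
    (hz : z ∈ (chartAt (Eu n) c).target) (I : Fin 1 → Fin n) :
    S.dFun F (u + v) c z I = S.dFun F u c z I + S.dFun F v c z I := by
  by_cases hp : z ∈ S.posDom c
  · have h : (u + v).comps c z ![] = u.comps c z ![] + v.comps c z ![] := rfl
    rw [dFun_apply _ _ _ hp, dFun_apply _ _ _ hp, dFun_apply _ _ _ hp, gradFun_add u v hz, h]
    module
  · simp only [(S.isTest_dFun F _).eq_zero_of_notMem hz hp, add_zero]

theorem dFun_smul (F : ℝ) (a : 𝕜) (u : S.TestFun 𝕜) {c : M} {z : Eu n}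
    (hz : z ∈ (chartAt (Eu n) c).target) (I : Fin 1 → Fin n) :
    S.dFun F (a • u) c z I = a * S.dFun F u c z I := by
  by_cases hp : z ∈ S.posDom c
  · have h : (a • u).comps c z ![] = a * u.comps c z ![] := rfl
    rw [dFun_apply _ _ _ hp, dFun_apply _ _ _ hp, gradFun_smul a u hz, h, mul_sub, mul_smul_comm]
  · simp only [(S.isTest_dFun F _).eq_zero_of_notMem hz hp, mul_zero]

theorem dForm_add (F : ℝ) (u v : S.TestForm 𝕜) {c : M} {z : Eu n}
    (hz : z ∈ (chartAt (Eu n) c).target) (I : Fin 2 → Fin n) :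
    S.dForm F (u + v) c z I = S.dForm F u c z I + S.dForm F v c z I := by
  by_cases hp : z ∈ S.posDom c
  · have h : ∀ k, (u + v).comps c z ![k] = u.comps c z ![k] + v.comps c z ![k] := fun k ↦ rfl
    simp only [dForm_apply _ _ _ hp, symGrad, gradForm_add _ u v hz, h]
    module
  · simp only [(S.isTest_dForm F _).eq_zero_of_notMem hz hp, add_zero]

theorem dForm_smul (F : ℝ) (a : 𝕜) (u : S.TestForm 𝕜) {c : M} {z : Eu n}
    (hz : z ∈ (chartAt (Eu n) c).target) (I : Fin 2 → Fin n) :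
    S.dForm F (a • u) c z I = a * S.dForm F u c z I := by
  by_cases hp : z ∈ S.posDom c
  · have h : ∀ k, (a • u).comps c z ![k] = a * u.comps c z ![k] := fun k ↦ rfl
    simp only [dForm_apply _ _ _ hp, symGrad, gradForm_smul _ a u hz, h, mul_sub, mul_smul_comm,
      mul_add]
  · simp only [(S.isTest_dForm F _).eq_zero_of_notMem hz hp, mul_zero]

/-- A form `⟨D u, D v⟩` whose square is equivalent to the norm of the form domain is invertible. -/
theorem exists_equiv_of_l2 {U : Type*} [SeminormedAddCommGroup U] [InnerProductSpace 𝕜 U]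
    {r r₁ r₂ : ℕ} {s : U → Comps n M 𝕜 r} {t₁ : U → Comps n M 𝕜 r₁} {t₂ : U → Comps n M 𝕜 r₂}
    (hs : ∀ u, S.IsTest (s u)) (hadd : ∀ u v, ∀ c, ∀ z ∈ (chartAt (Eu n) c).target, ∀ I,
      s (u + v) c z I = s u c z I + s v c z I)
    (hsmul : ∀ (a : 𝕜) u, ∀ c, ∀ z ∈ (chartAt (Eu n) c).target, ∀ I,
      s (a • u) c z I = a * s u c z I)
    (hn : ∀ u, ‖u‖ ^ 2 = S.energy (t₁ u) (fun _ ↦ 1) + S.energy (t₂ u) fun _ ↦ 1)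
    {A B C : ℝ} (hB : 0 ≤ B) (hC : 0 ≤ C)
    (h1 : ∀ u, S.energy (s u) (fun _ ↦ 1) ≤
      A * (S.energy (t₂ u) (fun _ ↦ 1) + S.energy (t₁ u) fun _ ↦ 1))
    (h2 : ∀ u, S.energy (t₂ u) (fun _ ↦ 1) ≤
      B * (S.energy (s u) (fun _ ↦ 1) + S.energy (t₁ u) fun _ ↦ 1))
    (h3 : ∀ u, S.energy (t₁ u) (fun _ ↦ 1) ≤ C * S.energy (s u) fun _ ↦ 1) :
    ∃ Δ : UniformSpace.Completion U ≃L[𝕜] (UniformSpace.Completion U →L⋆[𝕜] 𝕜),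
      ∀ u v : U, Δ u v = S.l2 (s v) (s u) := by
  have hpos : 0 < C + B * (1 + C) + 1 := by positivity
  refine exists_equiv_of_coercive (fun u v ↦ S.l2 (s u) (s v)) (C := A)
    (κ := (C + B * (1 + C) + 1)⁻¹) (fun u v ↦ S.l2_conj _ _)
    (fun u u' v ↦ S.l2_add (hs u) (hs u') (hs v) (hadd u u'))
    (fun a u v ↦ S.l2_smul a (hsmul a u)) (fun u ↦ ?_) (by positivity) fun u ↦ ?_
  · rw [re_l2_self (hs u), hn, add_comm (S.energy (t₁ u) _)]
    exact h1 u
  · rw [re_l2_self (hs u), hn, inv_mul_le_iff₀ hpos]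
    have n1 := energy_nonneg (hs u) (f := fun _ ↦ 1) fun _ _ ↦ zero_le_one
    have n2 := mul_le_mul_of_nonneg_left (h3 u) hB
    linarith [h2 u, h3 u]

theorem exists_equiv_fun (S : Region n M) (𝕜 : Type*) [RCLike 𝕜] {F : ℝ} (hF : 0 < F) :
    ∃ Δ : S.HdotFun 𝕜 ≃L[𝕜] (S.HdotFun 𝕜 →L⋆[𝕜] 𝕜),
      ∀ u v : S.TestFun 𝕜, Δ u v = S.laplaceFun F u v := by
  obtain ⟨C, hC, h3⟩ := exists_energy_fun_le S 𝕜 hF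
  obtain ⟨B, hB, h2⟩ := exists_energy_le_of_local (S := S) (S.isTest_gradFun (𝕜 := 𝕜))
    fun _ hp ↦ localBound_gradFun F hp.1
  obtain ⟨A, -, h1⟩ := exists_energy_le_of_local (S := S) (S.isTest_dFun (𝕜 := 𝕜) F)
    fun _ hp ↦ localBound_dFun F hp.1
  exact exists_equiv_of_l2 (S.isTest_dFun F) (fun u v _ _ hz I ↦ dFun_add F u v hz I)
    (fun a u _ _ hz I ↦ dFun_smul F a u hz I) norm_sq_testFun hB hC h1 h2 h3

theorem exists_equiv_form (S : Region n M) (𝕜 : Type*) [RCLike 𝕜] :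
    ∃ F₀ : ℝ, 0 < F₀ ∧ ∀ F : ℝ, F₀ ≤ F →
      ∃ Δ : S.HdotForm 𝕜 ≃L[𝕜] (S.HdotForm 𝕜 →L⋆[𝕜] 𝕜),
        ∀ u v : S.TestForm 𝕜, Δ u v = S.laplaceForm F u v := by
  obtain ⟨F₀, hF₀, h⟩ := exists_energy_form_le S 𝕜
  refine ⟨F₀, hF₀, fun F hF ↦ ?_⟩
  obtain ⟨C, hC, h3⟩ := h F hF
  obtain ⟨B, hB, h2⟩ := exists_energy_le_of_local (S := S) (S.isTest_gradForm (𝕜 := 𝕜))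
    fun _ hp ↦ localBound_gradForm (hF₀.le.trans hF) hp.1
  obtain ⟨A, -, h1⟩ := exists_energy_le_of_local (S := S) (S.isTest_dForm (𝕜 := 𝕜) F)
    fun _ hp ↦ localBound_dForm F hp.1
  exact exists_equiv_of_l2 (S.isTest_dForm F) (fun u v _ _ hz I ↦ dForm_add F u v hz I)
    (fun a u _ _ hz I ↦ dForm_smul F a u hz I) norm_sq_testForm hB hC h1 h2 h3

end Region

end ScatteringGauge

end

theorem lemma4p2 {n : ℕ} {M : Type*} [TopologicalSpace M] [ChartedSpace (ScatteringGauge.Eu n) M]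
    [IsManifold (𝓡 n) ∞ M] [T2Space M] [SigmaCompactSpace M] (S : ScatteringGauge.Region n M)
    (𝕜 : Type*) [RCLike 𝕜] :
    (∀ F : ℝ, 0 < F →
      ∃ Δ : S.HdotFun 𝕜 ≃L[𝕜] (S.HdotFun 𝕜 →L⋆[𝕜] 𝕜),
        ∀ u v : S.TestFun 𝕜, Δ u v = S.laplaceFun F u v) ∧
    (∃ F₀ : ℝ, 0 < F₀ ∧ ∀ F : ℝ, F₀ ≤ F →
      ∃ Δ : S.HdotForm 𝕜 ≃L[𝕜] (S.HdotForm 𝕜 →L⋆[𝕜] 𝕜),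
        ∀ u v : S.TestForm 𝕜, Δ u v = S.laplaceForm F u v) :=
  ⟨fun _ hF ↦ S.exists_equiv_fun 𝕜 hF, S.exists_equiv_form 𝕜⟩
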